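/- **Theorem (the extension theorem).** Let $n\ge 3$ and let $(M,g)$ be a smooth $n$-dimensional Riemannian manifold with boundary (possibly with several boundary components), with non-negative scalar curvature. Let $\partial^c M$ be a connected component of $\partial M$ that is compact and strictly mean-convex. Here the second fundamental form of a boundary is $\Theta(v,w)=\langle\nabla_v\varsigma,w\rangle$, with $\varsigma$ the outgoing unit normal; the mean curvature is $\theta=\mathrm{tr}_h\Theta$, with $h$ the induced metric; strictly mean-convex means $\theta>0$; strictly convex, totally geodesic and strictly concave mean respectively that $\Theta$ is positive definite, zero, and negative definite at each point. Then for each of the three types T $\in$ {strictly convex, totally geodesic, strictly concave} there are a smooth $n$-dimensional manifold with boundary $\bar M$, a Riemannian metric $\bar g$ of class $C^2$ on $\bar M$ with non-negative scalar curvature, and a smooth isometric embedding $\varphi:(M,g)\to(\bar M,\bar g)$ such that: 1. $\bar M\setminus\varphi(M\setminus\partial^c M)$ is diffeomorphic to $\partial^c M\times[0,1]$, by a diffeomorphism $\Phi:\partial^cM\times[0,1]\to\bar M\setminus\varphi(M\setminus\partial^c M)$ with $\Phi(x,0)=\varphi(x)$ for all $x\in\partial^c M$; 2. $\partial\bar M=\varphi(\partial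 M\setminus\partial^c M)\cup\Phi(\partial^c M\times\{1\})$, so that $\partial^cM$ is replaced by the new boundary component $\Phi(\partial^c M\times\{1\})$; 3. the new boundary component $\Phi(\partial^c M\times\{1\})$ is of type T. -/

import Mathlib

open Set
open scoped Manifold ContDiff Topology

universe u

noncomputable section

namespace ScalarExtension

/-! ### Tensor calculus in coordinates

`S` is the set in which derivatives are taken (below: the closed half-space), and `G z` is the
matrix of metric components at the point `z`. -/

/-- The partial derivative `∂ᵢ f` at `y`, taken within `S`. -/
def partialDeriv {n : ℕ} (S : Set (EuclideanSpace ℝ (Fin n)))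
    (f : EuclideanSpace ℝ (Fin n) → ℝ) (i : Fin n) (y : EuclideanSpace ℝ (Fin n)) : ℝ :=
  fderivWithin ℝ f S y (EuclideanSpace.single i (1 : ℝ))

/-- Christoffel symbols of the Levi-Civita connection,
`Γᵏᵢⱼ = ½ gᵏˡ (∂ᵢ gⱼₗ + ∂ⱼ gᵢₗ - ∂ₗ gᵢⱼ)`. -/
def christoffel {n : ℕ} (S : Set (EuclideanSpace ℝ (Fin n)))
    (G : EuclideanSpace ℝ (Fin n) → Matrix (Fin n) (Fin n) ℝ) (k i j : Fin n)
    (y : EuclideanSpace ℝ (Fin n)) : ℝ :=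
  (1 / 2 : ℝ) * ∑ l, (G y)⁻¹ k l *
    (partialDeriv S (fun z => G z j l) i y + partialDeriv S (fun z => G z i l) j y
      - partialDeriv S (fun z => G z i j) l y)

/-- Ricci curvature,
`Rᵢⱼ = ∂ₖ Γᵏᵢⱼ - ∂ⱼ Γᵏᵢₖ + Γᵏₖₗ Γˡᵢⱼ - Γᵏⱼₗ Γˡᵢₖ`. -/
def ricci {n : ℕ} (S : Set (EuclideanSpace ℝ (Fin n)))
    (G : EuclideanSpace ℝ (Fin n) → Matrix (Fin n) (Fin n) ℝ) (i j : Fin n)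
    (y : EuclideanSpace ℝ (Fin n)) : ℝ :=
  ∑ k, (partialDeriv S (christoffel S G k i j) k y - partialDeriv S (christoffel S G k i k) j y)
    + ∑ k, ∑ l, (christoffel S G k k l y * christoffel S G l i j y
      - christoffel S G k j l y * christoffel S G l i k y)

/-- Scalar curvature, `R = gⁱʲ Rᵢⱼ`. -/
def coordScalarCurvature {n : ℕ} (S : Set (EuclideanSpace ℝ (Fin n)))
    (G : EuclideanSpace ℝ (Fin n) → Matrix (Fin n) (Fin n) ℝ)
    (y : EuclideanSpace ℝ (Fin n)) : ℝ :=
  ∑ i, ∑ j, (G y)⁻¹ i j * ricci S G i j y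

/-- The `k`-th component of the covariant derivative `∇_v X` at `y`,
`(∇_v X)ᵏ = vⁱ ∂ᵢ Xᵏ + Γᵏᵢⱼ vⁱ Xʲ`. -/
def covDeriv {n : ℕ} (S : Set (EuclideanSpace ℝ (Fin n)))
    (G : EuclideanSpace ℝ (Fin n) → Matrix (Fin n) (Fin n) ℝ)
    (X : EuclideanSpace ℝ (Fin n) → Fin n → ℝ) (v : Fin n → ℝ)
    (y : EuclideanSpace ℝ (Fin n)) (k : Fin n) : ℝ :=
  ∑ i, v i * partialDeriv S (fun z => X z k) i y
    + ∑ i, ∑ j, christoffel S G k i j y * v i * X y j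

/-- The unit normal `ςᵏ = -gᵏ⁰ / √g⁰⁰` of the level sets of the coordinate `x₀`, pointing towards
decreasing `x₀`. Along the boundary `x₀ = 0` of the half-space `0 ≤ x₀` it is the outgoing unit
normal. -/
def outwardNormal {n : ℕ} [NeZero n]
    (G : EuclideanSpace ℝ (Fin n) → Matrix (Fin n) (Fin n) ℝ)
    (y : EuclideanSpace ℝ (Fin n)) (k : Fin n) : ℝ :=
  -(G y)⁻¹ k 0 / Real.sqrt ((G y)⁻¹ 0 0)

/-! ### Riemannian manifolds with boundary -/

/-- Riemannian metrics of class `C^k` on a smooth `n`-manifold with (possibly empty) boundary. -/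
abbrev RMetric (n : ℕ) [NeZero n] (k : WithTop ℕ∞) (M : Type u) [TopologicalSpace M]
    [ChartedSpace (EuclideanHalfSpace n) M] [IsManifold (𝓡∂ n) ∞ M] : Type u :=
  Bundle.ContMDiffRiemannianMetric (𝓡∂ n) k (EuclideanSpace ℝ (Fin n))
    (fun x : M => TangentSpace (𝓡∂ n) x)

section Metric

variable {n : ℕ} [NeZero n] {k : WithTop ℕ∞} {M : Type u} [TopologicalSpace M]
  [ChartedSpace (EuclideanHalfSpace n) M] [IsManifold (𝓡∂ n) ∞ M]

/-- The components `gᵢⱼ = g(∂ᵢ, ∂ⱼ)` of the metric in the preferred chart at `x`, as functions of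
the coordinates `y`. -/
def chartMetric (g : RMetric n k M) (x : M) (y : EuclideanSpace ℝ (Fin n)) :
    Matrix (Fin n) (Fin n) ℝ := fun i j =>
  g.inner ((extChartAt (𝓡∂ n) x).symm y)
    (mfderivWithin 𝓘(ℝ, EuclideanSpace ℝ (Fin n)) (𝓡∂ n) (extChartAt (𝓡∂ n) x).symm
      (range (𝓡∂ n)) y (EuclideanSpace.single i (1 : ℝ) : EuclideanSpace ℝ (Fin n)))
    (mfderivWithin 𝓘(ℝ, EuclideanSpace ℝ (Fin n)) (𝓡∂ n) (extChartAt (𝓡∂ n) x).symm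
      (range (𝓡∂ n)) y (EuclideanSpace.single j (1 : ℝ) : EuclideanSpace ℝ (Fin n)))

/-- The scalar curvature of `g` at `x`. -/
def scalarCurvature (g : RMetric n k M) (x : M) : ℝ :=
  coordScalarCurvature (range (𝓡∂ n)) (chartMetric g x) (extChartAt (𝓡∂ n) x x)

/-- The second fundamental form `Θ(v, w) = ⟨∇_v ς, w⟩` of the boundary at a boundary point `x`,
with respect to the outgoing unit normal `ς`. Here `v` and `w` are given by their components in
the preferred chart at `x`; they are tangent to the boundary when `v 0 = 0` and `w 0 = 0`. -/
def secondFundamentalForm (g : RMetric n k M) (x : M) (v w : Fin n → ℝ) : ℝ :=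
  ∑ a, ∑ b, chartMetric g x (extChartAt (𝓡∂ n) x x) a b *
    covDeriv (range (𝓡∂ n)) (chartMetric g x) (outwardNormal (chartMetric g x)) v
      (extChartAt (𝓡∂ n) x x) a * w b

/-- The mean curvature `θ = tr_h Θ` of the boundary at a boundary point `x`, where `h` is the
metric induced on the boundary: the restriction of `g` to the span of the `∂ₐ` with `a ≠ 0`. -/
def meanCurvature (g : RMetric n k M) (x : M) : ℝ :=
  ∑ a : {i : Fin n // i ≠ 0}, ∑ b : {i : Fin n // i ≠ 0},
    ((chartMetric g x (extChartAt (𝓡∂ n) x x)).submatrix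
      (Subtype.val : {i : Fin n // i ≠ 0} → Fin n) Subtype.val)⁻¹ a b *
      secondFundamentalForm g x (Pi.single a.1 1) (Pi.single b.1 1)

/-- Non-negative scalar curvature. -/
def NonnegScalarCurvature (g : RMetric n k M) : Prop :=
  ∀ x : M, 0 ≤ scalarCurvature g x

/-- The part `B` of the boundary is strictly mean-convex. -/
def IsStrictlyMeanConvex (g : RMetric n k M) (B : Set M) : Prop :=
  ∀ x ∈ B, 0 < meanCurvature g x

/-- The part `B` of the boundary is strictly convex. -/
def IsStrictlyConvex (g : RMetric n k M) (B : Set M) : Prop :=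
  ∀ x ∈ B, ∀ v : Fin n → ℝ, v 0 = 0 → v ≠ 0 → 0 < secondFundamentalForm g x v v

/-- The part `B` of the boundary is totally geodesic. -/
def IsTotallyGeodesic (g : RMetric n k M) (B : Set M) : Prop :=
  ∀ x ∈ B, ∀ v w : Fin n → ℝ, v 0 = 0 → w 0 = 0 → secondFundamentalForm g x v w = 0

/-- The part `B` of the boundary is strictly concave. -/
def IsStrictlyConcave (g : RMetric n k M) (B : Set M) : Prop :=
  ∀ x ∈ B, ∀ v : Fin n → ℝ, v 0 = 0 → v ≠ 0 → secondFundamentalForm g x v v < 0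

end Metric

/-- `C` is a connected component of the boundary of `M`. -/
def IsBoundaryComponent (n : ℕ) [NeZero n] {M : Type u} [TopologicalSpace M]
    [ChartedSpace (EuclideanHalfSpace n) M] (C : Set M) : Prop :=
  ∃ p ∈ (𝓡∂ n).boundary M, C = connectedComponentIn ((𝓡∂ n).boundary M) p

/-- `f` restricts to a (smooth) diffeomorphism between the subsets `s` and `t` of two manifolds:
a bijection from `s` to `t` that is smooth in both directions, smoothness of a map on a subset
being understood through the ambient manifold. On embedded submanifolds with boundary this is the
notion of diffeomorphism for the induced smooth structures. -/
def IsDiffeomorphismOn {E E' H H' M N : Type*} [NormedAddCommGroup E] [NormedSpace ℝ E]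
    [NormedAddCommGroup E'] [NormedSpace ℝ E'] [TopologicalSpace H] [TopologicalSpace H']
    (I : ModelWithCorners ℝ E H) (J : ModelWithCorners ℝ E' H')
    [TopologicalSpace M] [ChartedSpace H M] [TopologicalSpace N] [ChartedSpace H' N]
    (f : M → N) (s : Set M) (t : Set N) : Prop :=
  ∃ f' : N → M, MapsTo f s t ∧ MapsTo f' t s ∧ LeftInvOn f' f s ∧ RightInvOn f' f t ∧
    ContMDiffOn I J ∞ f s ∧ ContMDiffOn J I ∞ f' t

/-- An isometric extension of `(M, g)` past the part `C` of its boundary by a collar `C × [0, 1]`,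
to a smooth manifold with a Riemannian metric of class `C²`. -/
structure CollarExtension {n : ℕ} [NeZero n] {M : Type u} [TopologicalSpace M]
    [ChartedSpace (EuclideanHalfSpace n) M] [IsManifold (𝓡∂ n) ∞ M]
    (g : RMetric n ∞ M) (C : Set M) where
  /-- The extended manifold. -/
  carrier : Type u
  [topologicalSpace : TopologicalSpace carrier]
  [t2Space : T2Space carrier]
  [secondCountable : SecondCountableTopology carrier]
  [chartedSpace : ChartedSpace (EuclideanHalfSpace n) carrier]
  [isManifold : IsManifold (𝓡∂ n) ∞ carrier]
  /-- The extended metric. -/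
  metric : RMetric n 2 carrier
  /-- The isometric embedding `φ` of `M`. -/
  φ : M → carrier
  isEmbedding : Topology.IsEmbedding φ
  contMDiff : ContMDiff (𝓡∂ n) (𝓡∂ n) ∞ φ
  isometry : ∀ (x : M) (v w : TangentSpace (𝓡∂ n) x),
    metric.inner (φ x) (mfderiv (𝓡∂ n) (𝓡∂ n) φ x v) (mfderiv (𝓡∂ n) (𝓡∂ n) φ x w)
      = g.inner x v w
  /-- The collar; only its values on `C × [0, 1]` matter. -/
  collar : M × ℝ → carrier
  /-- The complement of `φ (M \ C)` is diffeomorphic to `C × [0, 1]`. -/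
  collar_diffeo : IsDiffeomorphismOn ((𝓡∂ n).prod 𝓘(ℝ, ℝ)) (𝓡∂ n) collar
    (C ×ˢ Icc (0 : ℝ) 1) (φ '' Cᶜ)ᶜ
  /-- The collar is attached to `M` along `C`. -/
  collar_zero : ∀ x ∈ C, collar (x, 0) = φ x
  /-- In the boundary, the far end of the collar replaces `C`. -/
  boundary_eq : (𝓡∂ n).boundary carrier =
    φ '' ((𝓡∂ n).boundary M \ C) ∪ collar '' (C ×ˢ {(1 : ℝ)})

attribute [instance] CollarExtension.topologicalSpace CollarExtension.t2Space
  CollarExtension.secondCountable CollarExtension.chartedSpace CollarExtension.isManifold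

/-- The boundary component that replaces `C`. -/
def CollarExtension.newBoundary {n : ℕ} [NeZero n] {M : Type u} [TopologicalSpace M]
    [ChartedSpace (EuclideanHalfSpace n) M] [IsManifold (𝓡∂ n) ∞ M]
    {g : RMetric n ∞ M} {C : Set M} (X : CollarExtension g C) : Set X.carrier :=
  X.collar '' (C ×ˢ {(1 : ℝ)})

end ScalarExtension

end

/-!
# Collar extensions of manifolds with non-negative scalar curvature

The extended manifold is `M` itself. A smooth map `φ` pushes `M` inwards along a collar
`C × [0, a)` of the boundary component `C`, and what is left free, `C × [0, ε]`, is the new collar;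
so no gluing of manifolds is needed, only a metric of class `C²` on `M` that is the push-forward of
`g` on `φ (M)` and that has the required properties on the collar.

Let `x₀` be the normal coordinate of the collar, and let `A₀, A₁, A₂` be the normal derivatives of
order `0, 1, 2` of the components of `g` along `C`. With `x₀ = ε (1 - σ)` and `σ ∈ [0, 1]`, the
metric on the new collar is the Taylor polynomial `A₀ - ε σ A₁ + ε² σ² / 2 A₂`, which continues `g`
to second order at `σ = 0`, plus a multiple of `σ³` (`profile`). The cubic term does not affect the
`C²` matching (`glue_jets`, `contDiffAt_extBil`), and it is chosen such that at the far end `σ = 1`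
the normal direction is orthogonal to the boundary and the second fundamental form is a positive
multiple of `δ A₀` (`coordSFF_collarBil`). The sign of `δ` decides between convex, totally geodesic
and concave.

The scalar curvature of the collar, multiplied by `ε`, is a smooth function of `(σ, ε, δ)` and of
the derivatives of `A₀, A₁, A₂` along `C`, up to and including `ε = 0` (`collarS`). There only the
second normal derivatives of the cubic term count, and for `δ = 0` they give `σ` times a positive
multiple of the mean curvature (`collarS_zero`). Since `C` is strictly mean-convex, the scalar
curvature increases with `σ` for small `ε` and `δ` (`collarS_monotone`), starting at `σ = 0` from
the scalar curvature of `g` along `C`, which is non-negative (`exists_collar_nonneg`). Compactness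
of `C` makes `ε` and `δ` uniform.

The collar has to be such that its normal curves start orthogonally to `C`. It is obtained from a
composition of finitely many chart-wise displacements in the direction of the gradient of the
boundary coordinate (`exists_isPush`), which near `C` is a diffeomorphism by an inverse function
theorem on the half-space (`exists_halfSpace_inverse`, `IsPush.exists_isCollar`). The collar metric
does not depend on the chart of `C` (`collarBil_parBil_eq`), because changes of these charts
preserve `x₀`.

The curvature quantities of the statement are index expressions in a preferred chart. They are
computed in collar coordinates by means of their invariance under parametrizations,
`coordScalarCurvature_pullback` and `coordSFF_pullback`, which rest on the index-free transformation
law of the Christoffel symbols.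
-/

set_option maxSynthPendingDepth 3

noncomputable section

namespace ScalarExtension

/-! ### Christoffel symbols and curvature without indices -/

section IndexFree

variable {E : Type*} [NormedAddCommGroup E] [NormedSpace ℝ E]

/-- Continuous bilinear forms on `E`. -/
abbrev Bil (E : Type*) [NormedAddCommGroup E] [NormedSpace ℝ E] := E →L[ℝ] E →L[ℝ] ℝ

/-- The right-hand side of the Koszul formula, `D ↦ D v w u + D w v u - D u v w`, where `D` is the
derivative of a metric. -/
def koszulL : (E →L[ℝ] Bil E) →L[ℝ] (E →L[ℝ] E →L[ℝ] E →L[ℝ] ℝ) :=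
  let fl : (E →L[ℝ] Bil E) →L[ℝ] (E →L[ℝ] Bil E) :=
    ((ContinuousLinearMap.flipₗᵢ ℝ E E (E →L[ℝ] ℝ)).toContinuousLinearEquiv : _ →L[ℝ] _)
  let fl₂ : Bil E →L[ℝ] Bil E :=
    ((ContinuousLinearMap.flipₗᵢ ℝ E E ℝ).toContinuousLinearEquiv : _ →L[ℝ] _)
  ContinuousLinearMap.id ℝ _ + fl - (ContinuousLinearMap.compL ℝ E (Bil E) (Bil E) fl₂) ∘L fl

lemma koszulL_apply (D : E →L[ℝ] Bil E) (u v w : E) :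
    koszulL D v w u = D v w u + D w v u - D u v w := by
  simp [koszulL]

/-- The Christoffel symbols of the metric `B` as a bilinear map. -/
def chr (S : Set E) (B : E → Bil E) (y : E) : E →L[ℝ] E →L[ℝ] E :=
  (1 / 2 : ℝ) • ((ContinuousLinearMap.compL ℝ E (E →L[ℝ] ℝ) E (B y).inverse) ∘L
    koszulL (fderivWithin ℝ B S y))

/-- The Riemann curvature operator of the metric `B`. -/
def riem (S : Set E) (B : E → Bil E) (y u v w : E) : E :=
  fderivWithin ℝ (chr S B) S y u v w - fderivWithin ℝ (chr S B) S y v u w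
    + chr S B y u (chr S B y v w) - chr S B y v (chr S B y u w)

variable {S S' : Set E} {B B' : E → Bil E} {F : E → E} {y : E}

/-- The Koszul formula. -/
lemma chr_koszul (hB : (B y).IsInvertible) (u v w : E) :
    2 * B y (chr S B y v w) u = fderivWithin ℝ B S y v w u + fderivWithin ℝ B S y w v u
      - fderivWithin ℝ B S y u v w := by
  rw [← koszulL_apply]
  have : B y ((B y).inverse (koszulL (fderivWithin ℝ B S y) v w))
      = koszulL (fderivWithin ℝ B S y) v w := by
    rw [← ContinuousLinearMap.comp_apply, hB.self_comp_inverse]; rfl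
  simp only [chr, smul_apply, ContinuousLinearMap.comp_apply,
    ContinuousLinearMap.compL_apply, map_smul, this, smul_eq_mul]
  ring

lemma fderivWithin_apply_symm (hS : UniqueDiffOn ℝ S) (hy : y ∈ S)
    (hB : DifferentiableWithinAt ℝ B S y) (hs : ∀ z ∈ S, ∀ v w, B z v w = B z w v) (u v w : E) :
    fderivWithin ℝ B S y u v w = fderivWithin ℝ B S y u w v := by
  have h : ∀ v w, HasFDerivWithinAt (fun z => B z v w)
      (((fderivWithin ℝ B S y).flip v).flip w) S y := by
    intro v w
    exact ((hB.hasFDerivWithinAt.clm_apply (hasFDerivWithinAt_const v y S)).clm_apply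
      (hasFDerivWithinAt_const w y S)).congr_fderiv (by ext u; simp)
  have h2 := (h v w).congr (f₁ := fun z => B z w v) (fun z hz => hs z hz w v) (hs y hy w v)
  have := (hS y hy).eq h2 (h w v)
  exact congrArg (fun T => T u) this

lemma chr_symm (hS : UniqueDiffOn ℝ S) (hy : y ∈ S) (hi : (B y).IsInvertible)
    (hB : DifferentiableWithinAt ℝ B S y) (hs : ∀ z ∈ S, ∀ v w, B z v w = B z w v) (v w : E) :
    chr S B y v w = chr S B y w v := by
  apply hi.injective
  ext u
  have h1 := chr_koszul (S := S) hi u v w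
  have h2 := chr_koszul (S := S) hi u w v
  have := fderivWithin_apply_symm hS hy hB hs u v w
  linarith

lemma contDiffWithinAt_chr [CompleteSpace E] {m : WithTop ℕ∞} (hS : UniqueDiffOn ℝ S) (hy : y ∈ S)
    (hi : (B y).IsInvertible) (hB : ContDiffWithinAt ℝ (m + 1) B S y) :
    ContDiffWithinAt ℝ m (chr S B) S y := by
  have h1 : ContDiffWithinAt ℝ m (fun z => (B z).inverse) S y := by
    obtain ⟨e, he⟩ := hi
    have := (contDiffAt_map_inverse (n := m) e)
    rw [he] at this
    exact this.comp_contDiffWithinAt y (hB.of_le le_self_add)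
  have h2 : ContDiffWithinAt ℝ m (fderivWithin ℝ B S) S y :=
    hB.fderivWithin_right hS le_rfl hy
  unfold chr
  exact (((ContinuousLinearMap.compL ℝ E (E →L[ℝ] ℝ) E).contDiff.comp_contDiffWithinAt
    h1).clm_comp ((ContinuousLinearMap.contDiff koszulL).comp_contDiffWithinAt h2)).const_smul _

/-- The derivative of a pulled back metric. -/
lemma fderivWithin_pullback (hS : UniqueDiffOn ℝ S) (hy : y ∈ S)
    (hF : ContDiffWithinAt ℝ 2 F S y) (hm : ∀ᶠ z in 𝓝[S] y, F z ∈ S')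
    (hB' : DifferentiableWithinAt ℝ B' S' (F y)) (hBd : DifferentiableWithinAt ℝ B S y)
    (h : ∀ᶠ z in 𝓝[S] y, ∀ v w,
      B z v w = B' (F z) (fderivWithin ℝ F S z v) (fderivWithin ℝ F S z w)) (u v w : E) :
    fderivWithin ℝ B S y u v w =
      fderivWithin ℝ B' S' (F y) (fderivWithin ℝ F S y u) (fderivWithin ℝ F S y v)
        (fderivWithin ℝ F S y w)
      + B' (F y) (fderivWithin ℝ (fderivWithin ℝ F S) S y u v) (fderivWithin ℝ F S y w)
      + B' (F y) (fderivWithin ℝ F S y v) (fderivWithin ℝ (fderivWithin ℝ F S) S y u w) := by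
  have hF1 : HasFDerivWithinAt F (fderivWithin ℝ F S y) S y :=
    (hF.differentiableWithinAt (by norm_num)).hasFDerivWithinAt
  have hF2 : HasFDerivWithinAt (fderivWithin ℝ F S) (fderivWithin ℝ (fderivWithin ℝ F S) S y) S y :=
    ((hF.fderivWithin_right (m := 1) hS (by norm_num) hy).differentiableWithinAt
      (by norm_num)).hasFDerivWithinAt
  have hv : ∀ v, HasFDerivWithinAt (fun z => fderivWithin ℝ F S z v) _ S y :=
    fun v => hF2.clm_apply (hasFDerivWithinAt_const v y S)
  have hBF : HasFDerivWithinAt (fun z => B' (F z))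
      ((fderivWithin ℝ B' S' (F y)) ∘L fderivWithin ℝ F S y) S y :=
    HasFDerivWithinAt.comp_of_tendsto (f := F) y hB'.hasFDerivWithinAt hF1
      (tendsto_nhdsWithin_iff.2 ⟨hF1.continuousWithinAt, hm⟩)
  have h1 := (hBF.clm_apply (hv v)).clm_apply (hv w)
  have h2 := (hBd.hasFDerivWithinAt.clm_apply (hasFDerivWithinAt_const v y S)).clm_apply
    (hasFDerivWithinAt_const w y S)
  have h3 := h2.congr_of_eventuallyEq (f₁ := fun z => B' (F z) (fderivWithin ℝ F S z v)
    (fderivWithin ℝ F S z w)) (by filter_upwards [h] with z hz using (hz v w).symm)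
    ((h.self_of_nhdsWithin hy) v w).symm
  have := congrArg (fun T => T u) ((hS y hy).eq h3 h1)
  simp at this
  rw [this]
  ring

/-- The transformation law of the Christoffel symbols. It follows from the Koszul formula, since
the second derivative of `F` is symmetric. -/
lemma chr_pullback [FiniteDimensional ℝ E] (hS : UniqueDiffOn ℝ S) (hS' : S ⊆ closure (interior S))
    (hy : y ∈ S)
    (hF : ContDiffWithinAt ℝ 2 F S y) (hm : ∀ᶠ z in 𝓝[S] y, F z ∈ S')
    (hB' : DifferentiableWithinAt ℝ B' S' (F y)) (hBd : DifferentiableWithinAt ℝ B S y)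
    (hi : (B y).IsInvertible) (hi' : (B' (F y)).IsInvertible)
    (hL : Function.Surjective (fderivWithin ℝ F S y)) (hs' : ∀ v w, B' (F y) v w = B' (F y) w v)
    (h : ∀ᶠ z in 𝓝[S] y, ∀ v w,
      B z v w = B' (F z) (fderivWithin ℝ F S z v) (fderivWithin ℝ F S z w)) (v w : E) :
    fderivWithin ℝ F S y (chr S B y v w) = fderivWithin ℝ (fderivWithin ℝ F S) S y v w
      + chr S' B' (F y) (fderivWithin ℝ F S y v) (fderivWithin ℝ F S y w) := by
  apply hi'.injective
  ext u'
  obtain ⟨u, rfl⟩ := hL u'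
  have hsym : ∀ v w, fderivWithin ℝ (fderivWithin ℝ F S) S y v w
      = fderivWithin ℝ (fderivWithin ℝ F S) S y w v := by
    intro v w
    exact (hF.isSymmSndFDerivWithinAt (by simp) hS (hS' hy) hy) v w
  have e1 := chr_koszul (S := S) hi u v w
  have e2 := chr_koszul (S := S') hi' (fderivWithin ℝ F S y u) (fderivWithin ℝ F S y v)
    (fderivWithin ℝ F S y w)
  have p := fderivWithin_pullback hS hy hF hm hB' hBd h
  have e0 := (h.self_of_nhdsWithin hy) (chr S B y v w) u
  rw [p, p, p, hsym u v, hsym u w, hsym w v] at e1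
  have q1 := hs' (fderivWithin ℝ F S y w) (fderivWithin ℝ (fderivWithin ℝ F S) S y v u)
  have q2 := hs' (fderivWithin ℝ F S y v) (fderivWithin ℝ (fderivWithin ℝ F S) S y w u)
  simp only [map_add, add_apply]
  linarith

/-- Naturality of the curvature operator under maps with surjective derivative. -/
lemma riem_pullback [FiniteDimensional ℝ E] (hS : UniqueDiffOn ℝ S) (hS' : S ⊆ closure (interior S))
    (hSS' : UniqueDiffOn ℝ S') (hy : y ∈ S)
    (hF : ContDiffWithinAt ℝ 3 F S y) (hm : ∀ᶠ z in 𝓝[S] y, F z ∈ S')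
    (hB' : ContDiffWithinAt ℝ 2 B' S' (F y)) (hBd : ContDiffWithinAt ℝ 2 B S y)
    (hi : ∀ᶠ z in 𝓝[S] y, (B z).IsInvertible) (hi' : ∀ᶠ z in 𝓝[S] y, (B' (F z)).IsInvertible)
    (hL : ∀ᶠ z in 𝓝[S] y, Function.Surjective (fderivWithin ℝ F S z))
    (hs' : ∀ᶠ z in 𝓝[S] y, ∀ v w, B' (F z) v w = B' (F z) w v)
    (h : ∀ᶠ z in 𝓝[S] y, ∀ v w,
      B z v w = B' (F z) (fderivWithin ℝ F S z v) (fderivWithin ℝ F S z w)) (u v w : E) :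
    fderivWithin ℝ F S y (riem S B y u v w) = riem S' B' (F y) (fderivWithin ℝ F S y u)
      (fderivWithin ℝ F S y v) (fderivWithin ℝ F S y w) := by
  have : CompleteSpace E := FiniteDimensional.complete ℝ E
  have hFy : F y ∈ S' := hm.self_of_nhdsWithin hy
  have hF1 : HasFDerivWithinAt F (fderivWithin ℝ F S y) S y :=
    (hF.differentiableWithinAt (by norm_num)).hasFDerivWithinAt
  have hFt : Filter.Tendsto F (𝓝[S] y) (𝓝[S'] (F y)) :=
    tendsto_nhdsWithin_iff.2 ⟨hF1.continuousWithinAt, hm⟩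
  have hL2 : ContDiffWithinAt ℝ 2 (fderivWithin ℝ F S) S y :=
    hF.fderivWithin_right (m := 2) hS (by norm_num) hy
  have hF2 : HasFDerivWithinAt (fderivWithin ℝ F S) (fderivWithin ℝ (fderivWithin ℝ F S) S y) S y :=
    (hL2.differentiableWithinAt (by norm_num)).hasFDerivWithinAt
  have hF3 : HasFDerivWithinAt (fderivWithin ℝ (fderivWithin ℝ F S) S)
      (fderivWithin ℝ (fderivWithin ℝ (fderivWithin ℝ F S) S) S y) S y :=
    ((hL2.fderivWithin_right (m := 1) hS (by norm_num) hy).differentiableWithinAt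
      (by norm_num)).hasFDerivWithinAt
  -- the transformation law holds near `y`, so it may be differentiated
  have hlaw : ∀ᶠ z in 𝓝[S] y, ∀ v w,
      fderivWithin ℝ F S z (chr S B z v w) = fderivWithin ℝ (fderivWithin ℝ F S) S z v w
      + chr S' B' (F z) (fderivWithin ℝ F S z v) (fderivWithin ℝ F S z w) := by
    have a1 := hF.eventually (by simp)
    have a2 := hFt.eventually (hB'.eventually (by simp) |>.filter_mono
      (nhdsWithin_mono _ (subset_insert _ _)))
    have a3 := hBd.eventually (by simp)
    rw [insert_eq_of_mem hy] at a1 a3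
    filter_upwards [a1, a2, a3, hi, hi', hL, hs', eventually_eventually_nhdsWithin.2 hm,
      eventually_eventually_nhdsWithin.2 h, self_mem_nhdsWithin] with
      z b1 b2 b3 b4 b5 b6 b7 b8 b9 b10
    exact chr_pullback hS hS' b10 (b1.of_le (by norm_num)) b8
      (b2.differentiableWithinAt (by norm_num))
      (b3.differentiableWithinAt (by norm_num)) b4 b5 b6 b7 b9
  have hc : HasFDerivWithinAt (chr S B) (fderivWithin ℝ (chr S B) S y) S y :=
    ((contDiffWithinAt_chr (m := 1) hS hy (hi.self_of_nhdsWithin hy)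
      (by simpa [one_add_one_eq_two] using hBd)).differentiableWithinAt
      (by norm_num)).hasFDerivWithinAt
  have hc' : HasFDerivWithinAt (chr S' B') (fderivWithin ℝ (chr S' B') S' (F y)) S' (F y) :=
    ((contDiffWithinAt_chr (m := 1) hSS' hFy (hi'.self_of_nhdsWithin hy)
      (by simpa [one_add_one_eq_two] using hB')).differentiableWithinAt
      (by norm_num)).hasFDerivWithinAt
  have hcF : HasFDerivWithinAt (fun z => chr S' B' (F z)) _ S y :=
    HasFDerivWithinAt.comp_of_tendsto (f := F) y hc' hF1 hFt
  have key : ∀ u v w, fderivWithin ℝ (fderivWithin ℝ F S) S y u (chr S B y v w)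
      + fderivWithin ℝ F S y (fderivWithin ℝ (chr S B) S y u v w)
      = fderivWithin ℝ (fderivWithin ℝ (fderivWithin ℝ F S) S) S y u v w
      + (fderivWithin ℝ (chr S' B') S' (F y) (fderivWithin ℝ F S y u) (fderivWithin ℝ F S y v)
        (fderivWithin ℝ F S y w)
      + chr S' B' (F y) (fderivWithin ℝ (fderivWithin ℝ F S) S y u v) (fderivWithin ℝ F S y w)
      + chr S' B' (F y) (fderivWithin ℝ F S y v)
        (fderivWithin ℝ (fderivWithin ℝ F S) S y u w)) := by
    intro u v w
    have cv : ∀ v, HasFDerivWithinAt (fun z => fderivWithin ℝ F S z v) _ S y :=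
      fun v => hF2.clm_apply (hasFDerivWithinAt_const v y S)
    have l1 := hF2.clm_apply ((hc.clm_apply (hasFDerivWithinAt_const v y S)).clm_apply
      (hasFDerivWithinAt_const w y S))
    have l2 := ((hF3.clm_apply (hasFDerivWithinAt_const v y S)).clm_apply
      (hasFDerivWithinAt_const w y S)).add ((hcF.clm_apply (cv v)).clm_apply (cv w))
    have l3 := l1.congr_of_eventuallyEq (f₁ := fun z =>
      fderivWithin ℝ (fderivWithin ℝ F S) S z v w
      + chr S' B' (F z) (fderivWithin ℝ F S z v) (fderivWithin ℝ F S z w))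
      (by filter_upwards [hlaw] with z hz using (hz v w).symm)
      ((hlaw.self_of_nhdsWithin hy) v w).symm
    have := congrArg (fun T => T u) ((hS y hy).eq l3 l2)
    simp at this
    rw [add_comm, this]
    abel
  have law := hlaw.self_of_nhdsWithin hy
  have hsym : ∀ v w, fderivWithin ℝ (fderivWithin ℝ F S) S y v w
      = fderivWithin ℝ (fderivWithin ℝ F S) S y w v := fun v w =>
    (hF.isSymmSndFDerivWithinAt (by simp; norm_num) hS (hS' hy) hy) v w
  have hsym3 : ∀ v w u, fderivWithin ℝ (fderivWithin ℝ (fderivWithin ℝ F S) S) S y v w u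
      = fderivWithin ℝ (fderivWithin ℝ (fderivWithin ℝ F S) S) S y w v u := fun v w u =>
    congrArg (fun T => T u) ((hL2.isSymmSndFDerivWithinAt (by simp) hS (hS' hy) hy) v w)
  have k1 := key u v w
  have k2 := key v u w
  rw [← eq_sub_iff_add_eq'] at k1 k2
  simp only [riem, map_sub, map_add, k1, k2, law]
  rw [hsym3 v u w, hsym v u]
  abel

end IndexFree

/-! ### The index notation and the invariance of the scalar curvature -/

section IndexBridge

variable {n : ℕ}

/-- The standard basis vectors of Euclidean space. -/
abbrev bv (i : Fin n) : EuclideanSpace ℝ (Fin n) := EuclideanSpace.single i (1 : ℝ)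

/-- The matrix of components of a field of bilinear forms. -/
def matOf (B : EuclideanSpace ℝ (Fin n) → Bil (EuclideanSpace ℝ (Fin n)))
    (y : EuclideanSpace ℝ (Fin n)) : Matrix (Fin n) (Fin n) ℝ := fun i j => B y (bv i) (bv j)

lemma matOf_apply (B : EuclideanSpace ℝ (Fin n) → Bil (EuclideanSpace ℝ (Fin n)))
    (y : EuclideanSpace ℝ (Fin n)) (i j : Fin n) : matOf B y i j = B y (bv i) (bv j) := rfl

/-- `b` is symmetric and positive definite. -/
def IsMetric {E : Type*} [NormedAddCommGroup E] [NormedSpace ℝ E] (b : Bil E) : Prop :=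
  (∀ v w, b v w = b w v) ∧ ∀ v, v ≠ 0 → 0 < b v v

lemma IsMetric.injective {E : Type*} [NormedAddCommGroup E] [NormedSpace ℝ E] {b : Bil E}
    (hb : IsMetric b) : Function.Injective b := by
  rw [injective_iff_map_eq_zero]
  intro v hv
  by_contra h
  have := hb.2 v h
  simp [hv] at this

lemma isInvertible_of_injective {E : Type*} [NormedAddCommGroup E] [NormedSpace ℝ E]
    [FiniteDimensional ℝ E] {b : Bil E} (hb : Function.Injective b) : b.IsInvertible := by
  have hd : Module.finrank ℝ E = Module.finrank ℝ (E →L[ℝ] ℝ) := by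
    rw [← (LinearMap.toContinuousLinearMap (E := E) (F' := ℝ) (𝕜 := ℝ)).finrank_eq]
    exact (Subspace.dual_finrank_eq (K := ℝ) (V := E)).symm
  let e := LinearEquiv.ofInjectiveOfFinrankEq (b : E →ₗ[ℝ] (E →L[ℝ] ℝ)) hb hd
  exact ⟨e.toContinuousLinearEquiv, by ext v w; rfl⟩

lemma IsMetric.isInvertible {E : Type*} [NormedAddCommGroup E] [NormedSpace ℝ E]
    [FiniteDimensional ℝ E] {b : Bil E} (hb : IsMetric b) : b.IsInvertible :=
  isInvertible_of_injective hb.injective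

lemma sum_bv (v : EuclideanSpace ℝ (Fin n)) : ∑ i, v i • bv i = v := by
  ext j
  simp [bv, Finset.sum_apply, Pi.single_apply]

lemma clm_eq_sum {F : Type*} [NormedAddCommGroup F] [NormedSpace ℝ F]
    (L : EuclideanSpace ℝ (Fin n) →L[ℝ] F) (v : EuclideanSpace ℝ (Fin n)) :
    L v = ∑ i, v i • L (bv i) := by
  conv_lhs => rw [← sum_bv v]
  simp only [map_sum, map_smul]

lemma bil_eq_sum {F : Type*} [NormedAddCommGroup F] [NormedSpace ℝ F]
    (b : EuclideanSpace ℝ (Fin n) →L[ℝ] EuclideanSpace ℝ (Fin n) →L[ℝ] F)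
    (v w : EuclideanSpace ℝ (Fin n)) :
    b v w = ∑ i, ∑ j, (v i * w j) • b (bv i) (bv j) := by
  rw [clm_eq_sum b v, sum_apply]
  refine Finset.sum_congr rfl fun i _ => ?_
  rw [smul_apply, clm_eq_sum (b (bv i)) w, Finset.smul_sum]
  simp [smul_smul]

variable {S S' : Set (EuclideanSpace ℝ (Fin n))}
  {B B' : EuclideanSpace ℝ (Fin n) → Bil (EuclideanSpace ℝ (Fin n))}
  {F : EuclideanSpace ℝ (Fin n) → EuclideanSpace ℝ (Fin n)} {y : EuclideanSpace ℝ (Fin n)}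

lemma IsMetric.posDef (h : IsMetric (B y)) : (matOf B y).PosDef := by
  refine Matrix.PosDef.of_dotProduct_mulVec_pos ?_ ?_
  · exact Matrix.IsHermitian.ext fun i j => by simp [matOf_apply, h.1 (bv j) (bv i)]
  · intro x hx
    have hx' : (WithLp.toLp 2 x : EuclideanSpace ℝ (Fin n)) ≠ 0 := by
      intro h0; apply hx; simpa using h0
    have := h.2 _ hx'
    rw [bil_eq_sum] at this
    refine this.trans_eq ?_
    simp [dotProduct, Matrix.mulVec, matOf_apply, Finset.mul_sum, mul_assoc, mul_comm]

lemma IsMetric.isUnit_det (h : IsMetric (B y)) : IsUnit (matOf B y).det :=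
  h.posDef.det_pos.ne'.isUnit

lemma partialDeriv_matOf (hS : UniqueDiffOn ℝ S) (hy : y ∈ S)
    (hB : DifferentiableWithinAt ℝ B S y) (i j k : Fin n) :
    partialDeriv S (fun z => matOf B z i j) k y = fderivWithin ℝ B S y (bv k) (bv i) (bv j) := by
  have := ((hB.hasFDerivWithinAt.clm_apply (hasFDerivWithinAt_const (bv i) y S)).clm_apply
      (hasFDerivWithinAt_const (bv j) y S)).fderivWithin (hS y hy)
  unfold partialDeriv matOf
  rw [this]
  simp

/-- The index formula for the Christoffel symbols gives the components of `chr`. -/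
lemma christoffel_eq (hS : UniqueDiffOn ℝ S) (hy : y ∈ S)
    (hB : DifferentiableWithinAt ℝ B S y) (hm : IsMetric (B y)) (k i j : Fin n) :
    christoffel S (matOf B) k i j y = chr S B y (bv i) (bv j) k := by
  have key : (WithLp.toLp 2 (fun k => christoffel S (matOf B) k i j y) :
      EuclideanSpace ℝ (Fin n)) = chr S B y (bv i) (bv j) := by
    apply hm.injective
    ext u
    rw [clm_eq_sum _ u, clm_eq_sum (B y (chr S B y (bv i) (bv j))) u]
    refine Finset.sum_congr rfl fun m _ => ?_
    congr 1
    have h1 := chr_koszul (S := S) hm.isInvertible (bv m) (bv i) (bv j)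
    rw [clm_eq_sum (B y)]
    simp only [christoffel, partialDeriv_matOf hS hy hB, sum_apply, smul_apply,
      smul_eq_mul]
    have h2 : ∀ k, B y (bv k) (bv m) = matOf B y k m := fun _ => rfl
    have h3 : ∀ l, ∑ k, (matOf B y)⁻¹ k l * matOf B y k m = if l = m then 1 else 0 := by
      intro l
      have hsym : ∀ k, (matOf B y)⁻¹ k l = (matOf B y)⁻¹ l k := by
        intro k
        have := hm.posDef.inv.1.apply l k
        simpa using this
      simp only [hsym]
      rw [← Matrix.mul_apply, Matrix.nonsing_inv_mul _ hm.isUnit_det, Matrix.one_apply]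
    have h4 : ∀ l, fderivWithin ℝ B S y (bv i) (bv j) (bv l) +
        fderivWithin ℝ B S y (bv j) (bv i) (bv l) - fderivWithin ℝ B S y (bv l) (bv i) (bv j)
        = 2 * B y (chr S B y (bv i) (bv j)) (bv l) := by
      intro l
      rw [chr_koszul (S := S) hm.isInvertible]
    simp only [h2, h4]
    calc _ = ∑ l, (∑ k, (matOf B y)⁻¹ k l * matOf B y k m) *
          B y (chr S B y (bv i) (bv j)) (bv l) := by
          simp only [Finset.sum_mul, Finset.mul_sum]
          rw [Finset.sum_comm]
          refine Finset.sum_congr rfl fun l _ => Finset.sum_congr rfl fun k _ => ?_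
          ring
      _ = _ := by simp [h3]
  rw [← key]

lemma IsMetric.pullback {E : Type*} [NormedAddCommGroup E] [NormedSpace ℝ E] {b b' : Bil E}
    (L : E →L[ℝ] E) (hL : Function.Injective L) (hb : IsMetric b')
    (h : ∀ v w, b v w = b' (L v) (L w)) : IsMetric b := by
  refine ⟨fun v w => by rw [h, h, hb.1], fun v hv => ?_⟩
  rw [h]
  exact hb.2 _ (by rwa [Ne, map_eq_zero_iff L hL])

/-- The index formula for the Ricci curvature is a trace of `riem`. -/
lemma ricci_eq (hS : UniqueDiffOn ℝ S) (hy : y ∈ S) (hB : ContDiffWithinAt ℝ 2 B S y)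
    (hm : ∀ᶠ z in 𝓝[S] y, IsMetric (B z)) (hs : ∀ z ∈ S, ∀ v w, B z v w = B z w v) (i j : Fin n) :
    ricci S (matOf B) i j y = ∑ k, riem S B y (bv k) (bv j) (bv i) k := by
  have hmy := hm.self_of_nhdsWithin hy
  have hd := hB.eventually (by simp)
  rw [insert_eq_of_mem hy] at hd
  have hc : ContDiffWithinAt ℝ 1 (chr S B) S y := contDiffWithinAt_chr (m := 1) hS hy
    hmy.isInvertible (by simpa [one_add_one_eq_two] using hB)
  have hc' := (hc.differentiableWithinAt (by norm_num)).hasFDerivWithinAt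
  have hd0 : DifferentiableWithinAt ℝ B S y := hB.differentiableWithinAt (by norm_num)
  have hp : ∀ k i j m, partialDeriv S (christoffel S (matOf B) k i j) m y
      = fderivWithin ℝ (chr S B) S y (bv m) (bv i) (bv j) k := by
    intro k i j m
    have h1 : christoffel S (matOf B) k i j =ᶠ[𝓝[S] y] fun z => chr S B z (bv i) (bv j) k := by
      filter_upwards [hm, hd, self_mem_nhdsWithin] with z hz hdz hzS
      exact christoffel_eq hS hzS (hdz.differentiableWithinAt (by norm_num)) hz k i j
    have h2 := (((EuclideanSpace.proj k : EuclideanSpace ℝ (Fin n) →L[ℝ] ℝ).hasFDerivAt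
      (x := chr S B y (bv i) (bv j))).comp_hasFDerivWithinAt y
      ((hc'.clm_apply (hasFDerivWithinAt_const (bv i) y S)).clm_apply
      (hasFDerivWithinAt_const (bv j) y S))).congr_of_eventuallyEq h1
      (h1.self_of_nhdsWithin hy)
    unfold partialDeriv
    rw [h2.fderivWithin (hS y hy)]
    simp
  have hsy : ∀ v w, chr S B y v w = chr S B y w v :=
    chr_symm hS hy hmy.isInvertible hd0 hs
  have hsd : ∀ u v w, fderivWithin ℝ (chr S B) S y u v w = fderivWithin ℝ (chr S B) S y u w v := by
    intro u v w
    have h1 := (hc'.clm_apply (hasFDerivWithinAt_const v y S)).clm_apply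
      (hasFDerivWithinAt_const w y S)
    have h2 := (hc'.clm_apply (hasFDerivWithinAt_const w y S)).clm_apply
      (hasFDerivWithinAt_const v y S)
    have h3 := h2.congr_of_eventuallyEq (f₁ := fun z => chr S B z v w) (by
      filter_upwards [hm, hd, self_mem_nhdsWithin] with z hz hdz hzS
      exact chr_symm hS hzS hz.isInvertible (hdz.differentiableWithinAt (by norm_num)) hs v w)
      (hsy v w)
    have := congrArg (fun T => T u) ((hS y hy).eq h1 h3)
    simpa using this
  have hch : ∀ (v w : EuclideanSpace ℝ (Fin n)) (k : Fin n),
      chr S B y v w k = ∑ l, w l * chr S B y v (bv l) k := by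
    intro v w k
    rw [clm_eq_sum (chr S B y v) w]
    simp
  have hR : ∀ k, riem S B y (bv k) (bv j) (bv i) k =
      (fderivWithin ℝ (chr S B) S y (bv k) (bv i) (bv j) k
        - fderivWithin ℝ (chr S B) S y (bv j) (bv i) (bv k) k)
      + ∑ l, (chr S B y (bv k) (bv l) k * chr S B y (bv i) (bv j) l
        - chr S B y (bv j) (bv l) k * chr S B y (bv i) (bv k) l) := by
    intro k
    simp only [riem]
    rw [hsd (bv k) (bv j) (bv i), hsd (bv j) (bv k) (bv i), hsy (bv j) (bv i), hsy (bv k) (bv i)]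
    simp only [PiLp.add_apply, PiLp.sub_apply]
    rw [hch (bv k) (chr S B y (bv i) (bv j)), hch (bv j) (chr S B y (bv i) (bv k)),
      Finset.sum_sub_distrib]
    simp only [mul_comm]
    ring
  simp only [hR]
  rw [Finset.sum_add_distrib]
  unfold ricci
  simp only [hp, christoffel_eq hS hy hd0 hmy]

/-- **Invariance of the scalar curvature** under pullback by a map with injective derivative. -/
theorem coordScalarCurvature_pullback (hS : UniqueDiffOn ℝ S) (hS1 : S ⊆ closure (interior S))
    (hS' : UniqueDiffOn ℝ S') (hy : y ∈ S)
    (hF : ContDiffWithinAt ℝ 3 F S y) (hm : ∀ᶠ z in 𝓝[S] y, F z ∈ S')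
    (hB' : ContDiffWithinAt ℝ 2 B' S' (F y)) (hBd : ContDiffWithinAt ℝ 2 B S y)
    (hM' : ∀ᶠ z in 𝓝[S'] (F y), IsMetric (B' z))
    (hs : ∀ z ∈ S, ∀ v w, B z v w = B z w v) (hs' : ∀ z ∈ S', ∀ v w, B' z v w = B' z w v)
    (hL : ∀ᶠ z in 𝓝[S] y, Function.Injective (fderivWithin ℝ F S z))
    (h : ∀ᶠ z in 𝓝[S] y, ∀ v w,
      B z v w = B' (F z) (fderivWithin ℝ F S z v) (fderivWithin ℝ F S z w)) :
    coordScalarCurvature S (matOf B) y = coordScalarCurvature S' (matOf B') (F y) := by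
  have hFt : Filter.Tendsto F (𝓝[S] y) (𝓝[S'] (F y)) :=
    tendsto_nhdsWithin_iff.2 ⟨hF.continuousWithinAt, hm⟩
  have hM'F := hFt.eventually hM'
  have hM : ∀ᶠ z in 𝓝[S] y, IsMetric (B z) := by
    filter_upwards [hM'F, hL, h] with z h1 h2 h3
    exact IsMetric.pullback _ h2 h1 h3
  have hMy := hM.self_of_nhdsWithin hy
  have hM'y := hM'F.self_of_nhdsWithin hy
  set L := fderivWithin ℝ F S y with hLdef
  have hLi : Function.Injective L := hL.self_of_nhdsWithin hy
  have hriem := riem_pullback hS hS1 hS' hy hF hm hB' hBd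
    (hM.mono fun z hz => hz.isInvertible) (hM'F.mono fun z hz => hz.isInvertible)
    (hL.mono fun z hz => (LinearMap.injective_iff_surjective (f := (fderivWithin ℝ F S z :
      EuclideanSpace ℝ (Fin n) →ₗ[ℝ] EuclideanSpace ℝ (Fin n)))).1 hz)
    (hM'F.mono fun z hz => hz.1) h
  rw [← hLdef] at hriem
  -- the matrix of `L` and its inverse
  let A : Matrix (Fin n) (Fin n) ℝ := Matrix.of fun i j => L (bv j) i
  have hLA : ∀ v i, L v i = ∑ j, A i j * v j := by
    intro v i
    rw [clm_eq_sum L v]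
    simp [A, mul_comm]
  have hAu : IsUnit A.det := by
    rw [isUnit_iff_ne_zero]
    intro hdet
    obtain ⟨v, hv, hAv⟩ := Matrix.exists_mulVec_eq_zero_iff.2 hdet
    apply hv
    have : L (WithLp.toLp 2 v) = 0 := by
      ext i
      rw [hLA]
      exact congrFun hAv i
    rw [map_eq_zero_iff L hLi] at this
    simpa using this
  have hG : matOf B y = A.transpose * matOf B' (F y) * A := by
    ext i j
    have := (h.self_of_nhdsWithin hy) (bv i) (bv j)
    rw [matOf_apply, this, ← hLdef, bil_eq_sum]
    simp only [Matrix.mul_apply, Matrix.transpose_apply, smul_eq_mul, Finset.sum_mul, A,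
      matOf_apply, Matrix.of_apply]
    rw [Finset.sum_comm]
    refine Finset.sum_congr rfl fun a _ => Finset.sum_congr rfl fun b _ => ?_
    ring
  let R : Matrix (Fin n) (Fin n) ℝ := Matrix.of fun i j => ricci S (matOf B) i j y
  let R' : Matrix (Fin n) (Fin n) ℝ := Matrix.of fun i j => ricci S' (matOf B') i j (F y)
  have hR : R = A.transpose * R' * A := by
    -- the Ricci tensor is a trace of the curvature operator, and the trace is invariant
    have htr : ∀ i j, R i j = ∑ k, riem S' B' (F y) (bv k) (L (bv j)) (L (bv i)) k := by
      intro i j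
      have e1 : R i j = ∑ k, riem S B y (bv k) (bv j) (bv i) k := ricci_eq hS hy hBd hM hs i j
      rw [e1]
      let T : Matrix (Fin n) (Fin n) ℝ := Matrix.of fun a k => riem S B y (bv k) (bv j) (bv i) a
      let T' : Matrix (Fin n) (Fin n) ℝ := Matrix.of fun a k =>
        riem S' B' (F y) (bv k) (L (bv j)) (L (bv i)) a
      have hlin : ∀ u a, riem S' B' (F y) u (L (bv j)) (L (bv i)) a = ∑ k, T' a k * u k := by
        intro u a
        simp only [T', riem, Matrix.of_apply, PiLp.add_apply, PiLp.sub_apply]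
        have l1 : fderivWithin ℝ (chr S' B') S' (F y) u (L (bv j)) (L (bv i)) a = ∑ k, u k *
            fderivWithin ℝ (chr S' B') S' (F y) (bv k) (L (bv j)) (L (bv i)) a := by
          rw [clm_eq_sum _ u]; simp
        have l2 : fderivWithin ℝ (chr S' B') S' (F y) (L (bv j)) u (L (bv i)) a = ∑ k, u k *
            fderivWithin ℝ (chr S' B') S' (F y) (L (bv j)) (bv k) (L (bv i)) a := by
          rw [clm_eq_sum _ u]; simp
        have l3 : ∀ w, chr S' B' (F y) u w a = ∑ k, u k * chr S' B' (F y) (bv k) w a := by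
          intro w
          rw [clm_eq_sum _ u]; simp
        have l4 : chr S' B' (F y) (L (bv j)) (chr S' B' (F y) u (L (bv i))) a = ∑ k, u k *
            chr S' B' (F y) (L (bv j)) (chr S' B' (F y) (bv k) (L (bv i))) a := by
          rw [clm_eq_sum _ u]; simp
        rw [l1, l2, l3, l4, ← Finset.sum_sub_distrib, ← Finset.sum_add_distrib,
          ← Finset.sum_sub_distrib]
        exact Finset.sum_congr rfl fun k _ => by ring
      have hAT : A * T = T' * A := by
        ext a k
        have := congrArg (fun w => w a) (hriem (bv k) (bv j) (bv i))
        simp only [hLA, hlin] at this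
        simp only [Matrix.mul_apply, T, Matrix.of_apply]
        rw [this]
        simp [bv]
      have : T.trace = T'.trace := by
        have : T = A⁻¹ * (T' * A) := by
          rw [← hAT, Matrix.nonsing_inv_mul_cancel_left _ _ hAu]
        rw [this, Matrix.trace_mul_comm, Matrix.mul_assoc, Matrix.mul_nonsing_inv _ hAu,
          Matrix.mul_one]
      exact this
    ext i j
    rw [htr]
    have e2 : ∀ i j, R' i j = ∑ k, riem S' B' (F y) (bv k) (bv j) (bv i) k :=
      fun i j => ricci_eq hS' (hm.self_of_nhdsWithin hy) hB' hM' hs' i j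
    have hbil : ∀ (u v w : EuclideanSpace ℝ (Fin n)) (a : Fin n), riem S' B' (F y) u v w a =
        ∑ p, ∑ q, w p * v q * riem S' B' (F y) u (bv q) (bv p) a := by
      intro u v w a
      simp only [riem, PiLp.add_apply, PiLp.sub_apply]
      have m0 : ∀ (b : EuclideanSpace ℝ (Fin n) →L[ℝ] EuclideanSpace ℝ (Fin n) →L[ℝ]
          EuclideanSpace ℝ (Fin n)), b v w a = ∑ p, ∑ q, w p * v q * b (bv q) (bv p) a := by
        intro b
        rw [bil_eq_sum b v w, Finset.sum_comm]
        simp [mul_comm]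
      have l1 := m0 (fderivWithin ℝ (chr S' B') S' (F y) u)
      have l2 := m0 ((fderivWithin ℝ (chr S' B') S' (F y)).flip u)
      have l3 := m0 ((ContinuousLinearMap.compL ℝ _ _ _ (chr S' B' (F y) u)) ∘L (chr S' B' (F y)))
      have l4 := m0 (((ContinuousLinearMap.compL ℝ _ _ _).flip (chr S' B' (F y) u)) ∘L
        (chr S' B' (F y)))
      simp only [ContinuousLinearMap.flip_apply, ContinuousLinearMap.comp_apply,
        ContinuousLinearMap.compL_apply] at l1 l2 l3 l4
      rw [l1, l2, l3, l4]
      simp only [← Finset.sum_sub_distrib, ← Finset.sum_add_distrib]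
      exact Finset.sum_congr rfl fun p _ => Finset.sum_congr rfl fun q _ => by ring
    simp only [Matrix.mul_apply, Matrix.transpose_apply, e2, Finset.sum_mul, Finset.mul_sum]
    rw [Finset.sum_congr rfl fun k _ => hbil (bv k) (L (bv j)) (L (bv i)) k, Finset.sum_comm]
    conv_rhs => rw [Finset.sum_comm]
    refine Finset.sum_congr rfl fun p _ => ?_
    rw [Finset.sum_comm]
    refine Finset.sum_congr rfl fun q _ => Finset.sum_congr rfl fun k _ => ?_
    simp only [A, Matrix.of_apply]
    ring
  have hscal : ∀ (G R : Matrix (Fin n) (Fin n) ℝ), G.PosDef →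
      ∑ i, ∑ j, G⁻¹ i j * R i j = (G⁻¹ * R).trace := by
    intro G R hG
    simp only [Matrix.trace, Matrix.diag, Matrix.mul_apply]
    rw [Finset.sum_comm]
    refine Finset.sum_congr rfl fun j _ => Finset.sum_congr rfl fun i _ => ?_
    have := hG.inv.1.apply i j
    simp at this
    rw [this]
  unfold coordScalarCurvature
  have e1 := hscal _ R hMy.posDef
  have e2 := hscal _ R' hM'y.posDef
  refine e1.trans (Eq.trans ?_ e2.symm)
  have hAt : IsUnit A.transpose.det := by rwa [Matrix.det_transpose]
  rw [hG, hR, Matrix.mul_inv_rev, Matrix.mul_inv_rev, Matrix.mul_assoc, Matrix.mul_assoc,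
    Matrix.mul_assoc, Matrix.nonsing_inv_mul_cancel_left _ _ hAt, Matrix.trace_mul_comm,
    Matrix.mul_assoc, Matrix.mul_assoc, Matrix.mul_nonsing_inv _ hAu, Matrix.mul_one]

end IndexBridge

/-! ### The second fundamental form in boundary coordinates -/

section SecondFundamentalForm

variable {n : ℕ} [NeZero n]

lemma mem_range_iff {z : EuclideanSpace ℝ (Fin n)} : z ∈ range (𝓡∂ n) ↔ 0 ≤ z 0 := by
  rw [range_modelWithCornersEuclideanHalfSpace]; rfl

/-- The second fundamental form of the level sets of the coordinate `x₀`, in coordinates. -/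
def coordSFF (S : Set (EuclideanSpace ℝ (Fin n)))
    (G : EuclideanSpace ℝ (Fin n) → Matrix (Fin n) (Fin n) ℝ) (y : EuclideanSpace ℝ (Fin n))
    (v w : Fin n → ℝ) : ℝ :=
  ∑ a, ∑ b, G y a b * covDeriv S G (outwardNormal G) v y a * w b

/-- The gradient of the coordinate `x₀`. -/
def gradZero (B : EuclideanSpace ℝ (Fin n) → Bil (EuclideanSpace ℝ (Fin n)))
    (y : EuclideanSpace ℝ (Fin n)) : EuclideanSpace ℝ (Fin n) :=
  (B y).inverse (EuclideanSpace.proj 0)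

variable {S S' : Set (EuclideanSpace ℝ (Fin n))}
  {B B' : EuclideanSpace ℝ (Fin n) → Bil (EuclideanSpace ℝ (Fin n))}
  {F : EuclideanSpace ℝ (Fin n) → EuclideanSpace ℝ (Fin n)} {y : EuclideanSpace ℝ (Fin n)}

lemma apply_gradZero (hi : (B y).IsInvertible) (v : EuclideanSpace ℝ (Fin n)) :
    B y (gradZero B y) v = v 0 := by
  have : B y (gradZero B y) = EuclideanSpace.proj 0 := by
    unfold gradZero
    rw [← ContinuousLinearMap.comp_apply, hi.self_comp_inverse]; rfl
  rw [this]
  rfl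

lemma gradZero_zero_pos (hm : IsMetric (B y)) : 0 < gradZero B y 0 := by
  rw [← apply_gradZero hm.isInvertible]
  apply hm.2
  intro h
  have := apply_gradZero hm.isInvertible (bv 0)
  simp [h] at this

lemma contDiffWithinAt_gradZero {m : WithTop ℕ∞} (hi : (B y).IsInvertible)
    (hB : ContDiffWithinAt ℝ m B S y) : ContDiffWithinAt ℝ m (gradZero B) S y := by
  have h1 : ContDiffWithinAt ℝ m (fun z => (B z).inverse) S y := by
    obtain ⟨e, he⟩ := hi
    have := (contDiffAt_map_inverse (n := m) e)
    rw [he] at this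
    exact this.comp_contDiffWithinAt y hB
  exact h1.clm_apply contDiffWithinAt_const

lemma inv_matOf_zero (hm : IsMetric (B y)) (k : Fin n) :
    (matOf B y)⁻¹ k 0 = gradZero B y k := by
  have : (WithLp.toLp 2 (fun k => (matOf B y)⁻¹ k 0) : EuclideanSpace ℝ (Fin n))
      = gradZero B y := by
    apply hm.injective
    ext v
    rw [apply_gradZero hm.isInvertible, bil_eq_sum]
    have h3 : ∀ m, ∑ k, (matOf B y)⁻¹ k 0 * matOf B y k m = if m = 0 then 1 else 0 := by
      intro m
      have hsym : ∀ k, matOf B y k m = matOf B y m k := fun k => hm.1 _ _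
      simp only [hsym, mul_comm _ (matOf B y m _)]
      rw [← Matrix.mul_apply, Matrix.mul_nonsing_inv _ hm.isUnit_det, Matrix.one_apply]
    rw [Finset.sum_comm]
    calc _ = ∑ m, (∑ k, (matOf B y)⁻¹ k 0 * matOf B y k m) * v m := by
          simp only [Finset.sum_mul, smul_eq_mul, matOf_apply]
          exact Finset.sum_congr rfl fun m _ => Finset.sum_congr rfl fun k _ => by ring
      _ = _ := by simp [h3]
  rw [← this]

/-- The second fundamental form on tangent vectors is `Γ⁰(v, w) / √g⁰⁰`. -/
lemma coordSFF_eq (hS : UniqueDiffOn ℝ S) (hy : y ∈ S) (hB : ContDiffWithinAt ℝ 1 B S y)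
    (hm : ∀ᶠ z in 𝓝[S] y, IsMetric (B z)) (hs : ∀ z ∈ S, ∀ v w, B z v w = B z w v)
    (v w : EuclideanSpace ℝ (Fin n)) (hw : w 0 = 0) :
    coordSFF S (matOf B) y v w = chr S B y v w 0 / Real.sqrt (gradZero B y 0) := by
  have hmy := hm.self_of_nhdsWithin hy
  have hd0 : DifferentiableWithinAt ℝ B S y := hB.differentiableWithinAt (by norm_num)
  set N : EuclideanSpace ℝ (Fin n) → EuclideanSpace ℝ (Fin n) := fun z =>
    (-(Real.sqrt (gradZero B z 0))⁻¹) • gradZero B z with hN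
  have hNd : DifferentiableWithinAt ℝ N S y := by
    have h1 := (contDiffWithinAt_gradZero hmy.isInvertible hB).differentiableWithinAt
      (by norm_num)
    have h2 : DifferentiableWithinAt ℝ (fun z => gradZero B z 0) S y :=
      (EuclideanSpace.proj (0 : Fin n) :
        EuclideanSpace ℝ (Fin n) →L[ℝ] ℝ).differentiableAt.comp_differentiableWithinAt y h1
    have hp := gradZero_zero_pos hmy
    exact ((h2.sqrt hp.ne').inv (Real.sqrt_pos.2 hp).ne').neg.smul h1
  have hN' := hNd.hasFDerivWithinAt
  have hBN : ∀ z, IsMetric (B z) → ∀ u, B z (N z) u = -(Real.sqrt (gradZero B z 0))⁻¹ * u 0 := by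
    intro z hz u
    simp only [hN, map_smul, smul_apply, apply_gradZero hz.isInvertible, smul_eq_mul]
  have hout : ∀ k, (fun z => outwardNormal (matOf B) z k) =ᶠ[𝓝[S] y] fun z => N z k := by
    intro k
    filter_upwards [hm] with z hz
    simp only [outwardNormal, inv_matOf_zero hz, hN, PiLp.smul_apply, smul_eq_mul]
    ring
  have hpd : ∀ i k, partialDeriv S (fun z => outwardNormal (matOf B) z k) i y
      = fderivWithin ℝ N S y (bv i) k := by
    intro i k
    have h2 := (((EuclideanSpace.proj k : EuclideanSpace ℝ (Fin n) →L[ℝ] ℝ).hasFDerivAt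
      (x := N y)).comp_hasFDerivWithinAt y hN').congr_of_eventuallyEq (hout k)
      ((hout k).self_of_nhdsWithin hy)
    unfold partialDeriv
    rw [h2.fderivWithin (hS y hy)]
    simp
  have hcov : ∀ k, covDeriv S (matOf B) (outwardNormal (matOf B)) v y k
      = (fderivWithin ℝ N S y v + chr S B y v (N y)) k := by
    intro k
    rw [PiLp.add_apply, clm_eq_sum (fderivWithin ℝ N S y) v, bil_eq_sum (chr S B y)]
    simp only [covDeriv, hpd, christoffel_eq hS hy hd0 hmy, (hout _).self_of_nhdsWithin hy]
    simp [mul_comm, mul_assoc]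
    exact Finset.sum_congr rfl fun m _ => Finset.sum_congr rfl fun k _ => by ring
  have hsum : coordSFF S (matOf B) y v w
      = B y (fderivWithin ℝ N S y v + chr S B y v (N y)) w := by
    rw [bil_eq_sum (B y)]
    simp only [coordSFF, hcov, matOf_apply, smul_eq_mul]
    exact Finset.sum_congr rfl fun m _ => Finset.sum_congr rfl fun k _ => by ring
  -- differentiate `B (N, w) = 0`
  have hder : fderivWithin ℝ B S y v (N y) w + B y (fderivWithin ℝ N S y v) w = 0 := by
    have h1 := (hd0.hasFDerivWithinAt.clm_apply hN').clm_apply (hasFDerivWithinAt_const w y S)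
    have h2 : (fun z => B z (N z) w) =ᶠ[𝓝[S] y] fun _ => (0 : ℝ) := by
      filter_upwards [hm] with z hz
      rw [hBN z hz, hw, mul_zero]
    have h3 : HasFDerivWithinAt (fun z => B z (N z) w)
      (0 : EuclideanSpace ℝ (Fin n) →L[ℝ] ℝ) S y :=
      (hasFDerivWithinAt_const (0 : ℝ) y S).congr_of_eventuallyEq h2
      (by simp only [hBN y hmy, hw, mul_zero])
    have := DFunLike.congr_fun ((hS y hy).eq h1 h3) v
    simp at this
    linarith
  have k1 := chr_koszul (S := S) hmy.isInvertible w v (N y)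
  have k2 := chr_koszul (S := S) hmy.isInvertible (N y) v w
  have s1 := fderivWithin_apply_symm hS hy hd0 hs v (N y) w
  have s2 := fderivWithin_apply_symm hS hy hd0 hs w (N y) v
  have s3 := fderivWithin_apply_symm hS hy hd0 hs (N y) v w
  have s4 := hBN y hmy (chr S B y v w)
  rw [hmy.1] at s4
  rw [hsum, map_add, add_apply]
  have : chr S B y v w 0 / Real.sqrt (gradZero B y 0) = - B y (chr S B y v w) (N y) := by
    rw [s4]; ring
  rw [this]
  linarith

/-- A function that vanishes on the boundary hyperplane has vanishing tangential derivatives. -/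
lemma fderivWithin_apply_eq_zero_of_boundary {V : Type*} [NormedAddCommGroup V] [NormedSpace ℝ V]
    {f : EuclideanSpace ℝ (Fin n) → V} {f' : EuclideanSpace ℝ (Fin n) →L[ℝ] V}
    (hy : y 0 = 0) (hf : HasFDerivWithinAt f f' (range (𝓡∂ n)) y)
    (h0 : ∀ᶠ z in 𝓝[range (𝓡∂ n)] y, z 0 = 0 → f z = 0) {u : EuclideanSpace ℝ (Fin n)}
    (hu : u 0 = 0) : f' u = 0 := by
  have hl : HasDerivAt (fun s : ℝ => y + s • u) u 0 := by
    simpa using ((hasDerivAt_id (0 : ℝ)).smul_const u).const_add y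
  have hm : ∀ s : ℝ, (y + s • u) 0 = 0 := by intro s; simp [hy, hu]
  have hm' : ∀ s : ℝ, y + s • u ∈ range (𝓡∂ n) := fun s => mem_range_iff.2 (hm s).ge
  have ht : Filter.Tendsto (fun s : ℝ => y + s • u) (𝓝 0) (𝓝[range (𝓡∂ n)] y) := by
    rw [tendsto_nhdsWithin_iff]
    refine ⟨?_, Filter.Eventually.of_forall hm'⟩
    simpa using hl.continuousAt.tendsto
  have hf0 : HasFDerivWithinAt f f' (range (𝓡∂ n)) (y + (0 : ℝ) • u) := by simpa using hf
  have h1 : HasDerivAt (fun s : ℝ => f (y + s • u)) (f' u) 0 := by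
    have := hf0.comp_hasDerivWithinAt (s := univ) (0 : ℝ) hl.hasDerivWithinAt
      (fun s _ => hm' s)
    rw [hasDerivWithinAt_univ] at this
    exact this
  have h2 : (fun s : ℝ => f (y + s • u)) =ᶠ[𝓝 0] fun _ => 0 := by
    filter_upwards [ht.eventually h0] with s hs using hs (hm s)
  exact h1.unique ((hasDerivAt_const (0 : ℝ) (0 : V)).congr_of_eventuallyEq h2)

/-- A map of the half-space that preserves the boundary multiplies `dx₀` by a positive factor. -/
lemma exists_pos_fderivWithin_zero (hy : y 0 = 0)
    {L : EuclideanSpace ℝ (Fin n) →L[ℝ] EuclideanSpace ℝ (Fin n)}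
    (hF : HasFDerivWithinAt F L (range (𝓡∂ n)) y)
    (hm : ∀ᶠ z in 𝓝[range (𝓡∂ n)] y, F z ∈ range (𝓡∂ n))
    (hb : ∀ᶠ z in 𝓝[range (𝓡∂ n)] y, z 0 = 0 → F z 0 = 0)
    (hL : Function.Injective L) : ∃ c : ℝ, 0 < c ∧ ∀ u, L u 0 = c * u 0 := by
  have h0 := ((EuclideanSpace.proj (0 : Fin n) :
    EuclideanSpace ℝ (Fin n) →L[ℝ] ℝ).hasFDerivAt (x := F y)).comp_hasFDerivWithinAt y hF
  have ht : ∀ u : EuclideanSpace ℝ (Fin n), u 0 = 0 → L u 0 = 0 := fun u hu =>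
    fderivWithin_apply_eq_zero_of_boundary hy h0 hb hu
  have hlin : ∀ u, L u 0 = L (bv 0) 0 * u 0 := by
    intro u
    have := ht (u - u 0 • bv 0) (by simp [bv])
    rw [map_sub, map_smul] at this
    simp only [PiLp.sub_apply, PiLp.smul_apply, smul_eq_mul] at this
    linarith
  have hy' : y ∈ range (𝓡∂ n) := mem_range_iff.2 hy.ge
  have hge : 0 ≤ L (bv 0) 0 := by
    have hl : HasDerivAt (fun s : ℝ => y + s • bv (0 : Fin n)) (bv 0) 0 := by
      simpa using ((hasDerivAt_id (0 : ℝ)).smul_const (bv (0 : Fin n))).const_add y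
    have hmt : MapsTo (fun s : ℝ => y + s • bv (0 : Fin n)) (Ici 0) (range (𝓡∂ n)) := by
      intro s hs
      rw [mem_range_iff]
      simpa [hy, bv] using hs
    have ht : Filter.Tendsto (fun s : ℝ => y + s • bv (0 : Fin n)) (𝓝[Ici 0] 0)
        (𝓝[range (𝓡∂ n)] y) := by
      rw [tendsto_nhdsWithin_iff]
      refine ⟨?_, eventually_mem_nhdsWithin.mono hmt⟩
      simpa using hl.continuousAt.tendsto.mono_left nhdsWithin_le_nhds
    have h1 : HasFDerivWithinAt (fun z => F z 0) ((EuclideanSpace.proj 0 :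
      EuclideanSpace ℝ (Fin n) →L[ℝ] ℝ) ∘L L) (range (𝓡∂ n))
        (y + (0 : ℝ) • bv (0 : Fin n)) := by
      rw [zero_smul, add_zero]; exact h0
    have h2' := HasFDerivWithinAt.comp_hasDerivWithinAt (l := fun z => F z 0) (0 : ℝ) h1
        hl.hasDerivWithinAt hmt
    have h2 : HasDerivWithinAt (fun s : ℝ => F (y + s • bv (0 : Fin n)) 0) (L (bv 0) 0) (Ici 0) 0 :=
      h2'
    have h3 := hasDerivWithinAt_iff_tendsto_slope.1 h2
    have hF0 : F y 0 = 0 := hb.self_of_nhdsWithin hy' hy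
    rw [show Ici (0 : ℝ) \ {0} = Ioi 0 from Ici_sdiff_left] at h3
    refine ge_of_tendsto h3 ?_
    filter_upwards [(ht.eventually hm).filter_mono (nhdsWithin_mono _ Ioi_subset_Ici_self),
      self_mem_nhdsWithin] with s hs hs0
    rw [slope_def_field]
    have : 0 ≤ F (y + s • bv (0 : Fin n)) 0 := mem_range_iff.1 hs
    simp only [zero_smul, add_zero, hF0, sub_zero]
    exact div_nonneg this (le_of_lt hs0)
  refine ⟨L (bv 0) 0, lt_of_le_of_ne hge fun h => ?_, hlin⟩
  obtain ⟨u, hu⟩ := (LinearMap.injective_iff_surjective (f :=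
    (L : EuclideanSpace ℝ (Fin n) →ₗ[ℝ] EuclideanSpace ℝ (Fin n)))).1 hL (bv 0)
  have h1 := hlin u
  rw [← h] at h1
  have h2 : L u = bv 0 := hu
  rw [h2] at h1
  simp [bv] at h1

/-- **Invariance of the second fundamental form** under boundary preserving maps. -/
theorem coordSFF_pullback (hy : y 0 = 0)
    (hF : ContDiffWithinAt ℝ 2 F (range (𝓡∂ n)) y)
    (hm : ∀ᶠ z in 𝓝[range (𝓡∂ n)] y, F z ∈ range (𝓡∂ n))
    (hb : ∀ᶠ z in 𝓝[range (𝓡∂ n)] y, z 0 = 0 → F z 0 = 0)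
    (hB' : ContDiffWithinAt ℝ 1 B' (range (𝓡∂ n)) (F y))
    (hBd : ContDiffWithinAt ℝ 1 B (range (𝓡∂ n)) y)
    (hM' : ∀ᶠ z in 𝓝[range (𝓡∂ n)] (F y), IsMetric (B' z))
    (hs : ∀ z ∈ range (𝓡∂ n), ∀ v w, B z v w = B z w v)
    (hs' : ∀ z ∈ range (𝓡∂ n), ∀ v w, B' z v w = B' z w v)
    (hL : ∀ᶠ z in 𝓝[range (𝓡∂ n)] y, Function.Injective (fderivWithin ℝ F (range (𝓡∂ n)) z))
    (h : ∀ᶠ z in 𝓝[range (𝓡∂ n)] y, ∀ v w, B z v w = B' (F z)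
      (fderivWithin ℝ F (range (𝓡∂ n)) z v) (fderivWithin ℝ F (range (𝓡∂ n)) z w))
    (v w : EuclideanSpace ℝ (Fin n)) (hv : v 0 = 0) (hw : w 0 = 0) :
    coordSFF (range (𝓡∂ n)) (matOf B) y v w = coordSFF (range (𝓡∂ n)) (matOf B') (F y)
      (fderivWithin ℝ F (range (𝓡∂ n)) y v) (fderivWithin ℝ F (range (𝓡∂ n)) y w) := by
  set S := range (𝓡∂ n) with hSdef
  have hS : UniqueDiffOn ℝ S := (𝓡∂ n).uniqueDiffOn
  have hyS : y ∈ S := mem_range_iff.2 hy.ge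
  have hFS : F y ∈ S := hm.self_of_nhdsWithin hyS
  have hF1 : HasFDerivWithinAt F (fderivWithin ℝ F S y) S y :=
    (hF.differentiableWithinAt (by norm_num)).hasFDerivWithinAt
  have hFt : Filter.Tendsto F (𝓝[S] y) (𝓝[S] (F y)) :=
    tendsto_nhdsWithin_iff.2 ⟨hF1.continuousWithinAt, hm⟩
  have hM'F := hFt.eventually hM'
  have hM : ∀ᶠ z in 𝓝[S] y, IsMetric (B z) := by
    filter_upwards [hM'F, hL, h] with z h1 h2 h3
    exact IsMetric.pullback _ h2 h1 h3
  have hMy := hM.self_of_nhdsWithin hyS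
  have hM'y := hM'F.self_of_nhdsWithin hyS
  have hLy := hL.self_of_nhdsWithin hyS
  obtain ⟨c, hc, hcL⟩ := exists_pos_fderivWithin_zero hy hF1 hm hb hLy
  rw [coordSFF_eq hS hyS hBd hM hs v w hw,
    coordSFF_eq hS hFS hB' hM' hs' _ _ (by rw [hcL, hw, mul_zero])]
  have hsurj : Function.Surjective (fderivWithin ℝ F S y) :=
    (LinearMap.injective_iff_surjective (f := (fderivWithin ℝ F S y :
      EuclideanSpace ℝ (Fin n) →ₗ[ℝ] EuclideanSpace ℝ (Fin n)))).1 hLy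
  have hchr := chr_pullback hS (𝓡∂ n).range_subset_closure_interior hyS hF hm
    (hB'.differentiableWithinAt (by norm_num)) (hBd.differentiableWithinAt (by norm_num))
    hMy.isInvertible hM'y.isInvertible hsurj hM'y.1 h v w
  -- second derivatives of `F⁰` in tangential directions vanish
  have hF2 : HasFDerivWithinAt (fderivWithin ℝ F S) (fderivWithin ℝ (fderivWithin ℝ F S) S y) S y :=
    ((hF.fderivWithin_right (m := 1) hS (by norm_num) hyS).differentiableWithinAt
      (by norm_num)).hasFDerivWithinAt
  have hL2 : fderivWithin ℝ (fderivWithin ℝ F S) S y v w 0 = 0 := by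
    have h1 := ((EuclideanSpace.proj (0 : Fin n) :
      EuclideanSpace ℝ (Fin n) →L[ℝ] ℝ).hasFDerivAt).comp_hasFDerivWithinAt y
      (hF2.clm_apply (hasFDerivWithinAt_const w y S))
    have h2 : ∀ᶠ z in 𝓝[S] y, z 0 = 0 → fderivWithin ℝ F S z w 0 = 0 := by
      have hd := hF.eventually (by simp)
      rw [insert_eq_of_mem hyS] at hd
      filter_upwards [hd, eventually_eventually_nhdsWithin.2 hb] with z hz hbz hz0
      exact fderivWithin_apply_eq_zero_of_boundary hz0 (((EuclideanSpace.proj (0 : Fin n) :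
        EuclideanSpace ℝ (Fin n) →L[ℝ] ℝ).hasFDerivAt).comp_hasFDerivWithinAt z
        (hz.differentiableWithinAt (by norm_num)).hasFDerivWithinAt) hbz hw
    have := fderivWithin_apply_eq_zero_of_boundary hy h1 h2 hv
    simpa using this
  have h1 := hcL (chr S B y v w)
  rw [hchr, PiLp.add_apply, hL2, zero_add] at h1
  have hgrad : gradZero B' (F y) = c • fderivWithin ℝ F S y (gradZero B y) := by
    apply hM'y.injective
    ext u'
    obtain ⟨u, rfl⟩ := hsurj u'
    rw [apply_gradZero hM'y.isInvertible, hcL, map_smul, smul_apply,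
      ← (h.self_of_nhdsWithin hyS), apply_gradZero hMy.isInvertible, smul_eq_mul]
  rw [h1, hgrad, PiLp.smul_apply, hcL, smul_eq_mul, ← mul_assoc, Real.sqrt_mul (by positivity),
    Real.sqrt_mul_self hc.le, mul_div_mul_left _ _ hc.ne']

end SecondFundamentalForm

/-! ### The scalar curvature as a function of the 2-jet of the metric -/

section MatrixInverse

variable {X : Type*} [NormedAddCommGroup X] [NormedSpace ℝ X] {n : ℕ} {m : WithTop ℕ∞}
  {s : Set X} {x : X} {A : X → Matrix (Fin n) (Fin n) ℝ}

lemma contDiffWithinAt_det (hA : ∀ i j, ContDiffWithinAt ℝ m (fun z => A z i j) s x) :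
    ContDiffWithinAt ℝ m (fun z => (A z).det) s x := by
  simp only [Matrix.det_apply]
  exact ContDiffWithinAt.sum fun σ _ => (contDiffWithinAt_prod fun i _ => hA _ _).const_smul _

lemma contDiffWithinAt_matrix_inv (hA : ∀ i j, ContDiffWithinAt ℝ m (fun z => A z i j) s x)
    (hdet : (A x).det ≠ 0) (i j : Fin n) : ContDiffWithinAt ℝ m (fun z => (A z)⁻¹ i j) s x := by
  have h1 : (fun z => (A z)⁻¹ i j) = fun z => (A z).det⁻¹ * (A z).adjugate i j := by
    funext z
    simp [Matrix.inv_def]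
  rw [h1]
  refine ((contDiffWithinAt_det hA).inv hdet).mul ?_
  simp only [Matrix.adjugate_apply]
  refine contDiffWithinAt_det fun k l => ?_
  simp only [Matrix.updateRow_apply]
  split_ifs
  · exact contDiffWithinAt_const
  · exact hA k l

end MatrixInverse

section Jets

variable {n : ℕ}

/-- The Christoffel symbols as functions of the inverse metric `gi` and of the first derivatives
`p m i j = ∂ₘ gᵢⱼ`. -/
def jetChr (gi : Matrix (Fin n) (Fin n) ℝ) (p : Fin n → Fin n → Fin n → ℝ) (k i j : Fin n) : ℝ :=
  (1 / 2 : ℝ) * ∑ l, gi k l * (p i j l + p j i l - p l i j)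

/-- The part of `∂ₘ Γᵏᵢⱼ` that contains the second derivatives `q m l i j = ∂ₘ ∂ₗ gᵢⱼ`. -/
def jetDChrMain (gi : Matrix (Fin n) (Fin n) ℝ) (q : Fin n → Fin n → Fin n → Fin n → ℝ)
    (m k i j : Fin n) : ℝ :=
  (1 / 2 : ℝ) * ∑ l, gi k l * (q m i j l + q m j i l - q m l i j)

/-- The part of `∂ₘ Γᵏᵢⱼ` that is quadratic in the first derivatives. -/
def jetDChrRest (gi : Matrix (Fin n) (Fin n) ℝ) (p : Fin n → Fin n → Fin n → ℝ)
    (m k i j : Fin n) : ℝ :=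
  (1 / 2 : ℝ) * ∑ l, (-∑ a, ∑ b, gi k a * p m a b * gi b l) * (p i j l + p j i l - p l i j)

/-- The part of the scalar curvature that is linear in the second derivatives of the metric. -/
def jetScalMain (gi : Matrix (Fin n) (Fin n) ℝ) (q : Fin n → Fin n → Fin n → Fin n → ℝ) : ℝ :=
  ∑ i, ∑ j, gi i j * ∑ k, (jetDChrMain gi q k k i j - jetDChrMain gi q j k i k)

/-- The part of the scalar curvature that is quadratic in the first derivatives of the metric. -/
def jetScalRest (gi : Matrix (Fin n) (Fin n) ℝ) (p : Fin n → Fin n → Fin n → ℝ) : ℝ :=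
  ∑ i, ∑ j, gi i j * (∑ k, (jetDChrRest gi p k k i j - jetDChrRest gi p j k i k)
    + ∑ k, ∑ l, (jetChr gi p k k l * jetChr gi p l i j - jetChr gi p k j l * jetChr gi p l i k))

variable {S : Set (EuclideanSpace ℝ (Fin n))} {y : EuclideanSpace ℝ (Fin n)}
  {G : EuclideanSpace ℝ (Fin n) → Matrix (Fin n) (Fin n) ℝ}

lemma partialDeriv_inv (hS : UniqueDiffOn ℝ S) (hy : y ∈ S)
    (hG : ∀ i j, ContDiffWithinAt ℝ 1 (fun z => G z i j) S y) (hdet : (G y).det ≠ 0)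
    (k l m : Fin n) : partialDeriv S (fun z => (G z)⁻¹ k l) m y =
      -∑ a, ∑ b, (G y)⁻¹ k a * partialDeriv S (fun z => G z a b) m y * (G y)⁻¹ b l := by
  have hdet' : IsUnit (G y).det := hdet.isUnit
  have hi : ∀ k l, HasFDerivWithinAt (fun z => (G z)⁻¹ k l) _ S y := fun k l =>
    ((contDiffWithinAt_matrix_inv hG hdet k l).differentiableWithinAt
      (by norm_num)).hasFDerivWithinAt
  have hg : ∀ k l, HasFDerivWithinAt (fun z => G z k l) _ S y := fun k l =>
    ((hG k l).differentiableWithinAt (by norm_num)).hasFDerivWithinAt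
  have hone : ∀ b, ∑ a, partialDeriv S (fun z => (G z)⁻¹ k a) m y * G y a b =
      -∑ a, (G y)⁻¹ k a * partialDeriv S (fun z => G z a b) m y := by
    intro b
    have h1 := HasFDerivWithinAt.fun_sum (u := Finset.univ) fun a _ => (hi k a).mul (hg a b)
    have h2 : (fun z => ∑ a, (G z)⁻¹ k a * G z a b) =ᶠ[𝓝[S] y]
        fun _ => (1 : Matrix (Fin n) (Fin n) ℝ) k b := by
      have : ∀ᶠ z in 𝓝[S] y, (G z).det ≠ 0 :=
        (contDiffWithinAt_det hG).continuousWithinAt.eventually_ne hdet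
      filter_upwards [this] with z hz
      rw [← Matrix.mul_apply, Matrix.nonsing_inv_mul _ hz.isUnit]
    have h3 : HasFDerivWithinAt (fun z => ∑ a, (G z)⁻¹ k a * G z a b)
        (0 : EuclideanSpace ℝ (Fin n) →L[ℝ] ℝ) S y :=
      (hasFDerivWithinAt_const ((1 : Matrix (Fin n) (Fin n) ℝ) k b) y S).congr_of_eventuallyEq h2
        (by rw [← Matrix.mul_apply, Matrix.nonsing_inv_mul _ hdet'])
    have := DFunLike.congr_fun ((hS y hy).eq h1 h3) (EuclideanSpace.single m (1 : ℝ))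
    simp only [sum_apply, add_apply, smul_apply, smul_eq_mul, zero_apply,
      Finset.sum_add_distrib] at this
    unfold partialDeriv
    simp only [mul_comm _ (G y _ b)]
    linarith
  calc _ = ∑ b, (∑ a, partialDeriv S (fun z => (G z)⁻¹ k a) m y * G y a b) * (G y)⁻¹ b l := by
        simp only [Finset.sum_mul]
        rw [Finset.sum_comm]
        simp only [mul_assoc, ← Finset.mul_sum]
        simp only [← Matrix.mul_apply, Matrix.mul_nonsing_inv _ hdet', Matrix.one_apply]
        simp
    _ = _ := by
        simp only [hone, neg_mul, Finset.sum_neg_distrib, Finset.sum_mul]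
        rw [Finset.sum_comm]

/-- The scalar curvature is the sum of a part that is linear in the second derivatives of the
metric and a part that is quadratic in the first ones. -/
lemma coordScalarCurvature_eq_jet (hS : UniqueDiffOn ℝ S) (hy : y ∈ S)
    (hG : ∀ i j, ContDiffWithinAt ℝ 2 (fun z => G z i j) S y) (hdet : (G y).det ≠ 0) :
    coordScalarCurvature S G y =
      jetScalMain (G y)⁻¹
        (fun m l i j => partialDeriv S (fun z => partialDeriv S (fun z => G z i j) l z) m y)
      + jetScalRest (G y)⁻¹ (fun m i j => partialDeriv S (fun z => G z i j) m y) := by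
  have hG1 : ∀ i j, ContDiffWithinAt ℝ 1 (fun z => G z i j) S y :=
    fun i j => (hG i j).of_le (by norm_num)
  have hpd : ∀ i j l, HasFDerivWithinAt (fun z => partialDeriv S (fun z => G z i j) l z)
      (fderivWithin ℝ (fun z => partialDeriv S (fun z => G z i j) l z) S y) S y := by
    intro i j l
    have h1 : ContDiffWithinAt ℝ 1 (fderivWithin ℝ (fun z => G z i j) S) S y :=
      (hG i j).fderivWithin_right hS (by norm_num) hy
    exact ((h1.clm_apply contDiffWithinAt_const).differentiableWithinAt
      (by norm_num)).hasFDerivWithinAt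
  have hi : ∀ k l, HasFDerivWithinAt (fun z => (G z)⁻¹ k l)
      (fderivWithin ℝ (fun z => (G z)⁻¹ k l) S y) S y := fun k l =>
    ((contDiffWithinAt_matrix_inv hG1 hdet k l).differentiableWithinAt
      (by norm_num)).hasFDerivWithinAt
  have hc : ∀ k i j m, partialDeriv S (christoffel S G k i j) m y =
      jetDChrMain (G y)⁻¹
        (fun m l i j => partialDeriv S (fun z => partialDeriv S (fun z => G z i j) l z) m y) m k i j
      + jetDChrRest (G y)⁻¹ (fun m i j => partialDeriv S (fun z => G z i j) m y) m k i j := by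
    intro k i j m
    have h1 := (HasFDerivWithinAt.fun_sum (u := Finset.univ) fun l _ => (hi k l).mul
      (((hpd j l i).add (hpd i l j)).sub (hpd i j l))).const_mul (1 / 2 : ℝ)
    have h2 := h1.fderivWithin (hS y hy)
    have h3 : partialDeriv S (christoffel S G k i j) m y = _ :=
      DFunLike.congr_fun h2 (EuclideanSpace.single m (1 : ℝ))
    rw [h3]
    have hinv := partialDeriv_inv hS hy hG1 hdet
    have hrest : jetDChrRest (G y)⁻¹ (fun m i j => partialDeriv S (fun z => G z i j) m y) m k i j
        = (1 / 2 : ℝ) * ∑ l, partialDeriv S (fun z => (G z)⁻¹ k l) m y *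
          (partialDeriv S (fun z => G z j l) i y + partialDeriv S (fun z => G z i l) j y
            - partialDeriv S (fun z => G z i j) l y) := by
      simp only [hinv, jetDChrRest]
    rw [hrest]
    unfold jetDChrMain partialDeriv
    simp only [smul_apply, sum_apply, add_apply, sub_apply, smul_eq_mul, Pi.add_apply,
      Pi.sub_apply, Finset.sum_add_distrib, mul_add]
    congr 2
    exact Finset.sum_congr rfl fun l _ => mul_comm _ _
  have hch : ∀ k i j, christoffel S G k i j y = jetChr (G y)⁻¹
      (fun m i j => partialDeriv S (fun z => G z i j) m y) k i j := by
    intro k i j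
    simp only [christoffel, jetChr]
  unfold coordScalarCurvature ricci jetScalMain jetScalRest
  simp only [hc, hch, ← Finset.sum_add_distrib, ← mul_add]
  refine Finset.sum_congr rfl fun i _ => Finset.sum_congr rfl fun j _ => ?_
  congr 1
  exact Finset.sum_congr rfl fun k _ => by ring

end Jets

/-! ### The jets of the collar metric -/

section JetSmoothness

variable {n : ℕ} {X : Type*} [NormedAddCommGroup X] [NormedSpace ℝ X] {c : X}
  {gi : X → Matrix (Fin n) (Fin n) ℝ} {p : X → Fin n → Fin n → Fin n → ℝ}
  {q : X → Fin n → Fin n → Fin n → Fin n → ℝ}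

lemma contDiffAt_jetChr (hi : ∀ i j, ContDiffAt ℝ ∞ (fun c => gi c i j) c)
    (hp : ∀ m a b, ContDiffAt ℝ ∞ (fun c => p c m a b) c) (k i j : Fin n) :
    ContDiffAt ℝ ∞ (fun c => jetChr (gi c) (p c) k i j) c := by
  unfold jetChr
  exact contDiffAt_const.mul (ContDiffAt.sum fun l _ => (hi k l).mul
    (((hp _ _ _).add (hp _ _ _)).sub (hp _ _ _)))

lemma contDiffAt_jetScalMain (hi : ∀ i j, ContDiffAt ℝ ∞ (fun c => gi c i j) c)
    (hq : ∀ m l a b, ContDiffAt ℝ ∞ (fun c => q c m l a b) c) :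
    ContDiffAt ℝ ∞ (fun c => jetScalMain (gi c) (q c)) c := by
  have h1 : ∀ m k i j, ContDiffAt ℝ ∞ (fun c => jetDChrMain (gi c) (q c) m k i j) c := by
    intro m k i j
    unfold jetDChrMain
    exact contDiffAt_const.mul (ContDiffAt.sum fun l _ => (hi k l).mul
      (((hq _ _ _ _).add (hq _ _ _ _)).sub (hq _ _ _ _)))
  unfold jetScalMain
  exact ContDiffAt.sum fun i _ => ContDiffAt.sum fun j _ => (hi i j).mul
    (ContDiffAt.sum fun k _ => (h1 _ _ _ _).sub (h1 _ _ _ _))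

lemma contDiffAt_jetScalRest (hi : ∀ i j, ContDiffAt ℝ ∞ (fun c => gi c i j) c)
    (hp : ∀ m a b, ContDiffAt ℝ ∞ (fun c => p c m a b) c) :
    ContDiffAt ℝ ∞ (fun c => jetScalRest (gi c) (p c)) c := by
  have h1 : ∀ m k i j, ContDiffAt ℝ ∞ (fun c => jetDChrRest (gi c) (p c) m k i j) c := by
    intro m k i j
    unfold jetDChrRest
    exact contDiffAt_const.mul (ContDiffAt.sum fun l _ => (ContDiffAt.sum fun a _ =>
      ContDiffAt.sum fun b _ => ((hi _ _).mul (hp _ _ _)).mul (hi _ _)).neg.mul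
      (((hp _ _ _).add (hp _ _ _)).sub (hp _ _ _)))
  have h2 := contDiffAt_jetChr hi hp
  unfold jetScalRest
  exact ContDiffAt.sum fun i _ => ContDiffAt.sum fun j _ => (hi i j).mul
    ((ContDiffAt.sum fun k _ => (h1 _ _ _ _).sub (h1 _ _ _ _)).add
    (ContDiffAt.sum fun k _ => ContDiffAt.sum fun l _ =>
      ((h2 _ _ _).mul (h2 _ _ _)).sub ((h2 _ _ _).mul (h2 _ _ _))))

end JetSmoothness

section CollarJets

variable {n : ℕ} [NeZero n]

/-- The coefficients of the cubic correction in the collar. They depend on whether the component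
`(a, b)` is tangential to the boundary, mixed, or normal. -/
def maskCoeff (t x z : ℝ) (a b : Fin n) : ℝ :=
  if a = 0 then (if b = 0 then z else x) else (if b = 0 then x else t)

/-- The profile of the collar: the component `(a, b)` of the collar metric is
`A₀ + ε * profile σ ε δ a b A₀ A₁ A₂`, where `Aⱼ` is the `j`-th normal derivative of the metric of
`M` along the boundary and `σ ∈ [0, 1]` is the rescaled normal coordinate.

Up to terms in `σ ^ 3` this is the Taylor polynomial `-σ A₁ + ε σ² / 2 A₂` that continues the metric
to second order beyond `σ = 0`. The cubic terms are chosen such that, at `σ = 1`, the `σ`-derivative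
of the tangential profile is `2 δ A₀`, and the mixed components of the collar metric vanish when
those of `A₀` do. -/
def profile (σ ε δ : ℝ) (a b : Fin n) (X Y Z : ℝ) : ℝ :=
  δ * maskCoeff (2 / 3) 0 0 a b * σ ^ 3 * X + (maskCoeff (1 / 3) 1 0 a b * σ ^ 3 - σ) * Y
    + ε * (σ ^ 2 / 2 - maskCoeff (1 / 3) (1 / 2) 0 a b * σ ^ 3) * Z

/-- The derivative of `profile` in `σ`. -/
def profile' (σ ε δ : ℝ) (a b : Fin n) (X Y Z : ℝ) : ℝ :=
  δ * maskCoeff (2 / 3) 0 0 a b * (3 * σ ^ 2) * X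
    + (maskCoeff (1 / 3) 1 0 a b * (3 * σ ^ 2) - 1) * Y
    + ε * (σ - maskCoeff (1 / 3) (1 / 2) 0 a b * (3 * σ ^ 2)) * Z

/-- The second derivative of `profile` in `σ`. -/
def profile'' (σ ε δ : ℝ) (a b : Fin n) (X Y Z : ℝ) : ℝ :=
  δ * maskCoeff (2 / 3) 0 0 a b * (6 * σ) * X + maskCoeff (1 / 3) 1 0 a b * (6 * σ) * Y
    + ε * (1 - maskCoeff (1 / 3) (1 / 2) 0 a b * (6 * σ)) * Z

/-- The values and the first and second partial derivatives, at a boundary point, of the normal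
derivatives of order `0`, `1`, `2` of a metric. -/
abbrev JetData (n : ℕ) : Type :=
  (Fin 3 → Fin n → Fin n → ℝ) × (Fin 3 → Fin n → Fin n → Fin n → ℝ) ×
    (Fin 3 → Fin n → Fin n → Fin n → Fin n → ℝ)

/-- The parameters `(σ, ε, δ, D)`. -/
abbrev CollarParam (n : ℕ) : Type := ℝ × ℝ × ℝ × JetData n

/-- The components of the collar metric. -/
def collarG (c : CollarParam n) : Matrix (Fin n) (Fin n) ℝ := Matrix.of fun a b =>
  c.2.2.2.1 0 a b + c.2.1 * profile c.1 c.2.1 c.2.2.1 a b (c.2.2.2.1 0 a b) (c.2.2.2.1 1 a b)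
    (c.2.2.2.1 2 a b)

/-- The first derivatives of the collar metric; the normal coordinate is `ε * (1 - σ)`. -/
def collarP (c : CollarParam n) (m a b : Fin n) : ℝ :=
  c.2.2.2.2.1 0 m a b + c.2.1 * profile c.1 c.2.1 c.2.2.1 a b (c.2.2.2.2.1 0 m a b)
    (c.2.2.2.2.1 1 m a b) (c.2.2.2.2.1 2 m a b)
  - if m = 0 then profile' c.1 c.2.1 c.2.2.1 a b (c.2.2.2.1 0 a b) (c.2.2.2.1 1 a b)
    (c.2.2.2.1 2 a b) else 0

/-- The second derivatives of the collar metric, multiplied by `ε`. -/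
def collarQ (c : CollarParam n) (m l a b : Fin n) : ℝ :=
  (if m = 0 then (if l = 0 then profile'' c.1 c.2.1 c.2.2.1 a b (c.2.2.2.1 0 a b) (c.2.2.2.1 1 a b)
    (c.2.2.2.1 2 a b) else 0) else 0)
  - c.2.1 * (if m = 0 then profile' c.1 c.2.1 c.2.2.1 a b (c.2.2.2.2.1 0 l a b)
    (c.2.2.2.2.1 1 l a b) (c.2.2.2.2.1 2 l a b) else 0)
  - c.2.1 * (if l = 0 then profile' c.1 c.2.1 c.2.2.1 a b (c.2.2.2.2.1 0 m a b)
    (c.2.2.2.2.1 1 m a b) (c.2.2.2.2.1 2 m a b) else 0)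
  + c.2.1 * (c.2.2.2.2.2 0 m l a b + c.2.1 * profile c.1 c.2.1 c.2.2.1 a b (c.2.2.2.2.2 0 m l a b)
    (c.2.2.2.2.2 1 m l a b) (c.2.2.2.2.2 2 m l a b))

/-- The scalar curvature of the collar metric, multiplied by `ε`. It is smooth up to `ε = 0`. -/
def collarS (c : CollarParam n) : ℝ :=
  jetScalMain (collarG c)⁻¹ (collarQ c) + c.2.1 * jetScalRest (collarG c)⁻¹ (collarP c)

lemma contDiff_collarG (a b : Fin n) : ContDiff ℝ ∞ fun c : CollarParam n => collarG c a b := by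
  unfold collarG profile
  simp only [Matrix.of_apply]
  fun_prop

lemma contDiff_collarP (m a b : Fin n) : ContDiff ℝ ∞ fun c : CollarParam n => collarP c m a b := by
  unfold collarP profile profile'
  split_ifs <;> fun_prop

lemma contDiff_collarQ (m l a b : Fin n) :
    ContDiff ℝ ∞ fun c : CollarParam n => collarQ c m l a b := by
  unfold collarQ profile profile' profile''
  split_ifs <;> fun_prop

lemma contDiffAt_inv_collarG {c : CollarParam n} (hc : (collarG c).det ≠ 0) (i j : Fin n) :
    ContDiffAt ℝ ∞ (fun c : CollarParam n => (collarG c)⁻¹ i j) c := by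
  have := contDiffWithinAt_matrix_inv (s := univ) (x := c) (A := collarG)
    (fun i j => (contDiff_collarG i j).contDiffWithinAt) hc i j
  rwa [contDiffWithinAt_univ] at this

lemma contDiffAt_collarS {c : CollarParam n} (hc : (collarG c).det ≠ 0) :
    ContDiffAt ℝ ∞ collarS c := by
  have hi := contDiffAt_inv_collarG hc
  have he : ContDiffAt ℝ ∞ (fun c : CollarParam n => c.2.1) c :=
    contDiffAt_fst.comp c contDiffAt_snd
  exact (contDiffAt_jetScalMain hi fun m l a b => (contDiff_collarQ m l a b).contDiffAt).add
    (he.mul (contDiffAt_jetScalRest hi fun m a b => (contDiff_collarP m a b).contDiffAt))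

/-- The principal part of the scalar curvature when only the second normal derivatives are
non-zero: it is `-g⁰⁰` times the trace over the tangential components. -/
lemma jetScalMain_normal (gi : Matrix (Fin n) (Fin n) ℝ) (hsym : ∀ i j, gi i j = gi j i)
    (W : Fin n → Fin n → ℝ) :
    jetScalMain gi (fun m l a b => if m = 0 then (if l = 0 then W a b else 0) else 0)
      = ∑ j, ∑ l, gi 0 j * gi 0 l * W j l - gi 0 0 * ∑ i, ∑ j, gi i j * W i j := by
  have h1 : ∀ i j, ∑ k, jetDChrMain gi
      (fun m l a b => if m = 0 then (if l = 0 then W a b else 0) else 0) k k i j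
      = (1 / 2 : ℝ) * ((if i = 0 then ∑ l, gi 0 l * W j l else 0)
        + (if j = 0 then ∑ l, gi 0 l * W i l else 0) - gi 0 0 * W i j) := by
    intro i j
    rw [Finset.sum_eq_single 0 (fun k _ hk => by simp [jetDChrMain, hk]) (by simp)]
    simp only [jetDChrMain, if_true, mul_sub, mul_add, Finset.sum_sub_distrib,
      Finset.sum_add_distrib, mul_ite, mul_zero, Finset.sum_ite_eq', Finset.mem_univ]
    split_ifs <;> simp
  have h2 : ∀ i j k, jetDChrMain gi
      (fun m l a b => if m = 0 then (if l = 0 then W a b else 0) else 0) j k i k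
      = if j = 0 then (1 / 2 : ℝ) * ((if i = 0 then ∑ l, gi k l * W k l else 0)
        + (if k = 0 then ∑ l, gi 0 l * W i l else 0) - gi k 0 * W i k) else 0 := by
    intro i j k
    by_cases hj : j = 0
    · simp only [jetDChrMain, hj, if_true, mul_sub, mul_add, Finset.sum_sub_distrib,
        Finset.sum_add_distrib, mul_ite, mul_zero, Finset.sum_ite_eq', Finset.mem_univ]
      split_ifs with h3 h4 h4 <;> simp [*]
    · simp [jetDChrMain, hj]
  unfold jetScalMain
  have h3 : ∀ i j, gi i j * ∑ k, (jetDChrMain gi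
      (fun m l a b => if m = 0 then (if l = 0 then W a b else 0) else 0) k k i j - jetDChrMain gi
      (fun m l a b => if m = 0 then (if l = 0 then W a b else 0) else 0) j k i k)
      = gi i j * ((1 / 2 : ℝ) * ((if i = 0 then ∑ l, gi 0 l * W j l else 0)
        + (if j = 0 then ∑ l, gi 0 l * W i l else 0) - gi 0 0 * W i j))
      - gi i j * ∑ k, (if j = 0 then (1 / 2 : ℝ) *
        ((if i = 0 then ∑ l, gi k l * W k l else 0)
        + (if k = 0 then ∑ l, gi 0 l * W i l else 0) - gi k 0 * W i k) else 0) := by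
    intro i j
    rw [Finset.sum_sub_distrib, h1, mul_sub]
    simp only [h2]
  simp only [h3]
  simp only [Finset.sum_sub_distrib]
  have e1 : ∑ i, ∑ j, gi i j * ((1 / 2 : ℝ) * ((if i = 0 then ∑ l, gi 0 l * W j l else 0)
        + (if j = 0 then ∑ l, gi 0 l * W i l else 0) - gi 0 0 * W i j))
      = ∑ j, ∑ l, gi 0 j * gi 0 l * W j l - (1 / 2 : ℝ) * (gi 0 0 * ∑ i, ∑ j, gi i j * W i j) := by
    have a1 : ∑ i, ∑ j, gi i j * (if i = 0 then ∑ l, gi 0 l * W j l else 0)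
        = ∑ j, ∑ l, gi 0 j * gi 0 l * W j l := by
      rw [Finset.sum_eq_single 0 (fun k _ hk => by simp [hk]) (by simp)]
      simp [Finset.mul_sum, mul_assoc]
    have a2 : ∑ i, ∑ j, gi i j * (if j = 0 then ∑ l, gi 0 l * W i l else 0)
        = ∑ j, ∑ l, gi 0 j * gi 0 l * W j l := by
      simp only [mul_ite, mul_zero, Finset.sum_ite_eq', Finset.mem_univ, if_true]
      simp [Finset.mul_sum, mul_assoc, hsym _ 0]
    calc _ = (1 / 2 : ℝ) * (∑ i, ∑ j, gi i j * (if i = 0 then ∑ l, gi 0 l * W j l else 0))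
          + (1 / 2 : ℝ) * (∑ i, ∑ j, gi i j * (if j = 0 then ∑ l, gi 0 l * W i l else 0))
          - (1 / 2 : ℝ) * (gi 0 0 * ∑ i, ∑ j, gi i j * W i j) := by
          simp only [Finset.mul_sum, ← Finset.sum_add_distrib, ← Finset.sum_sub_distrib]
          exact Finset.sum_congr rfl fun i _ => Finset.sum_congr rfl fun j _ => by ring
      _ = _ := by rw [a1, a2]; ring
  have e2 : ∑ i, ∑ j, gi i j * ∑ k, (if j = 0 then (1 / 2 : ℝ) *
        ((if i = 0 then ∑ l, gi k l * W k l else 0)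
        + (if k = 0 then ∑ l, gi 0 l * W i l else 0) - gi k 0 * W i k) else 0)
      = (1 / 2 : ℝ) * (gi 0 0 * ∑ i, ∑ j, gi i j * W i j) := by
    have a1 : ∀ i, ∑ j, gi i j * ∑ k, (if j = 0 then (1 / 2 : ℝ) *
        ((if i = 0 then ∑ l, gi k l * W k l else 0)
        + (if k = 0 then ∑ l, gi 0 l * W i l else 0) - gi k 0 * W i k) else 0)
        = gi i 0 * ((1 / 2 : ℝ) * (if i = 0 then ∑ k, ∑ l, gi k l * W k l else 0)) := by
      intro i
      rw [Finset.sum_eq_single 0 (fun k _ hk => by simp [hk]) (by simp)]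
      congr 1
      simp only [if_true]
      rw [← Finset.mul_sum, Finset.sum_sub_distrib, Finset.sum_add_distrib]
      congr 1
      have : ∑ x : Fin n, (if x = 0 then ∑ l, gi 0 l * W i l else 0) = ∑ x, gi x 0 * W i x := by
        simp [hsym _ 0]
      rw [this, add_sub_cancel_right]
      split_ifs <;> simp
    simp only [a1]
    rw [Finset.sum_eq_single 0 (fun k _ hk => by simp [hk]) (by simp)]
    simp only [if_true]
    ring
  rw [e1, e2]
  ring

lemma collarG_zero (σ δ : ℝ) (D : JetData n) : collarG (σ, 0, δ, D) = Matrix.of (D.1 0) := by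
  ext a b
  simp [collarG]

/-- At `ε = 0` the rescaled scalar curvature is linear in `σ`. Only the second normal derivatives of
the metric, which come from the cubic terms of the profile, survive in this limit. -/
lemma collarS_zero (σ δ : ℝ) (D : JetData n) (hsym : ∀ a b, D.1 0 a b = D.1 0 b a)
    (hdet : (Matrix.of (D.1 0)).det ≠ 0) (hx : ∀ a, a ≠ 0 → D.1 0 0 a = 0) :
    collarS (σ, 0, δ, D) = σ * (-2 * (Matrix.of (D.1 0))⁻¹ 0 0 *
      ∑ a : Fin n, ∑ b : Fin n, if a ≠ 0 ∧ b ≠ 0 then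
        (Matrix.of (D.1 0))⁻¹ a b * (D.1 1 a b + 2 * δ * D.1 0 a b) else 0) := by
  set gi := (Matrix.of (D.1 0))⁻¹ with hgi
  have hgs : ∀ i j, gi i j = gi j i := by
    have h1 : (Matrix.of (D.1 0)).transpose = Matrix.of (D.1 0) := by
      ext a b; simp [hsym b a]
    intro i j
    rw [← Matrix.transpose_apply gi j i, hgi, Matrix.transpose_nonsing_inv, h1]
  have hg0 : ∀ a, a ≠ 0 → gi 0 a = 0 := by
    -- column `0` of the metric is a multiple of the basis vector
    intro a ha
    have h1 : (gi * Matrix.of (D.1 0)) a 0 = 0 := by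
      rw [hgi, Matrix.nonsing_inv_mul _ hdet.isUnit, Matrix.one_apply_ne ha]
    have h2 : (gi * Matrix.of (D.1 0)) 0 0 = 1 := by
      rw [hgi, Matrix.nonsing_inv_mul _ hdet.isUnit, Matrix.one_apply_eq]
    have h3 : ∀ c, (gi * Matrix.of (D.1 0)) c 0 = gi c 0 * D.1 0 0 0 := by
      intro c
      rw [Matrix.mul_apply, Finset.sum_eq_single 0 (fun k _ hk => by simp [hsym k 0, hx k hk])
        (by simp)]
      rfl
    rw [h3] at h1 h2
    rw [hgs]
    rcases mul_eq_zero.1 h1 with h | h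
    · exact h
    · rw [h, mul_zero] at h2
      exact absurd h2 zero_ne_one
  have hQ : collarQ (σ, 0, δ, D) = fun m l a b => if m = 0 then (if l = 0 then
      profile'' σ 0 δ a b (D.1 0 a b) (D.1 1 a b) (D.1 2 a b) else 0) else 0 := by
    funext m l a b
    simp [collarQ]
  unfold collarS
  rw [collarG_zero, ← hgi, hQ, jetScalMain_normal gi hgs]
  have hW0 : profile'' σ 0 δ (0 : Fin n) 0 (D.1 0 0 0) (D.1 1 0 0) (D.1 2 0 0) = 0 := by
    simp [profile'', maskCoeff]
  have e1 : ∑ j, ∑ l, gi 0 j * gi 0 l * profile'' σ 0 δ j l (D.1 0 j l) (D.1 1 j l) (D.1 2 j l)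
      = 0 := by
    refine Finset.sum_eq_zero fun j _ => Finset.sum_eq_zero fun l _ => ?_
    by_cases hj : j = 0
    · by_cases hl : l = 0
      · subst hj; subst hl; rw [hW0, mul_zero]
      · rw [hg0 l hl]; ring
    · rw [hg0 j hj]; ring
  have e2 : ∀ i j, gi i j * profile'' σ 0 δ i j (D.1 0 i j) (D.1 1 i j) (D.1 2 i j)
      = 2 * σ * (if i ≠ 0 ∧ j ≠ 0 then gi i j * (D.1 1 i j + 2 * δ * D.1 0 i j) else 0) := by
    intro i j
    by_cases hi : i = 0
    · by_cases hj : j = 0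
      · subst hi; subst hj; rw [hW0]; simp
      · subst hi; rw [hg0 j hj]; simp
    · by_cases hj : j = 0
      · subst hj; rw [hgs, hg0 i hi]; simp
      · simp only [profile'', maskCoeff, hi, hj, if_false, ne_eq, not_false_eq_true, and_self,
          if_true]
        ring
  simp only [e1, e2, ← Finset.mul_sum]
  ring

/-- For small `ε`, the scalar curvature of the collar is smallest where it is glued: by
`collarS_zero` the derivative in `σ` is positive at `ε = 0`, hence, by compactness of `[0, 1]`, near
the given parameters. The sign condition is mean-convexity, up to a term in `δ`. -/
theorem collarS_monotone (δ : ℝ) (D : JetData n) (hsym : ∀ a b, D.1 0 a b = D.1 0 b a)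
    (hpos : (Matrix.of (D.1 0)).PosDef) (hx : ∀ a, a ≠ 0 → D.1 0 0 a = 0)
    (htr : ∑ a : Fin n, ∑ b : Fin n, (if a ≠ 0 ∧ b ≠ 0 then
        (Matrix.of (D.1 0))⁻¹ a b * (D.1 1 a b + 2 * δ * D.1 0 a b) else 0) < 0) :
    ∀ᶠ x in 𝓝 ((0, δ, D) : ℝ × ℝ × JetData n), MonotoneOn (fun σ => collarS (σ, x)) (Icc 0 1) := by
  have hdet : (Matrix.of (D.1 0)).det ≠ 0 := hpos.det_pos.ne'
  have hsm : ∀ σ : ℝ, ContDiffAt ℝ ∞ collarS ((σ, 0, δ, D) : CollarParam n) := fun σ =>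
    contDiffAt_collarS (by rwa [collarG_zero])
  have hline : ∀ (c : CollarParam n), DifferentiableAt ℝ collarS c →
      HasDerivAt (fun σ => collarS (σ, c.2)) (fderiv ℝ collarS c (1, 0)) c.1 := by
    intro c hc
    have h1 : HasDerivAt (fun σ : ℝ => ((σ, c.2) : CollarParam n)) (1, 0) c.1 :=
      (hasDerivAt_id c.1).prodMk (hasDerivAt_const c.1 c.2)
    exact HasFDerivAt.comp_hasDerivAt (l := collarS) c.1 hc.hasFDerivAt h1
  have hev : ∀ σ ∈ Icc (0 : ℝ) 1, ∀ᶠ z in 𝓝 (((0, δ, D), σ) : (ℝ × ℝ × JetData n) × ℝ),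
      DifferentiableAt ℝ collarS (z.2, z.1) ∧ 0 < fderiv ℝ collarS (z.2, z.1) (1, 0) := by
    intro σ _
    have hsw : Filter.Tendsto (fun z : (ℝ × ℝ × JetData n) × ℝ => ((z.2, z.1) : CollarParam n))
        (𝓝 ((0, δ, D), σ)) (𝓝 (σ, 0, δ, D)) := (continuous_swap.tendsto _)
    apply hsw.eventually (p := fun c => DifferentiableAt ℝ collarS c ∧
      0 < fderiv ℝ collarS c (1, 0))
    have h1 : ∀ᶠ c in 𝓝 ((σ, 0, δ, D) : CollarParam n), DifferentiableAt ℝ collarS c := by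
      filter_upwards [((hsm σ).of_le (m := 1) (by exact_mod_cast le_top)).eventually (by simp)]
        with c hc using hc.differentiableAt (by norm_num)
    have h2 : 0 < fderiv ℝ collarS ((σ, 0, δ, D) : CollarParam n) (1, 0) := by
      have h3 := hline (σ, 0, δ, D) h1.self_of_nhds
      simp only [collarS_zero _ δ D hsym hdet hx] at h3
      have h4 := h3.unique ((hasDerivAt_id σ).mul_const _)
      rw [h4, one_mul]
      have h5 : 0 < (Matrix.of (D.1 0))⁻¹ 0 0 := hpos.inv.diag_pos
      nlinarith
    have h3 : ContinuousAt (fun c => fderiv ℝ collarS c (1, 0)) ((σ, 0, δ, D) : CollarParam n) :=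
      (((hsm σ).fderiv_right (m := 0) (by simp)).continuousAt).clm_apply continuousAt_const
    exact h1.and (h3.eventually (lt_mem_nhds h2))
  filter_upwards [isCompact_Icc.eventually_forall_of_forall_eventually (x₀ := (0, δ, D))
    (P := fun x σ => DifferentiableAt ℝ collarS ((σ, x) : CollarParam n) ∧
      0 < fderiv ℝ collarS ((σ, x) : CollarParam n) (1, 0)) hev] with x hx'
  refine monotoneOn_of_deriv_nonneg (convex_Icc 0 1) ?_ ?_ ?_
  · exact fun σ hσ => (hline (σ, x) (hx' σ hσ).1).continuousAt.continuousWithinAt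
  · exact fun σ hσ => (hline (σ, x)
      (hx' σ (interior_subset hσ)).1).differentiableAt.differentiableWithinAt
  · intro σ hσ
    rw [(hline (σ, x) (hx' σ (interior_subset hσ)).1).deriv]
    exact (hx' σ (interior_subset hσ)).2.le

end CollarJets

/-! ### Calculus on the half-space -/

section HalfSpace

variable {n : ℕ} [NeZero n]

/-- The projection to the boundary hyperplane `x₀ = 0`. -/
def bproj (z : EuclideanSpace ℝ (Fin n)) : EuclideanSpace ℝ (Fin n) := z - z 0 • bv 0

@[simp] lemma bproj_zero (z : EuclideanSpace ℝ (Fin n)) : bproj z 0 = 0 := by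
  simp [bproj, bv]

lemma bproj_of_ne (z : EuclideanSpace ℝ (Fin n)) {i : Fin n} (hi : i ≠ 0) : bproj z i = z i := by
  simp [bproj, bv, hi]

lemma bproj_eq_self {z : EuclideanSpace ℝ (Fin n)} (hz : z 0 = 0) : bproj z = z := by
  simp [bproj, hz]

lemma bproj_mem (z : EuclideanSpace ℝ (Fin n)) : bproj z ∈ range (𝓡∂ n) :=
  mem_range_iff.2 (bproj_zero z).ge

@[simp] lemma bproj_bproj (z : EuclideanSpace ℝ (Fin n)) : bproj (bproj z) = bproj z :=
  bproj_eq_self (bproj_zero z)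

lemma bproj_add_smul (z : EuclideanSpace ℝ (Fin n)) (t : ℝ) : bproj (z + t • bv 0) = bproj z := by
  ext i
  by_cases hi : i = 0
  · subst hi; simp
  · rw [bproj_of_ne _ hi, bproj_of_ne _ hi]; simp [bv, hi]

lemma bproj_add (z : EuclideanSpace ℝ (Fin n)) : bproj z + z 0 • bv 0 = z := by
  simp [bproj]

/-- The projection to the boundary hyperplane as a linear map. -/
def bprojL : EuclideanSpace ℝ (Fin n) →L[ℝ] EuclideanSpace ℝ (Fin n) :=
  ContinuousLinearMap.id ℝ _ - (EuclideanSpace.proj 0).smulRight (bv 0)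

lemma bprojL_apply (z : EuclideanSpace ℝ (Fin n)) : bprojL z = bproj z := by
  simp [bprojL, bproj]

lemma contDiff_bproj {m : WithTop ℕ∞} :
    ContDiff ℝ m (bproj : EuclideanSpace ℝ (Fin n) → EuclideanSpace ℝ (Fin n)) := by
  have : (bproj : EuclideanSpace ℝ (Fin n) → EuclideanSpace ℝ (Fin n)) = bprojL := by
    funext z; rw [bprojL_apply]
  rw [this]
  exact bprojL.contDiff

lemma contDiff_zeroCoord {m : WithTop ℕ∞} :
    ContDiff ℝ m (fun z : EuclideanSpace ℝ (Fin n) => z 0) :=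
  (EuclideanSpace.proj (0 : Fin n) : EuclideanSpace ℝ (Fin n) →L[ℝ] ℝ).contDiff

section ZeroExtension

variable {V : Type*} [NormedAddCommGroup V]

open Classical in
/-- The extension by zero of a function on the half-space. -/
def zeroExt (v : EuclideanSpace ℝ (Fin n) → V) (z : EuclideanSpace ℝ (Fin n)) : V :=
  if 0 ≤ z 0 then v z else 0

lemma zeroExt_of_nonpos {v : EuclideanSpace ℝ (Fin n) → V} {z : EuclideanSpace ℝ (Fin n)}
    (hz : z 0 ≤ 0) (hv : z 0 = 0 → v z = 0) : zeroExt v z = 0 := by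
  unfold zeroExt
  split_ifs with h
  · exact hv (le_antisymm hz h)
  · rfl

variable {W : Set (EuclideanSpace ℝ (Fin n))} {v : EuclideanSpace ℝ (Fin n) → V}

lemma continuousOn_zeroExt (hc : ∀ z ∈ W, 0 ≤ z 0 → ContinuousWithinAt v (range (𝓡∂ n)) z)
    (hW : IsOpen W) (h0 : ∀ z ∈ W, z 0 = 0 → v z = 0) : ContinuousOn (zeroExt v) W := by
  have hcont : Continuous fun z : EuclideanSpace ℝ (Fin n) => z 0 :=
    (contDiff_zeroCoord (m := 0)).continuous
  intro z hz
  refine ContinuousAt.continuousWithinAt ?_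
  rcases lt_or_ge (z 0) 0 with hneg | hnn
  · refine (continuousAt_const (y := (0 : V))).congr ?_
    filter_upwards [hcont.continuousAt.eventually (gt_mem_nhds hneg)] with w hw
    exact (zeroExt_of_nonpos hw.le (fun h => absurd h hw.ne)).symm
  · have a1 : ContinuousWithinAt (zeroExt v) (range (𝓡∂ n)) z :=
      (hc z hz hnn).congr (fun w hw => by simp [zeroExt, mem_range_iff.1 hw])
        (by simp [zeroExt, hnn])
    have a2 : ContinuousWithinAt (zeroExt v) ({w | w 0 ≤ 0} ∩ W) z := by
      rcases hnn.lt_or_eq with hpos | hzero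
      · have : {w : EuclideanSpace ℝ (Fin n) | w 0 ≤ 0}ᶜ ∈ 𝓝 z := by
          filter_upwards [hcont.continuousAt.eventually (lt_mem_nhds hpos)] with w hw
          simpa using hw
        refine continuousWithinAt_of_notMem_closure fun h => ?_
        obtain ⟨w, hw1, hw2⟩ := mem_closure_iff_nhds.1 h _ this
        exact hw1 hw2.1
      · refine (continuousWithinAt_const (b := (0 : V))).congr (fun w hw => ?_) ?_
        · exact zeroExt_of_nonpos hw.1 (h0 w hw.2)
        · exact zeroExt_of_nonpos hzero.ge (h0 z hz)
    refine (a1.union a2).continuousAt ?_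
    filter_upwards [hW.mem_nhds hz] with w hw
    rcases le_total 0 (w 0) with h | h
    · exact Or.inl (mem_range_iff.2 h)
    · exact Or.inr ⟨h, hw⟩

variable [NormedSpace ℝ V]

lemma hasFDerivAt_zeroExt (hW : IsOpen W)
    (hd : ∀ z ∈ W, 0 ≤ z 0 → DifferentiableWithinAt ℝ v (range (𝓡∂ n)) z)
    (h0 : ∀ z ∈ W, z 0 = 0 → v z = 0)
    (h1 : ∀ z ∈ W, z 0 = 0 → fderivWithin ℝ v (range (𝓡∂ n)) z = 0)
    {z : EuclideanSpace ℝ (Fin n)} (hz : z ∈ W) :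
    HasFDerivAt (zeroExt v) (zeroExt (fderivWithin ℝ v (range (𝓡∂ n))) z) z := by
  have hcont : Continuous fun z : EuclideanSpace ℝ (Fin n) => z 0 :=
    (contDiff_zeroCoord (m := 0)).continuous
  rcases lt_trichotomy (z 0) 0 with hneg | hzero | hpos
  · rw [zeroExt_of_nonpos hneg.le (fun h => absurd h hneg.ne)]
    refine (hasFDerivAt_const (0 : V) z).congr_of_eventuallyEq ?_
    filter_upwards [hcont.continuousAt.eventually (gt_mem_nhds hneg)] with w hw
    exact zeroExt_of_nonpos hw.le (fun h => absurd h hw.ne)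
  · rw [zeroExt_of_nonpos hzero.le (h1 z hz)]
    have a1 : HasFDerivWithinAt (zeroExt v) (0 : EuclideanSpace ℝ (Fin n) →L[ℝ] V)
        (range (𝓡∂ n)) z := by
      have := (hd z hz hzero.ge).hasFDerivWithinAt
      rw [h1 z hz hzero] at this
      refine this.congr (fun w hw => ?_) ?_
      · simp [zeroExt, mem_range_iff.1 hw]
      · simp [zeroExt, hzero.ge]
    have a2 : HasFDerivWithinAt (zeroExt v) (0 : EuclideanSpace ℝ (Fin n) →L[ℝ] V)
        ({w | w 0 ≤ 0} ∩ W) z := by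
      refine (hasFDerivWithinAt_const (0 : V) z _).congr (fun w hw => ?_) ?_
      · exact zeroExt_of_nonpos hw.1 (h0 w hw.2)
      · exact zeroExt_of_nonpos hzero.le (h0 z hz)
    have a3 := a1.union a2
    refine a3.hasFDerivAt ?_
    filter_upwards [hW.mem_nhds hz] with w hw
    rcases le_total 0 (w 0) with h | h
    · exact Or.inl (mem_range_iff.2 h)
    · exact Or.inr ⟨h, hw⟩
  · have : zeroExt (fderivWithin ℝ v (range (𝓡∂ n))) z = fderivWithin ℝ v (range (𝓡∂ n)) z := by
      simp [zeroExt, hpos.le]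
    rw [this]
    have hnh : ∀ᶠ w in 𝓝 z, 0 < w 0 := hcont.continuousAt.eventually (lt_mem_nhds hpos)
    have hmem : range (𝓡∂ n) ∈ 𝓝 z := by
      filter_upwards [hnh] with w hw using mem_range_iff.2 hw.le
    refine ((hd z hz hpos.le).hasFDerivWithinAt.hasFDerivAt hmem).congr_of_eventuallyEq ?_
    filter_upwards [hnh] with w hw
    simp [zeroExt, hw.le]

/-- A `C²` function on the half-space whose derivatives up to order two vanish on the boundary
extends by zero to a `C²` function. -/
lemma contDiffOn_zeroExt (hW : IsOpen W)
    (hd : ∀ z ∈ W, 0 ≤ z 0 → ContDiffWithinAt ℝ 2 v (range (𝓡∂ n)) z)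
    (h0 : ∀ z ∈ W, z 0 = 0 → v z = 0)
    (h1 : ∀ z ∈ W, z 0 = 0 → fderivWithin ℝ v (range (𝓡∂ n)) z = 0)
    (h2 : ∀ z ∈ W, z 0 = 0 →
      fderivWithin ℝ (fderivWithin ℝ v (range (𝓡∂ n))) (range (𝓡∂ n)) z = 0) :
    ContDiffOn ℝ 2 (zeroExt v) W := by
  have hS : UniqueDiffOn ℝ (range (𝓡∂ n)) := (𝓡∂ n).uniqueDiffOn
  have k1 : ∀ z ∈ W, HasFDerivAt (zeroExt v) (zeroExt (fderivWithin ℝ v (range (𝓡∂ n))) z) z :=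
    fun z hz => hasFDerivAt_zeroExt hW (fun w hw hw0 => (hd w hw hw0).differentiableWithinAt
      (by norm_num)) h0 h1 hz
  have hd1 : ∀ z ∈ W, 0 ≤ z 0 →
      ContDiffWithinAt ℝ 1 (fderivWithin ℝ v (range (𝓡∂ n))) (range (𝓡∂ n)) z :=
    fun z hz hz0 => (hd z hz hz0).fderivWithin_right hS (by norm_num) (mem_range_iff.2 hz0)
  have k2 : ∀ z ∈ W, HasFDerivAt (zeroExt (fderivWithin ℝ v (range (𝓡∂ n))))
      (zeroExt (fderivWithin ℝ (fderivWithin ℝ v (range (𝓡∂ n))) (range (𝓡∂ n))) z) z :=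
    fun z hz => hasFDerivAt_zeroExt hW (fun w hw hw0 => (hd1 w hw hw0).differentiableWithinAt
      (by norm_num)) h1 h2 hz
  have k3 : ContinuousOn
      (zeroExt (fderivWithin ℝ (fderivWithin ℝ v (range (𝓡∂ n))) (range (𝓡∂ n)))) W :=
    continuousOn_zeroExt (fun z hz hz0 => ((hd1 z hz hz0).fderivWithin_right (m := 0) hS
      (by norm_num) (mem_range_iff.2 hz0)).continuousWithinAt) hW h2
  have c1 : ContDiffOn ℝ 1 (zeroExt (fderivWithin ℝ v (range (𝓡∂ n)))) W := by
    rw [show (1 : WithTop ℕ∞) = 0 + 1 by norm_num, contDiffOn_succ_iff_fderiv_of_isOpen hW]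
    refine ⟨fun z hz => (k2 z hz).differentiableAt.differentiableWithinAt, by simp, ?_⟩
    rw [contDiffOn_zero]
    exact k3.congr fun z hz => (k2 z hz).fderiv
  rw [show (2 : WithTop ℕ∞) = 1 + 1 by norm_num, contDiffOn_succ_iff_fderiv_of_isOpen hW]
  refine ⟨fun z hz => (k1 z hz).differentiableAt.differentiableWithinAt, by simp, ?_⟩
  exact c1.congr fun z hz => (k1 z hz).fderiv

end ZeroExtension

end HalfSpace

/-! ### The collar profile and normal jets along the boundary -/

section Lines

variable {n : ℕ} {z : EuclideanSpace ℝ (Fin n)}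

lemma hasDerivAt_line (f : EuclideanSpace ℝ (Fin n) → ℝ) (hf : DifferentiableAt ℝ f z)
    (m : Fin n) : HasDerivAt (fun s : ℝ => f (z + s • bv m)) (fderiv ℝ f z (bv m)) 0 := by
  have hl : HasDerivAt (fun s : ℝ => z + s • bv m) (bv m) 0 := by
    simpa using ((hasDerivAt_id (0 : ℝ)).smul_const (bv m)).const_add z
  have h0 : HasFDerivAt f (fderiv ℝ f z) (z + (0 : ℝ) • bv m) := by
    simpa using hf.hasFDerivAt
  exact h0.comp_hasDerivAt (0 : ℝ) hl

lemma fderiv_eq_of_line {f : EuclideanSpace ℝ (Fin n) → ℝ} (hf : DifferentiableAt ℝ f z)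
    {m : Fin n} {d : ℝ} (hd : HasDerivAt (fun s : ℝ => f (z + s • bv m)) d 0) :
    fderiv ℝ f z (bv m) = d :=
  (hasDerivAt_line f hf m).unique hd

end Lines

section CollarFunctions

variable {n : ℕ} [NeZero n]

/-- The collar profile with coefficient functions `X 0`, `X 1`, `X 2`; the collar coordinate is
`z 0 = ε * (1 - σ)`. -/
def collarExpr (ε δ : ℝ) (a b : Fin n) (X : Fin 3 → EuclideanSpace ℝ (Fin n) → ℝ)
    (z : EuclideanSpace ℝ (Fin n)) : ℝ :=
  X 0 z + ε * profile (1 - z 0 / ε) ε δ a b (X 0 z) (X 1 z) (X 2 z)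

/-- The function `profile'` along the collar. -/
def collarExpr' (ε δ : ℝ) (a b : Fin n) (X : Fin 3 → EuclideanSpace ℝ (Fin n) → ℝ)
    (z : EuclideanSpace ℝ (Fin n)) : ℝ :=
  profile' (1 - z 0 / ε) ε δ a b (X 0 z) (X 1 z) (X 2 z)

variable {ε δ : ℝ} {a b : Fin n} {X : Fin 3 → EuclideanSpace ℝ (Fin n) → ℝ}
  {z : EuclideanSpace ℝ (Fin n)}

lemma contDiffAt_collarExpr {m : WithTop ℕ∞} (hX : ∀ j, ContDiffAt ℝ m (X j) z) :
    ContDiffAt ℝ m (collarExpr ε δ a b X) z := by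
  have h0 := hX 0
  have h1 := hX 1
  have h2 := hX 2
  have h3 : ContDiffAt ℝ m (fun z : EuclideanSpace ℝ (Fin n) => z 0) z :=
    contDiff_zeroCoord.contDiffAt
  have h4 : ContDiffAt ℝ m (fun z : EuclideanSpace ℝ (Fin n) => z 0 / ε) z := h3.div_const ε
  unfold collarExpr profile
  fun_prop

lemma hasDerivAt_sigma (m : Fin n) : HasDerivAt
    (fun s : ℝ => 1 - (z + s • bv m : EuclideanSpace ℝ (Fin n)) 0 / ε)
      (-(if m = 0 then 1 / ε else 0)) 0 := by
  have h1 : HasDerivAt (fun s : ℝ => (z + s • bv m : EuclideanSpace ℝ (Fin n)) 0)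
      (if m = 0 then 1 else 0) 0 := by
    have : (fun s : ℝ => (z + s • bv m : EuclideanSpace ℝ (Fin n)) 0)
        = fun s => z 0 + s * (if m = 0 then 1 else 0) := by
      funext s
      simp [bv, eq_comm]
    rw [this]
    simpa using ((hasDerivAt_id (0 : ℝ)).mul_const (if m = 0 then (1 : ℝ) else 0)).const_add (z 0)
  have h2 := (h1.div_const ε).const_sub 1
  exact h2.congr_deriv (by split_ifs <;> simp)

lemma hasDerivAt_profile {s x y w : ℝ → ℝ} {s' x' y' w' t : ℝ} (hs : HasDerivAt s s' t)
    (hx : HasDerivAt x x' t) (hy : HasDerivAt y y' t) (hw : HasDerivAt w w' t) :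
    HasDerivAt (fun t => profile (s t) ε δ a b (x t) (y t) (w t))
      (profile (s t) ε δ a b x' y' w' + s' * profile' (s t) ε δ a b (x t) (y t) (w t)) t := by
  unfold profile profile'
  refine ((((hs.fun_pow 3).const_mul (δ * maskCoeff (2 / 3) 0 0 a b)).fun_mul hx).fun_add
    ((((hs.fun_pow 3).const_mul (maskCoeff (1 / 3) 1 0 a b)).fun_sub hs).fun_mul hy)).fun_add
    (((((hs.fun_pow 2).div_const 2).fun_sub
      ((hs.fun_pow 3).const_mul (maskCoeff (1 / 3) (1 / 2) 0 a b))).const_mul ε).fun_mul hw)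
    |>.congr_deriv ?_
  simp only [Nat.cast_ofNat, Nat.reduceSub, pow_one]
  ring

lemma hasDerivAt_profile' {s x y w : ℝ → ℝ} {s' x' y' w' t : ℝ} (hs : HasDerivAt s s' t)
    (hx : HasDerivAt x x' t) (hy : HasDerivAt y y' t) (hw : HasDerivAt w w' t) :
    HasDerivAt (fun t => profile' (s t) ε δ a b (x t) (y t) (w t))
      (profile' (s t) ε δ a b x' y' w' + s' * profile'' (s t) ε δ a b (x t) (y t) (w t)) t := by
  unfold profile' profile''
  refine (((((hs.fun_pow 2).const_mul 3).const_mul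
      (δ * maskCoeff (2 / 3) 0 0 a b)).fun_mul hx).fun_add
    ((((((hs.fun_pow 2).const_mul 3).const_mul (maskCoeff (1 / 3) 1 0 a b)).sub_const 1).fun_mul
      hy))).fun_add (((hs.fun_sub (((hs.fun_pow 2).const_mul 3).const_mul
      (maskCoeff (1 / 3) (1 / 2) 0 a b))).const_mul ε).fun_mul hw) |>.congr_deriv ?_
  simp only [Nat.cast_ofNat, Nat.reduceSub, pow_one]
  ring

lemma fderiv_collarExpr (hε : ε ≠ 0) (hX : ∀ j, DifferentiableAt ℝ (X j) z) (m : Fin n)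
    (hc : DifferentiableAt ℝ (collarExpr ε δ a b X) z) :
    fderiv ℝ (collarExpr ε δ a b X) z (bv m)
      = collarExpr ε δ a b (fun j w => fderiv ℝ (X j) w (bv m)) z
        - if m = 0 then collarExpr' ε δ a b X z else 0 := by
  apply fderiv_eq_of_line hc
  have hx := fun j => hasDerivAt_line (X j) (hX j) m
  have hs := hasDerivAt_sigma (z := z) (ε := ε) m
  refine ((hx 0).fun_add
    ((hasDerivAt_profile hs (hx 0) (hx 1) (hx 2)).const_mul ε)).congr_deriv ?_
  simp only [collarExpr, collarExpr', zero_smul, add_zero]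
  by_cases hm : m = 0
  · simp only [hm, if_true]
    field_simp
    ring
  · simp only [hm, if_false]
    ring

lemma differentiableAt_collarExpr' (hX : ∀ j, DifferentiableAt ℝ (X j) z) :
    DifferentiableAt ℝ (collarExpr' ε δ a b X) z := by
  have h0 := hX 0
  have h1 := hX 1
  have h2 := hX 2
  have h3 : DifferentiableAt ℝ (fun z : EuclideanSpace ℝ (Fin n) => z 0) z :=
    (contDiff_zeroCoord (m := 1)).contDiffAt.differentiableAt (by norm_num)
  have h4 : DifferentiableAt ℝ (fun z : EuclideanSpace ℝ (Fin n) => z 0 / ε) z := by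
    simpa only [div_eq_mul_inv] using h3.mul_const ε⁻¹
  unfold collarExpr' profile'
  fun_prop

lemma fderiv_collarExpr' (hX : ∀ j, DifferentiableAt ℝ (X j) z) (m : Fin n) :
    fderiv ℝ (collarExpr' ε δ a b X) z (bv m)
      = collarExpr' ε δ a b (fun j w => fderiv ℝ (X j) w (bv m)) z
        - if m = 0 then (1 / ε) * profile'' (1 - z 0 / ε) ε δ a b (X 0 z) (X 1 z) (X 2 z)
          else 0 := by
  apply fderiv_eq_of_line (differentiableAt_collarExpr' hX)
  have hx := fun j => hasDerivAt_line (X j) (hX j) m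
  have hs := hasDerivAt_sigma (z := z) (ε := ε) m
  refine (hasDerivAt_profile' hs (hx 0) (hx 1) (hx 2)).congr_deriv ?_
  simp only [collarExpr', zero_smul, add_zero]
  split_ifs <;> ring

lemma fderiv_fderiv_collarExpr (hε : ε ≠ 0) (hX : ∀ j, ContDiffAt ℝ 2 (X j) z) (m l : Fin n) :
    fderiv ℝ (fun w => fderiv ℝ (collarExpr ε δ a b X) w (bv l)) z (bv m)
      = collarExpr ε δ a b (fun j w => fderiv ℝ (fun w => fderiv ℝ (X j) w (bv l)) w (bv m)) z
        - (if m = 0 then collarExpr' ε δ a b (fun j w => fderiv ℝ (X j) w (bv l)) z else 0)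
        - (if l = 0 then collarExpr' ε δ a b (fun j w => fderiv ℝ (X j) w (bv m)) z else 0)
        + (if m = 0 then (if l = 0 then
          (1 / ε) * profile'' (1 - z 0 / ε) ε δ a b (X 0 z) (X 1 z) (X 2 z) else 0) else 0) := by
  have hXd : ∀ j, DifferentiableAt ℝ (X j) z := fun j => (hX j).differentiableAt (by norm_num)
  have hX1 : ∀ j, ContDiffAt ℝ 1 (fun w => fderiv ℝ (X j) w (bv l)) z := fun j =>
    ((hX j).fderiv_right (m := 1) (by norm_num)).clm_apply contDiffAt_const
  have hX1d : ∀ j, DifferentiableAt ℝ (fun w => fderiv ℝ (X j) w (bv l)) z :=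
    fun j => (hX1 j).differentiableAt (by norm_num)
  have hev : (fun w => fderiv ℝ (collarExpr ε δ a b X) w (bv l)) =ᶠ[𝓝 z]
      fun w => collarExpr ε δ a b (fun j w => fderiv ℝ (X j) w (bv l)) w
        - if l = 0 then collarExpr' ε δ a b X w else 0 := by
    have h2 : ∀ᶠ w in 𝓝 z, ∀ j, ContDiffAt ℝ 2 (X j) w :=
      Filter.eventually_all.2 fun j => (hX j).eventually (by simp)
    filter_upwards [h2] with w hw
    exact fderiv_collarExpr hε (fun j => (hw j).differentiableAt (by norm_num)) l
      ((contDiffAt_collarExpr hw).differentiableAt (by norm_num))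
  rw [hev.fderiv_eq]
  have hc1 : DifferentiableAt ℝ (collarExpr ε δ a b (fun j w => fderiv ℝ (X j) w (bv l))) z :=
    (contDiffAt_collarExpr hX1).differentiableAt (by norm_num)
  have hc2 := differentiableAt_collarExpr' (ε := ε) (δ := δ) (a := a) (b := b) hXd
  have e1 := fderiv_collarExpr (ε := ε) (δ := δ) (a := a) (b := b) hε hX1d m hc1
  have e2 := fderiv_collarExpr' (ε := ε) (δ := δ) (a := a) (b := b) hXd m
  by_cases hl : l = 0
  · simp only [hl, if_true] at *
    rw [fderiv_fun_sub hc1 hc2, sub_apply, e1, e2]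
    split_ifs <;> ring
  · simp only [hl, if_false, sub_zero] at *
    rw [e1]
    split_ifs <;> ring

end CollarFunctions

section PartialDeriv

variable {n : ℕ}

lemma contDiffWithinAt_partialDeriv {f : EuclideanSpace ℝ (Fin n) → ℝ}
    {z : EuclideanSpace ℝ (Fin n)} {S : Set (EuclideanSpace ℝ (Fin n))} {m m' : WithTop ℕ∞}
    (hS : UniqueDiffOn ℝ S) (hz : z ∈ S) (hf : ContDiffWithinAt ℝ m' f S z) (hm : m + 1 ≤ m')
    (i : Fin n) : ContDiffWithinAt ℝ m (partialDeriv S f i) S z :=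
  (hf.fderivWithin_right hS hm hz).clm_apply contDiffWithinAt_const

lemma fderiv_add_const_eq {V : Type*} [NormedAddCommGroup V] [NormedSpace ℝ V]
    {h : EuclideanSpace ℝ (Fin n) → V} (c z : EuclideanSpace ℝ (Fin n))
    (hh : ∀ w, h (w + c) = h w) : fderiv ℝ h (z + c) = fderiv ℝ h z := by
  have : h = fun w => h (w + c) := by funext w; rw [hh]
  conv_rhs => rw [this]
  rw [fderiv_comp_add_right]

end PartialDeriv

section BoundaryJets

variable {n : ℕ} [NeZero n] {V V' : Type*} [NormedAddCommGroup V] [NormedSpace ℝ V]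
  [NormedAddCommGroup V'] [NormedSpace ℝ V'] {f : EuclideanSpace ℝ (Fin n) → V}
  {z : EuclideanSpace ℝ (Fin n)}

/-- The normal derivatives of order `0`, `1` and `2` of `f` along the boundary of the half-space,
extended to be constant in the normal direction. -/
def normalJet (f : EuclideanSpace ℝ (Fin n) → V) (j : Fin 3) (z : EuclideanSpace ℝ (Fin n)) : V :=
  ![f (bproj z), fderivWithin ℝ f (range (𝓡∂ n)) (bproj z) (bv 0),
    fderivWithin ℝ (fun w => fderivWithin ℝ f (range (𝓡∂ n)) w (bv 0)) (range (𝓡∂ n))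
      (bproj z) (bv 0)] j

lemma contDiffAt_normalJet (hf : ContDiffWithinAt ℝ ∞ f (range (𝓡∂ n)) (bproj z)) (j : Fin 3) :
    ContDiffAt ℝ ∞ (normalJet f j) z := by
  have key : ∀ h : EuclideanSpace ℝ (Fin n) → V, ContDiffWithinAt ℝ ∞ h (range (𝓡∂ n)) (bproj z) →
      ContDiffAt ℝ ∞ (fun w => h (bproj w)) z := by
    intro h hh
    rw [← contDiffWithinAt_univ]
    exact hh.comp z contDiff_bproj.contDiffWithinAt (fun w _ => bproj_mem w)
  have hS : UniqueDiffOn ℝ (range (𝓡∂ n)) := (𝓡∂ n).uniqueDiffOn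
  have h1 : ContDiffWithinAt ℝ ∞ (fun w => fderivWithin ℝ f (range (𝓡∂ n)) w (bv 0))
      (range (𝓡∂ n)) (bproj z) :=
    (hf.fderivWithin_right hS (by simp) (bproj_mem z)).clm_apply contDiffWithinAt_const
  have h2 := (h1.fderivWithin_right (m := ∞) hS (by simp) (bproj_mem z)).clm_apply
    (contDiffWithinAt_const (c := (bv 0 : EuclideanSpace ℝ (Fin n))))
  fin_cases j
  · exact key _ hf
  · exact key _ h1
  · exact key _ h2

lemma normalJet_add (j : Fin 3) (t : ℝ) : normalJet f j (z + t • bv 0) = normalJet f j z := by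
  unfold normalJet
  rw [bproj_add_smul]

/-- The normal derivatives are the derivatives along the line through the boundary point. -/
lemma normalJet_eq_derivWithin (hf : ContDiffWithinAt ℝ 2 f (range (𝓡∂ n)) (bproj z)) (j : Fin 3) :
    normalJet f j z = ![f (bproj z + (0 : ℝ) • bv 0),
      derivWithin (fun t : ℝ => f (bproj z + t • bv 0)) (Ici 0) 0,
      derivWithin (derivWithin (fun t : ℝ => f (bproj z + t • bv 0)) (Ici 0)) (Ici 0) 0] j := by
  have hS : UniqueDiffOn ℝ (range (𝓡∂ n)) := (𝓡∂ n).uniqueDiffOn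
  have hl : ∀ t : ℝ, HasDerivWithinAt (fun s : ℝ => bproj z + s • bv (0 : Fin n)) (bv 0)
      (Ici 0) t := fun t => by
    simpa using (((hasDerivAt_id t).smul_const (bv (0 : Fin n))).const_add
      (bproj z)).hasDerivWithinAt
  have hmt : MapsTo (fun s : ℝ => bproj z + s • bv (0 : Fin n)) (Ici 0) (range (𝓡∂ n)) := by
    intro s hs
    rw [mem_range_iff]
    simpa [bv] using hs
  have hu : ∀ t ∈ Ici (0 : ℝ), UniqueDiffWithinAt ℝ (Ici (0 : ℝ)) t := fun t ht =>
    uniqueDiffOn_Ici 0 t ht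
  have key : ∀ {h : EuclideanSpace ℝ (Fin n) → V} {t : ℝ}, 0 ≤ t →
      DifferentiableWithinAt ℝ h (range (𝓡∂ n)) (bproj z + t • bv 0) →
      derivWithin (fun s : ℝ => h (bproj z + s • bv 0)) (Ici 0) t
        = fderivWithin ℝ h (range (𝓡∂ n)) (bproj z + t • bv 0) (bv 0) := by
    intro h t ht hh
    have h1 := HasFDerivWithinAt.comp_hasDerivWithinAt (l := h) t hh.hasFDerivWithinAt (hl t) hmt
    exact h1.derivWithin (hu t ht)
  have hz : bproj z + (0 : ℝ) • bv (0 : Fin n) = bproj z := by simp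
  have h0 : ContDiffWithinAt ℝ 2 f (range (𝓡∂ n)) (bproj z + (0 : ℝ) • bv 0) := by rwa [hz]
  have hev : ∀ᶠ t in 𝓝[Ici 0] (0 : ℝ),
      ContDiffWithinAt ℝ 2 f (range (𝓡∂ n)) (bproj z + t • bv 0) := by
    have h1 : ∀ᶠ w in 𝓝[range (𝓡∂ n)] (bproj z + (0 : ℝ) • bv (0 : Fin n)),
        ContDiffWithinAt ℝ 2 f (range (𝓡∂ n)) w := by
      have := h0.eventually (by simp)
      rwa [insert_eq_of_mem (hmt (self_mem_Ici))] at this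
    have h2 : Filter.Tendsto (fun s : ℝ => bproj z + s • bv (0 : Fin n)) (𝓝[Ici 0] (0 : ℝ))
        (𝓝[range (𝓡∂ n)] (bproj z + (0 : ℝ) • bv (0 : Fin n))) :=
      (hl 0).continuousWithinAt.tendsto_nhdsWithin hmt
    exact h2.eventually h1
  have d1 : ∀ᶠ t in 𝓝[Ici 0] (0 : ℝ),
      derivWithin (fun s : ℝ => f (bproj z + s • bv 0)) (Ici 0) t
        = fderivWithin ℝ f (range (𝓡∂ n)) (bproj z + t • bv 0) (bv 0) := by
    filter_upwards [hev, self_mem_nhdsWithin] with t ht ht0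
    exact key ht0 (ht.differentiableWithinAt (by norm_num))
  have h1 : ContDiffWithinAt ℝ 1 (fun w => fderivWithin ℝ f (range (𝓡∂ n)) w (bv 0))
      (range (𝓡∂ n)) (bproj z + (0 : ℝ) • bv 0) :=
    (h0.fderivWithin_right hS (by norm_num) (hmt self_mem_Ici)).clm_apply contDiffWithinAt_const
  unfold normalJet
  fin_cases j
  · simp
  · simp only [Fin.mk_one, Matrix.cons_val_one, Matrix.cons_val_zero]
    rw [d1.self_of_nhdsWithin self_mem_Ici, hz]
  · simp only [Fin.reduceFinMk, Matrix.cons_val]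
    rw [Filter.EventuallyEq.derivWithin_eq d1 (d1.self_of_nhdsWithin self_mem_Ici),
      key (h := fun w => fderivWithin ℝ f (range (𝓡∂ n)) w (bv 0)) le_rfl
        (h1.differentiableWithinAt (by norm_num)), hz]

lemma normalJet_congr {z' : EuclideanSpace ℝ (Fin n)} {f' : EuclideanSpace ℝ (Fin n) → V}
    (hf : ContDiffWithinAt ℝ 2 f (range (𝓡∂ n)) (bproj z))
    (hf' : ContDiffWithinAt ℝ 2 f' (range (𝓡∂ n)) (bproj z'))
    (h : ∀ᶠ t in 𝓝[Ici 0] (0 : ℝ), f (bproj z + t • bv 0) = f' (bproj z' + t • bv 0))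
    (j : Fin 3) : normalJet f j z = normalJet f' j z' := by
  rw [normalJet_eq_derivWithin hf, normalJet_eq_derivWithin hf']
  have h0 := h.self_of_nhdsWithin self_mem_Ici
  have h1 : ∀ᶠ t in 𝓝[Ici 0] (0 : ℝ), derivWithin (fun t : ℝ => f (bproj z + t • bv 0)) (Ici 0) t
      = derivWithin (fun t : ℝ => f' (bproj z' + t • bv 0)) (Ici 0) t := by
    have h2 := eventually_eventually_nhdsWithin.2 h
    filter_upwards [h2, self_mem_nhdsWithin] with t ht ht0
    exact Filter.EventuallyEq.derivWithin_eq ht (ht.self_of_nhdsWithin ht0)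
  have h2 := h1.self_of_nhdsWithin self_mem_Ici
  rw [h0, h2, Filter.EventuallyEq.derivWithin_eq h1 h2]

lemma normalJet_clm (L : V →L[ℝ] V')
    (hf : ContDiffWithinAt ℝ 2 f (range (𝓡∂ n)) (bproj z)) (j : Fin 3) :
    normalJet (fun w => L (f w)) j z = L (normalJet f j z) := by
  have hS : UniqueDiffOn ℝ (range (𝓡∂ n)) := (𝓡∂ n).uniqueDiffOn
  have key : ∀ {h : EuclideanSpace ℝ (Fin n) → V} {w : EuclideanSpace ℝ (Fin n)},
      w ∈ range (𝓡∂ n) → DifferentiableWithinAt ℝ h (range (𝓡∂ n)) w →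
      fderivWithin ℝ (fun w => L (h w)) (range (𝓡∂ n)) w (bv 0)
        = L (fderivWithin ℝ h (range (𝓡∂ n)) w (bv 0)) := by
    intro h w hw hh
    have := (L.hasFDerivAt.comp_hasFDerivWithinAt w hh.hasFDerivWithinAt).fderivWithin (hS w hw)
    exact DFunLike.congr_fun this (bv 0)
  have hev : ∀ᶠ w in 𝓝[range (𝓡∂ n)] (bproj z), ContDiffWithinAt ℝ 2 f (range (𝓡∂ n)) w := by
    have := hf.eventually (by simp)
    rwa [insert_eq_of_mem (bproj_mem z)] at this
  have h1 : ∀ᶠ w in 𝓝[range (𝓡∂ n)] (bproj z),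
      fderivWithin ℝ (fun w => L (f w)) (range (𝓡∂ n)) w (bv 0)
        = L (fderivWithin ℝ f (range (𝓡∂ n)) w (bv 0)) := by
    filter_upwards [hev, self_mem_nhdsWithin] with w hw hwS
    exact key hwS (hw.differentiableWithinAt (by norm_num))
  have h2 : ContDiffWithinAt ℝ 1 (fun w => fderivWithin ℝ f (range (𝓡∂ n)) w (bv 0))
      (range (𝓡∂ n)) (bproj z) :=
    (hf.fderivWithin_right hS (by norm_num) (bproj_mem z)).clm_apply contDiffWithinAt_const
  unfold normalJet
  fin_cases j
  · rfl
  · exact h1.self_of_nhdsWithin (bproj_mem z)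
  · simp only [Fin.reduceFinMk, Matrix.cons_val]
    rw [Filter.EventuallyEq.fderivWithin_eq h1 (h1.self_of_nhdsWithin (bproj_mem z))]
    exact key (bproj_mem z) (h2.differentiableWithinAt (by norm_num))

lemma normalJet_equiv (L : V ≃L[ℝ] V') (j : Fin 3) :
    normalJet (fun w => L (f w)) j z = L (normalJet f j z) := by
  have hS : UniqueDiffOn ℝ (range (𝓡∂ n)) := (𝓡∂ n).uniqueDiffOn
  have key : ∀ {h : EuclideanSpace ℝ (Fin n) → V} {w : EuclideanSpace ℝ (Fin n)},
      w ∈ range (𝓡∂ n) → fderivWithin ℝ (fun w => L (h w)) (range (𝓡∂ n)) w (bv 0)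
        = L (fderivWithin ℝ h (range (𝓡∂ n)) w (bv 0)) := by
    intro h w hw
    have := L.comp_fderivWithin (f := h) (hS w hw)
    exact DFunLike.congr_fun this (bv 0)
  unfold normalJet
  fin_cases j
  · rfl
  · exact key (bproj_mem z)
  · simp only [Fin.reduceFinMk, Matrix.cons_val]
    rw [fderivWithin_congr (fun w hw => key hw) (key (bproj_mem z))]
    exact key (bproj_mem z)

lemma fderiv_normalJet_zero {f : EuclideanSpace ℝ (Fin n) → ℝ}
    (hf : ContDiffWithinAt ℝ ∞ f (range (𝓡∂ n)) (bproj z)) (j : Fin 3) :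
    fderiv ℝ (normalJet f j) z (bv 0) = 0 := by
  apply fderiv_eq_of_line ((contDiffAt_normalJet hf j).differentiableAt (by simp))
  simp only [normalJet_add]
  exact hasDerivAt_const _ _

/-- A `C²` function vanishes to second order along the boundary if its normal derivatives of order
at most two vanish there. -/
lemma fderivWithin_eq_zero_of_normal {v : EuclideanSpace ℝ (Fin n) → ℝ}
    {W : Set (EuclideanSpace ℝ (Fin n))} (hW : IsOpen W)
    (hv : ∀ z ∈ W, 0 ≤ z 0 → ContDiffWithinAt ℝ 2 v (range (𝓡∂ n)) z)
    (h0 : ∀ z ∈ W, z 0 = 0 → v z = 0)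
    (h1 : ∀ z ∈ W, z 0 = 0 → fderivWithin ℝ v (range (𝓡∂ n)) z (bv 0) = 0)
    (h2 : ∀ z ∈ W, z 0 = 0 → fderivWithin ℝ
      (fun w => fderivWithin ℝ v (range (𝓡∂ n)) w (bv 0)) (range (𝓡∂ n)) z (bv 0) = 0)
    (hz : z ∈ W) (hz0 : z 0 = 0) :
    fderivWithin ℝ v (range (𝓡∂ n)) z = 0 ∧
      fderivWithin ℝ (fderivWithin ℝ v (range (𝓡∂ n))) (range (𝓡∂ n)) z = 0 := by
  have hS : UniqueDiffOn ℝ (range (𝓡∂ n)) := (𝓡∂ n).uniqueDiffOn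
  have hdec : ∀ u : EuclideanSpace ℝ (Fin n), u = bproj u + u 0 • bv 0 := fun u =>
    (bproj_add u).symm
  have hd1 : ∀ w ∈ W, w 0 = 0 → fderivWithin ℝ v (range (𝓡∂ n)) w = 0 := by
    intro w hw hw0
    ext u
    have ht := fderivWithin_apply_eq_zero_of_boundary hw0 ((hv w hw hw0.ge).differentiableWithinAt
      (by norm_num)).hasFDerivWithinAt (by
        filter_upwards [mem_nhdsWithin_of_mem_nhds (hW.mem_nhds hw)] with y hy using h0 y hy)
      (bproj_zero u)
    rw [hdec u, map_add, map_smul, ht, h1 w hw hw0]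
    simp
  refine ⟨hd1 z hz hz0, ?_⟩
  have hzS : z ∈ range (𝓡∂ n) := mem_range_iff.2 hz0.ge
  have hc1 : ContDiffWithinAt ℝ 1 (fderivWithin ℝ v (range (𝓡∂ n))) (range (𝓡∂ n)) z :=
    (hv z hz hz0.ge).fderivWithin_right hS (by norm_num) hzS
  have hD := (hc1.differentiableWithinAt (by norm_num)).hasFDerivWithinAt
  set D := fderivWithin ℝ (fderivWithin ℝ v (range (𝓡∂ n))) (range (𝓡∂ n)) z
  have ht : ∀ u : EuclideanSpace ℝ (Fin n), u 0 = 0 → D u = 0 := fun u hu =>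
    fderivWithin_apply_eq_zero_of_boundary hz0 hD (by
      filter_upwards [mem_nhdsWithin_of_mem_nhds (hW.mem_nhds hz)] with y hy using hd1 y hy) hu
  have hsym : ∀ u w, D u w = D w u := by
    have : IsSymmSndFDerivWithinAt ℝ v (range (𝓡∂ n)) z :=
      (hv z hz hz0.ge).isSymmSndFDerivWithinAt (by simp) hS
        ((𝓡∂ n).range_subset_closure_interior hzS) hzS
    exact fun u w => this u w
  have hn : D (bv 0) (bv 0) = 0 := by
    rw [← h2 z hz hz0, (hD.clm_apply (hasFDerivWithinAt_const (bv 0) z _)).fderivWithin (hS z hzS)]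
    simp
  have hn' : D (bv 0) = 0 := by
    ext u
    rw [hdec u, map_add, map_smul, hn, hsym, ht _ (bproj_zero u)]
    simp
  ext u : 1
  rw [hdec u, map_add, map_smul, hn', ht _ (bproj_zero u)]
  simp

end BoundaryJets

/-! ### Matching of the collar with the metric to second order -/

lemma two_le_infty : (2 : WithTop ℕ∞) ≤ ∞ :=
  show ((2 : ℕ∞) : WithTop ℕ∞) ≤ ((⊤ : ℕ∞) : WithTop ℕ∞) from WithTop.coe_le_coe.2 le_top

section Glue

variable {n : ℕ} [NeZero n] {z c : EuclideanSpace ℝ (Fin n)}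

lemma fderivWithin_comp_add {h : EuclideanSpace ℝ (Fin n) → ℝ} (hz : z ∈ range (𝓡∂ n))
    (hh : ContDiffAt ℝ 2 h (z + c)) (u u' : EuclideanSpace ℝ (Fin n)) :
    fderivWithin ℝ (fun w => h (w + c)) (range (𝓡∂ n)) z u = fderiv ℝ h (z + c) u ∧
    fderivWithin ℝ (fun w => fderivWithin ℝ (fun w => h (w + c)) (range (𝓡∂ n)) w u')
      (range (𝓡∂ n)) z u = fderiv ℝ (fun w => fderiv ℝ h w u') (z + c) u := by
  have hS : UniqueDiffOn ℝ (range (𝓡∂ n)) := (𝓡∂ n).uniqueDiffOn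
  have key : ∀ {k : EuclideanSpace ℝ (Fin n) → ℝ} {w : EuclideanSpace ℝ (Fin n)},
      w ∈ range (𝓡∂ n) → DifferentiableAt ℝ k (w + c) →
      fderivWithin ℝ (fun w => k (w + c)) (range (𝓡∂ n)) w = fderiv ℝ k (w + c) := by
    intro k w hw hk
    have : DifferentiableAt ℝ (fun w => k (w + c)) w := (differentiableAt_comp_add_right c).2 hk
    rw [this.fderivWithin (hS w hw), fderiv_comp_add_right]
  refine ⟨by rw [key hz (hh.differentiableAt (by norm_num))], ?_⟩
  have hev : ∀ᶠ w in 𝓝[range (𝓡∂ n)] z,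
      fderivWithin ℝ (fun w => h (w + c)) (range (𝓡∂ n)) w u' = fderiv ℝ h (w + c) u' := by
    have h1 : ∀ᶠ w in 𝓝 z, ContDiffAt ℝ 2 h (w + c) :=
      ((continuous_add_const c).tendsto z).eventually (hh.eventually (by simp))
    filter_upwards [mem_nhdsWithin_of_mem_nhds h1, self_mem_nhdsWithin] with w hw hwS
    rw [key hwS (hw.differentiableAt (by norm_num))]
  have h1 : DifferentiableAt ℝ (fun w => fderiv ℝ h w u') (z + c) :=
    ((hh.fderiv_right (m := 1) (by norm_num)).clm_apply contDiffAt_const).differentiableAt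
      (by norm_num)
  rw [Filter.EventuallyEq.fderivWithin_eq hev (hev.self_of_nhdsWithin hz)]
  rw [key (k := fun w => fderiv ℝ h w u') hz h1]

variable {f : EuclideanSpace ℝ (Fin n) → ℝ} {W : Set (EuclideanSpace ℝ (Fin n))} {ε δ : ℝ}
  {a b : Fin n}

lemma contDiffAt_collarExpr_normalJet (hf : ContDiffWithinAt ℝ ∞ f (range (𝓡∂ n)) (bproj z)) :
    ContDiffAt ℝ ∞ (collarExpr ε δ a b (normalJet f)) z :=
  contDiffAt_collarExpr fun j => contDiffAt_normalJet hf j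

/-- The difference of `f` and the shifted collar function vanishes to second order along the
boundary, as the profile contains the Taylor polynomial of `f` up to cubic terms. -/
lemma glue_jets (hW : IsOpen W) (hWb : ∀ z ∈ W, bproj z ∈ W) (hε : ε ≠ 0)
    (hf : ∀ z ∈ W, 0 ≤ z 0 → ContDiffWithinAt ℝ ∞ f (range (𝓡∂ n)) z) :
    (∀ z ∈ W, 0 ≤ z 0 → ContDiffWithinAt ℝ 2
      (fun w => f w - collarExpr ε δ a b (normalJet f) (w + ε • bv 0)) (range (𝓡∂ n)) z) ∧
    ∀ z ∈ W, z 0 = 0 →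
      f z - collarExpr ε δ a b (normalJet f) (z + ε • bv 0) = 0 ∧
      fderivWithin ℝ (fun w => f w - collarExpr ε δ a b (normalJet f) (w + ε • bv 0))
        (range (𝓡∂ n)) z = 0 ∧
      fderivWithin ℝ (fderivWithin ℝ
        (fun w => f w - collarExpr ε δ a b (normalJet f) (w + ε • bv 0))
        (range (𝓡∂ n))) (range (𝓡∂ n)) z = 0 := by
  have hS : UniqueDiffOn ℝ (range (𝓡∂ n)) := (𝓡∂ n).uniqueDiffOn
  set k := collarExpr ε δ a b (normalJet f) with hk
  have hb : ∀ z ∈ W, ContDiffWithinAt ℝ ∞ f (range (𝓡∂ n)) (bproj z) := fun z hz =>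
    hf _ (hWb z hz) (by simp)
  have hks : ∀ z ∈ W, ContDiffAt ℝ ∞ k (z + ε • bv 0) := fun z hz =>
    contDiffAt_collarExpr_normalJet (by rw [bproj_add_smul]; exact hb z hz)
  have hk2 : ∀ z ∈ W, ContDiffAt ℝ 2 k (z + ε • bv 0) := fun z hz =>
    (hks z hz).of_le two_le_infty
  have hf2 : ∀ z ∈ W, 0 ≤ z 0 → ContDiffWithinAt ℝ 2 f (range (𝓡∂ n)) z := fun z hz h0 =>
    (hf z hz h0).of_le two_le_infty
  have hks' : ∀ z ∈ W, ContDiffWithinAt ℝ 2 (fun w => k (w + ε • bv 0)) (range (𝓡∂ n)) z :=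
    fun z hz => ((hk2 z hz).comp z (contDiff_id.add contDiff_const).contDiffAt).contDiffWithinAt
  have hv : ∀ z ∈ W, 0 ≤ z 0 → ContDiffWithinAt ℝ 2 (fun w => f w - k (w + ε • bv 0))
      (range (𝓡∂ n)) z := fun z hz hz0 => (hf2 z hz hz0).sub (hks' z hz)
  have hσ : ∀ z : EuclideanSpace ℝ (Fin n), z 0 = 0 →
      1 - (z + ε • bv 0 : EuclideanSpace ℝ (Fin n)) 0 / ε = 0 := by
    intro z hz0
    simp [bv, hz0, hε]
  have v0 : ∀ z ∈ W, z 0 = 0 → f z - k (z + ε • bv 0) = 0 := by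
    intro z hz hz0
    simp only [hk, collarExpr, hσ z hz0, profile, normalJet_add]
    simp [normalJet, bproj_eq_self hz0]
  have hX : ∀ z ∈ W, ∀ j, ContDiffAt ℝ 2 (normalJet f j) (z + ε • bv 0) := fun z hz j =>
    (contDiffAt_normalJet (by rw [bproj_add_smul]; exact hb z hz) j).of_le two_le_infty
  have hX0 : ∀ z ∈ W, ∀ j, fderiv ℝ (normalJet f j) (z + ε • bv 0) (bv 0) = 0 := fun z hz j =>
    fderiv_normalJet_zero (by rw [bproj_add_smul]; exact hb z hz) j
  have hdf : ∀ z ∈ W, 0 ≤ z 0 → fderivWithin ℝ (fun w => f w - k (w + ε • bv 0))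
      (range (𝓡∂ n)) z = fderivWithin ℝ f (range (𝓡∂ n)) z
        - fderivWithin ℝ (fun w => k (w + ε • bv 0)) (range (𝓡∂ n)) z := fun z hz hz0 =>
    fderivWithin_fun_sub (hS z (mem_range_iff.2 hz0)) ((hf2 z hz hz0).differentiableWithinAt
      (by norm_num)) ((hks' z hz).differentiableWithinAt (by norm_num))
  have v1 : ∀ z ∈ W, z 0 = 0 → fderivWithin ℝ (fun w => f w - k (w + ε • bv 0))
      (range (𝓡∂ n)) z (bv 0) = 0 := by
    intro z hz hz0
    rw [hdf z hz hz0.ge, sub_apply,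
      (fderivWithin_comp_add (mem_range_iff.2 hz0.ge) (hk2 z hz) (bv 0) (bv 0)).1, hk,
      fderiv_collarExpr hε (fun j => (hX z hz j).differentiableAt (by norm_num)) 0
        ((hk2 z hz).differentiableAt (by norm_num))]
    simp only [collarExpr, collarExpr', hX0 z hz, hσ z hz0, profile, profile', normalJet_add]
    simp [normalJet, bproj_eq_self hz0]
  have v2 : ∀ z ∈ W, z 0 = 0 → fderivWithin ℝ (fun w => fderivWithin ℝ
      (fun w => f w - k (w + ε • bv 0)) (range (𝓡∂ n)) w (bv 0)) (range (𝓡∂ n)) z (bv 0) = 0 := by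
    intro z hz hz0
    have hzS : z ∈ range (𝓡∂ n) := mem_range_iff.2 hz0.ge
    have hev : ∀ᶠ w in 𝓝[range (𝓡∂ n)] z, fderivWithin ℝ (fun w => f w - k (w + ε • bv 0))
      (range (𝓡∂ n)) w (bv 0) = fderivWithin ℝ f (range (𝓡∂ n)) w (bv 0)
        - fderivWithin ℝ (fun w => k (w + ε • bv 0)) (range (𝓡∂ n)) w (bv 0) := by
      filter_upwards [mem_nhdsWithin_of_mem_nhds (hW.mem_nhds hz), self_mem_nhdsWithin]
        with w hw hwS
      rw [hdf w hw (mem_range_iff.1 hwS), sub_apply]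
    have e1 : DifferentiableWithinAt ℝ (fun w => fderivWithin ℝ f (range (𝓡∂ n)) w (bv 0))
        (range (𝓡∂ n)) z :=
      (((hf2 z hz hz0.ge).fderivWithin_right (m := 1) hS (by norm_num) hzS).clm_apply
        contDiffWithinAt_const).differentiableWithinAt (by norm_num)
    have e2 : DifferentiableWithinAt ℝ
        (fun w => fderivWithin ℝ (fun w => k (w + ε • bv 0)) (range (𝓡∂ n)) w (bv 0))
        (range (𝓡∂ n)) z :=
      (((hks' z hz).fderivWithin_right (m := 1) hS (by norm_num) hzS).clm_apply
        contDiffWithinAt_const).differentiableWithinAt (by norm_num)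
    rw [Filter.EventuallyEq.fderivWithin_eq hev (hev.self_of_nhdsWithin hzS),
      fderivWithin_fun_sub (hS z hzS) e1 e2, sub_apply,
      (fderivWithin_comp_add hzS (hk2 z hz) (bv 0) (bv 0)).2, hk,
      fderiv_fderiv_collarExpr hε (hX z hz)]
    have hX00 : ∀ j, fderiv ℝ (fun w => fderiv ℝ (normalJet f j) w (bv 0)) (z + ε • bv 0) (bv 0)
        = 0 := by
      intro j
      have : ∀ᶠ w in 𝓝 (z + ε • bv 0), fderiv ℝ (normalJet f j) w (bv 0) = 0 := by
        have h1 : ∀ᶠ w in 𝓝 (z + ε • bv 0), w - ε • bv 0 ∈ W := by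
          have : Filter.Tendsto (fun w : EuclideanSpace ℝ (Fin n) => w - ε • bv 0)
              (𝓝 (z + ε • bv 0)) (𝓝 z) := by
            have h := (continuous_sub_right (ε • bv 0 : EuclideanSpace ℝ (Fin n))).tendsto
              (z + ε • bv 0)
            rwa [add_sub_cancel_right] at h
          exact this.eventually (hW.mem_nhds hz)
        filter_upwards [h1] with w hw
        simpa using hX0 _ hw j
      rw [Filter.EventuallyEq.fderiv_eq (f := fun _ => (0 : ℝ)) this]
      simp
    simp only [collarExpr, collarExpr', hX0 z hz, hX00, hσ z hz0, profile, profile', profile'',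
      normalJet_add]
    simp [normalJet, bproj_eq_self hz0, hε]
  exact ⟨hv, fun z hz hz0 => ⟨v0 z hz hz0, fderivWithin_eq_zero_of_normal hW hv v0 v1 v2 hz hz0⟩⟩

end Glue

/-! ### The collar metric in coordinates -/

section CollarMetric

variable {n : ℕ}

lemma contDiffWithinAt_bil {X : Type*} [NormedAddCommGroup X] [NormedSpace ℝ X] {m : WithTop ℕ∞}
    {B : X → Bil (EuclideanSpace ℝ (Fin n))} {S : Set X} {x : X}
    (h : ∀ i j, ContDiffWithinAt ℝ m (fun z => B z (bv i) (bv j)) S x) :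
    ContDiffWithinAt ℝ m B S x := by
  have : B = fun z => ∑ i, ∑ j, B z (bv i) (bv j) •
      ((EuclideanSpace.proj i : EuclideanSpace ℝ (Fin n) →L[ℝ] ℝ).smulRight
        (EuclideanSpace.proj j : EuclideanSpace ℝ (Fin n) →L[ℝ] ℝ)) := by
    funext z
    ext v w
    rw [bil_eq_sum]
    simp [sum_apply, mul_comm]
  rw [this]
  exact ContDiffWithinAt.sum fun i _ => ContDiffWithinAt.sum fun j _ =>
    (h i j).smul contDiffWithinAt_const

lemma partialDeriv_congr {S : Set (EuclideanSpace ℝ (Fin n))} {f g : EuclideanSpace ℝ (Fin n) → ℝ}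
    {z : EuclideanSpace ℝ (Fin n)} (h : f =ᶠ[𝓝[S] z] g) (m : Fin n) :
    ∀ᶠ w in 𝓝[S] z, w ∈ S → partialDeriv S f m w = partialDeriv S g m w := by
  filter_upwards [eventually_eventually_nhdsWithin.2 h] with w hw hwS
  unfold partialDeriv
  rw [Filter.EventuallyEq.fderivWithin_eq hw (hw.self_of_nhdsWithin hwS)]

lemma contDiffWithinAt_entry {m : WithTop ℕ∞}
    {B : EuclideanSpace ℝ (Fin n) → Bil (EuclideanSpace ℝ (Fin n))}
    {z : EuclideanSpace ℝ (Fin n)} {S : Set (EuclideanSpace ℝ (Fin n))}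
    (hB : ContDiffWithinAt ℝ m B S z) (i j : Fin n) :
    ContDiffWithinAt ℝ m (fun w => B w (bv i) (bv j)) S z :=
  (hB.clm_apply contDiffWithinAt_const).clm_apply contDiffWithinAt_const

lemma jetScalMain_smul (gi : Matrix (Fin n) (Fin n) ℝ) (q : Fin n → Fin n → Fin n → Fin n → ℝ)
    (r : ℝ) : jetScalMain gi (fun m l a b => r * q m l a b) = r * jetScalMain gi q := by
  simp only [jetScalMain, jetDChrMain, Finset.mul_sum, ← Finset.sum_sub_distrib]
  refine Finset.sum_congr rfl fun i _ => Finset.sum_congr rfl fun j _ =>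
    Finset.sum_congr rfl fun k _ => Finset.sum_congr rfl fun l _ => ?_
  ring

variable [NeZero n]

/-- Scaling of the tangential, mixed and normal parts of a bilinear form by `t`, `x` and `c`. -/
def maskBil (t x c : ℝ) (b : Bil (EuclideanSpace ℝ (Fin n))) : Bil (EuclideanSpace ℝ (Fin n)) :=
  t • b.bilinearComp bprojL bprojL
    + x • (b.bilinearComp bprojL (ContinuousLinearMap.id ℝ _ - bprojL)
      + b.bilinearComp (ContinuousLinearMap.id ℝ _ - bprojL) bprojL)
    + c • b.bilinearComp (ContinuousLinearMap.id ℝ _ - bprojL) (ContinuousLinearMap.id ℝ _ - bprojL)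

lemma maskBil_apply (t x c : ℝ) (b : Bil (EuclideanSpace ℝ (Fin n)))
    (v w : EuclideanSpace ℝ (Fin n)) : maskBil t x c b v w =
      t * b (bproj v) (bproj w) + x * (b (bproj v) (w - bproj w) + b (v - bproj v) (bproj w))
        + c * b (v - bproj v) (w - bproj w) := by
  simp only [maskBil, add_apply, smul_apply, ContinuousLinearMap.bilinearComp_apply,
    bprojL_apply, sub_apply, ContinuousLinearMap.id_apply, smul_eq_mul]

lemma bproj_bv_zero : bproj (bv 0 : EuclideanSpace ℝ (Fin n)) = 0 := by
  simp [bproj, bv]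

lemma bproj_bv_of_ne {i : Fin n} (hi : i ≠ 0) :
    bproj (bv i : EuclideanSpace ℝ (Fin n)) = bv i :=
  bproj_eq_self (by simp [bv, hi.symm])

lemma maskBil_bv (t x c : ℝ) (b : Bil (EuclideanSpace ℝ (Fin n))) (i j : Fin n) :
    maskBil t x c b (bv i) (bv j) = maskCoeff t x c i j * b (bv i) (bv j) := by
  rw [maskBil_apply]
  unfold maskCoeff
  by_cases hi : i = 0 <;> by_cases hj : j = 0 <;>
    simp [hi, hj, bproj_bv_zero, bproj_bv_of_ne]

/-- The collar metric with coefficients `A 0`, `A 1`, `A 2`. -/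
def collarBil (ε δ : ℝ) (A : Fin 3 → EuclideanSpace ℝ (Fin n) → Bil (EuclideanSpace ℝ (Fin n)))
    (z : EuclideanSpace ℝ (Fin n)) : Bil (EuclideanSpace ℝ (Fin n)) :=
  A 0 z + ε • ((δ * (1 - z 0 / ε) ^ 3) • maskBil (2 / 3) 0 0 (A 0 z)
    + ((1 - z 0 / ε) ^ 3 • maskBil (1 / 3) 1 0 (A 1 z) - (1 - z 0 / ε) • A 1 z)
    + ε • (((1 - z 0 / ε) ^ 2 / 2) • A 2 z
      - (1 - z 0 / ε) ^ 3 • maskBil (1 / 3) (1 / 2) 0 (A 2 z)))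

variable {ε δ : ℝ} {z : EuclideanSpace ℝ (Fin n)} {W : Set (EuclideanSpace ℝ (Fin n))}
  {B : EuclideanSpace ℝ (Fin n) → Bil (EuclideanSpace ℝ (Fin n))}

lemma collarBil_bv (A : Fin 3 → EuclideanSpace ℝ (Fin n) → Bil (EuclideanSpace ℝ (Fin n)))
    (i j : Fin n) : collarBil ε δ A z (bv i) (bv j)
      = collarExpr ε δ i j (fun k w => A k w (bv i) (bv j)) z := by
  simp only [collarBil, collarExpr, profile, add_apply, sub_apply, smul_apply, maskBil_bv,
    smul_eq_mul]
  ring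

lemma maskBil_symm {t x c : ℝ} {b : Bil (EuclideanSpace ℝ (Fin n))} (hb : ∀ v w, b v w = b w v)
    (v w : EuclideanSpace ℝ (Fin n)) : maskBil t x c b v w = maskBil t x c b w v := by
  rw [maskBil_apply, maskBil_apply, hb (bproj v), hb (bproj v), hb (v - bproj v),
    hb (v - bproj v)]
  ring

lemma normalJet_symm (hB : ∀ z v w, B z v w = B z w v) (j : Fin 3)
    (v w : EuclideanSpace ℝ (Fin n)) : normalJet B j z v w = normalJet B j z w v := by
  have h := normalJet_equiv (f := B) (z := z) (ContinuousLinearMap.flipₗᵢ ℝ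
    (EuclideanSpace ℝ (Fin n)) (EuclideanSpace ℝ (Fin n)) ℝ).toContinuousLinearEquiv j
  have h2 : (fun w => (ContinuousLinearMap.flipₗᵢ ℝ (EuclideanSpace ℝ (Fin n))
      (EuclideanSpace ℝ (Fin n)) ℝ).toContinuousLinearEquiv (B w)) = B := by
    funext y
    ext v w
    exact hB y w v
  rw [h2] at h
  conv_lhs => rw [h]
  rfl

lemma collarBil_symm (hB : ∀ z v w, B z v w = B z w v) (v w : EuclideanSpace ℝ (Fin n)) :
    collarBil ε δ (normalJet B) z v w = collarBil ε δ (normalJet B) z w v := by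
  have h := fun j => normalJet_symm (z := z) hB j
  simp only [collarBil, add_apply, sub_apply, smul_apply, smul_eq_mul]
  rw [maskBil_symm (h 0) v w, maskBil_symm (h 1) v w, maskBil_symm (h 2) v w, h 0 v w, h 1 v w,
    h 2 v w]

/-- The field of bilinear forms obtained from `B` by attaching a collar of width `ε`: a collar for
`z 0 ≤ ε`, and the translate of `B` further on. -/
def extBil (ε δ : ℝ) (B : EuclideanSpace ℝ (Fin n) → Bil (EuclideanSpace ℝ (Fin n)))
    (z : EuclideanSpace ℝ (Fin n)) : Bil (EuclideanSpace ℝ (Fin n)) :=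
  if z 0 ≤ ε then collarBil ε δ (normalJet B) z else B (z - ε • bv 0)

lemma collarBil_normalJet_bv (hB : ContDiffWithinAt ℝ 2 B (range (𝓡∂ n)) (bproj z)) (i j : Fin n) :
    collarBil ε δ (normalJet B) z (bv i) (bv j)
      = collarExpr ε δ i j (normalJet fun w => B w (bv i) (bv j)) z := by
  rw [collarBil_bv]
  have h : ∀ k, normalJet (fun w => B w (bv i) (bv j)) k z = normalJet B k z (bv i) (bv j) :=
    fun k => normalJet_clm ((ContinuousLinearMap.apply ℝ ℝ (bv j)).comp
      (ContinuousLinearMap.apply ℝ _ (bv i))) hB k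
  simp only [collarExpr, h]

/-- The glued metric is of class `C²`. -/
lemma contDiffAt_extBil (hW : IsOpen W) (hWb : ∀ z ∈ W, bproj z ∈ W) (hε : 0 < ε)
    (hB : ∀ z ∈ W, 0 ≤ z 0 → ContDiffWithinAt ℝ ∞ B (range (𝓡∂ n)) z)
    (hz : z - ε • bv 0 ∈ W) : ContDiffAt ℝ 2 (extBil ε δ B) z := by
  rw [← contDiffWithinAt_univ]
  refine contDiffWithinAt_bil fun i j => ?_
  set f : EuclideanSpace ℝ (Fin n) → ℝ := fun w => B w (bv i) (bv j) with hf
  have hfs : ∀ z ∈ W, 0 ≤ z 0 → ContDiffWithinAt ℝ ∞ f (range (𝓡∂ n)) z := fun z hz h0 =>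
    contDiffWithinAt_entry (hB z hz h0) i j
  obtain ⟨g1, g2⟩ := glue_jets (δ := δ) (a := i) (b := j) hW hWb hε.ne' hfs
  have h1 := contDiffOn_zeroExt hW g1 (fun z hz h0 => (g2 z hz h0).1)
    (fun z hz h0 => (g2 z hz h0).2.1) (fun z hz h0 => (g2 z hz h0).2.2)
  have hsub : ContDiff ℝ 2 fun w : EuclideanSpace ℝ (Fin n) => w - ε • bv 0 :=
    contDiff_id.sub contDiff_const
  have h2 := ContDiffAt.comp z (h1.contDiffAt (hW.mem_nhds hz)) hsub.contDiffAt
  have hbz : ∀ w : EuclideanSpace ℝ (Fin n), bproj (w - ε • bv 0) = bproj w := fun w => by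
    rw [sub_eq_add_neg, ← neg_smul, bproj_add_smul]
  have hb : bproj z ∈ W := by rw [← hbz]; exact hWb _ hz
  have h3 : ContDiffAt ℝ 2 (collarExpr ε δ i j (normalJet f)) z :=
    (contDiffAt_collarExpr_normalJet (hfs _ hb (by simp))).of_le two_le_infty
  rw [contDiffWithinAt_univ]
  refine (h3.add h2).congr_of_eventuallyEq ?_
  filter_upwards [hsub.continuous.continuousAt.preimage_mem_nhds (hW.mem_nhds hz)] with w hw
  have hwb : bproj w ∈ W := by rw [← hbz]; exact hWb _ hw
  have hBw : ContDiffWithinAt ℝ 2 B (range (𝓡∂ n)) (bproj w) :=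
    (hB _ hwb (by simp)).of_le two_le_infty
  have hw0 : (w - ε • bv 0 : EuclideanSpace ℝ (Fin n)) 0 = w 0 - ε := by simp [bv]
  simp only [extBil, Function.comp_apply]
  rcases le_or_gt (w 0) ε with h | h
  · rw [if_pos h, collarBil_normalJet_bv hBw, zeroExt_of_nonpos (by rw [hw0]; linarith)
      (fun h0 => (g2 _ hw h0).1), add_zero]
  · rw [if_neg h.not_ge, zeroExt, if_pos (by rw [hw0]; linarith)]
    simp only [sub_add_cancel, hf]
    ring

/-- The values and first and second derivatives of the normal jets of `B`. -/
def jetData (B : EuclideanSpace ℝ (Fin n) → Bil (EuclideanSpace ℝ (Fin n)))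
    (z : EuclideanSpace ℝ (Fin n)) : JetData n :=
  (fun k a b => normalJet (fun w => B w (bv a) (bv b)) k z,
    fun k m a b => fderiv ℝ (normalJet (fun w => B w (bv a) (bv b)) k) z (bv m),
    fun k m l a b => fderiv ℝ
      (fun w => fderiv ℝ (normalJet (fun w => B w (bv a) (bv b)) k) w (bv l)) z (bv m))

lemma jetData_add (t : ℝ) : jetData B (z + t • bv 0) = jetData B z := by
  unfold jetData
  have h1 : ∀ (k : Fin 3) (a b : Fin n) (w : EuclideanSpace ℝ (Fin n)),
      fderiv ℝ (normalJet (fun w => B w (bv a) (bv b)) k) (w + t • bv 0)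
        = fderiv ℝ (normalJet (fun w => B w (bv a) (bv b)) k) w := fun k a b w =>
    fderiv_add_const_eq (t • bv 0) w fun w => normalJet_add k t
  refine Prod.ext ?_ (Prod.ext ?_ ?_)
  · funext k a b
    exact normalJet_add (f := fun w => B w (bv a) (bv b)) k t
  · funext k m a b
    exact DFunLike.congr_fun (h1 k a b z) _
  · funext k m l a b
    exact DFunLike.congr_fun (fderiv_add_const_eq (h := fun w => fderiv ℝ
      (normalJet (fun w => B w (bv a) (bv b)) k) w (bv l)) (t • bv 0) z fun w => by rw [h1]) _

lemma continuousAt_jetData (hB : ContDiffWithinAt ℝ ∞ B (range (𝓡∂ n)) (bproj z)) :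
    ContinuousAt (jetData B) z := by
  have h0 : ∀ a b k, ContDiffAt ℝ ∞ (normalJet (fun w => B w (bv a) (bv b)) k) z := fun a b k =>
    contDiffAt_normalJet (contDiffWithinAt_entry hB a b) k
  have h1 : ∀ a b k m, ContDiffAt ℝ ∞
      (fun w => fderiv ℝ (normalJet (fun w => B w (bv a) (bv b)) k) w (bv m)) z := fun a b k m =>
    ((h0 a b k).fderiv_right (m := ∞) (by simp)).clm_apply contDiffAt_const
  have h2 : ∀ a b k l m, ContDiffAt ℝ ∞
      (fun w => fderiv ℝ
        (fun w => fderiv ℝ (normalJet (fun w => B w (bv a) (bv b)) k) w (bv l)) w (bv m)) z :=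
    fun a b k l m =>
      ((h1 a b k l).fderiv_right (m := ∞) (by simp)).clm_apply contDiffAt_const
  unfold jetData
  refine ContinuousAt.prodMk ?_ (ContinuousAt.prodMk ?_ ?_)
  · exact continuousAt_pi.2 fun k => continuousAt_pi.2 fun a => continuousAt_pi.2 fun b =>
      (h0 a b k).continuousAt
  · exact continuousAt_pi.2 fun k => continuousAt_pi.2 fun m => continuousAt_pi.2 fun a =>
      continuousAt_pi.2 fun b => (h1 a b k m).continuousAt
  · exact continuousAt_pi.2 fun k => continuousAt_pi.2 fun m => continuousAt_pi.2 fun l =>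
      continuousAt_pi.2 fun a => continuousAt_pi.2 fun b => (h2 a b k l m).continuousAt

lemma fderiv_collarExpr_jetData (hε : ε ≠ 0)
    (hB : ContDiffWithinAt ℝ ∞ B (range (𝓡∂ n)) (bproj z)) (m l a b : Fin n) :
    fderiv ℝ (collarExpr ε δ a b (normalJet fun w => B w (bv a) (bv b))) z (bv m)
        = collarP (1 - z 0 / ε, ε, δ, jetData B z) m a b ∧
      ε * fderiv ℝ (fun w => fderiv ℝ
        (collarExpr ε δ a b (normalJet fun w => B w (bv a) (bv b))) w (bv l)) z (bv m)
        = collarQ (1 - z 0 / ε, ε, δ, jetData B z) m l a b := by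
  have hX : ∀ j, ContDiffAt ℝ 2 (normalJet (fun w => B w (bv a) (bv b)) j) z := fun j =>
    (contDiffAt_normalJet (contDiffWithinAt_entry hB a b) j).of_le two_le_infty
  constructor
  · rw [fderiv_collarExpr hε (fun j => (hX j).differentiableAt (by norm_num)) m
      ((contDiffAt_collarExpr hX).differentiableAt (by norm_num))]
    rfl
  · rw [fderiv_fderiv_collarExpr hε hX]
    simp only [collarExpr, collarExpr', collarQ, jetData]
    split_ifs
    · field_simp
      ring
    · ring
    · ring
    · ring

lemma matOf_collarBil (hB : ContDiffWithinAt ℝ ∞ B (range (𝓡∂ n)) (bproj z)) :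
    matOf (collarBil ε δ (normalJet B)) z = collarG (1 - z 0 / ε, ε, δ, jetData B z) := by
  ext a b
  exact collarBil_normalJet_bv (hB.of_le two_le_infty) a b

lemma matOf_collarBil_eventuallyEq (hW : IsOpen W)
    (hB : ∀ z ∈ W, 0 ≤ z 0 → ContDiffWithinAt ℝ ∞ B (range (𝓡∂ n)) z) (hzW : bproj z ∈ W)
    (a b : Fin n) : (fun w => matOf (collarBil ε δ (normalJet B)) w a b) =ᶠ[𝓝[range (𝓡∂ n)] z]
      (fun w => collarExpr ε δ a b (normalJet fun w => B w (bv a) (bv b)) (w + 0)) := by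
  filter_upwards [mem_nhdsWithin_of_mem_nhds ((contDiff_bproj (m := 0)).continuous.continuousAt
    |>.preimage_mem_nhds (hW.mem_nhds hzW))] with w hw
  rw [add_zero]
  exact collarBil_normalJet_bv ((hB _ hw (by simp)).of_le two_le_infty) a b

lemma contDiffWithinAt_collarBil (hW : IsOpen W)
    (hB : ∀ z ∈ W, 0 ≤ z 0 → ContDiffWithinAt ℝ ∞ B (range (𝓡∂ n)) z) (hz : 0 ≤ z 0)
    (hzW : bproj z ∈ W) :
    ContDiffWithinAt ℝ 2 (collarBil ε δ (normalJet B)) (range (𝓡∂ n)) z := by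
  refine contDiffWithinAt_bil fun a b => ?_
  have hX : ContDiffAt ℝ 2 (collarExpr ε δ a b (normalJet fun w => B w (bv a) (bv b))) z :=
    (contDiffAt_collarExpr_normalJet (contDiffWithinAt_entry (hB _ hzW (by simp)) a b)).of_le
      two_le_infty
  have hev := matOf_collarBil_eventuallyEq (ε := ε) (δ := δ) hW hB hzW a b
  refine ContDiffWithinAt.congr_of_eventuallyEq hX.contDiffWithinAt ?_ ?_
  · filter_upwards [hev] with w hw
    refine hw.trans ?_
    rw [add_zero]
  · refine (hev.self_of_nhdsWithin (mem_range_iff.2 hz)).trans ?_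
    simp only [add_zero]

lemma partialDeriv_collarBil (hε : ε ≠ 0) (hW : IsOpen W)
    (hB : ∀ z ∈ W, 0 ≤ z 0 → ContDiffWithinAt ℝ ∞ B (range (𝓡∂ n)) z) (hz : 0 ≤ z 0)
    (hzW : bproj z ∈ W) (m a b : Fin n) : partialDeriv (range (𝓡∂ n))
      (fun w => matOf (collarBil ε δ (normalJet B)) w a b) m z
      = collarP (1 - z 0 / ε, ε, δ, jetData B z) m a b := by
  have hzS : z ∈ range (𝓡∂ n) := mem_range_iff.2 hz
  have hX : ContDiffAt ℝ 2
      (collarExpr ε δ a b (normalJet fun w => B w (bv a) (bv b))) (z + 0) := by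
    rw [add_zero]
    exact (contDiffAt_collarExpr_normalJet (contDiffWithinAt_entry
      (hB _ hzW (by simp)) a b)).of_le two_le_infty
  rw [(partialDeriv_congr (matOf_collarBil_eventuallyEq hW hB hzW a b) m).self_of_nhdsWithin
    hzS hzS]
  refine ((fderivWithin_comp_add hzS hX (bv m) (bv m)).1).trans ?_
  rw [add_zero]
  exact (fderiv_collarExpr_jetData hε (hB _ hzW (by simp)) m m a b).1

/-- The scalar curvature of the collar metric in terms of the jets along the boundary. -/
lemma coordScalarCurvature_collarBil (hε : ε ≠ 0) (hW : IsOpen W)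
    (hB : ∀ z ∈ W, 0 ≤ z 0 → ContDiffWithinAt ℝ ∞ B (range (𝓡∂ n)) z) (hz : 0 ≤ z 0)
    (hzW : bproj z ∈ W) (hdet : (matOf (collarBil ε δ (normalJet B)) z).det ≠ 0) :
    ε * coordScalarCurvature (range (𝓡∂ n)) (matOf (collarBil ε δ (normalJet B))) z
      = collarS (1 - z 0 / ε, ε, δ, jetData B z) := by
  have hS : UniqueDiffOn ℝ (range (𝓡∂ n)) := (𝓡∂ n).uniqueDiffOn
  have hzS : z ∈ range (𝓡∂ n) := mem_range_iff.2 hz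
  have hBz := hB _ hzW (by simp)
  have hev := matOf_collarBil_eventuallyEq (ε := ε) (δ := δ) hW hB hzW
  have hX' : ∀ a b, ContDiffAt ℝ 2
      (collarExpr ε δ a b (normalJet fun w => B w (bv a) (bv b))) (z + 0) := fun a b => by
    rw [add_zero]
    exact (contDiffAt_collarExpr_normalJet (contDiffWithinAt_entry hBz a b)).of_le two_le_infty
  have e1 := partialDeriv_collarBil (δ := δ) hε hW hB hz hzW
  have e2 : ∀ m l a b, partialDeriv (range (𝓡∂ n)) (fun z => partialDeriv (range (𝓡∂ n))
      (fun w => matOf (collarBil ε δ (normalJet B)) w a b) l z) m z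
      = ε⁻¹ * collarQ (1 - z 0 / ε, ε, δ, jetData B z) m l a b := by
    intro m l a b
    have h1 := partialDeriv_congr (hev a b) l
    have h2 : (fun z => partialDeriv (range (𝓡∂ n))
        (fun w => matOf (collarBil ε δ (normalJet B)) w a b) l z) =ᶠ[𝓝[range (𝓡∂ n)] z]
        fun z => partialDeriv (range (𝓡∂ n)) (fun w => collarExpr ε δ a b
          (normalJet fun w => B w (bv a) (bv b)) (w + 0)) l z := by
      filter_upwards [h1, self_mem_nhdsWithin] with w hw hwS using hw hwS
    rw [(partialDeriv_congr h2 m).self_of_nhdsWithin hzS hzS]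
    refine ((fderivWithin_comp_add hzS (hX' a b) (bv m) (bv l)).2).trans ?_
    rw [add_zero, ← (fderiv_collarExpr_jetData hε hBz m l a b).2, inv_mul_cancel_left₀ hε]
  have hG : ∀ i j, ContDiffWithinAt ℝ 2 (fun w => matOf (collarBil ε δ (normalJet B)) w i j)
      (range (𝓡∂ n)) z := fun i j =>
    contDiffWithinAt_entry (contDiffWithinAt_collarBil hW hB hz hzW) i j
  rw [coordScalarCurvature_eq_jet hS hzS hG hdet]
  simp only [e1, e2, matOf_collarBil hBz]
  rw [jetScalMain_smul, collarS, mul_add, mul_inv_cancel_left₀ hε]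

/-- The collar has the scalar curvature of the original metric where it is glued. -/
lemma coordScalarCurvature_boundary (hε : ε ≠ 0) (hW : IsOpen W) (hWb : ∀ z ∈ W, bproj z ∈ W)
    (hB : ∀ z ∈ W, 0 ≤ z 0 → ContDiffWithinAt ℝ ∞ B (range (𝓡∂ n)) z) (hz : z 0 = 0)
    (hzW : z ∈ W) (hdet : (matOf B z).det ≠ 0) :
    ε * coordScalarCurvature (range (𝓡∂ n)) (matOf B) z = collarS (0, ε, δ, jetData B z) := by
  have hS : UniqueDiffOn ℝ (range (𝓡∂ n)) := (𝓡∂ n).uniqueDiffOn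
  have hzS : z ∈ range (𝓡∂ n) := mem_range_iff.2 hz.ge
  have hBz := hB _ hzW hz.ge
  have hBe : ContDiffWithinAt ℝ ∞ B (range (𝓡∂ n)) (bproj (z + ε • bv 0)) := by
    rw [bproj_add_smul, bproj_eq_self hz]; exact hBz
  have hσ : 1 - (z + ε • bv 0 : EuclideanSpace ℝ (Fin n)) 0 / ε = 0 := by
    simp [bv, hz, hε]
  have hf2 : ∀ a b, ∀ z ∈ W, 0 ≤ z 0 → ContDiffWithinAt ℝ 2 (fun w => B w (bv a) (bv b))
      (range (𝓡∂ n)) z := fun a b z hz h0 =>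
    (contDiffWithinAt_entry (hB z hz h0) a b).of_le two_le_infty
  have hX : ∀ a b, ContDiffAt ℝ 2
      (collarExpr ε δ a b (normalJet fun w => B w (bv a) (bv b))) (z + ε • bv 0) := fun a b =>
    (contDiffAt_collarExpr_normalJet (contDiffWithinAt_entry hBe a b)).of_le two_le_infty
  have key : ∀ m l a b, partialDeriv (range (𝓡∂ n)) (fun w => matOf B w a b) m z
        = collarP (0, ε, δ, jetData B z) m a b ∧
      partialDeriv (range (𝓡∂ n)) (fun z => partialDeriv (range (𝓡∂ n))
        (fun w => matOf B w a b) l z) m z = ε⁻¹ * collarQ (0, ε, δ, jetData B z) m l a b ∧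
      matOf B z a b = collarG (0, ε, δ, jetData B z) a b := by
    intro m l a b
    set k := collarExpr ε δ a b (normalJet fun w => B w (bv a) (bv b)) with hk
    obtain ⟨g1, g2⟩ := glue_jets (δ := δ) (a := a) (b := b) hW hWb hε
      (fun z hz h0 => contDiffWithinAt_entry (hB z hz h0) a b)
    obtain ⟨g3, g4, g5⟩ := g2 z hzW hz
    have hks : ContDiffWithinAt ℝ 2 (fun w => k (w + ε • bv 0)) (range (𝓡∂ n)) z :=
      ((hX a b).comp z (contDiff_id.add contDiff_const).contDiffAt).contDiffWithinAt
    have hv := g1 z hzW hz.ge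
    set v : EuclideanSpace ℝ (Fin n) → ℝ := fun w => B w (bv a) (bv b) - k (w + ε • bv 0) with hv'
    have hfv : (fun w => matOf B w a b) = fun w => v w + k (w + ε • bv 0) := by
      funext w
      simp [hv', matOf_apply]
    have d1 : ∀ᶠ w in 𝓝[range (𝓡∂ n)] z, ∀ m, partialDeriv (range (𝓡∂ n))
        (fun w => matOf B w a b) m w = fderivWithin ℝ v (range (𝓡∂ n)) w (bv m)
          + partialDeriv (range (𝓡∂ n)) (fun w => k (w + ε • bv 0)) m w := by
      have h1 := hv.eventually (by simp)
      have h2 := hks.eventually (by simp)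
      rw [insert_eq_of_mem hzS] at h1 h2
      filter_upwards [h1, h2, self_mem_nhdsWithin] with w hw1 hw2 hwS m
      rw [hfv]
      unfold partialDeriv
      rw [fderivWithin_fun_add (hS w hwS) (hw1.differentiableWithinAt (by norm_num))
        (hw2.differentiableWithinAt (by norm_num)), add_apply]
    have d2 := d1.self_of_nhdsWithin hzS
    have p := fderiv_collarExpr_jetData (δ := δ) hε hBe m l a b
    rw [hσ, jetData_add] at p
    refine ⟨?_, ?_, ?_⟩
    · rw [d2, g4]
      refine (zero_add _).trans (((fderivWithin_comp_add hzS (hX a b) (bv m) (bv l)).1).trans p.1)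
    · rw [← p.2, inv_mul_cancel_left₀ hε]
      have hev : (fun z => partialDeriv (range (𝓡∂ n)) (fun w => matOf B w a b) l z)
          =ᶠ[𝓝[range (𝓡∂ n)] z] fun w => fderivWithin ℝ v (range (𝓡∂ n)) w (bv l)
          + partialDeriv (range (𝓡∂ n)) (fun w => k (w + ε • bv 0)) l w := by
        filter_upwards [d1] with w hw using hw l
      rw [(partialDeriv_congr hev m).self_of_nhdsWithin hzS hzS]
      have hv1 : DifferentiableWithinAt ℝ (fderivWithin ℝ v (range (𝓡∂ n))) (range (𝓡∂ n)) z :=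
        (hv.fderivWithin_right (m := 1) hS (by norm_num) hzS).differentiableWithinAt (by norm_num)
      have hk1 := (contDiffWithinAt_partialDeriv (m := 1) hS hzS hks (by norm_num)
        l).differentiableWithinAt (by norm_num)
      have hv2 := hv1.hasFDerivWithinAt.clm_apply
        (hasFDerivWithinAt_const (bv l : EuclideanSpace ℝ (Fin n)) z _)
      rw [g5] at hv2
      have h3 := (hv2.fun_add hk1.hasFDerivWithinAt).fderivWithin (hS z hzS)
      unfold partialDeriv at h3 ⊢
      rw [h3]
      have h4 := (fderivWithin_comp_add hzS (hX a b) (bv m) (bv l)).2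
      simpa using h4
    · have : matOf B z a b = k (z + ε • bv 0) := by
        rw [matOf_apply]; linarith
      rw [this, hk, collarExpr, hσ]
      simp only [normalJet_add]
      rfl
  have e0 : matOf B z = collarG (0, ε, δ, jetData B z) := by
    ext a b
    exact (key a a a b).2.2
  rw [coordScalarCurvature_eq_jet (G := matOf B) hS hzS (fun i j => hf2 i j z hzW hz.ge) hdet]
  have e1 := fun m a b => (key m m a b).1
  have e2 := fun m l a b => (key m l a b).2.1
  simp only [e1, e2]
  rw [jetScalMain_smul, collarS, mul_add, mul_inv_cancel_left₀ hε, e0]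

end CollarMetric

/-! ### Curvature and convexity of the collar in coordinates -/

section Boundary

variable {n : ℕ} [NeZero n] {y : EuclideanSpace ℝ (Fin n)}
  {B : EuclideanSpace ℝ (Fin n) → Bil (EuclideanSpace ℝ (Fin n))}

lemma apply_bv_zero_of_orthogonal {b : Bil (EuclideanSpace ℝ (Fin n))}
    (hx : ∀ i, i ≠ 0 → b (bv 0) (bv i) = 0) (u : EuclideanSpace ℝ (Fin n)) :
    b (bv 0) u = u 0 * b (bv 0) (bv 0) := by
  rw [clm_eq_sum (b (bv 0)) u, Finset.sum_eq_single 0]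
  · rfl
  · intro i _ hi
    rw [hx i hi, smul_zero]
  · simp

lemma gradZero_of_orthogonal (hm : IsMetric (B y))
    (hx : ∀ i, i ≠ 0 → B y (bv 0) (bv i) = 0) :
    gradZero B y = (B y (bv 0) (bv 0))⁻¹ • bv 0 := by
  have hpos : 0 < B y (bv 0) (bv 0) := hm.2 _ (by simp [bv])
  apply hm.injective
  ext u
  rw [apply_gradZero hm.isInvertible, map_smul, smul_apply, apply_bv_zero_of_orthogonal hx u,
    smul_eq_mul]
  field_simp

/-- If the normal coordinate line is orthogonal to the boundary, the second fundamental form is a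
multiple of the normal derivative of the metric. -/
lemma coordSFF_of_orthogonal (hy : y 0 = 0) (hB : ContDiffWithinAt ℝ 1 B (range (𝓡∂ n)) y)
    (hm : ∀ᶠ z in 𝓝[range (𝓡∂ n)] y, IsMetric (B z))
    (hs : ∀ z ∈ range (𝓡∂ n), ∀ v w, B z v w = B z w v)
    (hx : ∀ᶠ z in 𝓝[range (𝓡∂ n)] y, z 0 = 0 → ∀ i, i ≠ 0 → B z (bv 0) (bv i) = 0)
    {v w : EuclideanSpace ℝ (Fin n)} (hv : v 0 = 0) (hw : w 0 = 0) :
    coordSFF (range (𝓡∂ n)) (matOf B) y v w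
      = -(1 / 2) * Real.sqrt (gradZero B y 0) * fderivWithin ℝ B (range (𝓡∂ n)) y (bv 0) v w := by
  have hS : UniqueDiffOn ℝ (range (𝓡∂ n)) := (𝓡∂ n).uniqueDiffOn
  have hyS : y ∈ range (𝓡∂ n) := mem_range_iff.2 hy.ge
  have hmy := hm.self_of_nhdsWithin hyS
  have hxy := hx.self_of_nhdsWithin hyS hy
  have hd := (hB.differentiableWithinAt (by norm_num)).hasFDerivWithinAt
  have hD : ∀ v w : EuclideanSpace ℝ (Fin n), v 0 = 0 → w 0 = 0 →
      fderivWithin ℝ B (range (𝓡∂ n)) y v w (bv 0) = 0 := by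
    intro v w hv hw
    have h1 := (hd.clm_apply (hasFDerivWithinAt_const w y _)).clm_apply
      (hasFDerivWithinAt_const (bv 0 : EuclideanSpace ℝ (Fin n)) y _)
    have h2 := fderivWithin_apply_eq_zero_of_boundary hy h1 (by
      filter_upwards [hx, self_mem_nhdsWithin] with z hz hzS hz0
      rw [hs z hzS, apply_bv_zero_of_orthogonal (hz hz0), hw, zero_mul]) hv
    simpa using h2
  rw [coordSFF_eq hS hyS hB hm hs v w hw]
  have hk := chr_koszul (S := range (𝓡∂ n)) hmy.isInvertible (bv 0) v w
  rw [hD v w hv hw, hD w v hw hv, hmy.1 (chr (range (𝓡∂ n)) B y v w),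
    apply_bv_zero_of_orthogonal hxy] at hk
  rw [gradZero_of_orthogonal hmy hxy]
  have hpos : 0 < B y (bv 0) (bv 0) := hmy.2 _ (by simp [bv])
  have hc : chr (range (𝓡∂ n)) B y v w 0
      = -(1 / 2) * (B y (bv 0) (bv 0))⁻¹ * fderivWithin ℝ B (range (𝓡∂ n)) y (bv 0) v w := by
    field_simp
    linarith
  have h0 : ((B y (bv 0) (bv 0))⁻¹ • bv 0 : EuclideanSpace ℝ (Fin n)) 0
      = (B y (bv 0) (bv 0))⁻¹ := by simp [bv]
  rw [h0, hc]
  have hsq : 0 < Real.sqrt (B y (bv 0) (bv 0))⁻¹ := Real.sqrt_pos.2 (by positivity)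
  rw [div_eq_iff hsq.ne']
  have := Real.mul_self_sqrt (show 0 ≤ (B y (bv 0) (bv 0))⁻¹ by positivity)
  linear_combination (1 / 2) * fderivWithin ℝ B (range (𝓡∂ n)) y (bv 0) v w * this

lemma inv_submatrix_of_orthogonal {G : Matrix (Fin n) (Fin n) ℝ} (hdet : IsUnit G.det)
    (hx : ∀ i, i ≠ 0 → G i 0 = 0) (a b : {i : Fin n // i ≠ 0}) :
    (G.submatrix (Subtype.val : {i : Fin n // i ≠ 0} → Fin n) Subtype.val)⁻¹ a b
      = G⁻¹ a b := by
  have : (G.submatrix (Subtype.val : {i : Fin n // i ≠ 0} → Fin n)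
        (Subtype.val : {i : Fin n // i ≠ 0} → Fin n))
      * (G⁻¹.submatrix (Subtype.val : {i : Fin n // i ≠ 0} → Fin n)
        (Subtype.val : {i : Fin n // i ≠ 0} → Fin n)) = 1 := by
    ext a b
    have h1 := congrFun (congrFun (Matrix.mul_nonsing_inv G hdet) a.1) b.1
    rw [Matrix.mul_apply, ← Finset.sum_filter_add_sum_filter_not _ (fun i : Fin n => i ≠ 0)] at h1
    have h2 : ∑ i ∈ Finset.univ.filter (fun i : Fin n => ¬ i ≠ 0), G a.1 i * G⁻¹ i b.1 = 0 := by
      refine Finset.sum_eq_zero fun i hi => ?_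
      have : i = 0 := by simpa using hi
      rw [this, hx _ a.2, zero_mul]
    rw [h2, add_zero] at h1
    rw [Matrix.mul_apply]
    simp only [Matrix.submatrix_apply]
    rw [Finset.sum_subtype (p := fun i : Fin n => i ≠ 0) _ (by simp)] at h1
    rw [h1, Matrix.one_apply, Matrix.one_apply]
    simp [Subtype.ext_iff]
  rw [Matrix.inv_eq_right_inv this]
  rfl

/-- The mean curvature in coordinates whose normal lines are orthogonal to the boundary. -/
lemma meanCurvature_of_orthogonal (hy : y 0 = 0) (hB : ContDiffWithinAt ℝ 1 B (range (𝓡∂ n)) y)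
    (hm : ∀ᶠ z in 𝓝[range (𝓡∂ n)] y, IsMetric (B z))
    (hs : ∀ z ∈ range (𝓡∂ n), ∀ v w, B z v w = B z w v)
    (hx : ∀ᶠ z in 𝓝[range (𝓡∂ n)] y, z 0 = 0 → ∀ i, i ≠ 0 → B z (bv 0) (bv i) = 0) :
    ∑ a : {i : Fin n // i ≠ 0}, ∑ b : {i : Fin n // i ≠ 0},
      ((matOf B y).submatrix (Subtype.val : {i : Fin n // i ≠ 0} → Fin n) Subtype.val)⁻¹ a b *
        coordSFF (range (𝓡∂ n)) (matOf B) y (bv a.1) (bv b.1)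
      = -(1 / 2) * Real.sqrt (gradZero B y 0) * ∑ a : Fin n, ∑ b : Fin n,
        if a ≠ 0 ∧ b ≠ 0 then (matOf B y)⁻¹ a b *
          partialDeriv (range (𝓡∂ n)) (fun z => matOf B z a b) 0 y else 0 := by
  have hS : UniqueDiffOn ℝ (range (𝓡∂ n)) := (𝓡∂ n).uniqueDiffOn
  have hyS : y ∈ range (𝓡∂ n) := mem_range_iff.2 hy.ge
  have hmy := hm.self_of_nhdsWithin hyS
  have hxy := hx.self_of_nhdsWithin hyS hy
  have hsub : ∀ f : Fin n → ℝ, ∑ a : {i : Fin n // i ≠ 0}, f a.1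
      = ∑ a : Fin n, if a ≠ 0 then f a else 0 := by
    intro f
    rw [← Finset.sum_filter, Finset.sum_subtype (p := fun i : Fin n => i ≠ 0) _ (by simp)]
  have key : ∀ a b : {i : Fin n // i ≠ 0},
      ((matOf B y).submatrix (Subtype.val : {i : Fin n // i ≠ 0} → Fin n) Subtype.val)⁻¹ a b *
        coordSFF (range (𝓡∂ n)) (matOf B) y (bv a.1) (bv b.1)
      = -(1 / 2) * Real.sqrt (gradZero B y 0) * ((matOf B y)⁻¹ a.1 b.1 *
          partialDeriv (range (𝓡∂ n)) (fun z => matOf B z a.1 b.1) 0 y) := by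
    intro a b
    rw [coordSFF_of_orthogonal hy hB hm hs hx (by simp [bv, a.2.symm]) (by simp [bv, b.2.symm]),
      inv_submatrix_of_orthogonal hmy.isUnit_det (fun i hi => by
        rw [matOf_apply, hmy.1]; exact hxy i hi),
      partialDeriv_matOf hS hyS (hB.differentiableWithinAt (by norm_num))]
    ring
  simp only [key]
  rw [hsub (fun a => ∑ b : {i : Fin n // i ≠ 0}, -(1 / 2) * Real.sqrt (gradZero B y 0) *
    ((matOf B y)⁻¹ a b.1 * partialDeriv (range (𝓡∂ n)) (fun z => matOf B z a b.1) 0 y)),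
    Finset.mul_sum]
  refine Finset.sum_congr rfl fun a _ => ?_
  rw [hsub (fun b => -(1 / 2) * Real.sqrt (gradZero B y 0) *
    ((matOf B y)⁻¹ a b * partialDeriv (range (𝓡∂ n)) (fun z => matOf B z a b) 0 y)),
    Finset.mul_sum]
  by_cases ha : a = 0
  · simp [ha]
  · simp only [ha, ne_eq, not_false_eq_true, if_true, true_and]
    refine Finset.sum_congr rfl fun b _ => ?_
    split_ifs <;> simp

end Boundary

section LocalCollar

variable {n : ℕ} [NeZero n] {W : Set (EuclideanSpace ℝ (Fin n))} {z p : EuclideanSpace ℝ (Fin n)}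
  {B : EuclideanSpace ℝ (Fin n) → Bil (EuclideanSpace ℝ (Fin n))} {ε δ : ℝ}

lemma jetData_bproj : jetData B (bproj z) = jetData B z := by
  conv_rhs => rw [← bproj_add z]
  rw [jetData_add]

/-- The far end of the collar is totally umbilic, with principal curvatures proportional to `δ`. -/
lemma coordSFF_collarBil (hε : ε ≠ 0) (hW : IsOpen W) (hWb : ∀ z ∈ W, bproj z ∈ W)
    (hB : ∀ z ∈ W, 0 ≤ z 0 → ContDiffWithinAt ℝ ∞ B (range (𝓡∂ n)) z)
    (hs : ∀ z v w, B z v w = B z w v)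
    (hx : ∀ z ∈ W, z 0 = 0 → ∀ i, i ≠ 0 → B z (bv 0) (bv i) = 0) (hz : z 0 = 0) (hzW : z ∈ W)
    (hm : ∀ᶠ w in 𝓝[range (𝓡∂ n)] z, IsMetric (collarBil ε δ (normalJet B) w))
    {v w : EuclideanSpace ℝ (Fin n)} (hv : v 0 = 0) (hw : w 0 = 0) :
    coordSFF (range (𝓡∂ n)) (matOf (collarBil ε δ (normalJet B))) z v w
      = δ * Real.sqrt (gradZero (collarBil ε δ (normalJet B)) z 0) * B z v w := by
  have hS : UniqueDiffOn ℝ (range (𝓡∂ n)) := (𝓡∂ n).uniqueDiffOn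
  have hzS : z ∈ range (𝓡∂ n) := mem_range_iff.2 hz.ge
  have hc := contDiffWithinAt_collarBil (ε := ε) (δ := δ) hW hB hz.ge (hWb z hzW)
  rw [coordSFF_of_orthogonal hz (hc.of_le (by norm_num)) hm (fun z _ => collarBil_symm hs)
    ?_ hv hw]
  · have hD : fderivWithin ℝ (collarBil ε δ (normalJet B)) (range (𝓡∂ n)) z (bv 0) v w
        = -2 * δ * B z v w := by
      rw [bil_eq_sum, bil_eq_sum (B z), Finset.mul_sum]
      refine Finset.sum_congr rfl fun a _ => ?_
      rw [Finset.mul_sum]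
      refine Finset.sum_congr rfl fun b _ => ?_
      by_cases ha : a = 0
      · simp [ha, hv]
      by_cases hb : b = 0
      · simp [hb, hw]
      rw [← partialDeriv_matOf hS hzS (hc.differentiableWithinAt (by norm_num)),
        partialDeriv_collarBil hε hW hB hz.ge (hWb z hzW)]
      have h0 : ∀ k, (jetData B z).2.1 k 0 a b = 0 := fun k =>
        fderiv_normalJet_zero (contDiffWithinAt_entry (hB _ (hWb z hzW) (by simp)) a b) k
      have h1 : (jetData B z).1 0 a b = B z (bv a) (bv b) := by
        simp [jetData, normalJet, bproj_eq_self hz]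
      simp only [collarP, h0, hz, h1, profile, profile', maskCoeff, ha, hb, if_true, if_false]
      norm_num
      ring
    rw [hD]
    ring
  · filter_upwards [mem_nhdsWithin_of_mem_nhds (hW.mem_nhds hzW)] with y hy hy0 i hi
    rw [collarBil_normalJet_bv ((hB _ (hWb y hy) (by simp)).of_le two_le_infty)]
    simp only [collarExpr, hy0, profile, maskCoeff, hi, if_true, if_false]
    have : normalJet (fun w => B w (bv 0) (bv i)) 0 y = 0 := by
      simp [normalJet, bproj_eq_self hy0, hx y hy hy0 i hi]
    rw [this]
    norm_num

/-- Near a strictly mean-convex boundary point the collar has non-negative scalar curvature, if it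
is short and the far end is almost totally geodesic: the scalar curvature increases along the collar
by `collarS_monotone`, and is that of the given metric where the collar is glued. The last
hypothesis is mean-convexity, in coordinates whose normal line is orthogonal to the boundary. -/
theorem exists_collar_nonneg (hW : IsOpen W) (hWb : ∀ z ∈ W, bproj z ∈ W)
    (hB : ∀ z ∈ W, 0 ≤ z 0 → ContDiffWithinAt ℝ ∞ B (range (𝓡∂ n)) z)
    (hs : ∀ z v w, B z v w = B z w v)
    (hm : ∀ z ∈ W, z 0 = 0 → IsMetric (B z))
    (hR : ∀ z ∈ W, z 0 = 0 → 0 ≤ coordScalarCurvature (range (𝓡∂ n)) (matOf B) z)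
    (hp : p 0 = 0) (hpW : p ∈ W)
    (hx : ∀ i, i ≠ 0 → B p (bv 0) (bv i) = 0)
    (htr : ∑ a : Fin n, ∑ b : Fin n, (if a ≠ 0 ∧ b ≠ 0 then (matOf B p)⁻¹ a b *
      partialDeriv (range (𝓡∂ n)) (fun z => matOf B z a b) 0 p else 0) < 0) :
    ∃ N ∈ 𝓝 p, ∃ η > 0, ∀ ε ∈ Ioo 0 η, ∀ δ ∈ Ioo (-η) η, ∀ z, bproj z ∈ N → 0 ≤ z 0 → z 0 ≤ ε →
      IsMetric (collarBil ε δ (normalJet B) z) ∧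
      0 ≤ coordScalarCurvature (range (𝓡∂ n)) (matOf (collarBil ε δ (normalJet B))) z := by
  set D := jetData B p with hD
  have hD0 : ∀ a b, D.1 0 a b = B p (bv a) (bv b) := fun a b => by
    simp [hD, jetData, normalJet, bproj_eq_self hp]
  have hD0' : Matrix.of (D.1 0) = matOf B p := by
    ext a b
    exact hD0 a b
  have hmono := collarS_monotone 0 D (fun a b => by rw [hD0, hD0, hs])
    (by rw [hD0']; exact (hm p hpW hp).posDef) (fun a ha => by rw [hD0]; exact hx a ha) (by
      refine lt_of_eq_of_lt ?_ htr
      refine Finset.sum_congr rfl fun a _ => Finset.sum_congr rfl fun b _ => ?_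
      have : D.1 1 a b = partialDeriv (range (𝓡∂ n)) (fun z => matOf B z a b) 0 p := by
        simp [hD, jetData, normalJet, bproj_eq_self hp, partialDeriv, matOf]
      rw [this, hD0', mul_zero, zero_mul, add_zero])
  -- at `ε = 0` the collar metric is `B p`; positivity persists nearby, on the compact unit sphere
  have hposev : ∀ᶠ x in 𝓝 ((0, 0, D) : ℝ × ℝ × JetData n),
      ∀ s ∈ (Icc (0 : ℝ) 1) ×ˢ Metric.sphere (0 : EuclideanSpace ℝ (Fin n)) 1,
        0 < ∑ a, ∑ b, s.2 a * s.2 b * collarG ((s.1, x) : CollarParam n) a b := by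
    refine (isCompact_Icc.prod (isCompact_sphere _ _)).eventually_forall_of_forall_eventually ?_
    rintro ⟨σ, v⟩ ⟨_, hv⟩
    have hc : Continuous fun q : (ℝ × ℝ × JetData n) × (ℝ × EuclideanSpace ℝ (Fin n)) =>
        ∑ a, ∑ b, q.2.2 a * q.2.2 b * collarG ((q.2.1, q.1) : CollarParam n) a b := by
      refine continuous_finsetSum _ fun a _ => continuous_finsetSum _ fun b _ => ?_
      have h1 : Continuous fun q : (ℝ × ℝ × JetData n) × (ℝ × EuclideanSpace ℝ (Fin n)) =>
          collarG ((q.2.1, q.1) : CollarParam n) a b :=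
        (contDiff_collarG a b).continuous.comp (by fun_prop)
      fun_prop
    refine hc.continuousAt.eventually (lt_mem_nhds ?_)
    have hv0 : v ≠ 0 := by
      rintro rfl
      simp at hv
    have := (hm p hpW hp).2 v hv0
    rw [bil_eq_sum] at this
    refine this.trans_eq (Finset.sum_congr rfl fun a _ => Finset.sum_congr rfl fun b _ => ?_)
    simp only [collarG_zero]
    rw [smul_eq_mul, hD0']
    rfl
  have hBp : ContDiffWithinAt ℝ ∞ B (range (𝓡∂ n)) (bproj p) := by
    rw [bproj_eq_self hp]; exact hB p hpW hp.ge
  have htend : Filter.Tendsto (fun q : ℝ × ℝ × EuclideanSpace ℝ (Fin n) =>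
      (q.1, q.2.1, jetData B q.2.2)) (𝓝 (0, 0, p)) (𝓝 (0, 0, D)) := by
    have h1 : ContinuousAt (fun q : ℝ × ℝ × EuclideanSpace ℝ (Fin n) => jetData B q.2.2)
        (0, 0, p) :=
      ContinuousAt.comp (g := jetData B) (continuousAt_jetData hBp)
        (continuous_snd.snd.continuousAt)
    exact (continuous_fst.continuousAt.prodMk (continuous_snd.fst.continuousAt.prodMk h1)).tendsto
  obtain ⟨r, hr, hball⟩ := Metric.eventually_nhds_iff.1 (htend.eventually (hmono.and hposev))
  refine ⟨Metric.ball p r ∩ W, Filter.inter_mem (Metric.ball_mem_nhds p hr) (hW.mem_nhds hpW), r,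
    hr, ?_⟩
  rintro ε ⟨hε, hεr⟩ δ ⟨hδ1, hδ2⟩ z ⟨hzb, hzW⟩ hz0 hzε
  obtain ⟨h1, h2⟩ := @hball (ε, δ, bproj z) (by
    simp only [Prod.dist_eq, sup_lt_iff, Real.dist_eq, sub_zero]
    exact ⟨by rwa [abs_of_pos hε], abs_lt.2 ⟨hδ1, hδ2⟩, hzb⟩)
  simp only [jetData_bproj] at h1 h2
  have hBz := hB _ hzW (by simp)
  have hσ : (1 - z 0 / ε) ∈ Icc (0 : ℝ) 1 :=
    ⟨by have := (div_le_one hε).2 hzε; linarith, by have := div_nonneg hz0 hε.le; linarith⟩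
  have hmet : IsMetric (collarBil ε δ (normalJet B) z) := by
    refine ⟨collarBil_symm hs, fun v hv => ?_⟩
    have hv' : 0 < ‖v‖ := norm_pos_iff.2 hv
    have h3 := h2 (1 - z 0 / ε, ‖v‖⁻¹ • v) ⟨hσ, by simp [norm_smul, hv'.ne']⟩
    rw [← matOf_collarBil hBz] at h3
    have h4 : collarBil ε δ (normalJet B) z v v = ‖v‖ ^ 2 *
        ∑ a, ∑ b, (‖v‖⁻¹ • v) a * (‖v‖⁻¹ • v) b * matOf (collarBil ε δ (normalJet B)) z a b := by
      rw [bil_eq_sum, Finset.mul_sum]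
      refine Finset.sum_congr rfl fun a _ => ?_
      rw [Finset.mul_sum]
      refine Finset.sum_congr rfl fun b _ => ?_
      simp only [PiLp.smul_apply, smul_eq_mul, matOf_apply]
      field_simp
    rw [h4]
    positivity
  refine ⟨hmet, ?_⟩
  have h5 := coordScalarCurvature_collarBil (δ := δ) hε.ne' hW hB hz0 hzW hmet.isUnit_det.ne_zero
  have h6 := coordScalarCurvature_boundary (δ := δ) hε.ne' hW hWb hB (bproj_zero z) hzW
    (hm _ hzW (bproj_zero z)).isUnit_det.ne_zero
  have h7 := h1 (left_mem_Icc.2 zero_le_one) hσ hσ.1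
  simp only at h7
  rw [jetData_bproj] at h6
  rw [← h5, ← h6] at h7
  exact (mul_nonneg hε.le (hR _ hzW (bproj_zero z))).trans h7 |> nonneg_of_mul_nonneg_right <| hε

end LocalCollar

/-! ### The inverse function theorem on the half-space -/

section HalfSpaceInverse

variable {n : ℕ} [NeZero n] {f : EuclideanSpace ℝ (Fin n) → ℝ} {z p : EuclideanSpace ℝ (Fin n)}
  {W : Set (EuclideanSpace ℝ (Fin n))}

/-- The second order Taylor polynomial of `f` in the normal variable along the boundary. -/
def normalTaylor (f : EuclideanSpace ℝ (Fin n) → ℝ) (z : EuclideanSpace ℝ (Fin n)) : ℝ :=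
  normalJet f 0 z + z 0 * normalJet f 1 z + z 0 ^ 2 / 2 * normalJet f 2 z

/-- An extension of a function on the half-space to the whole space: its second order normal
Taylor polynomial outside the half-space. -/
def halfExt (f : EuclideanSpace ℝ (Fin n) → ℝ) (z : EuclideanSpace ℝ (Fin n)) : ℝ :=
  normalTaylor f z + zeroExt (fun w => f w - normalTaylor f w) z

lemma halfExt_of_nonneg (hz : 0 ≤ z 0) : halfExt f z = f z := by
  simp [halfExt, zeroExt, hz]

lemma halfExt_of_neg (hz : z 0 < 0) : halfExt f z = normalTaylor f z := by
  simp [halfExt, zeroExt, hz.not_ge]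

lemma contDiffAt_normalTaylor (hf : ContDiffWithinAt ℝ ∞ f (range (𝓡∂ n)) (bproj z)) :
    ContDiffAt ℝ ∞ (normalTaylor f) z := by
  have h := contDiffAt_normalJet hf
  have h0 : ContDiffAt ℝ ∞ (fun z : EuclideanSpace ℝ (Fin n) => z 0) z :=
    contDiff_zeroCoord.contDiffAt
  exact ((h 0).add (h0.mul (h 1))).add (((h0.pow 2).div_const 2).mul (h 2))

lemma fderiv_normalTaylor (hf : ContDiffWithinAt ℝ ∞ f (range (𝓡∂ n)) (bproj z)) :
    fderiv ℝ (normalTaylor f) z (bv 0) = normalJet f 1 z + z 0 * normalJet f 2 z := by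
  apply fderiv_eq_of_line ((contDiffAt_normalTaylor hf).differentiableAt (by simp))
  have h1 : ∀ s : ℝ, (z + s • bv 0 : EuclideanSpace ℝ (Fin n)) 0 = z 0 + s := by simp [bv]
  simp only [normalTaylor, normalJet_add, h1]
  have h2 : HasDerivAt (fun s : ℝ => z 0 + s) 1 0 := (hasDerivAt_id (0 : ℝ)).const_add (z 0)
  refine (((h2.mul_const (normalJet f 1 z)).const_add (normalJet f 0 z)).fun_add
    (((h2.fun_pow 2).div_const 2).mul_const (normalJet f 2 z))).congr_deriv ?_
  simp

lemma contDiffOn_halfExt (hW : IsOpen W) (hWb : ∀ z ∈ W, bproj z ∈ W)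
    (hf : ∀ z ∈ W, 0 ≤ z 0 → ContDiffWithinAt ℝ ∞ f (range (𝓡∂ n)) z) :
    ContDiffOn ℝ 2 (halfExt f) W := by
  have hS : UniqueDiffOn ℝ (range (𝓡∂ n)) := (𝓡∂ n).uniqueDiffOn
  have hb : ∀ z ∈ W, ContDiffWithinAt ℝ ∞ f (range (𝓡∂ n)) (bproj z) := fun z hz =>
    hf _ (hWb z hz) (by simp)
  have hT : ∀ z ∈ W, ContDiffAt ℝ 2 (normalTaylor f) (z + 0) := fun z hz => by
    rw [add_zero]
    exact (contDiffAt_normalTaylor (hb z hz)).of_le two_le_infty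
  have hT' : ∀ z ∈ W, ContDiffWithinAt ℝ 2 (fun w => normalTaylor f (w + 0))
      (range (𝓡∂ n)) z := fun z hz => by
    simp only [add_zero]
    exact ((contDiffAt_normalTaylor (hb z hz)).of_le two_le_infty).contDiffWithinAt
  have hf2 : ∀ z ∈ W, 0 ≤ z 0 → ContDiffWithinAt ℝ 2 f (range (𝓡∂ n)) z := fun z hz h0 =>
    (hf z hz h0).of_le two_le_infty
  have hv : ∀ z ∈ W, 0 ≤ z 0 → ContDiffWithinAt ℝ 2 (fun w => f w - normalTaylor f (w + 0))
      (range (𝓡∂ n)) z := fun z hz h0 => (hf2 z hz h0).sub (hT' z hz)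
  have v0 : ∀ z ∈ W, z 0 = 0 → f z - normalTaylor f (z + 0) = 0 := by
    intro z _ hz0
    simp [normalTaylor, normalJet, hz0, bproj_eq_self hz0]
  have hdf : ∀ z ∈ W, 0 ≤ z 0 → fderivWithin ℝ (fun w => f w - normalTaylor f (w + 0))
      (range (𝓡∂ n)) z (bv 0) = fderivWithin ℝ f (range (𝓡∂ n)) z (bv 0)
        - fderivWithin ℝ (fun w => normalTaylor f (w + 0)) (range (𝓡∂ n)) z (bv 0) := by
    intro z hz hz0
    rw [fderivWithin_fun_sub (hS z (mem_range_iff.2 hz0)) ((hf2 z hz hz0).differentiableWithinAt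
      (by norm_num)) ((hT' z hz).differentiableWithinAt (by norm_num)), sub_apply]
  have v1 : ∀ z ∈ W, z 0 = 0 → fderivWithin ℝ (fun w => f w - normalTaylor f (w + 0))
      (range (𝓡∂ n)) z (bv 0) = 0 := by
    intro z hz hz0
    rw [hdf z hz hz0.ge, (fderivWithin_comp_add (mem_range_iff.2 hz0.ge) (hT z hz) _ (bv 0)).1,
      add_zero, fderiv_normalTaylor (hb z hz), hz0]
    simp [normalJet, bproj_eq_self hz0]
  have v2 : ∀ z ∈ W, z 0 = 0 → fderivWithin ℝ (fun w => fderivWithin ℝ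
      (fun w => f w - normalTaylor f (w + 0)) (range (𝓡∂ n)) w (bv 0)) (range (𝓡∂ n)) z (bv 0)
      = 0 := by
    intro z hz hz0
    have hzS : z ∈ range (𝓡∂ n) := mem_range_iff.2 hz0.ge
    have hev : ∀ᶠ w in 𝓝[range (𝓡∂ n)] z, fderivWithin ℝ (fun w => f w - normalTaylor f (w + 0))
      (range (𝓡∂ n)) w (bv 0) = fderivWithin ℝ f (range (𝓡∂ n)) w (bv 0)
        - fderivWithin ℝ (fun w => normalTaylor f (w + 0)) (range (𝓡∂ n)) w (bv 0) := by
      filter_upwards [mem_nhdsWithin_of_mem_nhds (hW.mem_nhds hz), self_mem_nhdsWithin]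
        with w hw hwS using hdf w hw (mem_range_iff.1 hwS)
    have e1 : DifferentiableWithinAt ℝ (fun w => fderivWithin ℝ f (range (𝓡∂ n)) w (bv 0))
        (range (𝓡∂ n)) z :=
      (((hf2 z hz hz0.ge).fderivWithin_right (m := 1) hS (by norm_num) hzS).clm_apply
        contDiffWithinAt_const).differentiableWithinAt (by norm_num)
    have e2 : DifferentiableWithinAt ℝ
        (fun w => fderivWithin ℝ (fun w => normalTaylor f (w + 0)) (range (𝓡∂ n)) w (bv 0))
        (range (𝓡∂ n)) z :=
      (((hT' z hz).fderivWithin_right (m := 1) hS (by norm_num) hzS).clm_apply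
        contDiffWithinAt_const).differentiableWithinAt (by norm_num)
    rw [Filter.EventuallyEq.fderivWithin_eq hev (hev.self_of_nhdsWithin hzS),
      fderivWithin_fun_sub (hS z hzS) e1 e2, sub_apply,
      (fderivWithin_comp_add hzS (hT z hz) (bv 0) (bv 0)).2, add_zero]
    have h3 : ∀ᶠ w in 𝓝 z, fderiv ℝ (normalTaylor f) w (bv 0)
        = normalJet f 1 w + w 0 * normalJet f 2 w := by
      filter_upwards [hW.mem_nhds hz] with w hw using fderiv_normalTaylor (hb w hw)
    rw [Filter.EventuallyEq.fderiv_eq h3]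
    have h4 : fderiv ℝ (fun w => normalJet f 1 w + w 0 * normalJet f 2 w) z (bv 0)
        = normalJet f 2 z := by
      have hd := fun j => (contDiffAt_normalJet (hb z hz) j).differentiableAt (by simp)
      have hd0 : DifferentiableAt ℝ (fun z : EuclideanSpace ℝ (Fin n) => z 0) z :=
        (contDiff_zeroCoord (m := 1)).contDiffAt.differentiableAt (by norm_num)
      apply fderiv_eq_of_line ((hd 1).fun_add (hd0.fun_mul (hd 2)))
      have h1 : ∀ s : ℝ, (z + s • bv 0 : EuclideanSpace ℝ (Fin n)) 0 = z 0 + s := by simp [bv]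
      simp only [normalJet_add, h1]
      have h2 : HasDerivAt (fun s : ℝ => z 0 + s) 1 0 := (hasDerivAt_id (0 : ℝ)).const_add (z 0)
      exact ((h2.mul_const (normalJet f 2 z)).const_add (normalJet f 1 z)).congr_deriv (one_mul _)
    rw [h4]
    simp [normalJet, bproj_eq_self hz0]
  have key := fun z hz hz0 => fderivWithin_eq_zero_of_normal hW hv v0 v1 v2 (z := z) hz hz0
  have h1 := contDiffOn_zeroExt hW hv v0 (fun z hz h0 => (key z hz h0).1)
    (fun z hz h0 => (key z hz h0).2)
  simp only [add_zero] at h1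
  exact ContDiffOn.add (fun z hz => ((contDiffAt_normalTaylor (hb z hz)).of_le
    two_le_infty).contDiffWithinAt) h1

lemma eq_bproj_add (u : EuclideanSpace ℝ (Fin n)) : u = bproj u + u 0 • bv 0 := (bproj_add u).symm

/-- The inverse function theorem on a half-space, for a map that fixes the boundary. The map has a
`C²` extension to a full neighbourhood, to which the ordinary inverse function theorem applies; the
inverse is smooth on the half-space because its derivative is the inverse of that of `k`. -/
theorem exists_halfSpace_inverse {k : EuclideanSpace ℝ (Fin n) → EuclideanSpace ℝ (Fin n)}
    (hp : p 0 = 0) (hW : IsOpen W) (hWb : ∀ z ∈ W, bproj z ∈ W) (hpW : p ∈ W)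
    (hk : ∀ z ∈ W, 0 ≤ z 0 → ContDiffWithinAt ℝ ∞ k (range (𝓡∂ n)) z)
    (hid : ∀ z ∈ W, z 0 = 0 → k z = z) (hkH : ∀ z ∈ W, 0 ≤ z 0 → 0 ≤ k z 0)
    (hX : 0 < fderivWithin ℝ k (range (𝓡∂ n)) p (bv 0) 0) :
    ∃ e : OpenPartialHomeomorph (EuclideanSpace ℝ (Fin n)) (EuclideanSpace ℝ (Fin n)),
      p ∈ e.source ∧ e.source ⊆ W ∧ (∀ z ∈ e.source, 0 ≤ z 0 → e z = k z) ∧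
      (∀ z ∈ e.source, (0 ≤ e z 0 ↔ 0 ≤ z 0)) ∧ (∀ z ∈ e.source, (e z 0 = 0 ↔ z 0 = 0)) ∧
      ∀ w ∈ e.target, 0 ≤ w 0 → ContDiffWithinAt ℝ ∞ e.symm (range (𝓡∂ n)) w := by
  have hS : UniqueDiffOn ℝ (range (𝓡∂ n)) := (𝓡∂ n).uniqueDiffOn
  have hcomp : ∀ i, ∀ z ∈ W, 0 ≤ z 0 → ContDiffWithinAt ℝ ∞ (fun w => k w i) (range (𝓡∂ n)) z :=
    fun i z hz h0 => (EuclideanSpace.proj i : EuclideanSpace ℝ (Fin n) →L[ℝ] ℝ).contDiff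
      |>.comp_contDiffWithinAt (hk z hz h0)
  set K : EuclideanSpace ℝ (Fin n) → EuclideanSpace ℝ (Fin n) := fun z =>
    WithLp.toLp 2 fun i => halfExt (fun w => k w i) z with hKdef
  have hKk : ∀ z, 0 ≤ z 0 → K z = k z := by
    intro z hz
    ext i
    simp [hKdef, halfExt_of_nonneg hz]
  have hK2 : ContDiffOn ℝ 2 K W := by
    rw [contDiffOn_euclidean]
    exact fun i => contDiffOn_halfExt hW hWb (hcomp i)
  have hKat : ∀ z ∈ W, ContDiffAt ℝ 2 K z := fun z hz => hK2.contDiffAt (hW.mem_nhds hz)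
  have hKd : ∀ z ∈ W, 0 ≤ z 0 → fderiv ℝ K z = fderivWithin ℝ k (range (𝓡∂ n)) z := by
    intro z hz hz0
    have hzS := mem_range_iff.2 hz0
    rw [← ((hKat z hz).differentiableAt (by norm_num)).fderivWithin (hS z hzS)]
    exact fderivWithin_congr (fun w hw => hKk w (mem_range_iff.1 hw)) (hKk z hz0)
  have hpS : p ∈ range (𝓡∂ n) := mem_range_iff.2 hp.ge
  have hA : ∀ u : EuclideanSpace ℝ (Fin n), u 0 = 0 → fderiv ℝ K p u = u := by
    intro u hu
    rw [hKd p hpW hp.ge]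
    have h1 := fderivWithin_apply_eq_zero_of_boundary hp
      ((((hk p hpW hp.ge).differentiableWithinAt (by simp)).hasFDerivWithinAt).sub
        (hasFDerivWithinAt_id p _)) (by
        filter_upwards [mem_nhdsWithin_of_mem_nhds (hW.mem_nhds hpW)] with w hw hw0
        simp [hid w hw hw0]) hu
    simpa [sub_eq_zero] using h1
  have hAinj : Function.Injective (fderiv ℝ K p) := by
    rw [injective_iff_map_eq_zero]
    intro u hu
    rw [eq_bproj_add u, map_add, map_smul, hA _ (bproj_zero u)] at hu
    have h0 := congrArg (fun w : EuclideanSpace ℝ (Fin n) => w 0) hu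
    simp only [PiLp.add_apply, PiLp.smul_apply, bproj_zero, smul_eq_mul, zero_add,
      PiLp.zero_apply, hKd p hpW hp.ge] at h0
    have hu0 : u 0 = 0 := by
      rcases mul_eq_zero.1 h0 with h | h
      · exact h
      · exact absurd h hX.ne'
    rw [hu0, zero_smul, add_zero] at hu
    rw [eq_bproj_add u, hu, hu0, zero_smul, add_zero]
  let A : EuclideanSpace ℝ (Fin n) ≃L[ℝ] EuclideanSpace ℝ (Fin n) :=
    (LinearEquiv.ofInjectiveEndo (fderiv ℝ K p).toLinearMap hAinj).toContinuousLinearEquiv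
  have hAK : (A : EuclideanSpace ℝ (Fin n) →L[ℝ] EuclideanSpace ℝ (Fin n)) = fderiv ℝ K p := by
    ext u : 1
    rfl
  have hstrict : HasStrictFDerivAt K
      (A : EuclideanSpace ℝ (Fin n) →L[ℝ] EuclideanSpace ℝ (Fin n)) p := by
    rw [hAK]
    exact (hKat p hpW).hasStrictFDerivAt (by norm_num)
  set e₀ := hstrict.toOpenPartialHomeomorph K with he₀
  have he₀K : ∀ z, e₀ z = K z := fun z => rfl
  have hKp : K p = p := by rw [hKk p hp.ge, hid p hpW hp]
  have hev : ∀ᶠ z in 𝓝 p, z ∈ e₀.source ∧ z ∈ W ∧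
      fderiv ℝ K z ∈ range ((↑) : (EuclideanSpace ℝ (Fin n) ≃L[ℝ] EuclideanSpace ℝ (Fin n)) →
        EuclideanSpace ℝ (Fin n) →L[ℝ] EuclideanSpace ℝ (Fin n)) ∧ (z 0 < 0 → K z 0 < 0) := by
    have h1 : ContinuousAt (fderiv ℝ K) p :=
      ((hKat p hpW).fderiv_right (m := 1) (by norm_num)).continuousAt
    have h2 := h1.eventually (show _ ∈ 𝓝 (fderiv ℝ K p) by
      rw [← hAK]; exact ContinuousLinearEquiv.nhds A)
    have h3 : ∀ᶠ z in 𝓝 p, 0 < normalJet (fun w => k w 0) 1 z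
        + z 0 / 2 * normalJet (fun w => k w 0) 2 z := by
      have hb : ContDiffWithinAt ℝ ∞ (fun w => k w 0) (range (𝓡∂ n)) (bproj p) := by
        rw [bproj_eq_self hp]; exact hcomp 0 p hpW hp.ge
      have hc := fun j => (contDiffAt_normalJet hb j).continuousAt
      have hc0 : ContinuousAt (fun z : EuclideanSpace ℝ (Fin n) => z 0) p :=
        (contDiff_zeroCoord (m := 0)).continuous.continuousAt
      have := (hc 1).add ((hc0.div_const 2).mul (hc 2))
      refine this.eventually (lt_mem_nhds ?_)
      have hN : normalJet (fun w => k w 0) 1 p = fderivWithin ℝ k (range (𝓡∂ n)) p (bv 0) 0 := by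
        have h4 := ((EuclideanSpace.proj (0 : Fin n) :
          EuclideanSpace ℝ (Fin n) →L[ℝ] ℝ).hasFDerivAt.comp_hasFDerivWithinAt p
          ((hk p hpW hp.ge).differentiableWithinAt (by simp)).hasFDerivWithinAt).fderivWithin
            (hS p hpS)
        simp only [normalJet, bproj_eq_self hp, Matrix.cons_val_one, Matrix.cons_val_zero]
        exact DFunLike.congr_fun h4 (bv 0)
      simp only [Pi.add_apply, Pi.mul_apply, hp, zero_div, zero_mul, add_zero, hN]
      exact hX
    filter_upwards [e₀.open_source.mem_nhds hstrict.mem_toOpenPartialHomeomorph_source,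
      hW.mem_nhds hpW, h2, h3] with z hz1 hz2 hz3 hz4
    refine ⟨hz1, hz2, hz3, fun hz0 => ?_⟩
    have h5 : normalJet (fun w => k w 0) 0 z = 0 := by
      simp [normalJet, hid _ (hWb z hz2) (bproj_zero z)]
    -- the extension is a Taylor polynomial, so it maps the complement of the half-space to itself
    have h6 : K z 0 = z 0 * (normalJet (fun w => k w 0) 1 z
        + z 0 / 2 * normalJet (fun w => k w 0) 2 z) := by
      simp only [hKdef, halfExt_of_neg hz0, normalTaylor, h5]
      ring
    rw [h6]
    exact mul_neg_of_neg_of_pos hz0 hz4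
  obtain ⟨R, hR, hRo, hpR⟩ := eventually_nhds_iff.1 hev
  -- The image of the smaller domain `R'` is contained in `R`, where `K` is injective.
  set R' := R ∩ (e₀.source ∩ e₀ ⁻¹' R) with hR'
  have hR'o : IsOpen R' := hRo.inter (e₀.isOpen_inter_preimage hRo)
  have hpR' : p ∈ R' := ⟨hpR, (hR p hpR).1, by rw [mem_preimage, he₀K, hKp]; exact hpR⟩
  set e := e₀.restrOpen R' hR'o with hedef
  have hes : e.source = e₀.source ∩ R' := rfl
  have heK : ∀ z, e z = K z := fun z => rfl
  have hpos : ∀ z ∈ e.source, 0 < z 0 → 0 < K z 0 := by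
    intro z hz hz0
    have hzR := hz.2.1
    have h1 : 0 ≤ K z 0 := by rw [hKk z hz0.le]; exact hkH z (hR z hzR).2.1 hz0.le
    refine lt_of_le_of_ne h1 fun h => ?_
    have hKz : K z ∈ R := hz.2.2.2
    -- if `K z` were on the boundary, it would be fixed, against injectivity
    have h2 : K (K z) = K z := by
      rw [hKk _ h.le, hid _ (hR _ hKz).2.1 h.symm]
    have h3 := e₀.injOn (hR _ hKz).1 hz.1 h2
    rw [h3] at h
    exact hz0.ne h
  have hzero : ∀ z ∈ e.source, z 0 = 0 → K z 0 = 0 := by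
    intro z hz hz0
    rw [hKk z hz0.ge, hid z (hR z hz.2.1).2.1 hz0, hz0]
  have hneg : ∀ z ∈ e.source, z 0 < 0 → K z 0 < 0 := fun z hz => (hR z hz.2.1).2.2.2
  have hiff : ∀ z ∈ e.source, (0 ≤ e z 0 ↔ 0 ≤ z 0) := by
    intro z hz
    rw [heK]
    constructor
    · intro h
      by_contra h'
      exact absurd h (hneg z hz (not_le.1 h')).not_ge
    · intro h
      rcases h.eq_or_lt with h | h
      · exact (hzero z hz h.symm).ge
      · exact (hpos z hz h).le
  refine ⟨e, ⟨(hR p hpR).1, hpR'⟩, fun z hz => (hR z hz.2.1).2.1, fun z _ hz0 => hKk z hz0, hiff,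
    ?_, ?_⟩
  · intro z hz
    rw [heK]
    refine ⟨fun h => ?_, hzero z hz⟩
    rcases lt_trichotomy (z 0) 0 with h' | h' | h'
    · exact absurd h (hneg z hz h').ne
    · exact h'
    · exact absurd h (hpos z hz h').ne'
  · set T := e.target ∩ range (𝓡∂ n) with hT
    have hTu : UniqueDiffOn ℝ T := by
      rw [hT, inter_comm]; exact hS.inter e.open_target
    have hTm : ∀ w ∈ T, e.symm w ∈ e.source ∧ 0 ≤ e.symm w 0 := by
      rintro w ⟨hw, hw0⟩
      have h1 := e.map_target hw
      refine ⟨h1, (hiff _ h1).1 ?_⟩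
      rw [e.right_inv hw]
      exact mem_range_iff.1 hw0
    have hder : ∀ w ∈ T, HasFDerivAt e.symm
        (ContinuousLinearMap.inverse (fderivWithin ℝ k (range (𝓡∂ n)) (e.symm w))) w := by
      intro w hw
      obtain ⟨h1, h2⟩ := hTm w hw
      have h3 := hR _ h1.2.1
      obtain ⟨A', hA'⟩ := h3.2.2.1
      have h4 : HasFDerivAt e (A' : EuclideanSpace ℝ (Fin n) →L[ℝ] EuclideanSpace ℝ (Fin n))
          (e.symm w) := by
        rw [hA']
        exact ((hKat _ h3.2.1).differentiableAt (by norm_num)).hasFDerivAt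
      have h5 := e.hasFDerivAt_symm hw.1 h4
      rwa [← hKd _ h3.2.1 h2, ← hA', ContinuousLinearMap.inverse_equiv]
    -- bootstrap: the formula for the derivative of the inverse gains one order at each step
    have hnat : ∀ m : ℕ, ContDiffOn ℝ m e.symm T := by
      intro m
      induction m with
      | zero =>
        rw [Nat.cast_zero, contDiffOn_zero]
        exact e.continuousOn_symm.mono inter_subset_left
      | succ m ih =>
        rw [Nat.cast_succ]
        refine contDiffOn_succ_of_fderivWithin
          (fun w hw => (hder w hw).differentiableAt.differentiableWithinAt) (by simp) ?_
        have hcg : ContDiffOn ℝ m (fun w => ContinuousLinearMap.inverse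
            (fderivWithin ℝ k (range (𝓡∂ n)) (e.symm w))) T := by
          intro w hw
          obtain ⟨h1, h2⟩ := hTm w hw
          have h3 := hR _ h1.2.1
          have h4 : ContDiffWithinAt ℝ m (fderivWithin ℝ k (range (𝓡∂ n))) (range (𝓡∂ n))
              (e.symm w) :=
            ((hk _ h3.2.1 h2).fderivWithin_right (m := ∞) hS (by simp)
              (mem_range_iff.2 h2)).of_le (by exact_mod_cast le_top)
          have h5 := h4.comp w (ih w hw) (fun w' hw' => mem_range_iff.2 (hTm w' hw').2)
          obtain ⟨A', hA'⟩ := h3.2.2.1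
          have h6 : ContDiffAt ℝ m ContinuousLinearMap.inverse
              (fderivWithin ℝ k (range (𝓡∂ n)) (e.symm w)) := by
            rw [← hKd _ h3.2.1 h2, ← hA']
            exact contDiffAt_map_inverse A'
          exact h6.comp_contDiffWithinAt w h5
        exact hcg.congr fun w hw => ((hder w hw).hasFDerivWithinAt).fderivWithin (hTu w hw)
    intro w hw hw0
    have h1 : ContDiffOn ℝ ∞ e.symm T := contDiffOn_infty.2 hnat
    have h2 := h1 w ⟨hw, mem_range_iff.2 hw0⟩
    rw [hT, inter_comm] at h2
    exact (contDiffWithinAt_inter (e.open_target.mem_nhds hw)).1 h2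

end HalfSpaceInverse

/-! ### Derivatives and bilinear forms on manifolds with boundary -/

lemma contDiffWithinAt_bilinearComp {n : ℕ} {z : EuclideanSpace ℝ (Fin n)} {m : WithTop ℕ∞}
    {S : Set (EuclideanSpace ℝ (Fin n))}
    {B : EuclideanSpace ℝ (Fin n) → Bil (EuclideanSpace ℝ (Fin n))}
    {L : EuclideanSpace ℝ (Fin n) → EuclideanSpace ℝ (Fin n) →L[ℝ] EuclideanSpace ℝ (Fin n)}
    (hB : ContDiffWithinAt ℝ m B S z) (hL : ContDiffWithinAt ℝ m L S z) :
    ContDiffWithinAt ℝ m (fun w => (B w).bilinearComp (L w) (L w)) S z := by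
  refine contDiffWithinAt_bil fun i j => ?_
  simp only [ContinuousLinearMap.bilinearComp_apply]
  exact (hB.clm_apply (hL.clm_apply contDiffWithinAt_const)).clm_apply
    (hL.clm_apply contDiffWithinAt_const)

section Derivatives

variable {n : ℕ} [NeZero n] {M : Type*} [TopologicalSpace M]
  [ChartedSpace (EuclideanHalfSpace n) M] {N : Type*} [TopologicalSpace N]
  [ChartedSpace (EuclideanHalfSpace n) N]

/-- The derivative within the half-space of a map to a manifold. -/
def dmap (f : EuclideanSpace ℝ (Fin n) → M) (z : EuclideanSpace ℝ (Fin n)) :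
    EuclideanSpace ℝ (Fin n) →L[ℝ] EuclideanSpace ℝ (Fin n) :=
  mfderivWithin 𝓘(ℝ, EuclideanSpace ℝ (Fin n)) (𝓡∂ n) f (range (𝓡∂ n)) z

/-- The derivative of a vector-valued map on a manifold. -/
def dcomap (κ : M → EuclideanSpace ℝ (Fin n)) (q : M) :
    EuclideanSpace ℝ (Fin n) →L[ℝ] EuclideanSpace ℝ (Fin n) :=
  mfderiv (𝓡∂ n) 𝓘(ℝ, EuclideanSpace ℝ (Fin n)) κ q

/-- The derivative of a map between manifolds, as a map between the model spaces. -/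
def dself (φ : M → N) (q : M) : EuclideanSpace ℝ (Fin n) →L[ℝ] EuclideanSpace ℝ (Fin n) :=
  mfderiv (𝓡∂ n) (𝓡∂ n) φ q

variable {f f' : EuclideanSpace ℝ (Fin n) → M} {z : EuclideanSpace ℝ (Fin n)}
  {κ κ' : M → EuclideanSpace ℝ (Fin n)} {φ φ' : M → N} {q : M}

lemma uniqueMDiffWithinAt_range (hz : z ∈ range (𝓡∂ n)) :
    UniqueMDiffWithinAt 𝓘(ℝ, EuclideanSpace ℝ (Fin n)) (range (𝓡∂ n)) z :=
  ((𝓡∂ n).uniqueDiffOn z hz).uniqueMDiffWithinAt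

lemma dmap_congr (h : f =ᶠ[𝓝[range (𝓡∂ n)] z] f') (hz : z ∈ range (𝓡∂ n)) :
    dmap f z = dmap f' z :=
  Filter.EventuallyEq.mfderivWithin_eq h (h.self_of_nhdsWithin hz)

lemma dcomap_congr (h : κ =ᶠ[𝓝 q] κ') : dcomap κ q = dcomap κ' q :=
  Filter.EventuallyEq.mfderiv_eq h

lemma dself_congr (h : φ =ᶠ[𝓝 q] φ') : dself (n := n) φ q = dself φ' q :=
  Filter.EventuallyEq.mfderiv_eq h

lemma fderivWithin_comp_dmap
    (hκ : MDifferentiableAt (𝓡∂ n) 𝓘(ℝ, EuclideanSpace ℝ (Fin n)) κ (f z))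
    (hf : MDifferentiableWithinAt 𝓘(ℝ, EuclideanSpace ℝ (Fin n)) (𝓡∂ n) f (range (𝓡∂ n)) z)
    (hz : z ∈ range (𝓡∂ n)) :
    fderivWithin ℝ (κ ∘ f) (range (𝓡∂ n)) z = (dcomap κ (f z)).comp (dmap f z) := by
  rw [← mfderivWithin_eq_fderivWithin]
  exact mfderiv_comp_mfderivWithin z hκ hf (uniqueMDiffWithinAt_range hz)

lemma dmap_comp_dself (hφ : MDifferentiableAt (𝓡∂ n) (𝓡∂ n) φ (f z))
    (hf : MDifferentiableWithinAt 𝓘(ℝ, EuclideanSpace ℝ (Fin n)) (𝓡∂ n) f (range (𝓡∂ n)) z)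
    (hz : z ∈ range (𝓡∂ n)) : dmap (φ ∘ f) z = (dself φ (f z)).comp (dmap f z) :=
  mfderiv_comp_mfderivWithin z hφ hf (uniqueMDiffWithinAt_range hz)

lemma dmap_comp_fderivWithin {F : EuclideanSpace ℝ (Fin n) → EuclideanSpace ℝ (Fin n)}
    (hf : MDifferentiableWithinAt 𝓘(ℝ, EuclideanSpace ℝ (Fin n)) (𝓡∂ n) f (range (𝓡∂ n)) (F z))
    (hF : DifferentiableWithinAt ℝ F (range (𝓡∂ n)) z)
    (hm : ∀ᶠ w in 𝓝[range (𝓡∂ n)] z, F w ∈ range (𝓡∂ n)) (hz : z ∈ range (𝓡∂ n)) :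
    dmap (f ∘ F) z = (dmap f (F z)).comp (fderivWithin ℝ F (range (𝓡∂ n)) z) := by
  rw [← mfderivWithin_eq_fderivWithin]
  exact mfderivWithin_comp_of_preimage_mem_nhdsWithin z hf hF.mdifferentiableWithinAt hm
    (uniqueMDiffWithinAt_range hz)

lemma dcomap_comp_dself (hκ : MDifferentiableAt (𝓡∂ n) 𝓘(ℝ, EuclideanSpace ℝ (Fin n)) κ q)
    {ψ : N → M} {p : N} (hp : ψ p = q) (hψ : MDifferentiableAt (𝓡∂ n) (𝓡∂ n) ψ p) :
    dcomap (κ ∘ ψ) p = (dcomap κ q).comp (dself ψ p) := by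
  subst hp
  exact mfderiv_comp p hκ hψ

lemma dcomap_comp_fderivWithin {F : EuclideanSpace ℝ (Fin n) → EuclideanSpace ℝ (Fin n)}
    (hκ : MDifferentiableAt (𝓡∂ n) 𝓘(ℝ, EuclideanSpace ℝ (Fin n)) κ q)
    (hF : DifferentiableWithinAt ℝ F (range (𝓡∂ n)) (κ q))
    (hm : ∀ᶠ w in 𝓝 q, κ w ∈ range (𝓡∂ n)) :
    dcomap (F ∘ κ) q = (fderivWithin ℝ F (range (𝓡∂ n)) (κ q)).comp (dcomap κ q) := by
  rw [← mfderivWithin_eq_fderivWithin]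
  unfold dcomap
  rw [← mfderivWithin_univ, ← mfderivWithin_univ]
  exact mfderivWithin_comp_of_preimage_mem_nhdsWithin q hF.mdifferentiableWithinAt
    hκ.mdifferentiableWithinAt (by rwa [nhdsWithin_univ]) (uniqueMDiffWithinAt_univ _)

/-- The pull-back of a field of bilinear forms on a manifold. -/
def famPull (G : M → Bil (EuclideanSpace ℝ (Fin n))) (f : EuclideanSpace ℝ (Fin n) → M)
    (z : EuclideanSpace ℝ (Fin n)) : Bil (EuclideanSpace ℝ (Fin n)) :=
  (G (f z)).bilinearComp (dmap f z) (dmap f z)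

/-- The components of a field of bilinear forms in the preferred chart at `x`. -/
def chartBil (G : M → Bil (EuclideanSpace ℝ (Fin n))) (x : M) (z : EuclideanSpace ℝ (Fin n)) :
    Bil (EuclideanSpace ℝ (Fin n)) :=
  famPull G (extChartAt (𝓡∂ n) x).symm z

variable {G : M → Bil (EuclideanSpace ℝ (Fin n))}

lemma famPull_apply (v w : EuclideanSpace ℝ (Fin n)) :
    famPull G f z v w = G (f z) (dmap f z v) (dmap f z w) := rfl

lemma famPull_symm (hG : ∀ q v w, G q v w = G q w v) (v w : EuclideanSpace ℝ (Fin n)) :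
    famPull G f z v w = famPull G f z w v := hG _ _ _

lemma extChartAt_target_subset (x : M) : (extChartAt (𝓡∂ n) x).target ⊆ range (𝓡∂ n) := by
  rw [extChartAt_target]
  exact inter_subset_right

variable [IsManifold (𝓡∂ n) ∞ M]

instance : IsManifold (𝓡∂ n) 1 M := IsManifold.of_le (n := ∞) (by simp)

lemma dmap_symm_dcomap {x : M} (hq : q ∈ (extChartAt (𝓡∂ n) x).source)
    (v : EuclideanSpace ℝ (Fin n)) : dmap (extChartAt (𝓡∂ n) x).symm (extChartAt (𝓡∂ n) x q)
      (dcomap (extChartAt (𝓡∂ n) x) q v) = v :=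
  DFunLike.congr_fun (mfderivWithin_extChartAt_symm_comp_mfderiv_extChartAt' hq) v

lemma dcomap_dmap_symm {x : M} (hz : z ∈ (extChartAt (𝓡∂ n) x).target)
    (v : EuclideanSpace ℝ (Fin n)) : dcomap (extChartAt (𝓡∂ n) x) ((extChartAt (𝓡∂ n) x).symm z)
      (dmap (extChartAt (𝓡∂ n) x).symm z v) = v :=
  DFunLike.congr_fun (mfderiv_extChartAt_comp_mfderivWithin_extChartAt_symm hz) v

lemma mdifferentiableAt_extChart {x : M} (hq : q ∈ (extChartAt (𝓡∂ n) x).source) :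
    MDifferentiableAt (𝓡∂ n) 𝓘(ℝ, EuclideanSpace ℝ (Fin n)) (extChartAt (𝓡∂ n) x) q :=
  mdifferentiableAt_extChartAt (by rwa [extChartAt_source] at hq)

/-- A pull-back in terms of the components in a chart. -/
lemma famPull_eq_chartBil {x : M} (hx : f z ∈ (extChartAt (𝓡∂ n) x).source)
    (hf : MDifferentiableWithinAt 𝓘(ℝ, EuclideanSpace ℝ (Fin n)) (𝓡∂ n) f (range (𝓡∂ n)) z)
    (hz : z ∈ range (𝓡∂ n)) (v w : EuclideanSpace ℝ (Fin n)) :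
    famPull G f z v w = chartBil G x (extChartAt (𝓡∂ n) x (f z))
      (fderivWithin ℝ (extChartAt (𝓡∂ n) x ∘ f) (range (𝓡∂ n)) z v)
      (fderivWithin ℝ (extChartAt (𝓡∂ n) x ∘ f) (range (𝓡∂ n)) z w) := by
  rw [fderivWithin_comp_dmap (mdifferentiableAt_extChart hx) hf hz]
  unfold chartBil
  rw [famPull_apply, famPull_apply, ContinuousLinearMap.comp_apply, ContinuousLinearMap.comp_apply,
    dmap_symm_dcomap hx, dmap_symm_dcomap hx, (extChartAt (𝓡∂ n) x).left_inv hx]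

lemma contMDiffWithinAt_extChartAt_symm {x : M} (hz : z ∈ (extChartAt (𝓡∂ n) x).target) :
    ContMDiffWithinAt 𝓘(ℝ, EuclideanSpace ℝ (Fin n)) (𝓡∂ n) ∞ (extChartAt (𝓡∂ n) x).symm
      (range (𝓡∂ n)) z :=
  (contMDiffOn_extChartAt_symm x z hz).mono_of_mem_nhdsWithin
    (extChartAt_target_mem_nhdsWithin_of_mem hz)

lemma eventually_contMDiffWithinAt_extChartAt_symm {x : M}
    (hz : z ∈ (extChartAt (𝓡∂ n) x).target) : ∀ᶠ w in 𝓝[range (𝓡∂ n)] z,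
    ContMDiffWithinAt 𝓘(ℝ, EuclideanSpace ℝ (Fin n)) (𝓡∂ n) ∞ (extChartAt (𝓡∂ n) x).symm
      (range (𝓡∂ n)) w := by
  filter_upwards [extChartAt_target_mem_nhdsWithin_of_mem hz] with w hw
  exact contMDiffWithinAt_extChartAt_symm hw

lemma contDiffWithinAt_extChartAt_comp {x : M} {m : WithTop ℕ∞} (hm : m ≤ ∞)
    (hx : f z ∈ (extChartAt (𝓡∂ n) x).source)
    (hf : ContMDiffWithinAt 𝓘(ℝ, EuclideanSpace ℝ (Fin n)) (𝓡∂ n) ∞ f (range (𝓡∂ n)) z) :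
    ContDiffWithinAt ℝ m (extChartAt (𝓡∂ n) x ∘ f) (range (𝓡∂ n)) z := by
  have h1 : ContMDiffAt (𝓡∂ n) 𝓘(ℝ, EuclideanSpace ℝ (Fin n)) ∞ (extChartAt (𝓡∂ n) x) (f z) :=
    contMDiffAt_extChartAt' (by rwa [extChartAt_source] at hx)
  exact ((h1.comp_contMDiffWithinAt z hf).contDiffWithinAt).of_le hm

/-- Pull-backs of smooth fields of bilinear forms by smooth maps are smooth. -/
lemma contDiffWithinAt_famPull {m : WithTop ℕ∞} (hm : m + 1 ≤ ∞) (hz : z ∈ range (𝓡∂ n))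
    (hf : ∀ᶠ w in 𝓝[range (𝓡∂ n)] z,
      ContMDiffWithinAt 𝓘(ℝ, EuclideanSpace ℝ (Fin n)) (𝓡∂ n) ∞ f (range (𝓡∂ n)) w)
    {x : M} (hx : f z ∈ (extChartAt (𝓡∂ n) x).source)
    (hG : ContDiffWithinAt ℝ m (chartBil G x) (range (𝓡∂ n)) (extChartAt (𝓡∂ n) x (f z))) :
    ContDiffWithinAt ℝ m (famPull G f) (range (𝓡∂ n)) z := by
  have hfz := hf.self_of_nhdsWithin hz
  have hS : UniqueDiffOn ℝ (range (𝓡∂ n)) := (𝓡∂ n).uniqueDiffOn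
  have hF := contDiffWithinAt_extChartAt_comp le_rfl hx hfz
  have hm' : m ≤ ∞ := le_self_add.trans hm
  have hsrc : ∀ᶠ w in 𝓝[range (𝓡∂ n)] z, f w ∈ (extChartAt (𝓡∂ n) x).source :=
    hfz.continuousWithinAt.eventually ((isOpen_extChartAt_source x).mem_nhds hx)
  have h1 : ContDiffWithinAt ℝ m (fun w => chartBil G x (extChartAt (𝓡∂ n) x (f w)))
      (range (𝓡∂ n)) z := by
    refine hG.comp_of_preimage_mem_nhdsWithin z (hF.of_le hm') ?_
    have hev : ∀ᶠ w in 𝓝[range (𝓡∂ n)] z, extChartAt (𝓡∂ n) x (f w) ∈ range (𝓡∂ n) := by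
      filter_upwards [hsrc] with w hw
      exact extChartAt_target_subset x ((extChartAt (𝓡∂ n) x).map_source hw)
    exact hev
  have h2 := hF.fderivWithin_right (m := m) hS hm hz
  refine (contDiffWithinAt_bilinearComp h1 h2).congr_of_eventuallyEq_of_mem ?_ hz
  filter_upwards [hf, hsrc, self_mem_nhdsWithin] with w hw1 hw2 hw3
  ext v u
  exact famPull_eq_chartBil hw2 (hw1.mdifferentiableWithinAt (by simp)) hw3 v u

/-- A field of bilinear forms is of class `C^m` if its components in charts are. -/
lemma contMDiffAt_section_iff {m : WithTop ℕ∞}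
    (s : ∀ b : M, TangentSpace (𝓡∂ n) b →L[ℝ] TangentSpace (𝓡∂ n) b →L[ℝ] ℝ) (x : M) :
    ContMDiffAt (𝓡∂ n) ((𝓡∂ n).prod 𝓘(ℝ, Bil (EuclideanSpace ℝ (Fin n)))) m
      (fun b : M => Bundle.TotalSpace.mk' (Bil (EuclideanSpace ℝ (Fin n)))
        (E := fun b : M => TangentSpace (𝓡∂ n) b →L[ℝ] TangentSpace (𝓡∂ n) b →L[ℝ] ℝ) b (s b)) x ↔
      ContDiffWithinAt ℝ m (chartBil (fun b : M => s b) x) (range (𝓡∂ n))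
        (extChartAt (𝓡∂ n) x x) := by
  refine (Bundle.contMDiffAt_section (IB := 𝓡∂ n) (F := Bil (EuclideanSpace ℝ (Fin n)))
    (E := fun b : M => TangentSpace (𝓡∂ n) b →L[ℝ] TangentSpace (𝓡∂ n) b →L[ℝ] ℝ) (s := s)
    x).trans ?_
  rw [contMDiffAt_iff_source, contMDiffWithinAt_iff_contDiffWithinAt]
  refine Filter.EventuallyEq.congr_contDiffWithinAt_of_mem ?_ (mem_range_self _)
  filter_upwards [extChartAt_target_mem_nhdsWithin x] with w hw
  have hs : (extChartAt (𝓡∂ n) x).symm w ∈ (chartAt (EuclideanHalfSpace n) x).source := by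
    rw [← extChartAt_source (𝓡∂ n)]
    exact (extChartAt (𝓡∂ n) x).map_target hw
  have key := TangentBundle.symmL_trivializationAt (I := 𝓡∂ n) (𝕜 := ℝ) hs
  rw [(extChartAt (𝓡∂ n) x).right_inv hw] at key
  simp only [Function.comp_apply]
  rw [hom_trivializationAt_apply]
  ext v u
  have hb : (extChartAt (𝓡∂ n) x).symm w ∈ (trivializationAt (EuclideanSpace ℝ (Fin n))
      (fun b : M => TangentSpace (𝓡∂ n) b) x).baseSet := by
    rwa [TangentBundle.trivializationAt_baseSet]
  refine (inCoordinates_apply_eq₂ (E₃ := Bundle.Trivial M ℝ) hb hb (mem_univ _)).trans ?_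
  have hk : ∀ u : EuclideanSpace ℝ (Fin n), (trivializationAt (EuclideanSpace ℝ (Fin n))
      (fun b : M => TangentSpace (𝓡∂ n) b) x).symm ((extChartAt (𝓡∂ n) x).symm w) u
      = dmap (extChartAt (𝓡∂ n) x).symm w u := fun u =>
    (Bundle.Trivialization.symmL_apply _ hb _).symm.trans (DFunLike.congr_fun key u)
  rw [hk, hk, Bundle.Trivialization.coe_linearMapAt_of_mem _ (mem_univ _)]
  rfl

end Derivatives

/-! ### Riemannian metrics in local parametrizations -/

lemma IsMetric.isBounded {E : Type*} [NormedAddCommGroup E] [NormedSpace ℝ E]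
    [FiniteDimensional ℝ E] {b : Bil E} (hb : IsMetric b) :
    Bornology.IsBounded {v : E | b v v < 1} := by
  obtain ⟨c, hc, h⟩ : ∃ c > 0, ∀ v, ‖v‖ = 1 → c ≤ b v v := by
    rcases (Metric.sphere (0 : E) 1).eq_empty_or_nonempty with he | he
    · refine ⟨1, one_pos, fun v hv => ?_⟩
      have : v ∈ Metric.sphere (0 : E) 1 := by simpa using hv
      simp [he] at this
    · have := FiniteDimensional.proper_real E
      obtain ⟨v, hv, hm⟩ := (isCompact_sphere (0 : E) 1).exists_isMinOn he
        (f := fun v => b v v) (by fun_prop)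
      refine ⟨b v v, hb.2 v ?_, fun w hw => hm (by simpa using hw)⟩
      rintro rfl
      simp at hv
  refine isBounded_iff_forall_norm_le.2 ⟨Real.sqrt c⁻¹, fun v hv => ?_⟩
  by_cases h0 : v = 0
  · simp [h0]
  have hn : 0 < ‖v‖ := norm_pos_iff.2 h0
  have h1 := h (‖v‖⁻¹ • v) (by rw [norm_smul, norm_inv, norm_norm, inv_mul_cancel₀ hn.ne'])
  simp only [map_smul, smul_apply, smul_eq_mul] at h1
  apply Real.le_sqrt_of_sq_le
  have hv' : b v v < 1 := hv
  rw [← mul_assoc, ← mul_inv, ← div_eq_inv_mul, le_div_iff₀ (by positivity)] at h1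
  rw [le_inv_comm₀ (by positivity) hc, ← one_div, le_div_iff₀ (by positivity)]
  nlinarith

lemma injective_of_isMetric {E : Type*} [NormedAddCommGroup E] [NormedSpace ℝ E] {L : E →L[ℝ] E}
    {b b' : Bil E} (hb : IsMetric b)
    (h : ∀ v w, b v w = b' (L v) (L w)) : Function.Injective L := by
  rw [injective_iff_map_eq_zero]
  intro v hv
  by_contra h0
  have := hb.2 v h0
  simp [h, hv] at this

section Metric

variable {n : ℕ} [NeZero n] {k : WithTop ℕ∞} {M : Type u} [TopologicalSpace M]
  [ChartedSpace (EuclideanHalfSpace n) M] [IsManifold (𝓡∂ n) ∞ M]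

/-- A Riemannian metric as a field of bilinear forms on the model space. -/
def metFam (g : RMetric n k M) (q : M) : Bil (EuclideanSpace ℝ (Fin n)) := g.inner q

variable {G : M → Bil (EuclideanSpace ℝ (Fin n))} {f : EuclideanSpace ℝ (Fin n) → M}
  {B : EuclideanSpace ℝ (Fin n) → Bil (EuclideanSpace ℝ (Fin n))}
  {z : EuclideanSpace ℝ (Fin n)}

lemma isMetric_metFam (g : RMetric n k M) (q : M) : IsMetric (metFam g q) :=
  ⟨g.symm q, fun v hv => g.pos q v hv⟩

lemma injective_dmap_symm {x : M} (hz : z ∈ (extChartAt (𝓡∂ n) x).target) :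
    Function.Injective (dmap (extChartAt (𝓡∂ n) x).symm z) :=
  Function.LeftInverse.injective (dcomap_dmap_symm hz)

lemma isMetric_chartBil (hG : ∀ q, IsMetric (G q)) {x : M}
    (hz : z ∈ (extChartAt (𝓡∂ n) x).target) : IsMetric (chartBil G x z) :=
  (hG _).pullback _ (injective_dmap_symm hz) fun _ _ => rfl

lemma contDiffWithinAt_chartBil_self {m : WithTop ℕ∞} (hm : m ≤ k) (g : RMetric n k M) (x : M) :
    ContDiffWithinAt ℝ m (chartBil (metFam g) x) (range (𝓡∂ n)) (extChartAt (𝓡∂ n) x x) :=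
  (contMDiffAt_section_iff g.inner x).1 ((g.contMDiff x).of_le hm)

lemma contDiffWithinAt_chartBil {m : WithTop ℕ∞} (hm : m ≤ k) (hm' : m + 1 ≤ ∞)
    (g : RMetric n k M) {x : M} (hz : z ∈ (extChartAt (𝓡∂ n) x).target) :
    ContDiffWithinAt ℝ m (chartBil (metFam g) x) (range (𝓡∂ n)) z :=
  contDiffWithinAt_famPull hm' (extChartAt_target_subset x hz)
    (eventually_contMDiffWithinAt_extChartAt_symm hz) (mem_extChartAt_source _)
    (contDiffWithinAt_chartBil_self hm g _)

/-- A symmetric positive definite field of bilinear forms with smooth components is a Riemannian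
metric. -/
def mkMetric (hG : ∀ q, IsMetric (G q))
    (hs : ∀ q, ContDiffWithinAt ℝ k (chartBil G q) (range (𝓡∂ n)) (extChartAt (𝓡∂ n) q q)) :
    RMetric n k M where
  inner q := G q
  symm q := (hG q).1
  pos q v hv := (hG q).2 v hv
  isVonNBounded q := NormedSpace.isVonNBounded_of_isBounded ℝ (E := EuclideanSpace ℝ (Fin n))
    (hG q).isBounded
  contMDiff q := (contMDiffAt_section_iff (fun q => G q) q).2 (hs q)

lemma famPull_eventually (hf : ∀ᶠ w in 𝓝[range (𝓡∂ n)] z,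
      ContMDiffWithinAt 𝓘(ℝ, EuclideanSpace ℝ (Fin n)) (𝓡∂ n) ∞ f (range (𝓡∂ n)) w)
    (hz : z ∈ range (𝓡∂ n)) (h : ∀ᶠ w in 𝓝[range (𝓡∂ n)] z, ∀ u v, B w u v = famPull G f w u v) :
    ∀ᶠ w in 𝓝[range (𝓡∂ n)] z, ∀ u v,
      B w u v = chartBil G (f z) ((extChartAt (𝓡∂ n) (f z) ∘ f) w)
      (fderivWithin ℝ (extChartAt (𝓡∂ n) (f z) ∘ f) (range (𝓡∂ n)) w u)
      (fderivWithin ℝ (extChartAt (𝓡∂ n) (f z) ∘ f) (range (𝓡∂ n)) w v) := by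
  have hsrc : ∀ᶠ w in 𝓝[range (𝓡∂ n)] z, f w ∈ (extChartAt (𝓡∂ n) (f z)).source :=
    (hf.self_of_nhdsWithin hz).continuousWithinAt.eventually
      ((isOpen_extChartAt_source (f z)).mem_nhds (mem_extChartAt_source _))
  filter_upwards [hf, hsrc, h, self_mem_nhdsWithin] with w h1 h2 h3 h4 u v
  rw [h3, famPull_eq_chartBil h2 (h1.mdifferentiableWithinAt (by simp)) h4]
  rfl

/-- Scalar curvature can be computed in any smooth parametrization. -/
lemma coordScalarCurvature_famPull (g : RMetric n k M) (hk : 2 ≤ k) (hz : z ∈ range (𝓡∂ n))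
    (hf : ∀ᶠ w in 𝓝[range (𝓡∂ n)] z,
      ContMDiffWithinAt 𝓘(ℝ, EuclideanSpace ℝ (Fin n)) (𝓡∂ n) ∞ f (range (𝓡∂ n)) w)
    (hB : ContDiffWithinAt ℝ 2 B (range (𝓡∂ n)) z)
    (hs : ∀ w v u, B w v u = B w u v) (hm : ∀ᶠ w in 𝓝[range (𝓡∂ n)] z, IsMetric (B w))
    (h : ∀ᶠ w in 𝓝[range (𝓡∂ n)] z, ∀ u v, B w u v = famPull (metFam g) f w u v) :
    coordScalarCurvature (range (𝓡∂ n)) (matOf B) z = scalarCurvature g (f z) := by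
  have hfz := hf.self_of_nhdsWithin hz
  have hev := famPull_eventually hf hz h
  refine coordScalarCurvature_pullback (F := extChartAt (𝓡∂ n) (f z) ∘ f)
    (B' := chartBil (metFam g) (f z)) (𝓡∂ n).uniqueDiffOn (𝓡∂ n).range_subset_closure_interior
    (𝓡∂ n).uniqueDiffOn hz
    (contDiffWithinAt_extChartAt_comp (by exact WithTop.coe_le_coe.2 (le_top : (3 : ℕ∞) ≤ ⊤))
      (mem_extChartAt_source _) hfz)
    (.of_forall fun _ => mem_range_self _) (contDiffWithinAt_chartBil_self hk g _) hB ?_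
    (fun w _ => hs w) (fun w _ => famPull_symm fun q => (isMetric_metFam g q).1) ?_ hev
  · filter_upwards [extChartAt_target_mem_nhdsWithin (f z)] with w hw
    exact isMetric_chartBil (isMetric_metFam g) hw
  · filter_upwards [hev, hm] with w h1 h2
    exact injective_of_isMetric h2 h1

/-- The second fundamental form can be computed in any smooth parametrization that maps boundary
to boundary. -/
lemma coordSFF_famPull (g : RMetric n k M) (hk : 1 ≤ k) (hz : z 0 = 0)
    (hf : ∀ᶠ w in 𝓝[range (𝓡∂ n)] z,
      ContMDiffWithinAt 𝓘(ℝ, EuclideanSpace ℝ (Fin n)) (𝓡∂ n) ∞ f (range (𝓡∂ n)) w)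
    (hb : ∀ᶠ w in 𝓝[range (𝓡∂ n)] z, w 0 = 0 → extChartAt (𝓡∂ n) (f z) (f w) 0 = 0)
    (hB : ContDiffWithinAt ℝ 1 B (range (𝓡∂ n)) z)
    (hs : ∀ w v u, B w v u = B w u v) (hm : ∀ᶠ w in 𝓝[range (𝓡∂ n)] z, IsMetric (B w))
    (h : ∀ᶠ w in 𝓝[range (𝓡∂ n)] z, ∀ u v, B w u v = famPull (metFam g) f w u v)
    {v w : EuclideanSpace ℝ (Fin n)} (hv : v 0 = 0) (hw : w 0 = 0) :
    coordSFF (range (𝓡∂ n)) (matOf B) z v w = secondFundamentalForm g (f z)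
      (fderivWithin ℝ (extChartAt (𝓡∂ n) (f z) ∘ f) (range (𝓡∂ n)) z v)
      (fderivWithin ℝ (extChartAt (𝓡∂ n) (f z) ∘ f) (range (𝓡∂ n)) z w) := by
  have hz' : z ∈ range (𝓡∂ n) := mem_range_iff.2 hz.ge
  have hfz := hf.self_of_nhdsWithin hz'
  have hev := famPull_eventually hf hz' h
  refine coordSFF_pullback (F := extChartAt (𝓡∂ n) (f z) ∘ f)
    (B' := chartBil (metFam g) (f z)) hz
    (contDiffWithinAt_extChartAt_comp two_le_infty (mem_extChartAt_source _) hfz)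
    (.of_forall fun _ => mem_range_self _) hb (contDiffWithinAt_chartBil_self hk g _) hB ?_
    (fun w _ => hs w) (fun w _ => famPull_symm fun q => (isMetric_metFam g q).1) ?_ hev v w hv hw
  · filter_upwards [extChartAt_target_mem_nhdsWithin (f z)] with w hw
    exact isMetric_chartBil (isMetric_metFam g) hw
  · filter_upwards [hev, hm] with w h1 h2
    exact injective_of_isMetric h2 h1

/-- A field that is the pull-back, under a map to the half-space, of a field of class `C^m` is of
class `C^m`. -/
lemma contDiffWithinAt_chartBil_of_comap {m : WithTop ℕ∞} (hm : m + 1 ≤ ∞)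
    {κ : M → EuclideanSpace ℝ (Fin n)} {q : M}
    (hκ : ∀ᶠ p in 𝓝 q, ContMDiffAt (𝓡∂ n) 𝓘(ℝ, EuclideanSpace ℝ (Fin n)) ∞ κ p)
    (hκH : ∀ᶠ p in 𝓝 q, κ p ∈ range (𝓡∂ n))
    (hB : ContDiffWithinAt ℝ m B (range (𝓡∂ n)) (κ q))
    (h : ∀ᶠ p in 𝓝 q, ∀ v w, G p v w = B (κ p) (dcomap κ p v) (dcomap κ p w)) :
    ContDiffWithinAt ℝ m (chartBil G q) (range (𝓡∂ n)) (extChartAt (𝓡∂ n) q q) := by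
  have hz : extChartAt (𝓡∂ n) q q ∈ (extChartAt (𝓡∂ n) q).target := mem_extChartAt_target q
  have hzr := extChartAt_target_subset q hz
  have hc : Filter.Tendsto (extChartAt (𝓡∂ n) q).symm
      (𝓝[range (𝓡∂ n)] (extChartAt (𝓡∂ n) q q)) (𝓝 q) := by
    have := (contMDiffWithinAt_extChartAt_symm hz).continuousWithinAt
    unfold ContinuousWithinAt at this
    rwa [extChartAt_to_inv] at this
  have hsm := eventually_contMDiffWithinAt_extChartAt_symm hz
  have h1 : ContDiffWithinAt ℝ ∞ (κ ∘ (extChartAt (𝓡∂ n) q).symm) (range (𝓡∂ n))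
      (extChartAt (𝓡∂ n) q q) := by
    have h0 := hκ.self_of_nhds
    rw [← extChartAt_to_inv (I := 𝓡∂ n) q] at h0
    exact (h0.comp_contMDiffWithinAt _ (contMDiffWithinAt_extChartAt_symm hz)).contDiffWithinAt
  have h2 : ContDiffWithinAt ℝ m (fun w => B ((κ ∘ (extChartAt (𝓡∂ n) q).symm) w))
      (range (𝓡∂ n)) (extChartAt (𝓡∂ n) q q) := by
    refine ContDiffWithinAt.comp_of_preimage_mem_nhdsWithin (t := range (𝓡∂ n)) (g := B) _ ?_
      (h1.of_le (le_self_add.trans hm)) (hc.eventually hκH)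
    rwa [Function.comp_apply, extChartAt_to_inv]
  refine (contDiffWithinAt_bilinearComp h2 (h1.fderivWithin_right (m := m) (𝓡∂ n).uniqueDiffOn hm
    hzr)).congr_of_eventuallyEq_of_mem ?_ hzr
  filter_upwards [hsm, hc.eventually hκ, hc.eventually h, self_mem_nhdsWithin] with w h3 h4 h5 h6
  ext u v
  rw [ContinuousLinearMap.bilinearComp_apply, fderivWithin_comp_dmap
    (h4.mdifferentiableAt (by simp)) (h3.mdifferentiableWithinAt (by simp)) h6]
  exact h5 _ _

/-- The pull-back of a metric under a smooth map between manifolds is smooth. -/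
lemma contDiffWithinAt_chartBil_of_map {N : Type u} [TopologicalSpace N]
    [ChartedSpace (EuclideanHalfSpace n) N] [IsManifold (𝓡∂ n) ∞ N] {m : WithTop ℕ∞}
    (hm : m + 1 ≤ ∞) (hmk : m ≤ k) (g : RMetric n k N) {ψ : M → N} {q : M}
    (hψ : ∀ᶠ p in 𝓝 q, ContMDiffAt (𝓡∂ n) (𝓡∂ n) ∞ ψ p)
    (h : ∀ᶠ p in 𝓝 q, ∀ v w, G p v w = metFam g (ψ p) (dself ψ p v) (dself ψ p w)) :
    ContDiffWithinAt ℝ m (chartBil G q) (range (𝓡∂ n)) (extChartAt (𝓡∂ n) q q) := by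
  have hz : extChartAt (𝓡∂ n) q q ∈ (extChartAt (𝓡∂ n) q).target := mem_extChartAt_target q
  have hzr := extChartAt_target_subset q hz
  have hc : Filter.Tendsto (extChartAt (𝓡∂ n) q).symm
      (𝓝[range (𝓡∂ n)] (extChartAt (𝓡∂ n) q q)) (𝓝 q) := by
    have := (contMDiffWithinAt_extChartAt_symm hz).continuousWithinAt
    unfold ContinuousWithinAt at this
    rwa [extChartAt_to_inv] at this
  have hsm := eventually_contMDiffWithinAt_extChartAt_symm hz
  have h1 := contDiffWithinAt_famPull (G := metFam g) (f := ψ ∘ (extChartAt (𝓡∂ n) q).symm) hm hzr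
    (by filter_upwards [hsm, hc.eventually hψ] with w h1 h2
        exact h2.comp_contMDiffWithinAt w h1)
    (mem_extChartAt_source _) (contDiffWithinAt_chartBil_self hmk g _)
  refine h1.congr_of_eventuallyEq_of_mem ?_ hzr
  filter_upwards [hsm, hc.eventually hψ, hc.eventually h, self_mem_nhdsWithin] with w h3 h4 h5 h6
  ext u v
  rw [famPull_apply, dmap_comp_dself (h4.mdifferentiableAt (by simp))
    (h3.mdifferentiableWithinAt (by simp)) h6]
  exact h5 _ _

end Metric

/-! ### The boundary, and displacements of it -/

section Boundary

variable {n : ℕ} [NeZero n]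

/-- Boundary preserving local isometries map the gradient of the boundary coordinate to a positive
multiple of it, at the boundary. -/
lemma gradZero_pullback {B B' : EuclideanSpace ℝ (Fin n) → Bil (EuclideanSpace ℝ (Fin n))}
    {F : EuclideanSpace ℝ (Fin n) → EuclideanSpace ℝ (Fin n)} {y : EuclideanSpace ℝ (Fin n)}
    {L : EuclideanSpace ℝ (Fin n) →L[ℝ] EuclideanSpace ℝ (Fin n)} (hy : y 0 = 0)
    (hF : HasFDerivWithinAt F L (range (𝓡∂ n)) y)
    (hm : ∀ᶠ z in 𝓝[range (𝓡∂ n)] y, F z ∈ range (𝓡∂ n))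
    (hb : ∀ᶠ z in 𝓝[range (𝓡∂ n)] y, z 0 = 0 → F z 0 = 0)
    (hB : IsMetric (B y)) (hB' : IsMetric (B' (F y)))
    (h : ∀ v w, B y v w = B' (F y) (L v) (L w)) :
    ∃ c : ℝ, 0 < c ∧ L (gradZero B y) = c • gradZero B' (F y) := by
  have hL := injective_of_isMetric hB h
  obtain ⟨c, hc, hcL⟩ := exists_pos_fderivWithin_zero hy hF hm hb hL
  refine ⟨c⁻¹, inv_pos.2 hc, ?_⟩
  have hsurj : Function.Surjective L :=
    (LinearMap.injective_iff_surjective (f := (L :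
      EuclideanSpace ℝ (Fin n) →ₗ[ℝ] EuclideanSpace ℝ (Fin n)))).1 hL
  apply hB'.injective
  ext u'
  obtain ⟨u, rfl⟩ := hsurj u'
  rw [← h, apply_gradZero hB.isInvertible, map_smul, smul_apply,
    apply_gradZero hB'.isInvertible, hcL, smul_eq_mul, inv_mul_cancel_left₀ hc.ne']

variable {M : Type u} [TopologicalSpace M] [ChartedSpace (EuclideanHalfSpace n) M]

lemma extChartAt_zero_nonneg (x q : M) : 0 ≤ extChartAt (𝓡∂ n) x q 0 :=
  mem_range_iff.1 (mem_range_self _)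

variable [IsManifold (𝓡∂ n) ∞ M]

lemma mem_boundary_iff {x q : M} (hq : q ∈ (extChartAt (𝓡∂ n) x).source) :
    q ∈ (𝓡∂ n).boundary M ↔ extChartAt (𝓡∂ n) x q 0 = 0 := by
  have hq' : q ∈ (chartAt (EuclideanHalfSpace n) x).source := by rwa [extChartAt_source] at hq
  have h := (𝓡∂ n).isInteriorPoint_iff_of_mem_atlas (n := ∞) (M := M) (by simp)
    (chart_mem_atlas (EuclideanHalfSpace n) x) hq'
  have h' : (𝓡∂ n).IsInteriorPoint q ↔ 0 < extChartAt (𝓡∂ n) x q 0 := by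
    rw [h]
    have : extChartAt (𝓡∂ n) x q ∈ interior (range (𝓡∂ n)) ↔ 0 < extChartAt (𝓡∂ n) x q 0 := by
      rw [interior_range_modelWithCornersEuclideanHalfSpace]
      rfl
    rw [← this]
    exact ⟨fun h => OpenPartialHomeomorph.interior_extend_target_subset_interior_range _ h,
      fun h => (chartAt (EuclideanHalfSpace n) x).mem_interior_extend_target
        ((chartAt (EuclideanHalfSpace n) x).map_source hq') h⟩
  rw [← (𝓡∂ n).compl_interior, mem_compl_iff]
  change ¬ (𝓡∂ n).IsInteriorPoint q ↔ _
  rw [h', not_lt]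
  exact ⟨fun h => le_antisymm h (extChartAt_zero_nonneg x q), fun h => h.le⟩

lemma symm_mem_boundary_iff {x : M} {z : EuclideanSpace ℝ (Fin n)}
    (hz : z ∈ (extChartAt (𝓡∂ n) x).target) :
    (extChartAt (𝓡∂ n) x).symm z ∈ (𝓡∂ n).boundary M ↔ z 0 = 0 := by
  rw [mem_boundary_iff ((extChartAt (𝓡∂ n) x).map_target hz), (extChartAt (𝓡∂ n) x).right_inv hz]

/-- A component of the boundary is relatively open in the boundary. -/
lemma IsBoundaryComponent.eventually_mem {C : Set M} (hC : IsBoundaryComponent n C) {x : M}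
    (hx : x ∈ C) : ∀ᶠ q in 𝓝 x, q ∈ (𝓡∂ n).boundary M → q ∈ C := by
  obtain ⟨p, hp, rfl⟩ := hC
  have hxb : x ∈ (𝓡∂ n).boundary M := connectedComponentIn_subset _ _ hx
  rw [connectedComponentIn_eq hx]
  obtain ⟨R, hR, hRt⟩ := Metric.mem_nhdsWithin_iff.1 (extChartAt_target_mem_nhdsWithin
    (I := 𝓡∂ n) x)
  set D : Set (EuclideanSpace ℝ (Fin n)) :=
    Metric.ball (extChartAt (𝓡∂ n) x x) R ∩ {z | z 0 = 0} with hD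
  have hDt : D ⊆ (extChartAt (𝓡∂ n) x).target := fun z hz =>
    hRt ⟨hz.1, mem_range_iff.2 (le_of_eq hz.2.symm)⟩
  have hDc : Convex ℝ D := (convex_ball _ _).inter
    (convex_hyperplane (f := fun z : EuclideanSpace ℝ (Fin n) => z 0)
      ⟨fun _ _ => rfl, fun _ _ => rfl⟩ 0)
  have himg : IsPreconnected ((extChartAt (𝓡∂ n) x).symm '' D) :=
    hDc.isPreconnected.image _ ((continuousOn_extChartAt_symm x).mono hDt)
  have hsub := himg.subset_connectedComponentIn (F := (𝓡∂ n).boundary M) (x := x)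
    ⟨extChartAt (𝓡∂ n) x x, ⟨Metric.mem_ball_self hR,
      (mem_boundary_iff (mem_extChartAt_source x)).1 hxb⟩, extChartAt_to_inv x⟩ (by
      rintro _ ⟨z, hz, rfl⟩
      exact (symm_mem_boundary_iff (hDt hz)).2 hz.2)
  filter_upwards [extChartAt_source_mem_nhds (I := 𝓡∂ n) x,
    (continuousAt_extChartAt (I := 𝓡∂ n) x).preimage_mem_nhds (Metric.ball_mem_nhds _ hR)]
    with q hq1 hq2 hqb
  exact hsub ⟨extChartAt (𝓡∂ n) x q, ⟨hq2, (mem_boundary_iff hq1).1 hqb⟩,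
    (extChartAt (𝓡∂ n) x).left_inv hq1⟩

end Boundary

section Push

variable {n : ℕ} [NeZero n] {M : Type u} [TopologicalSpace M]
  [ChartedSpace (EuclideanHalfSpace n) M] [IsManifold (𝓡∂ n) ∞ M]

/-- The map that displaces points in the direction of the gradient of the boundary coordinate of
the chart at `x`, with velocity cut off by `f`. -/
def pushMap (g : RMetric n ∞ M) (x : M) (f : M → ℝ) (p : M × ℝ) : M :=
  open Classical in
  if p.1 ∈ (extChartAt (𝓡∂ n) x).source then (extChartAt (𝓡∂ n) x).symm (extChartAt (𝓡∂ n) x p.1 +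
    (p.2 * f p.1) • gradZero (chartBil (metFam g) x) (extChartAt (𝓡∂ n) x p.1)) else p.1

variable (g : RMetric n ∞ M)

lemma pushMap_of_eq_zero {x p : M} {f : M → ℝ} {s : ℝ} (h : s * f p = 0) :
    pushMap g x f (p, s) = p := by
  unfold pushMap
  split_ifs with hp
  · simp only at hp
    simp only [h, zero_smul, add_zero]
    exact (extChartAt (𝓡∂ n) x).left_inv hp
  · rfl

lemma contMDiffAt_gradZero_comp {x p : M} (hp : p ∈ (extChartAt (𝓡∂ n) x).source) :
    ContMDiffAt (𝓡∂ n) 𝓘(ℝ, EuclideanSpace ℝ (Fin n)) ∞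
      (fun q => gradZero (chartBil (metFam g) x) (extChartAt (𝓡∂ n) x q)) p := by
  have hz := (extChartAt (𝓡∂ n) x).map_source hp
  have h1 : ContDiffWithinAt ℝ ∞ (gradZero (chartBil (metFam g) x)) (range (𝓡∂ n))
      (extChartAt (𝓡∂ n) x p) :=
    contDiffWithinAt_gradZero (isMetric_chartBil (isMetric_metFam g) hz).isInvertible
      (contDiffWithinAt_chartBil le_rfl (by simp) g hz)
  have h2 : ContMDiffAt (𝓡∂ n) 𝓘(ℝ, EuclideanSpace ℝ (Fin n)) ∞ (extChartAt (𝓡∂ n) x) p :=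
    contMDiffAt_extChartAt' (by rwa [extChartAt_source] at hp)
  exact h1.contMDiffWithinAt.comp p h2.contMDiffWithinAt (t := range (𝓡∂ n))
    (fun q _ => mem_range_self _)

variable [T2Space M]

lemma exists_pushMap_mem_target {x : M} (f : SmoothBumpFunction (𝓡∂ n) x) :
    ∃ s₀ > 0, ∀ p ∈ (extChartAt (𝓡∂ n) x).source, ∀ s ∈ Ico 0 s₀,
      extChartAt (𝓡∂ n) x p + (s * f p) • gradZero (chartBil (metFam g) x) (extChartAt (𝓡∂ n) x p)
        ∈ (extChartAt (𝓡∂ n) x).target := by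
  have hK : IsCompact (tsupport f) := f.hasCompactSupport
  have hKs : tsupport f ⊆ (extChartAt (𝓡∂ n) x).source := f.tsupport_subset_extChartAt_source
  have ho : IsOpen ((𝓡∂ n).symm ⁻¹' (chartAt (EuclideanHalfSpace n) x).target) :=
    (chartAt (EuclideanHalfSpace n) x).open_target.preimage (𝓡∂ n).continuous_symm
  have hKi := hK.image_of_continuousOn ((continuousOn_extChartAt (I := 𝓡∂ n) x).mono hKs)
  obtain ⟨δ, hδ, hsub⟩ := hKi.exists_thickening_subset_open ho (by
    rintro _ ⟨p, hp, rfl⟩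
    have := (extChartAt (𝓡∂ n) x).map_source (hKs hp)
    rw [extChartAt_target] at this
    exact this.1)
  obtain ⟨b, hb⟩ := hK.exists_bound_of_continuousOn
    (f := fun q => f q • gradZero (chartBil (metFam g) x) (extChartAt (𝓡∂ n) x q))
    (fun p hp => ((f.continuous.continuousAt).smul
      (contMDiffAt_gradZero_comp g (hKs hp)).continuousAt).continuousWithinAt)
  have hb0 : 0 ≤ b := (norm_nonneg _).trans (hb x (subset_closure f.c_mem_support))
  refine ⟨δ / (b + 1), by positivity, fun p hp s hs => ?_⟩
  by_cases hpt : p ∈ tsupport f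
  · rw [extChartAt_target]
    refine ⟨hsub (Metric.mem_thickening_iff.2 ⟨_, mem_image_of_mem _ hpt, ?_⟩), ?_⟩
    · rw [dist_eq_norm, add_sub_cancel_left, mul_smul, norm_smul, Real.norm_of_nonneg hs.1]
      have h1 := (lt_div_iff₀ (by positivity)).1 hs.2
      nlinarith [hb p hpt, hs.1]
    · rw [mem_range_iff, PiLp.add_apply, PiLp.smul_apply, smul_eq_mul]
      exact add_nonneg (extChartAt_zero_nonneg x p) (mul_nonneg (mul_nonneg hs.1 f.nonneg)
        (gradZero_zero_pos (isMetric_chartBil (isMetric_metFam g)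
          ((extChartAt (𝓡∂ n) x).map_source hp))).le)
  · rw [image_eq_zero_of_notMem_tsupport hpt, mul_zero, zero_smul, add_zero]
    exact (extChartAt (𝓡∂ n) x).map_source hp

/-- For short times `pushMap` is smooth. -/
lemma exists_contMDiffOn_pushMap {x : M} (f : SmoothBumpFunction (𝓡∂ n) x) :
    ∃ s₀ > 0, ContMDiffOn ((𝓡∂ n).prod 𝓘(ℝ, ℝ)) (𝓡∂ n) ∞ (pushMap g x f)
      (univ ×ˢ Ico 0 s₀) := by
  obtain ⟨s₀, hs₀, ht⟩ := exists_pushMap_mem_target g f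
  refine ⟨s₀, hs₀, ?_⟩
  rintro ⟨p, s⟩ ⟨-, hs⟩
  by_cases hp : p ∈ (extChartAt (𝓡∂ n) x).source
  · have hfst : ContMDiffAt ((𝓡∂ n).prod 𝓘(ℝ, ℝ)) (𝓡∂ n) ∞ (Prod.fst : M × ℝ → M) (p, s) :=
      contMDiffAt_fst
    have h1 : ContMDiffAt ((𝓡∂ n).prod 𝓘(ℝ, ℝ)) 𝓘(ℝ, EuclideanSpace ℝ (Fin n)) ∞
        (fun q : M × ℝ => extChartAt (𝓡∂ n) x q.1) (p, s) :=
      (contMDiffAt_extChartAt' (by rwa [extChartAt_source] at hp)).comp (p, s) hfst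
    have h2 : ContMDiffAt ((𝓡∂ n).prod 𝓘(ℝ, ℝ)) 𝓘(ℝ, EuclideanSpace ℝ (Fin n)) ∞
        (fun q : M × ℝ => gradZero (chartBil (metFam g) x) (extChartAt (𝓡∂ n) x q.1)) (p, s) :=
      (contMDiffAt_gradZero_comp g hp).comp (p, s) hfst
    have h3 : ContMDiffAt ((𝓡∂ n).prod 𝓘(ℝ, ℝ)) 𝓘(ℝ, ℝ) ∞ (fun q : M × ℝ => q.2 * f q.1) (p, s) :=
      contMDiffAt_snd.mul ((f.contMDiff p).comp (p, s) hfst)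
    have h4 := h1.add (h3.smul h2)
    have h5 : ContMDiffWithinAt 𝓘(ℝ, EuclideanSpace ℝ (Fin n)) (𝓡∂ n) ∞
        (extChartAt (𝓡∂ n) x).symm (extChartAt (𝓡∂ n) x).target _ :=
      (contMDiffOn_extChartAt_symm (I := 𝓡∂ n) (n := ∞) x _ (ht p hp s hs))
    have hev : ∀ᶠ q in 𝓝[univ ×ˢ Ico 0 s₀] (p, s), q.1 ∈ (extChartAt (𝓡∂ n) x).source :=
      nhdsWithin_le_nhds (continuousAt_fst.eventually
        ((isOpen_extChartAt_source x).mem_nhds hp))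
    have h6 := (ContMDiffWithinAt.comp' (p, s) h5 h4.contMDiffWithinAt
      (s := univ ×ˢ Ico 0 s₀)).mono_of_mem_nhdsWithin (Filter.inter_mem self_mem_nhdsWithin <| by
        filter_upwards [hev, self_mem_nhdsWithin] with q hq1 hq2
        exact ht q.1 hq1 q.2 hq2.2)
    refine h6.congr_of_eventuallyEq ?_ (if_pos hp)
    filter_upwards [hev] with q hq
    exact if_pos hq
  · have hp' : p ∈ (tsupport f)ᶜ := fun h => hp (f.tsupport_subset_extChartAt_source h)
    have hev : ∀ᶠ q in 𝓝[univ ×ˢ Ico 0 s₀] (p, s), q.1 ∈ (tsupport f)ᶜ :=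
      nhdsWithin_le_nhds (continuousAt_fst.eventually
        ((isClosed_tsupport f).isOpen_compl.mem_nhds hp'))
    refine (contMDiffWithinAt_fst (M := M) (N := ℝ)).congr_of_eventuallyEq ?_ ?_
    · filter_upwards [hev] with q hq
      exact pushMap_of_eq_zero g (by rw [image_eq_zero_of_notMem_tsupport hq, mul_zero])
    · exact pushMap_of_eq_zero g (by rw [image_eq_zero_of_notMem_tsupport hp', mul_zero])

end Push

/-! ### Displacements with inward normal velocity -/

section Push

variable {n : ℕ} [NeZero n] {M : Type u} [TopologicalSpace M]
  [ChartedSpace (EuclideanHalfSpace n) M] [IsManifold (𝓡∂ n) ∞ M]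

/-- `Ψ` is, for short times, a smooth displacement of the points of `M` that starts at the boundary
with a non-negative multiple of the inner normal as velocity, and with a positive multiple at the
points of `P`. -/
structure IsPush (g : RMetric n ∞ M) (Ψ : M × ℝ → M) (s₀ : ℝ) (P : Set M) : Prop where
  pos : 0 < s₀
  smooth : ContMDiffOn ((𝓡∂ n).prod 𝓘(ℝ, ℝ)) (𝓡∂ n) ∞ Ψ (univ ×ˢ Ico 0 s₀)
  zero : ∀ p, Ψ (p, 0) = p
  velocity : ∀ p ∈ (𝓡∂ n).boundary M, ∃ c : ℝ, 0 ≤ c ∧ (p ∈ P → 0 < c) ∧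
    HasDerivWithinAt (fun s : ℝ => extChartAt (𝓡∂ n) p (Ψ (p, s)))
      (c • gradZero (chartBil (metFam g) p) (extChartAt (𝓡∂ n) p p)) (Ici 0) 0

variable {g : RMetric n ∞ M}

lemma hasDerivWithinAt_pushMap {x p : M} {f : M → ℝ} (hf : ∀ q, 0 ≤ f q)
    (hfs : Function.support f ⊆ (extChartAt (𝓡∂ n) x).source) (hp : p ∈ (𝓡∂ n).boundary M) :
    ∃ c : ℝ, 0 ≤ c ∧ (p ∈ Function.support f → 0 < c) ∧
      HasDerivWithinAt (fun s : ℝ => extChartAt (𝓡∂ n) p (pushMap g x f (p, s)))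
        (c • gradZero (chartBil (metFam g) p) (extChartAt (𝓡∂ n) p p)) (Ici 0) 0 := by
  by_cases hps : p ∈ (extChartAt (𝓡∂ n) x).source
  · set y := extChartAt (𝓡∂ n) x p with hy
    have hyt : y ∈ (extChartAt (𝓡∂ n) x).target := (extChartAt (𝓡∂ n) x).map_source hps
    have hyr := extChartAt_target_subset x hyt
    have hyp : (extChartAt (𝓡∂ n) x).symm y = p := (extChartAt (𝓡∂ n) x).left_inv hps
    have hy0 : y 0 = 0 := (mem_boundary_iff hps).1 hp
    set F := extChartAt (𝓡∂ n) p ∘ (extChartAt (𝓡∂ n) x).symm with hF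
    have hFy : F y = extChartAt (𝓡∂ n) p p := by rw [hF, Function.comp_apply, hyp]
    have hsm := contMDiffWithinAt_extChartAt_symm hyt
    have hsrc : (extChartAt (𝓡∂ n) x).symm y ∈ (extChartAt (𝓡∂ n) p).source := by
      rw [hyp]
      exact mem_extChartAt_source p
    have hFd : HasFDerivWithinAt F (fderivWithin ℝ F (range (𝓡∂ n)) y) (range (𝓡∂ n)) y :=
      ((contDiffWithinAt_extChartAt_comp le_rfl hsrc hsm).differentiableWithinAt
        (by simp)).hasFDerivWithinAt
    obtain ⟨c, hc, hcL⟩ := gradZero_pullback (B := chartBil (metFam g) x)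
      (B' := chartBil (metFam g) p) hy0 hFd (.of_forall fun _ => mem_range_self _) (by
        have hev := hsm.continuousWithinAt.eventually
          ((isOpen_extChartAt_source p).mem_nhds hsrc)
        filter_upwards [hev, extChartAt_target_mem_nhdsWithin_of_mem hyt] with z hz1 hz2 hz0
        exact (mem_boundary_iff hz1).1 ((symm_mem_boundary_iff hz2).2 hz0))
      (isMetric_chartBil (isMetric_metFam g) hyt)
      (isMetric_chartBil (isMetric_metFam g) (by rw [hFy]; exact mem_extChartAt_target p))
      (fun v w => famPull_eq_chartBil hsrc (hsm.mdifferentiableWithinAt (by simp)) hyr v w)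
    rw [hFy] at hcL
    refine ⟨f p * c, mul_nonneg (hf p) hc.le,
      fun h => mul_pos (lt_of_le_of_ne (hf p) (Ne.symm h)) hc, ?_⟩
    set X := gradZero (chartBil (metFam g) x) y with hX
    have hγ : HasDerivWithinAt (fun s : ℝ => y + (s * f p) • X) (f p • X) (Ici 0) 0 := by
      have h1 : HasDerivAt (fun s : ℝ => s * f p) (f p) 0 := by
        simpa using (hasDerivAt_id (0 : ℝ)).mul_const (f p)
      exact ((h1.smul_const X).const_add y).hasDerivWithinAt
    have hmaps : MapsTo (fun s : ℝ => y + (s * f p) • X) (Ici 0) (range (𝓡∂ n)) := by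
      intro s hs
      rw [mem_range_iff, PiLp.add_apply, PiLp.smul_apply, smul_eq_mul, hy0, zero_add]
      exact mul_nonneg (mul_nonneg hs (hf p))
        (gradZero_zero_pos (isMetric_chartBil (isMetric_metFam g) hyt)).le
    have hcomp := HasFDerivWithinAt.comp_hasDerivWithinAt_of_eq (0 : ℝ) hFd hγ hmaps (by simp)
    rw [map_smul, hcL, smul_smul] at hcomp
    refine hcomp.congr_of_eventuallyEq_of_mem (.of_forall fun s => ?_) self_mem_Ici
    change extChartAt (𝓡∂ n) p (pushMap g x f (p, s)) = _
    unfold pushMap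
    rw [if_pos (show (p, s).1 ∈ _ from hps)]
    rfl
  · have hf0 : f p = 0 := by
      by_contra h
      exact hps (hfs h)
    refine ⟨0, le_rfl, fun h => absurd hf0 h, ?_⟩
    rw [zero_smul]
    refine (hasDerivWithinAt_const (0 : ℝ) (Ici 0) (extChartAt (𝓡∂ n) p p)).congr_of_mem
      (fun s _ => ?_) self_mem_Ici
    rw [pushMap_of_eq_zero g (by rw [hf0, mul_zero])]

lemma IsPush.contMDiffWithinAt {Ψ : M × ℝ → M} {s₀ : ℝ} {P : Set M} (h : IsPush g Ψ s₀ P) (p : M)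
    {s : ℝ} (hs : s ∈ Ico 0 s₀) :
    ContMDiffWithinAt ((𝓡∂ n).prod 𝓘(ℝ, ℝ)) (𝓡∂ n) ∞ Ψ (univ ×ˢ Ico 0 s₀) (p, s) :=
  h.smooth _ ⟨mem_univ _, hs⟩

lemma IsPush.continuousWithinAt {Ψ : M × ℝ → M} {s₀ : ℝ} {P : Set M} (h : IsPush g Ψ s₀ P) (p : M) :
    ContinuousWithinAt (fun s => Ψ (p, s)) (Ico 0 s₀) 0 := by
  have h1 := (h.contMDiffWithinAt p ⟨le_rfl, h.pos⟩).continuousWithinAt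
  exact h1.comp (t := univ ×ˢ Ico 0 s₀) (f := fun s : ℝ => (p, s)) (by fun_prop)
    (fun s hs => ⟨mem_univ _, hs⟩)

/-- The derivative of a push in a chart, at time `0`: the identity in the directions of `M`. -/
lemma IsPush.exists_hasFDerivWithinAt {Ψ : M × ℝ → M} {s₀ : ℝ} {P : Set M} (h : IsPush g Ψ s₀ P)
    {p : M} {V : EuclideanSpace ℝ (Fin n)}
    (hV : HasDerivWithinAt (fun s : ℝ => extChartAt (𝓡∂ n) p (Ψ (p, s))) V (Ici 0) 0) :
    ∃ D : EuclideanSpace ℝ (Fin n) × ℝ →L[ℝ] EuclideanSpace ℝ (Fin n),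
      (∀ u t, D (u, t) = u + t • V) ∧
      HasFDerivWithinAt (fun y : EuclideanSpace ℝ (Fin n) × ℝ =>
        extChartAt (𝓡∂ n) p (Ψ ((extChartAt (𝓡∂ n) p).symm y.1, y.2))) D
        (range (𝓡∂ n) ×ˢ Ico 0 s₀) (extChartAt (𝓡∂ n) p p, 0) := by
  set y := extChartAt (𝓡∂ n) p p with hy
  have hyt : y ∈ (extChartAt (𝓡∂ n) p).target := mem_extChartAt_target p
  have hyr := extChartAt_target_subset p hyt
  set k : EuclideanSpace ℝ (Fin n) × ℝ → EuclideanSpace ℝ (Fin n) := fun y =>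
    extChartAt (𝓡∂ n) p (Ψ ((extChartAt (𝓡∂ n) p).symm y.1, y.2)) with hk
  have hyp : (extChartAt (𝓡∂ n) p).symm y = p := extChartAt_to_inv p
  have h1 : ContMDiffWithinAt 𝓘(ℝ, EuclideanSpace ℝ (Fin n) × ℝ) (𝓡∂ n) ∞
      (fun y : EuclideanSpace ℝ (Fin n) × ℝ => (extChartAt (𝓡∂ n) p).symm y.1)
      (range (𝓡∂ n) ×ˢ Ico 0 s₀) (y, 0) :=
    (contMDiffWithinAt_extChartAt_symm hyt).comp (y, (0 : ℝ))
      contDiff_fst.contDiffWithinAt.contMDiffWithinAt (fun q hq => hq.1)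
  have h2 : ContMDiffWithinAt 𝓘(ℝ, EuclideanSpace ℝ (Fin n) × ℝ) 𝓘(ℝ, ℝ) ∞
      (fun y : EuclideanSpace ℝ (Fin n) × ℝ => y.2) (range (𝓡∂ n) ×ˢ Ico 0 s₀) (y, 0) :=
    contDiff_snd.contDiffWithinAt.contMDiffWithinAt
  have h3 : ContMDiffWithinAt 𝓘(ℝ, EuclideanSpace ℝ (Fin n) × ℝ) (𝓡∂ n) ∞
      (fun y : EuclideanSpace ℝ (Fin n) × ℝ => Ψ ((extChartAt (𝓡∂ n) p).symm y.1, y.2))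
      (range (𝓡∂ n) ×ˢ Ico 0 s₀) (y, 0) :=
    ContMDiffWithinAt.comp (t := univ ×ˢ Ico 0 s₀) (y, (0 : ℝ))
      (h.contMDiffWithinAt ((extChartAt (𝓡∂ n) p).symm y) (s := 0) ⟨le_rfl, h.pos⟩)
      (h1.prodMk h2) (fun q hq => ⟨mem_univ _, hq.2⟩)
  have hval : Ψ ((extChartAt (𝓡∂ n) p).symm y, 0) = p := by rw [hyp, h.zero]
  have h4 : ContMDiffAt (𝓡∂ n) 𝓘(ℝ, EuclideanSpace ℝ (Fin n)) ∞ (extChartAt (𝓡∂ n) p)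
      (Ψ ((extChartAt (𝓡∂ n) p).symm y, 0)) := by
    rw [hval]
    exact contMDiffAt_extChartAt
  have h5 : ContDiffWithinAt ℝ ∞ k (range (𝓡∂ n) ×ˢ Ico 0 s₀) (y, 0) :=
    (h4.comp_contMDiffWithinAt (y, (0 : ℝ)) h3).contDiffWithinAt
  have hD := (h5.differentiableWithinAt (by simp)).hasFDerivWithinAt
  set D := fderivWithin ℝ k (range (𝓡∂ n) ×ˢ Ico 0 s₀) (y, 0)
  have hD1 : ∀ u, D (u, 0) = u := by
    have ha : HasFDerivWithinAt (fun w : EuclideanSpace ℝ (Fin n) => k (w, 0))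
        (D.comp ((ContinuousLinearMap.id ℝ _).prod 0)) (range (𝓡∂ n)) y :=
      HasFDerivWithinAt.comp (f := fun w : EuclideanSpace ℝ (Fin n) => (w, (0 : ℝ))) y hD
        ((hasFDerivWithinAt_id y _).prodMk (hasFDerivWithinAt_const (0 : ℝ) y _))
        (fun w hw => ⟨hw, le_rfl, h.pos⟩)
    have hb : HasFDerivWithinAt (fun w : EuclideanSpace ℝ (Fin n) => k (w, 0))
        (ContinuousLinearMap.id ℝ _) (range (𝓡∂ n)) y := by
      have hev : (fun w : EuclideanSpace ℝ (Fin n) => k (w, 0)) =ᶠ[𝓝[range (𝓡∂ n)] y] id := by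
        filter_upwards [extChartAt_target_mem_nhdsWithin_of_mem hyt] with w hw
        simp only [hk, h.zero, id]
        exact (extChartAt (𝓡∂ n) p).right_inv hw
      exact HasFDerivWithinAt.congr_of_eventuallyEq (hasFDerivWithinAt_id y _) hev
        (hev.self_of_nhdsWithin hyr)
    intro u
    simpa using DFunLike.congr_fun (((𝓡∂ n).uniqueDiffOn y hyr).eq ha hb) u
  have hD2 : D (0, 1) = V := by
    have ha : HasDerivWithinAt (fun s : ℝ => k (y, s)) (D (0, 1)) (Ico 0 s₀) 0 :=
      HasFDerivWithinAt.comp_hasDerivWithinAt_of_eq (f := fun s : ℝ => (y, s)) (0 : ℝ) hD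
        ((hasDerivWithinAt_const (0 : ℝ) (Ico 0 s₀) y).prodMk (hasDerivWithinAt_id (0 : ℝ) _))
        (fun s hs => ⟨hyr, hs⟩) rfl
    simp only [hk, hyp] at ha
    exact (uniqueDiffOn_Ico 0 s₀ 0 ⟨le_rfl, h.pos⟩).eq_deriv _ ha (hV.mono Ico_subset_Ici_self)
  refine ⟨D, fun u t => ?_, hD⟩
  rw [show ((u, t) : EuclideanSpace ℝ (Fin n) × ℝ) = (u, 0) + t • (0, 1) by simp, map_add, map_smul,
    hD1, hD2]

/-- Pushes can be composed, and their velocities add up. -/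
lemma IsPush.comp {Ψ₁ Ψ₂ : M × ℝ → M} {s₁ s₂ : ℝ} {P₁ P₂ : Set M} (h₁ : IsPush g Ψ₁ s₁ P₁)
    (h₂ : IsPush g Ψ₂ s₂ P₂) :
    IsPush g (fun q => Ψ₂ (Ψ₁ q, q.2)) (min s₁ s₂) (P₁ ∪ P₂) where
  pos := lt_min h₁.pos h₂.pos
  smooth := h₂.smooth.comp ((h₁.smooth.mono (prod_mono_right
    (Ico_subset_Ico_right (min_le_left _ _)))).prodMk contMDiffOn_snd)
    (fun q hq => ⟨mem_univ _, hq.2.1, hq.2.2.trans_le (min_le_right _ _)⟩)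
  zero p := by rw [h₁.zero, h₂.zero]
  velocity p hp := by
    obtain ⟨c₁, hc₁, hp₁, hV₁⟩ := h₁.velocity p hp
    obtain ⟨c₂, hc₂, hp₂, hV₂⟩ := h₂.velocity p hp
    refine ⟨c₁ + c₂, add_nonneg hc₁ hc₂, fun h => ?_, ?_⟩
    · rcases h with h | h
      · exact add_pos_of_pos_of_nonneg (hp₁ h) hc₂
      · exact add_pos_of_nonneg_of_pos hc₁ (hp₂ h)
    · have hs : 0 < min s₁ s₂ := lt_min h₁.pos h₂.pos
      obtain ⟨D, hD, hDk⟩ := h₂.exists_hasFDerivWithinAt hV₂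
      have hmono : Ico 0 (min s₁ s₂) ⊆ Ico 0 s₁ := Ico_subset_Ico_right (min_le_left _ _)
      have hc := HasFDerivWithinAt.comp_hasDerivWithinAt_of_eq (0 : ℝ)
        (f := fun s : ℝ => (extChartAt (𝓡∂ n) p (Ψ₁ (p, s)), s)) hDk
        ((hV₁.mono (Ico_subset_Ici_self : Ico 0 (min s₁ s₂) ⊆ Ici 0)).prodMk
          (hasDerivWithinAt_id (0 : ℝ) _))
        (fun s (hs : s ∈ Ico 0 (min s₁ s₂)) =>
          ⟨mem_range_self _, hs.1, hs.2.trans_le (min_le_right _ _)⟩)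
        (by rw [h₁.zero])
      rw [hD, one_smul, ← add_smul] at hc
      refine HasDerivWithinAt.mono_of_mem_nhdsWithin ?_ (Ico_mem_nhdsGE hs)
      refine hc.congr_of_eventuallyEq_of_mem ?_ ⟨le_rfl, hs⟩
      have hev := ((h₁.continuousWithinAt p).mono hmono).eventually
        ((isOpen_extChartAt_source (I := 𝓡∂ n) p).mem_nhds
          (by simp only [h₁.zero]; exact mem_extChartAt_source p))
      filter_upwards [hev] with s hs
      simp only [Function.comp_apply, (extChartAt (𝓡∂ n) p).left_inv hs]

/-- Around a compact part of the boundary there is a push. -/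
lemma exists_isPush [T2Space M] (g : RMetric n ∞ M) {C : Set M} (hC : IsCompact C) :
    ∃ (Ψ : M × ℝ → M) (s₀ : ℝ), IsPush g Ψ s₀ C := by
  have f : ∀ x : M, SmoothBumpFunction (𝓡∂ n) x := fun x => Classical.choice inferInstance
  obtain ⟨t, -, ht⟩ := hC.elim_nhds_subcover (fun x => Function.support (f x))
    (fun x _ => (f x).support_mem_nhds)
  suffices h : ∀ t : Finset M, ∃ (Ψ : M × ℝ → M) (s₀ : ℝ),
      IsPush g Ψ s₀ (⋃ x ∈ t, Function.support (f x)) by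
    obtain ⟨Ψ, s₀, hΨ⟩ := h t
    refine ⟨Ψ, s₀, hΨ.pos, hΨ.smooth, hΨ.zero, fun p hp => ?_⟩
    obtain ⟨c, h1, h2, h3⟩ := hΨ.velocity p hp
    exact ⟨c, h1, fun h => h2 (ht h), h3⟩
  -- compose the pushes supported in finitely many charts
  classical
  intro t
  induction t using Finset.induction_on with
  | empty =>
    refine ⟨Prod.fst, 1, one_pos, contMDiffOn_fst (I := 𝓡∂ n) (J := 𝓘(ℝ, ℝ)), fun _ => rfl,
      fun p _ => ⟨0, le_rfl, fun h => by simp at h, ?_⟩⟩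
    rw [zero_smul]
    exact hasDerivWithinAt_const (0 : ℝ) (Ici 0) (extChartAt (𝓡∂ n) p p)
  | insert x t _ ih =>
    obtain ⟨Ψ, s₀, hΨ⟩ := ih
    obtain ⟨s₁, hs₁, hsm⟩ := exists_contMDiffOn_pushMap g (f x)
    have h1 : IsPush g (pushMap g x (f x)) s₁ (Function.support (f x)) :=
      ⟨hs₁, hsm, fun p => pushMap_of_eq_zero g (zero_mul _), fun p hp =>
        hasDerivWithinAt_pushMap (fun q => (f x).nonneg)
          ((subset_closure).trans (f x).tsupport_subset_extChartAt_source) hp⟩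
    rw [Finset.set_biUnion_insert]
    exact ⟨_, _, h1.comp hΨ⟩

end Push

/-! ### Local parametrizations of a collar -/

section ParMap

lemma bproj_mem_ball {n : ℕ} [NeZero n] {z p : EuclideanSpace ℝ (Fin n)} (hp : p 0 = 0) {R : ℝ}
    (hz : z ∈ Metric.ball p R) : bproj z ∈ Metric.ball p R := by
  rw [Metric.mem_ball, EuclideanSpace.dist_eq] at hz ⊢
  refine lt_of_le_of_lt (Real.sqrt_le_sqrt (Finset.sum_le_sum fun i _ => ?_)) hz
  by_cases hi : i = 0
  · subst hi
    rw [bproj_zero, hp, dist_self]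
    simpa using sq_nonneg (z 0)
  · rw [bproj_of_ne _ hi]

variable {n : ℕ} [NeZero n] {M : Type u} [TopologicalSpace M]
  [ChartedSpace (EuclideanHalfSpace n) M]

/-- The parametrization of a neighbourhood of the boundary by a chart at `x` of the boundary and
the time `z 0` of the push `Ψ`. -/
def parMap (Ψ : M × ℝ → M) (x : M) (z : EuclideanSpace ℝ (Fin n)) : M :=
  Ψ ((extChartAt (𝓡∂ n) x).symm (bproj z), z 0)

variable {Ψ : M × ℝ → M} {x : M}

lemma parMap_add {y : EuclideanSpace ℝ (Fin n)} (hy : y 0 = 0) (s : ℝ) :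
    parMap Ψ x (y + s • bv 0) = Ψ ((extChartAt (𝓡∂ n) x).symm y, s) := by
  unfold parMap
  rw [bproj_add_smul, bproj_eq_self hy]
  simp [hy, bv]

variable [IsManifold (𝓡∂ n) ∞ M] {g : RMetric n ∞ M} {s₀ : ℝ} {C : Set M}
  {z : EuclideanSpace ℝ (Fin n)}

lemma IsPush.contMDiffWithinAt_parMap (h : IsPush g Ψ s₀ C)
    (hz : bproj z ∈ (extChartAt (𝓡∂ n) x).target) (h0 : 0 ≤ z 0) (h1 : z 0 < s₀) :
    ContMDiffWithinAt 𝓘(ℝ, EuclideanSpace ℝ (Fin n)) (𝓡∂ n) ∞ (parMap Ψ x) (range (𝓡∂ n)) z := by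
  have ha : ContMDiffWithinAt 𝓘(ℝ, EuclideanSpace ℝ (Fin n)) (𝓡∂ n) ∞
      (fun z : EuclideanSpace ℝ (Fin n) => (extChartAt (𝓡∂ n) x).symm (bproj z))
      (range (𝓡∂ n)) z :=
    (contMDiffWithinAt_extChartAt_symm hz).comp z
      contDiff_bproj.contDiffWithinAt.contMDiffWithinAt (fun q _ => bproj_mem q)
  have hb : ContMDiffWithinAt 𝓘(ℝ, EuclideanSpace ℝ (Fin n)) 𝓘(ℝ, ℝ) ∞
      (fun z : EuclideanSpace ℝ (Fin n) => z 0) (range (𝓡∂ n)) z :=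
    (EuclideanSpace.proj (0 : Fin n) :
      EuclideanSpace ℝ (Fin n) →L[ℝ] ℝ).contDiff.contDiffWithinAt.contMDiffWithinAt
  refine (ContMDiffWithinAt.comp' (t := univ ×ˢ Ico 0 s₀) z
    (h.contMDiffWithinAt ((extChartAt (𝓡∂ n) x).symm (bproj z)) (s := z 0) ⟨h0, h1⟩)
    (ha.prodMk hb)).mono_of_mem_nhdsWithin (Filter.inter_mem self_mem_nhdsWithin ?_)
  have hev : ∀ᶠ w : EuclideanSpace ℝ (Fin n) in 𝓝[range (𝓡∂ n)] z, w 0 < s₀ :=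
    nhdsWithin_le_nhds ((EuclideanSpace.proj (0 : Fin n) :
      EuclideanSpace ℝ (Fin n) →L[ℝ] ℝ).continuous.continuousAt.eventually (gt_mem_nhds h1))
  filter_upwards [hev, self_mem_nhdsWithin] with w hw1 hw2
  exact ⟨mem_univ _, mem_range_iff.1 hw2, hw1⟩

lemma IsPush.eventually_contMDiffWithinAt_parMap (h : IsPush g Ψ s₀ C)
    (hz : bproj z ∈ (extChartAt (𝓡∂ n) x).target) (h1 : z 0 < s₀) :
    ∀ᶠ w in 𝓝[range (𝓡∂ n)] z,
      ContMDiffWithinAt 𝓘(ℝ, EuclideanSpace ℝ (Fin n)) (𝓡∂ n) ∞ (parMap Ψ x) (range (𝓡∂ n)) w := by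
  have hev : ∀ᶠ w : EuclideanSpace ℝ (Fin n) in 𝓝[range (𝓡∂ n)] z, w 0 < s₀ :=
    nhdsWithin_le_nhds ((EuclideanSpace.proj (0 : Fin n) :
      EuclideanSpace ℝ (Fin n) →L[ℝ] ℝ).continuous.continuousAt.eventually (gt_mem_nhds h1))
  have ht : Filter.Tendsto bproj (𝓝[range (𝓡∂ n)] z) (𝓝[range (𝓡∂ n)] (bproj z)) :=
    tendsto_nhdsWithin_iff.2 ⟨(contDiff_bproj (m := 0)).continuous.continuousAt.mono_left
      nhdsWithin_le_nhds, .of_forall bproj_mem⟩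
  filter_upwards [hev, ht.eventually (extChartAt_target_mem_nhdsWithin_of_mem hz),
    self_mem_nhdsWithin] with w h1 h2 h3
  exact h.contMDiffWithinAt_parMap h2 (mem_range_iff.1 h3) h1

lemma IsPush.parMap_of_zero (h : IsPush g Ψ s₀ C) (hz : z 0 = 0) :
    parMap Ψ x z = (extChartAt (𝓡∂ n) x).symm z := by
  unfold parMap
  rw [bproj_eq_self hz, hz, h.zero]

/-- The normal derivative of `parMap` at the boundary is the velocity of the push. -/
lemma IsPush.fderivWithin_parMap (h : IsPush g Ψ s₀ C)
    (hz : z ∈ (extChartAt (𝓡∂ n) x).target) (h0 : z 0 = 0) {p : M}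
    (hp : (extChartAt (𝓡∂ n) x).symm z = p) {V : EuclideanSpace ℝ (Fin n)}
    (hV : HasDerivWithinAt (fun s : ℝ => extChartAt (𝓡∂ n) p (Ψ (p, s))) V (Ici 0) 0) :
    fderivWithin ℝ (extChartAt (𝓡∂ n) p ∘ parMap Ψ x) (range (𝓡∂ n)) z (bv 0) = V := by
  have hbz : bproj z = z := bproj_eq_self h0
  have hpz : parMap Ψ x z = p := by rw [h.parMap_of_zero h0, hp]
  have h1 := contDiffWithinAt_extChartAt_comp (x := p) le_rfl
    (by rw [hpz]; exact mem_extChartAt_source p)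
    (h.contMDiffWithinAt_parMap (x := x) (z := z) (by rwa [hbz]) h0.ge (h0.trans_lt h.pos))
  have h2 := (h1.differentiableWithinAt (by simp)).hasFDerivWithinAt
  have hl : HasDerivWithinAt (fun s : ℝ => z + s • bv (0 : Fin n)) (bv 0) (Ici 0) 0 := by
    have := ((hasDerivAt_id (0 : ℝ)).smul_const (bv (0 : Fin n))).const_add z
    rw [one_smul] at this
    exact this.hasDerivWithinAt
  have h3 := HasFDerivWithinAt.comp_hasDerivWithinAt_of_eq (0 : ℝ) h2 hl (fun s hs => by
    rw [mem_range_iff]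
    simpa [h0, bv] using hs) (by simp)
  refine (uniqueDiffOn_Ici (0 : ℝ) 0 self_mem_Ici).eq_deriv _ h3 (hV.congr (fun s _ => ?_) ?_)
  · rw [Function.comp_apply, Function.comp_apply, parMap_add h0, hp]
  · rw [Function.comp_apply, Function.comp_apply, parMap_add h0, hp]

/-- The parametrization `parMap` is well-behaved near the centre of the chart. -/
lemma IsPush.exists_ball (h : IsPush g Ψ s₀ C) (hC : IsBoundaryComponent n C) (hx : x ∈ C) :
    ∃ R > 0, ∀ z ∈ Metric.ball (extChartAt (𝓡∂ n) x x) R, z 0 < s₀ ∧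
      (0 ≤ z 0 → z ∈ (extChartAt (𝓡∂ n) x).target ∧ parMap Ψ x z ∈ (extChartAt (𝓡∂ n) x).source) ∧
      (z 0 = 0 → (extChartAt (𝓡∂ n) x).symm z ∈ C) := by
  have hxb : x ∈ (𝓡∂ n).boundary M := by
    obtain ⟨p, hp, rfl⟩ := hC
    exact connectedComponentIn_subset _ _ hx
  have h0 := (mem_boundary_iff (mem_extChartAt_source (I := 𝓡∂ n) x)).1 hxb
  have hxt := mem_extChartAt_target (I := 𝓡∂ n) x
  have hc := (h.contMDiffWithinAt_parMap (x := x) (by rwa [bproj_eq_self h0]) h0.ge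
    (h0.trans_lt h.pos)).continuousWithinAt.eventually
    ((isOpen_extChartAt_source (I := 𝓡∂ n) x).mem_nhds (by
      rw [h.parMap_of_zero h0, extChartAt_to_inv]
      exact mem_extChartAt_source x))
  have hs : ∀ᶠ w : EuclideanSpace ℝ (Fin n) in 𝓝 (extChartAt (𝓡∂ n) x x), w 0 < s₀ :=
    (EuclideanSpace.proj (0 : Fin n) : EuclideanSpace ℝ (Fin n) →L[ℝ]
      ℝ).continuous.continuousAt.eventually (gt_mem_nhds (h0.trans_lt h.pos))
  have hb := hC.eventually_mem hx
  have hsy : Filter.Tendsto (extChartAt (𝓡∂ n) x).symm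
      (𝓝[range (𝓡∂ n)] (extChartAt (𝓡∂ n) x x)) (𝓝 x) := by
    have := (contMDiffWithinAt_extChartAt_symm hxt).continuousWithinAt
    unfold ContinuousWithinAt at this
    rwa [extChartAt_to_inv] at this
  have htg : ∀ᶠ z in 𝓝[range (𝓡∂ n)] (extChartAt (𝓡∂ n) x x), z ∈ (extChartAt (𝓡∂ n) x).target :=
    extChartAt_target_mem_nhdsWithin_of_mem hxt
  have hall : ∀ᶠ z in 𝓝 (extChartAt (𝓡∂ n) x x), z 0 < s₀ ∧
      (0 ≤ z 0 → z ∈ (extChartAt (𝓡∂ n) x).target ∧ parMap Ψ x z ∈ (extChartAt (𝓡∂ n) x).source) ∧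
      (z 0 = 0 → (extChartAt (𝓡∂ n) x).symm z ∈ C) := by
    filter_upwards [hs, eventually_nhdsWithin_iff.1 hc, eventually_nhdsWithin_iff.1
      htg,
      eventually_nhdsWithin_iff.1 (hsy.eventually hb)] with z h1 h2 h3 h4
    exact ⟨h1, fun hz => ⟨h3 (mem_range_iff.2 hz), h2 (mem_range_iff.2 hz)⟩, fun hz =>
      h4 (mem_range_iff.2 hz.ge) ((symm_mem_boundary_iff (h3 (mem_range_iff.2 hz.ge))).2 hz)⟩
  obtain ⟨R, hR, hsub⟩ := Metric.mem_nhds_iff.1 hall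
  exact ⟨R, hR, fun z hz => hsub hz⟩

/-- Near a point of `C`, a push parametrizes a neighbourhood of `C` diffeomorphically. -/
lemma IsPush.exists_local_collar (h : IsPush g Ψ s₀ C) (hC : IsBoundaryComponent n C)
    (hx : x ∈ C) : ∃ A : Set (M × ℝ), IsOpen A ∧ (x, 0) ∈ A ∧ InjOn Ψ (A ∩ C ×ˢ Ici 0) ∧
      ∀ p ∈ C, ∀ s : ℝ, 0 ≤ s → (p, s) ∈ A → (Ψ (p, s) ∈ (𝓡∂ n).boundary M ↔ s = 0) ∧
        ∃ (r : M → M) (ρ : M → ℝ), ContMDiffAt (𝓡∂ n) (𝓡∂ n) ∞ r (Ψ (p, s)) ∧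
          ContMDiffAt (𝓡∂ n) 𝓘(ℝ, ℝ) ∞ ρ (Ψ (p, s)) ∧ r (Ψ (p, s)) = p ∧ ρ (Ψ (p, s)) = s ∧
          ∀ᶠ q in 𝓝 (Ψ (p, s)), r q ∈ C ∧ 0 ≤ ρ q ∧ Ψ (r q, ρ q) = q := by
  obtain ⟨R, hR, hW⟩ := h.exists_ball hC hx
  have hCb : C ⊆ (𝓡∂ n).boundary M := by
    obtain ⟨p, hp, rfl⟩ := hC
    exact connectedComponentIn_subset _ _
  set W := Metric.ball (extChartAt (𝓡∂ n) x x) R with hWdef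
  have hxs := mem_extChartAt_source (I := 𝓡∂ n) x
  have hxt := mem_extChartAt_target (I := 𝓡∂ n) x
  have h0 := (mem_boundary_iff hxs).1 (hCb hx)
  have hWb : ∀ z ∈ W, bproj z ∈ W := fun z hz => bproj_mem_ball h0 hz
  have hWbt : ∀ z ∈ W, bproj z ∈ (extChartAt (𝓡∂ n) x).target := fun z hz =>
    ((hW _ (hWb z hz)).2.1 (bproj_zero z).ge).1
  have hK : ∀ z ∈ W, 0 ≤ z 0 → ContMDiffWithinAt 𝓘(ℝ, EuclideanSpace ℝ (Fin n)) (𝓡∂ n) ∞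
      (parMap Ψ x) (range (𝓡∂ n)) z := fun z hz hz0 =>
    h.contMDiffWithinAt_parMap (hWbt z hz) hz0 (hW z hz).1
  obtain ⟨c, hc0, hc, hV⟩ := h.velocity x (hCb hx)
  obtain ⟨e, hxe, heW, hek, he0, he1, hes⟩ := exists_halfSpace_inverse
    (k := extChartAt (𝓡∂ n) x ∘ parMap Ψ x) h0 Metric.isOpen_ball hWb (Metric.mem_ball_self hR)
    (fun z hz hz0 => contDiffWithinAt_extChartAt_comp le_rfl ((hW z hz).2.1 hz0).2 (hK z hz hz0))
    (fun z hz hz0 => by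
      rw [Function.comp_apply, h.parMap_of_zero hz0,
        (extChartAt (𝓡∂ n) x).right_inv ((hW z hz).2.1 hz0.ge).1])
    (fun z hz hz0 => extChartAt_zero_nonneg _ _)
    (by
      rw [h.fderivWithin_parMap hxt h0 (extChartAt_to_inv x) hV, PiLp.smul_apply, smul_eq_mul]
      exact mul_pos (hc hx) (gradZero_zero_pos (isMetric_chartBil (isMetric_metFam g) hxt)))
  set Z : M × ℝ → EuclideanSpace ℝ (Fin n) := fun q => extChartAt (𝓡∂ n) x q.1 + q.2 • bv 0 with hZ
  have hZ0 : ∀ p ∈ C, p ∈ (extChartAt (𝓡∂ n) x).source → ∀ s, Z (p, s) 0 = s := by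
    intro p hp hps s
    change extChartAt (𝓡∂ n) x p 0 + (s • bv (0 : Fin n)) 0 = s
    rw [(mem_boundary_iff hps).1 (hCb hp)]
    simp [bv]
  have hZp : ∀ p ∈ C, p ∈ (extChartAt (𝓡∂ n) x).source → ∀ s,
      bproj (Z (p, s)) = extChartAt (𝓡∂ n) x p := by
    intro p hp hps s
    rw [hZ, bproj_add_smul, bproj_eq_self ((mem_boundary_iff hps).1 (hCb hp))]
  have hKZ : ∀ p ∈ C, p ∈ (extChartAt (𝓡∂ n) x).source → ∀ s, parMap Ψ x (Z (p, s)) = Ψ (p, s) := by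
    intro p hp hps s
    unfold parMap
    rw [hZp p hp hps, hZ0 p hp hps, (extChartAt (𝓡∂ n) x).left_inv hps]
  -- the values of the parametrization in the chart at `x`
  have heZ : ∀ p ∈ C, p ∈ (extChartAt (𝓡∂ n) x).source → ∀ s, 0 ≤ s → Z (p, s) ∈ e.source →
      Ψ (p, s) ∈ (extChartAt (𝓡∂ n) x).source ∧ extChartAt (𝓡∂ n) x (Ψ (p, s)) = e (Z (p, s)) := by
    intro p hp hps s hs hZe
    have hZn : 0 ≤ Z (p, s) 0 := by rwa [hZ0 p hp hps]
    rw [hek _ hZe hZn, Function.comp_apply, hKZ p hp hps, ← hKZ p hp hps]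
    exact ⟨((hW _ (heW hZe)).2.1 hZn).2, rfl⟩
  refine ⟨{q | q.1 ∈ (extChartAt (𝓡∂ n) x).source ∧ Z q ∈ e.source}, ?_, ⟨hxs, ?_⟩, ?_, ?_⟩
  · have hcont : ContinuousOn Z (Prod.fst ⁻¹' (extChartAt (𝓡∂ n) x).source) :=
      ((continuousOn_extChartAt (I := 𝓡∂ n) x).comp continuousOn_fst (fun q hq => hq)).add
        (continuousOn_snd.smul continuousOn_const)
    exact hcont.isOpen_inter_preimage ((isOpen_extChartAt_source x).preimage continuous_fst)
      e.open_source
  · simpa [hZ] using hxe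
  · rintro ⟨p, s⟩ ⟨⟨hps, hpe⟩, hp, hs⟩ ⟨p', s'⟩ ⟨⟨hps', hpe'⟩, hp', hs'⟩ heq
    have h1 : e (Z (p, s)) = e (Z (p', s')) := by
      rw [← (heZ p hp hps s hs hpe).2, ← (heZ p' hp' hps' s' hs' hpe').2, heq]
    have h2 := e.injOn hpe hpe' h1
    have h3 : p = p' := (extChartAt (𝓡∂ n) x).injOn hps hps' (by
      rw [← hZp p hp hps s, ← hZp p' hp' hps' s', h2])
    have h4 : s = s' := by rw [← hZ0 p hp hps s, ← hZ0 p' hp' hps' s', h2]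
    rw [h3, h4]
  · rintro p hp s hs ⟨hps, hpe⟩
    simp only at hps
    obtain ⟨hΨs, hΨe⟩ := heZ p hp hps s hs hpe
    have hwt : extChartAt (𝓡∂ n) x (Ψ (p, s)) ∈ e.target := by
      rw [hΨe]
      exact e.map_source hpe
    refine ⟨?_, ?_⟩
    · rw [mem_boundary_iff hΨs, hΨe, he1 _ hpe, hZ0 p hp hps]
    have hsym : e.symm (extChartAt (𝓡∂ n) x (Ψ (p, s))) = Z (p, s) := by
      rw [hΨe, e.left_inv hpe]
    have hsm : ContMDiffAt (𝓡∂ n) 𝓘(ℝ, EuclideanSpace ℝ (Fin n)) ∞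
        (e.symm ∘ extChartAt (𝓡∂ n) x) (Ψ (p, s)) :=
      (hes _ hwt (extChartAt_zero_nonneg _ _)).contMDiffWithinAt.comp (t := range (𝓡∂ n)) _
        (contMDiffAt_extChartAt' (by rwa [extChartAt_source] at hΨs)).contMDiffWithinAt
        (fun q _ => mem_range_self _)
    refine ⟨fun q => (extChartAt (𝓡∂ n) x).symm (bproj (e.symm (extChartAt (𝓡∂ n) x q))),
      fun q => e.symm (extChartAt (𝓡∂ n) x q) 0, ?_, ?_, ?_, ?_, ?_⟩
    · have hb : ContMDiffAt (𝓡∂ n) 𝓘(ℝ, EuclideanSpace ℝ (Fin n)) ∞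
          (fun q => bproj (e.symm (extChartAt (𝓡∂ n) x q))) (Ψ (p, s)) :=
        contDiff_bproj.contDiffAt.contMDiffAt.comp _ hsm
      refine ContMDiffWithinAt.comp (t := range (𝓡∂ n)) _
        (contMDiffWithinAt_extChartAt_symm (x := x) ?_) hb.contMDiffWithinAt
        (fun q _ => bproj_mem _)
      rw [hsym]
      exact hWbt _ (heW hpe)
    · exact contDiff_zeroCoord.contDiffAt.contMDiffAt.comp _ hsm
    · simp only [hsym]
      rw [hZp p hp hps, (extChartAt (𝓡∂ n) x).left_inv hps]
    · simp only [hsym]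
      exact hZ0 p hp hps s
    · have hca := continuousAt_extChartAt' (I := 𝓡∂ n) hΨs
      filter_upwards [hca.eventually (e.open_target.mem_nhds hwt),
        (isOpen_extChartAt_source x).mem_nhds hΨs] with q hq1 hq2
      set z := e.symm (extChartAt (𝓡∂ n) x q) with hz
      have hze : z ∈ e.source := e.map_target hq1
      have hez : e z = extChartAt (𝓡∂ n) x q := e.right_inv hq1
      have hz0 : 0 ≤ z 0 := by
        rw [← he0 z hze, hez]
        exact extChartAt_zero_nonneg _ _
      refine ⟨(hW _ (hWb z (heW hze))).2.2 (bproj_zero z), hz0, ?_⟩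
      refine (extChartAt (𝓡∂ n) x).injOn ((hW z (heW hze)).2.1 hz0).2 hq2 ?_
      rw [← hez, hek z hze hz0]
      rfl

end ParMap

/-! ### The collar of a compact boundary component -/

section Collar

variable {n : ℕ} [NeZero n] {M : Type u} [TopologicalSpace M]
  [ChartedSpace (EuclideanHalfSpace n) M] [IsManifold (𝓡∂ n) ∞ M]

variable (n) in
/-- `Ψ` is a diffeomorphism of `C × [0, a)` to the open set `U`, with inverse `(r, ρ)`. -/
structure IsCollar (C : Set M) (Ψ : M × ℝ → M) (r : M → M) (ρ : M → ℝ) (U : Set M) (a : ℝ) :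
    Prop where
  pos : 0 < a
  isOpen : IsOpen U
  smooth : ContMDiffOn ((𝓡∂ n).prod 𝓘(ℝ, ℝ)) (𝓡∂ n) ∞ Ψ (univ ×ˢ Ico 0 a)
  map_mem : ∀ p ∈ C, ∀ s ∈ Ico 0 a, Ψ (p, s) ∈ U
  r_mem : ∀ q ∈ U, r q ∈ C
  ρ_mem : ∀ q ∈ U, ρ q ∈ Ico 0 a
  apply_r_ρ : ∀ q ∈ U, Ψ (r q, ρ q) = q
  r_apply : ∀ p ∈ C, ∀ s ∈ Ico 0 a, r (Ψ (p, s)) = p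
  ρ_apply : ∀ p ∈ C, ∀ s ∈ Ico 0 a, ρ (Ψ (p, s)) = s
  smooth_r : ∀ q ∈ U, ContMDiffAt (𝓡∂ n) (𝓡∂ n) ∞ r q
  smooth_ρ : ∀ q ∈ U, ContMDiffAt (𝓡∂ n) 𝓘(ℝ, ℝ) ∞ ρ q
  boundary_iff : ∀ q ∈ U, (q ∈ (𝓡∂ n).boundary M ↔ ρ q = 0)

variable [T2Space M] {g : RMetric n ∞ M} {Ψ : M × ℝ → M} {s₀ : ℝ} {C : Set M}

/-- A push is injective near a compact part of the boundary, for short times. -/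
lemma IsPush.exists_injOn (h : IsPush g Ψ s₀ C) (hC : IsBoundaryComponent n C)
    (hCc : IsCompact C) : ∃ a > 0, InjOn Ψ (C ×ˢ Ico 0 a) := by
  have : CompactSpace C := isCompact_iff_compactSpace.1 hCc
  set S : Set (C × Ici (0 : ℝ)) := univ ×ˢ {⟨0, self_mem_Ici⟩} with hS
  set f : C × Ici (0 : ℝ) → M := fun q => Ψ (q.1, q.2) with hf
  have hj : Continuous fun q : C × Ici (0 : ℝ) => ((q.1 : M), (q.2 : ℝ)) := by fun_prop
  -- `Ψ` is injective on `C × {0}` and locally injective near it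
  obtain ⟨t, ht, hinj⟩ := Set.InjOn.exists_mem_nhdsSet (f := f) (s := S) (by
      rintro ⟨p, s⟩ ⟨-, hs⟩ ⟨p', s'⟩ ⟨-, hs'⟩ heq
      rw [mem_singleton_iff] at hs hs'
      simp only at hs hs'
      subst hs hs'
      simp only [hf, h.zero] at heq
      rw [Subtype.ext heq]) (isCompact_univ.prod isCompact_singleton) (by
      rintro ⟨p, s⟩ ⟨-, hs⟩
      rw [mem_singleton_iff] at hs
      simp only at hs
      subst hs
      have h1 := (h.contMDiffWithinAt (p : M) (s := 0) ⟨le_rfl, h.pos⟩).continuousWithinAt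
      unfold ContinuousAt
      refine h1.tendsto.comp (tendsto_nhdsWithin_iff.2 ⟨hj.continuousAt, ?_⟩)
      have hs : ∀ᶠ q : C × Ici (0 : ℝ) in 𝓝 (p, ⟨0, self_mem_Ici⟩), (q.2 : ℝ) < s₀ :=
        (by fun_prop : Continuous fun q : C × Ici (0 : ℝ) => (q.2 : ℝ)).continuousAt.eventually
          (gt_mem_nhds h.pos)
      filter_upwards [hs] with q hq
      exact ⟨mem_univ _, q.2.2, hq⟩) (by
      rintro ⟨p, s⟩ ⟨-, hs⟩
      rw [mem_singleton_iff] at hs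
      simp only at hs
      subst hs
      obtain ⟨A, hA, hpA, hAi, -⟩ := h.exists_local_collar hC p.2
      refine ⟨_, hj.continuousAt.preimage_mem_nhds (hA.mem_nhds hpA), fun q hq q' hq' heq => ?_⟩
      have := hAi ⟨hq, q.1.2, q.2.2⟩ ⟨hq', q'.1.2, q'.2.2⟩ heq
      rw [Prod.mk.injEq] at this
      exact Prod.ext (Subtype.ext this.1) (Subtype.ext this.2))
  obtain ⟨O, hO, hSO, hOt⟩ := mem_nhdsSet_iff_exists.1 ht
  obtain ⟨u, v, -, hv, hu, hv0, huv⟩ := generalized_tube_lemma isCompact_univ isCompact_singleton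
    hO hSO
  obtain ⟨a, ha, hav⟩ := Metric.isOpen_iff.1 hv _ (singleton_subset_iff.1 hv0)
  refine ⟨a, ha, ?_⟩
  have hmem : ∀ q : M × ℝ, ∀ hq : q ∈ C ×ˢ Ico 0 a,
      ((⟨q.1, hq.1⟩, ⟨q.2, hq.2.1⟩) : C × Ici (0 : ℝ)) ∈ t := by
    rintro ⟨p, s⟩ ⟨hp, hs⟩
    refine hOt (huv ⟨hu (mem_univ _), hav ?_⟩)
    rw [Metric.mem_ball, Subtype.dist_eq, Real.dist_eq, sub_zero, abs_of_nonneg hs.1]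
    exact hs.2
  intro q hq q' hq' heq
  have := hinj (hmem q hq) (hmem q' hq') heq
  simp only [Prod.mk.injEq, Subtype.mk.injEq] at this
  exact Prod.ext this.1 (congrArg Subtype.val this.2)

/-- A compact boundary component has a collar. -/
theorem IsPush.exists_isCollar (h : IsPush g Ψ s₀ C) (hC : IsBoundaryComponent n C)
    (hCc : IsCompact C) :
    ∃ (r : M → M) (ρ : M → ℝ) (U : Set M), ∃ a ≤ s₀, IsCollar n C Ψ r ρ U a := by
  obtain ⟨a₁, ha₁, hinj⟩ := h.exists_injOn hC hCc
  choose! A hAo hA0 hAi hA using fun x (hx : x ∈ C) => h.exists_local_collar hC hx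
  obtain ⟨u, v, -, hv, hu, hv0, huv⟩ := generalized_tube_lemma hCc
    (isCompact_singleton (x := (0 : ℝ)))
    (isOpen_biUnion fun x (hx : x ∈ C) => hAo x hx) (by
      rintro ⟨x, s⟩ ⟨hx, hs⟩
      rw [mem_singleton_iff] at hs
      simp only at hs
      subst hs
      exact mem_biUnion hx (hA0 x hx))
  obtain ⟨a₂, ha₂, hav⟩ := Metric.isOpen_iff.1 hv _ (singleton_subset_iff.1 hv0)
  set a := min s₀ (min a₁ a₂) with ha
  have hapos : 0 < a := lt_min h.pos (lt_min ha₁ ha₂)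
  have hinj' : InjOn Ψ (C ×ˢ Ico 0 a) := hinj.mono (prod_mono_right (Ico_subset_Ico_right
    ((min_le_right _ _).trans (min_le_left _ _))))
  have : Nonempty (M × ℝ) := by
    obtain ⟨p, -, -⟩ := hC
    exact ⟨(p, 0)⟩
  set S := C ×ˢ Ico 0 a with hS
  set inv := Function.invFunOn Ψ S with hinv
  have hleft : ∀ q ∈ S, inv (Ψ q) = q := hinj'.leftInvOn_invFunOn
  have hmem : ∀ q ∈ Ψ '' S, inv q ∈ S := fun q hq => Function.invFunOn_mem hq
  have hright : ∀ q ∈ Ψ '' S, Ψ (inv q) = q := fun q hq => Function.invFunOn_eq hq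
  -- near each point the inverse agrees with a smooth local one
  have hloc : ∀ q ∈ Ψ '' S, (q ∈ (𝓡∂ n).boundary M ↔ (inv q).2 = 0) ∧
      ∃ (r : M → M) (ρ : M → ℝ), ContMDiffAt (𝓡∂ n) (𝓡∂ n) ∞ r q ∧
        ContMDiffAt (𝓡∂ n) 𝓘(ℝ, ℝ) ∞ ρ q ∧ ∀ᶠ q' in 𝓝 q, q' ∈ Ψ '' S ∧ inv q' = (r q', ρ q') := by
    rintro _ ⟨⟨p, s⟩, ⟨hp, hs⟩, rfl⟩
    have hsA : (p, s) ∈ ⋃ x ∈ C, A x := huv ⟨hu hp, hav (by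
      rw [Metric.mem_ball, Real.dist_eq, sub_zero, abs_of_nonneg hs.1]
      exact hs.2.trans_le ((min_le_right _ _).trans (min_le_right _ _)))⟩
    simp only [mem_iUnion] at hsA
    obtain ⟨x, hx, hxA⟩ := hsA
    obtain ⟨h1, r, ρ, hr, hρ, hrp, hρs, hev⟩ := hA x hx p hp s hs.1 hxA
    refine ⟨by rw [h1, hleft (p, s) ⟨hp, hs⟩], r, ρ, hr, hρ, ?_⟩
    have hlt : ∀ᶠ q in 𝓝 (Ψ (p, s)), ρ q < a :=
      hρ.continuousAt.eventually (gt_mem_nhds (by rw [hρs]; exact hs.2))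
    filter_upwards [hev, hlt] with q hq1 hq2
    have hq : (r q, ρ q) ∈ S := ⟨hq1.1, hq1.2.1, hq2⟩
    refine ⟨⟨_, hq, hq1.2.2⟩, ?_⟩
    rw [← hleft _ hq, hq1.2.2]
  refine ⟨fun q => (inv q).1, fun q => (inv q).2, Ψ '' S, a, min_le_left _ _, hapos, ?_,
    h.smooth.mono (prod_mono_right (Ico_subset_Ico_right (min_le_left _ _))),
    fun p hp s hs => ⟨(p, s), ⟨hp, hs⟩, rfl⟩, fun q hq => (hmem q hq).1, fun q hq => (hmem q hq).2,
    hright, fun p hp s hs => by rw [hleft (p, s) ⟨hp, hs⟩],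
    fun p hp s hs => by rw [hleft (p, s) ⟨hp, hs⟩], fun q hq => ?_, fun q hq => ?_,
    fun q hq => (hloc q hq).1⟩
  · refine isOpen_iff_mem_nhds.2 fun q hq => ?_
    obtain ⟨-, r, ρ, -, -, hev⟩ := hloc q hq
    filter_upwards [hev] with q' hq'
    exact hq'.1
  · obtain ⟨-, r, ρ, hr, -, hev⟩ := hloc q hq
    refine hr.congr_of_eventuallyEq ?_
    filter_upwards [hev] with q' hq'
    rw [hq'.2]
  · obtain ⟨-, r, ρ, -, hρ, hev⟩ := hloc q hq
    refine hρ.congr_of_eventuallyEq ?_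
    filter_upwards [hev] with q' hq'
    rw [hq'.2]

end Collar

/-! ### Coordinates on the collar -/

section CollarCoordinates

variable {n : ℕ} [NeZero n] {M : Type u} [TopologicalSpace M]
  [ChartedSpace (EuclideanHalfSpace n) M]

/-- The coordinates on a collar whose inverse is `parMap`. -/
def coMap (r : M → M) (ρ : M → ℝ) (x q : M) : EuclideanSpace ℝ (Fin n) :=
  extChartAt (𝓡∂ n) x (r q) + ρ q • bv 0

/-- The domain of the coordinates `parMap` around `x`. -/
def collarDom (C : Set M) (a : ℝ) (x : M) : Set (EuclideanSpace ℝ (Fin n)) :=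
  {z | bproj z ∈ (extChartAt (𝓡∂ n) x).target ∧ (extChartAt (𝓡∂ n) x).symm (bproj z) ∈ C ∧ z 0 < a}

lemma dself_comp_dmap_dcomap {N : Type u} [TopologicalSpace N]
    [ChartedSpace (EuclideanHalfSpace n) N] {f : EuclideanSpace ℝ (Fin n) → N}
    {κ : M → EuclideanSpace ℝ (Fin n)} {q : M}
    (hκ : MDifferentiableAt (𝓡∂ n) 𝓘(ℝ, EuclideanSpace ℝ (Fin n)) κ q)
    (hf : MDifferentiableWithinAt 𝓘(ℝ, EuclideanSpace ℝ (Fin n)) (𝓡∂ n) f (range (𝓡∂ n)) (κ q))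
    (hm : ∀ᶠ w in 𝓝 q, κ w ∈ range (𝓡∂ n)) :
    dself (n := n) (f ∘ κ) q = (dmap f (κ q)).comp (dcomap κ q) := by
  unfold dself dmap dcomap
  rw [← mfderivWithin_univ, ← mfderivWithin_univ]
  exact mfderivWithin_comp_of_preimage_mem_nhdsWithin q hf
    hκ.mdifferentiableWithinAt (by rwa [nhdsWithin_univ]) (uniqueMDiffWithinAt_univ _)

lemma dself_id (q : M) : dself (n := n) (id : M → M) q = ContinuousLinearMap.id ℝ _ :=
  mfderiv_id

variable {Ψ : M × ℝ → M} {r : M → M} {ρ : M → ℝ} {U C : Set M} {a : ℝ} {x q : M}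
  {z : EuclideanSpace ℝ (Fin n)}

lemma IsBoundaryComponent.subset_boundary (hC : IsBoundaryComponent n C) :
    C ⊆ (𝓡∂ n).boundary M := by
  obtain ⟨p, hp, rfl⟩ := hC
  exact connectedComponentIn_subset _ _

lemma bproj_mem_collarDom (ha : 0 < a) (hz : z ∈ collarDom (n := n) C a x) :
    bproj z ∈ collarDom C a x := by
  refine ⟨?_, ?_, ?_⟩
  · rw [bproj_bproj]
    exact hz.1
  · rw [bproj_bproj]
    exact hz.2.1
  · rwa [bproj_zero]

lemma parMap_mem (hc : IsCollar n C Ψ r ρ U a)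
    (hz : z ∈ collarDom C a x) (h0 : 0 ≤ z 0) : parMap Ψ x z ∈ U :=
  hc.map_mem _ hz.2.1 _ ⟨h0, hz.2.2⟩

lemma r_parMap (hc : IsCollar n C Ψ r ρ U a)
    (hz : z ∈ collarDom C a x) (h0 : 0 ≤ z 0) :
    r (parMap Ψ x z) = (extChartAt (𝓡∂ n) x).symm (bproj z) :=
  hc.r_apply _ hz.2.1 _ ⟨h0, hz.2.2⟩

lemma ρ_parMap (hc : IsCollar n C Ψ r ρ U a)
    (hz : z ∈ collarDom C a x) (h0 : 0 ≤ z 0) : ρ (parMap Ψ x z) = z 0 :=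
  hc.ρ_apply _ hz.2.1 _ ⟨h0, hz.2.2⟩

lemma eventually_r_mem (hc : IsCollar n C Ψ r ρ U a)
    (hq : q ∈ U) (hx : r q ∈ (extChartAt (𝓡∂ n) x).source) :
    ∀ᶠ p in 𝓝 q, p ∈ U ∧ r p ∈ (extChartAt (𝓡∂ n) x).source :=
  Filter.Eventually.and (hc.isOpen.mem_nhds hq : ∀ᶠ p in 𝓝 q, p ∈ U)
    ((hc.smooth_r q hq).continuousAt.eventually
    ((isOpen_extChartAt_source x).mem_nhds hx))

lemma r_parMap_mem (hc : IsCollar n C Ψ r ρ U a)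
    (hz : z ∈ collarDom C a x) (h0 : 0 ≤ z 0) :
    r (parMap Ψ x z) ∈ (extChartAt (𝓡∂ n) x).source := by
  rw [r_parMap hc hz h0]
  exact (extChartAt (𝓡∂ n) x).map_target hz.1

lemma coMap_parMap (hc : IsCollar n C Ψ r ρ U a)
    (hz : z ∈ collarDom C a x) (h0 : 0 ≤ z 0) :
    coMap r ρ x (parMap Ψ x z) = z := by
  unfold coMap
  rw [r_parMap hc hz h0, ρ_parMap hc hz h0, (extChartAt (𝓡∂ n) x).right_inv hz.1, bproj_add]

variable [IsManifold (𝓡∂ n) ∞ M] {g : RMetric n ∞ M}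

lemma isOpen_collarDom (hC : IsBoundaryComponent n C) : IsOpen (collarDom (n := n) C a x) := by
  refine isOpen_iff_mem_nhds.2 fun z ⟨hz1, hz2, hz3⟩ => ?_
  have ht : Filter.Tendsto bproj (𝓝 z) (𝓝[range (𝓡∂ n)] (bproj z)) :=
    tendsto_nhdsWithin_iff.2 ⟨(contDiff_bproj (m := 0)).continuous.continuousAt,
      .of_forall bproj_mem⟩
  have h1 : ∀ᶠ w in 𝓝[range (𝓡∂ n)] (bproj z), w ∈ (extChartAt (𝓡∂ n) x).target :=
    extChartAt_target_mem_nhdsWithin_of_mem hz1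
  have h2 := (contMDiffWithinAt_extChartAt_symm hz1).continuousWithinAt.eventually
    (hC.eventually_mem hz2)
  have h3 : ∀ᶠ w : EuclideanSpace ℝ (Fin n) in 𝓝 z, w 0 < a :=
    (contDiff_zeroCoord (m := 0)).continuous.continuousAt.eventually (gt_mem_nhds hz3)
  filter_upwards [ht.eventually h1, ht.eventually h2, h3] with w hw1 hw2 hw3
  exact ⟨hw1, hw2 ((symm_mem_boundary_iff hw1).2 (bproj_zero w)), hw3⟩

lemma extChartAt_mem_collarDom (hC : IsBoundaryComponent n C) (ha : 0 < a) {p : M} (hp : p ∈ C)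
    (hpx : p ∈ (extChartAt (𝓡∂ n) x).source) : extChartAt (𝓡∂ n) x p ∈ collarDom C a x := by
  have h0 := (mem_boundary_iff hpx).1 (hC.subset_boundary hp)
  refine ⟨?_, ?_, by rwa [h0]⟩
  · rw [bproj_eq_self h0]
    exact (extChartAt (𝓡∂ n) x).map_source hpx
  · rwa [bproj_eq_self h0, (extChartAt (𝓡∂ n) x).left_inv hpx]

lemma coMap_zero (hC : IsBoundaryComponent n C) (hc : IsCollar n C Ψ r ρ U a)
    (hq : q ∈ U) (hx : r q ∈ (extChartAt (𝓡∂ n) x).source) :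
    coMap (n := n) r ρ x q 0 = ρ q := by
  change extChartAt (𝓡∂ n) x (r q) 0 + (ρ q • bv (0 : Fin n)) 0 = ρ q
  rw [(mem_boundary_iff hx).1 (hC.subset_boundary (hc.r_mem q hq))]
  simp [bv]

lemma bproj_coMap (hC : IsBoundaryComponent n C) (hc : IsCollar n C Ψ r ρ U a)
    (hq : q ∈ U) (hx : r q ∈ (extChartAt (𝓡∂ n) x).source) :
    bproj (coMap r ρ x q) = extChartAt (𝓡∂ n) x (r q) := by
  unfold coMap
  rw [bproj_add_smul, bproj_eq_self ((mem_boundary_iff hx).1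
    (hC.subset_boundary (hc.r_mem q hq)))]

lemma coMap_mem_range (hC : IsBoundaryComponent n C) (hc : IsCollar n C Ψ r ρ U a)
    (hq : q ∈ U) (hx : r q ∈ (extChartAt (𝓡∂ n) x).source) :
    coMap (n := n) r ρ x q ∈ range (𝓡∂ n) := by
  rw [mem_range_iff, coMap_zero hC hc hq hx]
  exact (hc.ρ_mem q hq).1

lemma coMap_mem_collarDom (hC : IsBoundaryComponent n C) (hc : IsCollar n C Ψ r ρ U a)
    (hq : q ∈ U) (hx : r q ∈ (extChartAt (𝓡∂ n) x).source) :
    coMap (n := n) r ρ x q ∈ collarDom C a x := by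
  refine ⟨?_, ?_, ?_⟩
  · rw [bproj_coMap hC hc hq hx]
    exact (extChartAt (𝓡∂ n) x).map_source hx
  · rw [bproj_coMap hC hc hq hx, (extChartAt (𝓡∂ n) x).left_inv hx]
    exact hc.r_mem q hq
  · rw [coMap_zero hC hc hq hx]
    exact (hc.ρ_mem q hq).2

lemma contMDiffAt_coMap (hc : IsCollar n C Ψ r ρ U a)
    (hq : q ∈ U) (hx : r q ∈ (extChartAt (𝓡∂ n) x).source) :
    ContMDiffAt (𝓡∂ n) 𝓘(ℝ, EuclideanSpace ℝ (Fin n)) ∞ (coMap (n := n) r ρ x) q :=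
  ((contMDiffAt_extChartAt' (by rwa [extChartAt_source] at hx)).comp q (hc.smooth_r q hq)).add
    ((hc.smooth_ρ q hq).smul contMDiffAt_const)

lemma parMap_coMap (hC : IsBoundaryComponent n C) (hc : IsCollar n C Ψ r ρ U a)
    (hq : q ∈ U) (hx : r q ∈ (extChartAt (𝓡∂ n) x).source) :
    parMap Ψ x (coMap (n := n) r ρ x q) = q := by
  unfold parMap
  rw [bproj_coMap hC hc hq hx, coMap_zero hC hc hq hx, (extChartAt (𝓡∂ n) x).left_inv hx,
    hc.apply_r_ρ q hq]

lemma IsPush.contMDiffWithinAt_parMap' (h : IsPush g Ψ a C) (hz : z ∈ collarDom C a x)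
    (h0 : 0 ≤ z 0) :
    ContMDiffWithinAt 𝓘(ℝ, EuclideanSpace ℝ (Fin n)) (𝓡∂ n) ∞ (parMap Ψ x) (range (𝓡∂ n)) z :=
  h.contMDiffWithinAt_parMap hz.1 h0 hz.2.2

lemma IsPush.mdifferentiableWithinAt_parMap (h : IsPush g Ψ a C) (hz : z ∈ collarDom C a x)
    (h0 : 0 ≤ z 0) :
    MDifferentiableWithinAt 𝓘(ℝ, EuclideanSpace ℝ (Fin n)) (𝓡∂ n) (parMap Ψ x) (range (𝓡∂ n)) z :=
  (h.contMDiffWithinAt_parMap' hz h0).mdifferentiableWithinAt (by simp)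

lemma dmap_parMap_dcomap_coMap (h : IsPush g Ψ a C) (hC : IsBoundaryComponent n C)
    (hc : IsCollar n C Ψ r ρ U a) (hq : q ∈ U) (hx : r q ∈ (extChartAt (𝓡∂ n) x).source)
    (v : EuclideanSpace ℝ (Fin n)) :
    dmap (parMap Ψ x) (coMap r ρ x q) (dcomap (coMap r ρ x) q v) = v := by
  have hev := eventually_r_mem hc hq hx
  have h1 := dself_comp_dmap_dcomap (f := parMap Ψ x) (κ := coMap (n := n) r ρ x) (q := q)
    ((contMDiffAt_coMap hc hq hx).mdifferentiableAt (by simp))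
    (h.mdifferentiableWithinAt_parMap (coMap_mem_collarDom hC hc hq hx)
      (mem_range_iff.1 (coMap_mem_range hC hc hq hx)))
    (hev.mono fun p hp => coMap_mem_range hC hc hp.1 hp.2)
  have h2 : parMap Ψ x ∘ coMap (n := n) r ρ x =ᶠ[𝓝 q] id :=
    hev.mono fun p hp => parMap_coMap hC hc hp.1 hp.2
  rw [dself_congr h2, dself_id] at h1
  exact (DFunLike.congr_fun h1 v).symm

lemma dcomap_coMap_dmap_parMap (h : IsPush g Ψ a C) (hC : IsBoundaryComponent n C)
    (hc : IsCollar n C Ψ r ρ U a) (hz : z ∈ collarDom C a x) (h0 : 0 ≤ z 0)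
    (v : EuclideanSpace ℝ (Fin n)) :
    dcomap (coMap r ρ x) (parMap Ψ x z) (dmap (parMap Ψ x) z v) = v := by
  have hzr : z ∈ range (𝓡∂ n) := mem_range_iff.2 h0
  have h1 := fderivWithin_comp_dmap (κ := coMap (n := n) r ρ x) (f := parMap Ψ x) (z := z)
    ((contMDiffAt_coMap hc (parMap_mem hc hz h0) (r_parMap_mem hc hz h0)).mdifferentiableAt
      (by simp)) (h.mdifferentiableWithinAt_parMap hz h0) hzr
  have h2 : coMap (n := n) r ρ x ∘ parMap Ψ x =ᶠ[𝓝[range (𝓡∂ n)] z] id := by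
    filter_upwards [nhdsWithin_le_nhds ((isOpen_collarDom hC).mem_nhds hz), self_mem_nhdsWithin]
      with w hw1 hw2
    exact coMap_parMap hc hw1 (mem_range_iff.1 hw2)
  rw [h2.fderivWithin_eq (h2.self_of_nhdsWithin hzr),
    fderivWithin_id ((𝓡∂ n).uniqueDiffOn z hzr)] at h1
  exact (DFunLike.congr_fun h1 v).symm

/-- The metric in the coordinates of the collar. -/
def parBil (g : RMetric n ∞ M) (Ψ : M × ℝ → M) (x : M) (z : EuclideanSpace ℝ (Fin n)) :
    Bil (EuclideanSpace ℝ (Fin n)) :=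
  famPull (metFam g) (parMap Ψ x) z

lemma parBil_symm (v w : EuclideanSpace ℝ (Fin n)) : parBil g Ψ x z v w = parBil g Ψ x z w v :=
  (isMetric_metFam g _).1 _ _

lemma contDiffWithinAt_parBil (h : IsPush g Ψ a C) (hz : z ∈ collarDom C a x) (h0 : 0 ≤ z 0) :
    ContDiffWithinAt ℝ ∞ (parBil g Ψ x) (range (𝓡∂ n)) z :=
  contDiffWithinAt_famPull (by simp) (mem_range_iff.2 h0)
    (h.eventually_contMDiffWithinAt_parMap hz.1 hz.2.2) (mem_extChartAt_source _)
    (contDiffWithinAt_chartBil_self le_rfl g _)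

lemma isMetric_parBil (h : IsPush g Ψ a C) (hC : IsBoundaryComponent n C)
    (hc : IsCollar n C Ψ r ρ U a) (hz : z ∈ collarDom C a x) (h0 : 0 ≤ z 0) :
    IsMetric (parBil g Ψ x z) :=
  (isMetric_metFam g _).pullback _ (Function.LeftInverse.injective
    (dcomap_coMap_dmap_parMap h hC hc hz h0)) fun _ _ => rfl

lemma eventually_isMetric_parBil (h : IsPush g Ψ a C) (hC : IsBoundaryComponent n C)
    (hc : IsCollar n C Ψ r ρ U a) (hz : z ∈ collarDom C a x) :
    ∀ᶠ w in 𝓝[range (𝓡∂ n)] z, IsMetric (parBil g Ψ x w) := by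
  filter_upwards [nhdsWithin_le_nhds ((isOpen_collarDom hC).mem_nhds hz), self_mem_nhdsWithin]
    with w hw1 hw2
  exact isMetric_parBil h hC hc hw1 (mem_range_iff.1 hw2)

lemma eventually_boundary_parMap (h : IsPush g Ψ a C)
    (hz : z ∈ collarDom C a x) (h0 : z 0 = 0) {p : M} (hp : parMap Ψ x z = p) :
    ∀ᶠ w in 𝓝[range (𝓡∂ n)] z, w 0 = 0 → extChartAt (𝓡∂ n) p (parMap Ψ x w) 0 = 0 := by
  have hsrc := (h.contMDiffWithinAt_parMap' hz h0.ge).continuousWithinAt.eventually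
    ((isOpen_extChartAt_source (I := 𝓡∂ n) p).mem_nhds (by
      rw [hp]
      exact mem_extChartAt_source p))
  have ht := extChartAt_target_mem_nhdsWithin_of_mem hz.1
  rw [bproj_eq_self h0] at ht
  filter_upwards [hsrc, ht] with w hw1 hw2 hw0
  rw [h.parMap_of_zero hw0] at hw1 ⊢
  exact (mem_boundary_iff hw1).1 ((symm_mem_boundary_iff hw2).2 hw0)

/-- The curves of the push start orthogonally to the boundary. -/
lemma parBil_orthogonal (h : IsPush g Ψ a C) (hC : IsBoundaryComponent n C)
    (hz : z ∈ collarDom C a x) (h0 : z 0 = 0) {i : Fin n} (hi : i ≠ 0) :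
    parBil g Ψ x z (bv 0) (bv i) = 0 := by
  have hbz := bproj_eq_self h0
  set p := (extChartAt (𝓡∂ n) x).symm z with hp
  have hKp : parMap Ψ x z = p := h.parMap_of_zero h0
  have hpC : p ∈ C := by
    have := hz.2.1
    rwa [hbz] at this
  have hzt : z ∈ (extChartAt (𝓡∂ n) x).target := by
    have := hz.1
    rwa [hbz] at this
  obtain ⟨c, -, -, hV⟩ := h.velocity p (hC.subset_boundary hpC)
  have hsrc : parMap Ψ x z ∈ (extChartAt (𝓡∂ n) p).source := by
    rw [hKp]
    exact mem_extChartAt_source p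
  unfold parBil
  rw [famPull_eq_chartBil hsrc (h.mdifferentiableWithinAt_parMap hz h0.ge)
    (mem_range_iff.2 h0.ge), h.fderivWithin_parMap hzt h0 hp.symm hV, hKp, map_smul, smul_apply,
    apply_gradZero (isMetric_chartBil (isMetric_metFam g) (mem_extChartAt_target p)).isInvertible]
  have hd := ((contDiffWithinAt_extChartAt_comp le_rfl hsrc
    (h.contMDiffWithinAt_parMap' hz h0.ge)).differentiableWithinAt (by simp)).hasFDerivWithinAt
  have := fderivWithin_apply_eq_zero_of_boundary h0
    (((EuclideanSpace.proj (0 : Fin n) :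
      EuclideanSpace ℝ (Fin n) →L[ℝ] ℝ).hasFDerivAt).comp_hasFDerivWithinAt z hd)
    (eventually_boundary_parMap h hz h0 hKp) (u := bv i) (by simp [bv, hi.symm])
  rw [smul_eq_mul]
  exact mul_eq_zero_of_right _ this

/-- The scalar curvature in the coordinates of the collar. -/
lemma coordScalarCurvature_parBil (h : IsPush g Ψ a C) (hC : IsBoundaryComponent n C)
    (hc : IsCollar n C Ψ r ρ U a) (hz : z ∈ collarDom C a x) (h0 : 0 ≤ z 0) :
    coordScalarCurvature (range (𝓡∂ n)) (matOf (parBil g Ψ x)) z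
      = scalarCurvature g (parMap Ψ x z) :=
  coordScalarCurvature_famPull g two_le_infty (mem_range_iff.2 h0)
    (h.eventually_contMDiffWithinAt_parMap hz.1 hz.2.2)
    ((contDiffWithinAt_parBil h hz h0).of_le two_le_infty) (fun _ _ _ => parBil_symm _ _)
    (eventually_isMetric_parBil h hC hc hz) (.of_forall fun _ _ _ => rfl)

/-- In the coordinates centred at `p`, the derivative of the parametrization is the identity in
tangential directions. -/
lemma IsPush.fderivWithin_parMap_tangential (h : IsPush g Ψ a C) {p : M}
    (hp : extChartAt (𝓡∂ n) p p ∈ collarDom C a p) (h0 : extChartAt (𝓡∂ n) p p 0 = 0)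
    {v : EuclideanSpace ℝ (Fin n)} (hv : v 0 = 0) :
    fderivWithin ℝ (extChartAt (𝓡∂ n) p ∘ parMap Ψ p) (range (𝓡∂ n)) (extChartAt (𝓡∂ n) p p) v
      = v := by
  have hKp : parMap Ψ p (extChartAt (𝓡∂ n) p p) = p := by
    rw [h.parMap_of_zero h0, extChartAt_to_inv]
  have hd := ((contDiffWithinAt_extChartAt_comp (x := p) le_rfl (by
    rw [hKp]
    exact mem_extChartAt_source p)
    (h.contMDiffWithinAt_parMap' hp h0.ge)).differentiableWithinAt (by simp)).hasFDerivWithinAt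
  have := fderivWithin_apply_eq_zero_of_boundary h0
    (hd.sub (hasFDerivWithinAt_id (extChartAt (𝓡∂ n) p p) _)) (by
      filter_upwards [extChartAt_target_mem_nhdsWithin (I := 𝓡∂ n) p] with w hw hw0
      simp only [Pi.sub_apply, Function.comp_apply, id, h.parMap_of_zero hw0]
      rw [(extChartAt (𝓡∂ n) p).right_inv hw, sub_self]) hv
  rwa [sub_apply, sub_eq_zero] at this

/-- The mean curvature in the coordinates of the collar. -/
lemma trace_parBil_neg (h : IsPush g Ψ a C) (hC : IsBoundaryComponent n C)
    (hc : IsCollar n C Ψ r ρ U a) {p : M} (hp : p ∈ C) (hθ : 0 < meanCurvature g p) :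
    ∑ i : Fin n, ∑ j : Fin n, (if i ≠ 0 ∧ j ≠ 0 then
      (matOf (parBil g Ψ p) (extChartAt (𝓡∂ n) p p))⁻¹ i j *
        partialDeriv (range (𝓡∂ n)) (fun z => matOf (parBil g Ψ p) z i j) 0
          (extChartAt (𝓡∂ n) p p) else 0) < 0 := by
  set z := extChartAt (𝓡∂ n) p p with hzdef
  have hz : z ∈ collarDom C a p := extChartAt_mem_collarDom hC hc.pos hp (mem_extChartAt_source p)
  have h0 : z 0 = 0 := (mem_boundary_iff (mem_extChartAt_source p)).1 (hC.subset_boundary hp)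
  have hKp : parMap Ψ p z = p := by rw [h.parMap_of_zero h0, extChartAt_to_inv]
  have hB1 := (contDiffWithinAt_parBil h hz h0.ge).of_le (show (1 : WithTop ℕ∞) ≤ ∞ by simp)
  have hm := eventually_isMetric_parBil h hC hc hz
  have hx : ∀ᶠ w in 𝓝[range (𝓡∂ n)] z, w 0 = 0 → ∀ i, i ≠ 0 →
      parBil g Ψ p w (bv 0) (bv i) = 0 := by
    filter_upwards [nhdsWithin_le_nhds ((isOpen_collarDom hC).mem_nhds hz)] with w hw hw0 i hi
    exact parBil_orthogonal h hC hw hw0 hi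
  have hmean := meanCurvature_of_orthogonal h0 hB1 hm (fun _ _ _ _ => parBil_symm _ _) hx
  have htan : ∀ v u : EuclideanSpace ℝ (Fin n), v 0 = 0 → u 0 = 0 →
      parBil g Ψ p z v u = chartBil (metFam g) p z v u := by
    intro v u hv hu
    unfold parBil
    rw [famPull_eq_chartBil (x := p) (by rw [hKp]; exact mem_extChartAt_source p)
      (h.mdifferentiableWithinAt_parMap hz h0.ge) (mem_range_iff.2 h0.ge),
      h.fderivWithin_parMap_tangential hz h0 hv, h.fderivWithin_parMap_tangential hz h0 hu, hKp]
  have hbv : ∀ i : {i : Fin n // i ≠ 0}, (bv i.1 : EuclideanSpace ℝ (Fin n)) 0 = 0 := by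
    intro i
    simp [bv, i.2.symm]
  have hmc : meanCurvature g p = ∑ i : {i : Fin n // i ≠ 0}, ∑ j : {i : Fin n // i ≠ 0},
      ((matOf (parBil g Ψ p) z).submatrix (Subtype.val : {i : Fin n // i ≠ 0} → Fin n)
        Subtype.val)⁻¹ i j *
        coordSFF (range (𝓡∂ n)) (matOf (parBil g Ψ p)) z (bv i.1) (bv j.1) := by
    unfold meanCurvature
    have hsub : (matOf (parBil g Ψ p) z).submatrix (Subtype.val : {i : Fin n // i ≠ 0} → Fin n)
        (Subtype.val : {i : Fin n // i ≠ 0} → Fin n) = (chartMetric g p z).submatrix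
        (Subtype.val : {i : Fin n // i ≠ 0} → Fin n) Subtype.val := by
      ext i j
      exact htan _ _ (hbv i) (hbv j)
    rw [hsub]
    refine Finset.sum_congr rfl fun i _ => Finset.sum_congr rfl fun j _ => ?_
    have hsff := coordSFF_famPull g (by simp) h0
      (h.eventually_contMDiffWithinAt_parMap hz.1 hz.2.2) (eventually_boundary_parMap h hz h0 rfl)
      hB1 (fun _ _ _ => parBil_symm _ _) hm (.of_forall fun _ _ _ => rfl) (hbv i) (hbv j)
    rw [hKp, h.fderivWithin_parMap_tangential hz h0 (hbv i),
      h.fderivWithin_parMap_tangential hz h0 (hbv j)] at hsff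
    rw [hsff]
    rfl
  rw [hmc, hmean] at hθ
  have hsq : 0 ≤ Real.sqrt (gradZero (parBil g Ψ p) z 0) := Real.sqrt_nonneg _
  by_contra hcon
  rw [not_lt] at hcon
  nlinarith [mul_nonneg hsq hcon]

end CollarCoordinates

/-! ### Independence of the collar metric of the boundary chart -/

section Naturality

variable {n : ℕ} [NeZero n]

/-- The collar metric is natural under linear maps that preserve the splitting into normal and
tangential directions. -/
lemma collarBil_natural {B B' : EuclideanSpace ℝ (Fin n) → Bil (EuclideanSpace ℝ (Fin n))}
    {z z' : EuclideanSpace ℝ (Fin n)} {ε δ : ℝ}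
    {L : EuclideanSpace ℝ (Fin n) →L[ℝ] EuclideanSpace ℝ (Fin n)}
    (hB : ContDiffWithinAt ℝ 2 B (range (𝓡∂ n)) (bproj z))
    (hB' : ContDiffWithinAt ℝ 2 B' (range (𝓡∂ n)) (bproj z')) (hz : z' 0 = z 0)
    (hL : ∀ u, L (bproj u) = bproj (L u))
    (h : ∀ᶠ t in 𝓝[Ici 0] (0 : ℝ), ∀ u w,
      B (bproj z + t • bv 0) u w = B' (bproj z' + t • bv 0) (L u) (L w))
    (u w : EuclideanSpace ℝ (Fin n)) :
    collarBil ε δ (normalJet B) z u w = collarBil ε δ (normalJet B') z' (L u) (L w) := by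
  have key : ∀ j u w, normalJet B j z u w = normalJet B' j z' (L u) (L w) := by
    intro j u w
    have h1 := normalJet_clm ((ContinuousLinearMap.apply ℝ ℝ w).comp
      (ContinuousLinearMap.apply ℝ _ u)) hB j
    have h2 := normalJet_clm ((ContinuousLinearMap.apply ℝ ℝ (L w)).comp
      (ContinuousLinearMap.apply ℝ _ (L u))) hB' j
    simp only [ContinuousLinearMap.comp_apply, ContinuousLinearMap.apply_apply] at h1 h2
    rw [← h1, ← h2]
    exact normalJet_congr ((hB.clm_apply contDiffWithinAt_const).clm_apply contDiffWithinAt_const)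
      ((hB'.clm_apply contDiffWithinAt_const).clm_apply contDiffWithinAt_const)
      (h.mono fun t ht => ht u w) j
  simp only [collarBil, add_apply, sub_apply, smul_apply, maskBil_apply, smul_eq_mul, key, hz,
    map_sub, hL]

variable {M : Type u} [TopologicalSpace M] [ChartedSpace (EuclideanHalfSpace n) M]

/-- The change of collar coordinates from `x` to `p`. -/
def colTrans (x p : M) (y : EuclideanSpace ℝ (Fin n)) : EuclideanSpace ℝ (Fin n) :=
  extChartAt (𝓡∂ n) p ((extChartAt (𝓡∂ n) x).symm (bproj y)) + y 0 • bv 0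

variable [IsManifold (𝓡∂ n) ∞ M] {g : RMetric n ∞ M} {Ψ : M × ℝ → M} {r : M → M} {ρ : M → ℝ}
  {U C : Set M} {a : ℝ} {x p q : M} {y z : EuclideanSpace ℝ (Fin n)}

/-- The derivative of the change of collar coordinates does not depend on the time `y 0`. -/
lemma exists_hasFDerivAt_colTrans (hz : z 0 = 0) (hzx : z ∈ (extChartAt (𝓡∂ n) x).target)
    (hzp : (extChartAt (𝓡∂ n) x).symm z ∈ (extChartAt (𝓡∂ n) p).source) :
    ∃ L : EuclideanSpace ℝ (Fin n) →L[ℝ] EuclideanSpace ℝ (Fin n),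
      (∀ u, L (bproj u) = bproj (L u)) ∧ ∀ y, bproj y = z → HasFDerivAt (colTrans x p) L y := by
  have hd := ((contDiffWithinAt_extChartAt_comp le_rfl hzp
    (contMDiffWithinAt_extChartAt_symm hzx)).differentiableWithinAt (by simp)).hasFDerivWithinAt
  set τ' := fderivWithin ℝ (extChartAt (𝓡∂ n) p ∘ (extChartAt (𝓡∂ n) x).symm) (range (𝓡∂ n)) z
    with hτ
  have htan : ∀ v : EuclideanSpace ℝ (Fin n), v 0 = 0 → τ' v 0 = 0 := by
    intro v hv
    refine fderivWithin_apply_eq_zero_of_boundary hz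
      (((EuclideanSpace.proj (0 : Fin n) :
        EuclideanSpace ℝ (Fin n) →L[ℝ] ℝ).hasFDerivAt).comp_hasFDerivWithinAt z hd) ?_ hv
    filter_upwards [(contMDiffWithinAt_extChartAt_symm hzx).continuousWithinAt.eventually
      ((isOpen_extChartAt_source (I := 𝓡∂ n) p).mem_nhds hzp),
      extChartAt_target_mem_nhdsWithin_of_mem hzx] with w hw1 hw2 hw0
    exact (mem_boundary_iff hw1).1 ((symm_mem_boundary_iff hw2).2 hw0)
  refine ⟨τ'.comp bprojL + (EuclideanSpace.proj (0 : Fin n)).smulRight (bv 0), fun u => ?_,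
    fun y hy => ?_⟩
  · have h1 := bproj_eq_self (htan _ (bproj_zero u))
    simp only [add_apply, ContinuousLinearMap.comp_apply, bprojL_apply, bproj_bproj,
      ContinuousLinearMap.smulRight_apply, PiLp.proj_apply, bproj_zero, zero_smul,
      add_zero, bproj_add_smul, h1]
  · have h1 : HasFDerivAt (fun y : EuclideanSpace ℝ (Fin n) =>
        extChartAt (𝓡∂ n) p ((extChartAt (𝓡∂ n) x).symm (bproj y))) (τ'.comp bprojL) y := by
      rw [← hasFDerivWithinAt_univ]
      have hb : HasFDerivWithinAt (bproj : EuclideanSpace ℝ (Fin n) → EuclideanSpace ℝ (Fin n))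
          bprojL univ y := by
        have : (bproj : EuclideanSpace ℝ (Fin n) → EuclideanSpace ℝ (Fin n)) = bprojL := by
          funext z
          rw [bprojL_apply]
        rw [this]
        exact bprojL.hasFDerivWithinAt
      rw [← hy] at hd
      exact HasFDerivWithinAt.comp y hd hb (fun w _ => bproj_mem w)
    exact h1.add ((EuclideanSpace.proj (0 : Fin n) : EuclideanSpace ℝ (Fin n) →L[ℝ]
      ℝ).hasFDerivAt.smul_const (bv 0))

lemma colTrans_zero (hy : bproj y ∈ (extChartAt (𝓡∂ n) x).target)
    (hyp : (extChartAt (𝓡∂ n) x).symm (bproj y) ∈ (extChartAt (𝓡∂ n) p).source) :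
    colTrans x p y 0 = y 0 := by
  change extChartAt (𝓡∂ n) p ((extChartAt (𝓡∂ n) x).symm (bproj y)) 0
    + (y 0 • bv (0 : Fin n)) 0 = y 0
  rw [(mem_boundary_iff hyp).1 ((symm_mem_boundary_iff hy).2 (bproj_zero y))]
  simp [bv]

lemma bproj_colTrans (hy : bproj y ∈ (extChartAt (𝓡∂ n) x).target)
    (hyp : (extChartAt (𝓡∂ n) x).symm (bproj y) ∈ (extChartAt (𝓡∂ n) p).source) :
    bproj (colTrans x p y) = extChartAt (𝓡∂ n) p ((extChartAt (𝓡∂ n) x).symm (bproj y)) := by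
  unfold colTrans
  rw [bproj_add_smul, bproj_eq_self
    ((mem_boundary_iff hyp).1 ((symm_mem_boundary_iff hy).2 (bproj_zero y)))]

lemma parMap_colTrans (hy : bproj y ∈ (extChartAt (𝓡∂ n) x).target)
    (hyp : (extChartAt (𝓡∂ n) x).symm (bproj y) ∈ (extChartAt (𝓡∂ n) p).source) :
    parMap Ψ p (colTrans x p y) = parMap Ψ x y := by
  unfold parMap
  rw [bproj_colTrans hy hyp, colTrans_zero hy hyp, (extChartAt (𝓡∂ n) p).left_inv hyp]

lemma eventually_colTrans (hy : bproj y ∈ (extChartAt (𝓡∂ n) x).target)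
    (hyp : (extChartAt (𝓡∂ n) x).symm (bproj y) ∈ (extChartAt (𝓡∂ n) p).source) :
    ∀ᶠ w in 𝓝 y, bproj w ∈ (extChartAt (𝓡∂ n) x).target ∧
      (extChartAt (𝓡∂ n) x).symm (bproj w) ∈ (extChartAt (𝓡∂ n) p).source := by
  have ht : Filter.Tendsto bproj (𝓝 y) (𝓝[range (𝓡∂ n)] (bproj y)) :=
    tendsto_nhdsWithin_iff.2 ⟨(contDiff_bproj (m := 0)).continuous.continuousAt,
      .of_forall bproj_mem⟩
  have h1 : ∀ᶠ w in 𝓝[range (𝓡∂ n)] (bproj y), w ∈ (extChartAt (𝓡∂ n) x).target :=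
    extChartAt_target_mem_nhdsWithin_of_mem hy
  exact ht.eventually (h1.and ((contMDiffWithinAt_extChartAt_symm hy).continuousWithinAt.eventually
    ((isOpen_extChartAt_source (I := 𝓡∂ n) p).mem_nhds hyp)))

/-- The collar metric does not depend on the chart of the boundary. -/
lemma collarBil_parBil_eq (h : IsPush g Ψ a C) (hC : IsBoundaryComponent n C)
    (hc : IsCollar n C Ψ r ρ U a) {ε δ : ℝ} (hq : q ∈ U)
    (hx : r q ∈ (extChartAt (𝓡∂ n) x).source) (hp : r q ∈ (extChartAt (𝓡∂ n) p).source)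
    (v w : EuclideanSpace ℝ (Fin n)) :
    collarBil ε δ (normalJet (parBil g Ψ x)) (coMap r ρ x q) (dcomap (coMap r ρ x) q v)
        (dcomap (coMap r ρ x) q w)
      = collarBil ε δ (normalJet (parBil g Ψ p)) (coMap r ρ p q) (dcomap (coMap r ρ p) q v)
        (dcomap (coMap r ρ p) q w) := by
  set z := coMap (n := n) r ρ x q with hz
  have hbz : bproj z = extChartAt (𝓡∂ n) x (r q) := bproj_coMap hC hc hq hx
  have hzd : z ∈ collarDom C a x := coMap_mem_collarDom hC hc hq hx
  have hzp : (extChartAt (𝓡∂ n) x).symm (bproj z) ∈ (extChartAt (𝓡∂ n) p).source := by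
    rwa [hbz, (extChartAt (𝓡∂ n) x).left_inv hx]
  obtain ⟨L, hL, hLd⟩ := exists_hasFDerivAt_colTrans (p := p) (bproj_zero z) hzd.1 hzp
  have hev := eventually_r_mem hc hq hx
  -- the two coordinate systems are related by `colTrans`
  have hco : coMap (n := n) r ρ p =ᶠ[𝓝 q] colTrans x p ∘ coMap (n := n) r ρ x := by
    filter_upwards [hev, eventually_r_mem hc hq hp] with q' hq1 hq2
    change _ = colTrans x p (coMap r ρ x q')
    unfold colTrans
    rw [bproj_coMap hC hc hq1.1 hq1.2, coMap_zero hC hc hq1.1 hq1.2,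
      (extChartAt (𝓡∂ n) x).left_inv hq1.2]
    rfl
  have hcoq : coMap r ρ p q = colTrans x p z := hco.self_of_nhds
  have hzr : z ∈ range (𝓡∂ n) := coMap_mem_range hC hc hq hx
  have hF := (hLd z rfl).hasFDerivWithinAt (s := range (𝓡∂ n))
  have hdco : ∀ v, dcomap (coMap r ρ p) q v = L (dcomap (coMap r ρ x) q v) := by
    intro v
    rw [dcomap_congr hco, dcomap_comp_fderivWithin
      ((contMDiffAt_coMap hc hq hx).mdifferentiableAt (by simp)) hF.differentiableWithinAt
      (hev.mono fun q' hq' => coMap_mem_range hC hc hq'.1 hq'.2),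
      hF.fderivWithin ((𝓡∂ n).uniqueDiffOn z hzr)]
    rfl
  have hbz' : bproj (colTrans x p z) = extChartAt (𝓡∂ n) p (r q) := by
    rw [bproj_colTrans hzd.1 hzp, hbz, (extChartAt (𝓡∂ n) x).left_inv hx]
  have hsm : ∀ x, r q ∈ (extChartAt (𝓡∂ n) x).source →
      ContDiffWithinAt ℝ 2 (parBil g Ψ x) (range (𝓡∂ n)) (extChartAt (𝓡∂ n) x (r q)) := by
    intro x hx
    exact (contDiffWithinAt_parBil h (extChartAt_mem_collarDom hC hc.pos (hc.r_mem q hq) hx)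
      (extChartAt_zero_nonneg _ _)).of_le two_le_infty
  rw [hdco, hdco, hcoq]
  refine collarBil_natural (by rw [hbz]; exact hsm x hx) (by rw [hbz']; exact hsm p hp)
    (colTrans_zero hzd.1 hzp) hL ?_ _ _
  filter_upwards [self_mem_nhdsWithin, nhdsWithin_le_nhds (gt_mem_nhds hc.pos)] with t ht0 hta u w
  set y := bproj z + t • bv (0 : Fin n) with hy
  have hby : bproj y = bproj z := by rw [hy, bproj_add_smul, bproj_bproj]
  have hy0 : y 0 = t := by
    change bproj z 0 + (t • bv (0 : Fin n)) 0 = t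
    rw [bproj_zero]
    simp [bv]
  have hyr : y ∈ range (𝓡∂ n) := by
    rw [mem_range_iff, hy0]
    exact ht0
  have hyx : bproj y ∈ (extChartAt (𝓡∂ n) x).target := by rw [hby]; exact hzd.1
  have hyp : (extChartAt (𝓡∂ n) x).symm (bproj y) ∈ (extChartAt (𝓡∂ n) p).source := by rwa [hby]
  have hFy : colTrans x p y = bproj (colTrans x p z) + t • bv 0 := by
    rw [bproj_colTrans hzd.1 hzp]
    unfold colTrans
    rw [hby, hy0]
  have hyd : colTrans x p y ∈ collarDom C a p := by
    refine ⟨?_, ?_, ?_⟩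
    · rw [bproj_colTrans hyx hyp]
      exact (extChartAt (𝓡∂ n) p).map_source hyp
    · rw [bproj_colTrans hyx hyp, (extChartAt (𝓡∂ n) p).left_inv hyp, hby]
      exact hzd.2.1
    · rwa [colTrans_zero hyx hyp, hy0]
  have hFyd := (hLd y hby).hasFDerivWithinAt (s := range (𝓡∂ n))
  have hpar : parMap Ψ x =ᶠ[𝓝[range (𝓡∂ n)] y] parMap Ψ p ∘ colTrans x p := by
    filter_upwards [nhdsWithin_le_nhds (eventually_colTrans hyx hyp)] with w' hw'
    exact (parMap_colTrans hw'.1 hw'.2).symm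
  have hdm : dmap (parMap Ψ x) y = (dmap (parMap Ψ p) (colTrans x p y)).comp L := by
    rw [dmap_congr hpar hyr, dmap_comp_fderivWithin
      (h.mdifferentiableWithinAt_parMap hyd (by rw [colTrans_zero hyx hyp, hy0]; exact ht0))
      hFyd.differentiableWithinAt ?_ hyr, hFyd.fderivWithin ((𝓡∂ n).uniqueDiffOn y hyr)]
    filter_upwards [nhdsWithin_le_nhds (eventually_colTrans hyx hyp), self_mem_nhdsWithin]
      with w' hw1 hw2
    rw [mem_range_iff, colTrans_zero hw1.1 hw1.2]
    exact mem_range_iff.1 hw2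
  rw [← hFy]
  unfold parBil
  rw [famPull_apply, famPull_apply, hdm, parMap_colTrans hyx hyp]
  rfl

end Naturality

/-! ### Shifts along the collar -/

section Shift

/-- `up` is a diffeomorphism of the line, with inverse `dn`, that is the translation by `ε` near the
negative half-line and the identity beyond `a / 2`. -/
structure IsShift (a ε : ℝ) (up dn : ℝ → ℝ) : Prop where
  pos : 0 < ε
  lt : ε < a / 4
  contDiff_up : ContDiff ℝ ∞ up
  contDiff_dn : ContDiff ℝ ∞ dn
  strictMono : StrictMono up
  dn_up : ∀ s, dn (up s) = s
  up_dn : ∀ s, up (dn s) = s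
  up_near : ∀ s ≤ a / 4, up s = s + ε
  up_far : ∀ s, a / 2 ≤ s → up s = s
  le_up : ∀ s, s ≤ up s

lemma exists_cutoff {a : ℝ} (ha : 0 < a) : ∃ (χ : ℝ → ℝ) (K : ℝ), 0 < K ∧ ContDiff ℝ ∞ χ ∧
    (∀ s ≤ a / 4, χ s = 1) ∧ (∀ s, a / 2 ≤ s → χ s = 0) ∧ (∀ s, 0 ≤ χ s ∧ χ s ≤ 1) ∧
    ∀ s, |deriv χ s| ≤ K := by
  set χ : ℝ → ℝ := fun s => 1 - Real.smoothTransition ((s - a / 4) / (a / 4)) with hχ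
  have hsm : ContDiff ℝ ∞ χ := contDiff_const.sub (Real.smoothTransition.contDiff.comp
    ((contDiff_id.sub contDiff_const).div_const _))
  have h1 : ∀ s ≤ a / 4, χ s = 1 := fun s hs => by
    simp only [hχ]
    rw [Real.smoothTransition.zero_of_nonpos
      (div_nonpos_of_nonpos_of_nonneg (by linarith) (by linarith)), sub_zero]
  have h0 : ∀ s, a / 2 ≤ s → χ s = 0 := fun s hs => by
    simp only [hχ]
    rw [Real.smoothTransition.one_of_one_le ((one_le_div (by linarith)).2 (by linarith)), sub_self]
  have hc : Continuous (deriv χ) := hsm.continuous_deriv (by simp)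
  obtain ⟨K, hK⟩ := isCompact_Icc.exists_bound_of_continuousOn (s := Icc (a / 4) (a / 2))
    hc.continuousOn
  refine ⟨χ, max K 1, by positivity, hsm, h1, h0, fun s => ⟨?_, ?_⟩, fun s => ?_⟩
  · simpa [hχ] using Real.smoothTransition.le_one _
  · simpa [hχ] using Real.smoothTransition.nonneg _
  · by_cases hs : s ∈ Icc (a / 4) (a / 2)
    · exact (hK s hs).trans (le_max_left _ _)
    · have hd : deriv χ s = 0 := by
        rw [mem_Icc, not_and_or, not_le, not_le] at hs
        rcases hs with hs | hs
        · have : χ =ᶠ[𝓝 s] fun _ => 1 := by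
            filter_upwards [gt_mem_nhds hs] with t ht
            exact h1 t (le_of_lt ht)
          rw [this.deriv_eq, deriv_const]
        · have : χ =ᶠ[𝓝 s] fun _ => 0 := by
            filter_upwards [lt_mem_nhds hs] with t ht
            exact h0 t (le_of_lt ht)
          rw [this.deriv_eq, deriv_const]
      rw [hd, abs_zero]
      positivity

lemma exists_isShift {a : ℝ} (ha : 0 < a) :
    ∃ η > 0, ∀ ε ∈ Ioo 0 η, ∃ up dn, IsShift a ε up dn := by
  obtain ⟨χ, K, hK, hsm, h1, h0, h01, hd⟩ := exists_cutoff ha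
  refine ⟨min (1 / (2 * K)) (a / 4), by positivity, fun ε ⟨hε, hεη⟩ => ?_⟩
  have hεK : ε * K < 1 := by
    have := (lt_div_iff₀ (by positivity)).1 (hεη.trans_le (min_le_left _ _))
    nlinarith
  set up : ℝ → ℝ := fun s => s + ε * χ s with hup
  have hupc : ContDiff ℝ ∞ up := contDiff_id.add (contDiff_const.mul hsm)
  have hder : ∀ s, HasDerivAt up (1 + ε * deriv χ s) s := fun s =>
    (hasDerivAt_id s).add (((hsm.differentiable (by simp)) s).hasDerivAt.const_mul ε)
  have hpos : ∀ s, 0 < 1 + ε * deriv χ s := fun s => by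
    have := (abs_le.1 (hd s)).1
    nlinarith
  have hmono : StrictMono up := strictMono_of_deriv_pos fun s => by
    rw [(hder s).deriv]
    exact hpos s
  have hle : ∀ s, s ≤ up s := fun s => by
    have := mul_nonneg hε.le (h01 s).1
    simp only [hup]
    linarith
  have hsurj : Function.Surjective up := by
    refine hupc.continuous.surjective ?_ ?_
    · exact Filter.tendsto_atTop_mono hle Filter.tendsto_id
    · have hb : Filter.Tendsto (fun s : ℝ => s + ε) Filter.atBot Filter.atBot :=
        Filter.tendsto_atBot_add_const_right _ _ Filter.tendsto_id
      refine Filter.tendsto_atBot_mono (fun s => ?_) hb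
      have := mul_le_mul_of_nonneg_left (h01 s).2 hε.le
      simp only [hup]
      linarith
  set e := (hmono.orderIsoOfSurjective up hsurj).toHomeomorph with he
  have heup : ∀ s, e s = up s := fun _ => rfl
  refine ⟨up, e.symm, hε, hεη.trans_le (min_le_right _ _), hupc, ?_, hmono,
    fun s => e.symm_apply_apply s, fun s => e.apply_symm_apply s, fun s hs => ?_, fun s hs => ?_,
    hle⟩
  · exact e.contDiff_symm_deriv (f' := fun s => 1 + ε * deriv χ s) (fun s => (hpos s).ne')
      hder hupc
  · simp only [hup, h1 s hs, mul_one]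
  · simp only [hup, h0 s hs, mul_zero, add_zero]

variable {a ε : ℝ} {up dn : ℝ → ℝ}

lemma IsShift.strictMono_dn (h : IsShift a ε up dn) : StrictMono dn := fun s t hst => by
  rw [← h.strictMono.lt_iff_lt, h.up_dn, h.up_dn]
  exact hst

lemma IsShift.dn_le (h : IsShift a ε up dn) (s : ℝ) : dn s ≤ s := by
  have := h.le_up (dn s)
  rwa [h.up_dn] at this

lemma IsShift.dn_near (h : IsShift a ε up dn) {s : ℝ} (hs : s ≤ ε + a / 4) : dn s = s - ε := by
  rw [← h.dn_up (s - ε), h.up_near _ (by linarith), sub_add_cancel]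

lemma IsShift.dn_far (h : IsShift a ε up dn) {s : ℝ} (hs : a / 2 ≤ s) : dn s = s := by
  conv_lhs => rw [← h.up_far s hs, h.dn_up]

lemma IsShift.dn_self (h : IsShift a ε up dn) : dn ε = 0 := by
  have := h.lt
  rw [h.dn_near (by linarith [h.pos]), sub_self]

lemma IsShift.up_zero (h : IsShift a ε up dn) : up 0 = ε := by
  rw [h.up_near 0 (by linarith [h.pos, h.lt]), zero_add]

end Shift

section CollarShift

variable {M : Type u}

open Classical in
/-- The self-map of `M` that acts on the collar by the map `f` of its time coordinate. -/
def collarShift (Ψ : M × ℝ → M) (r : M → M) (ρ : M → ℝ) (U : Set M) (f : ℝ → ℝ) (q : M) : M :=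
  if q ∈ U then Ψ (r q, f (ρ q)) else q

variable {Ψ : M × ℝ → M} {r : M → M} {ρ : M → ℝ} {U C : Set M} {a : ℝ} {f : ℝ → ℝ} {q : M}

lemma collarShift_of_mem (hq : q ∈ U) : collarShift Ψ r ρ U f q = Ψ (r q, f (ρ q)) := if_pos hq

lemma collarShift_of_notMem (hq : q ∉ U) : collarShift Ψ r ρ U f q = q := if_neg hq

variable {n : ℕ} [NeZero n] [TopologicalSpace M] [ChartedSpace (EuclideanHalfSpace n) M]

lemma collarShift_mem (hc : IsCollar n C Ψ r ρ U a) (hf : ∀ s ∈ Ico 0 a, f s ∈ Ico 0 a)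
    (hq : q ∈ U) : collarShift Ψ r ρ U f q ∈ U := by
  rw [collarShift_of_mem hq]
  exact hc.map_mem _ (hc.r_mem q hq) _ (hf _ (hc.ρ_mem q hq))

lemma r_collarShift (hc : IsCollar n C Ψ r ρ U a) (hf : ∀ s ∈ Ico 0 a, f s ∈ Ico 0 a)
    (hq : q ∈ U) : r (collarShift Ψ r ρ U f q) = r q := by
  rw [collarShift_of_mem hq]
  exact hc.r_apply _ (hc.r_mem q hq) _ (hf _ (hc.ρ_mem q hq))

lemma ρ_collarShift (hc : IsCollar n C Ψ r ρ U a) (hf : ∀ s ∈ Ico 0 a, f s ∈ Ico 0 a)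
    (hq : q ∈ U) : ρ (collarShift Ψ r ρ U f q) = f (ρ q) := by
  rw [collarShift_of_mem hq]
  exact hc.ρ_apply _ (hc.r_mem q hq) _ (hf _ (hc.ρ_mem q hq))

lemma contMDiffAt_collarShift (hc : IsCollar n C Ψ r ρ U a) (hf : ∀ s ∈ Ico 0 a, f s ∈ Ico 0 a)
    (hq : q ∈ U) (hfq : ContDiffAt ℝ ∞ f (ρ q)) :
    ContMDiffAt (𝓡∂ n) (𝓡∂ n) ∞ (collarShift Ψ r ρ U f) q := by
  have h1 : ContMDiffAt (𝓡∂ n) ((𝓡∂ n).prod 𝓘(ℝ, ℝ)) ∞ (fun q => (r q, f (ρ q))) q :=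
    (hc.smooth_r q hq).prodMk (hfq.contMDiffAt.comp q (hc.smooth_ρ q hq))
  have h2 : ContMDiffWithinAt ((𝓡∂ n).prod 𝓘(ℝ, ℝ)) (𝓡∂ n) ∞ Ψ (univ ×ˢ Ico 0 a)
      (r q, f (ρ q)) := hc.smooth _ ⟨mem_univ _, hf _ (hc.ρ_mem q hq)⟩
  have h3 := (ContMDiffWithinAt.comp (t := univ ×ˢ Ico 0 a) q h2 (s := U) h1.contMDiffWithinAt
    (fun p hp => ⟨mem_univ _, hf _ (hc.ρ_mem p hp)⟩)).contMDiffAt (hc.isOpen.mem_nhds hq)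
  refine h3.congr_of_eventuallyEq ?_
  filter_upwards [hc.isOpen.mem_nhds hq] with p hp
  exact collarShift_of_mem hp

lemma continuousAt_collarShift (hc : IsCollar n C Ψ r ρ U a) (hf : ∀ s ∈ Ico 0 a, f s ∈ Ico 0 a)
    (hq : q ∈ U) (hfq : ContinuousAt f (ρ q)) : ContinuousAt (collarShift Ψ r ρ U f) q := by
  have h1 : ContinuousAt (fun q => (r q, f (ρ q))) q :=
    (hc.smooth_r q hq).continuousAt.prodMk (hfq.comp (hc.smooth_ρ q hq).continuousAt)
  have h2 : ContinuousWithinAt Ψ (univ ×ˢ Ico 0 a) (r q, f (ρ q)) :=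
    (hc.smooth _ ⟨mem_univ _, hf _ (hc.ρ_mem q hq)⟩).continuousWithinAt
  have h3 : ContinuousWithinAt (Ψ ∘ fun q => (r q, f (ρ q))) U q :=
    ContinuousWithinAt.comp (t := univ ×ˢ Ico 0 a) h2 h1.continuousWithinAt
      (fun p hp => ⟨mem_univ _, hf _ (hc.ρ_mem p hp)⟩)
  refine (h3.continuousAt (hc.isOpen.mem_nhds hq)).congr ?_
  filter_upwards [hc.isOpen.mem_nhds hq] with p hp
  exact (collarShift_of_mem hp).symm

/-- Points outside the collar are not limits of points in its inner half. -/
lemma IsCollar.eventually_notMem [T2Space M] (hc : IsCollar n C Ψ r ρ U a) (hCc : IsCompact C)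
    (hq : q ∉ U) : ∀ᶠ p in 𝓝 q, p ∈ U → a / 2 < ρ p := by
  have ha := hc.pos
  have hK : IsCompact (Ψ '' (C ×ˢ Icc 0 (a / 2))) :=
    (hCc.prod isCompact_Icc).image_of_continuousOn (hc.smooth.continuousOn.mono
      (prod_mono (subset_univ _) (fun s hs => ⟨hs.1, by linarith [hs.2]⟩)))
  have hqK : q ∈ (Ψ '' (C ×ˢ Icc 0 (a / 2)))ᶜ := by
    rintro ⟨⟨p, s⟩, ⟨hp, hs⟩, rfl⟩
    exact hq (hc.map_mem p hp s ⟨hs.1, by linarith [hs.2]⟩)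
  filter_upwards [hK.isClosed.isOpen_compl.mem_nhds hqK] with p hp hpU
  by_contra hcon
  exact hp ⟨(r p, ρ p), ⟨hc.r_mem p hpU, (hc.ρ_mem p hpU).1, not_lt.1 hcon⟩, hc.apply_r_ρ p hpU⟩

lemma collarShift_eventuallyEq [T2Space M] (hc : IsCollar n C Ψ r ρ U a) (hCc : IsCompact C)
    (hf : ∀ s, a / 2 ≤ s → f s = s) (hq : q ∉ U) : collarShift Ψ r ρ U f =ᶠ[𝓝 q] id := by
  filter_upwards [hc.eventually_notMem hCc hq] with p hp
  by_cases hpU : p ∈ U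
  · rw [collarShift_of_mem hpU, hf _ (hp hpU).le, hc.apply_r_ρ p hpU, id]
  · exact collarShift_of_notMem hpU

lemma continuous_collarShift [T2Space M] (hc : IsCollar n C Ψ r ρ U a) (hCc : IsCompact C)
    (hf : ∀ s ∈ Ico 0 a, f s ∈ Ico 0 a) (hf' : ∀ s, a / 2 ≤ s → f s = s) (hfc : Continuous f) :
    Continuous (collarShift Ψ r ρ U f) := by
  refine continuous_iff_continuousAt.2 fun q => ?_
  by_cases hq : q ∈ U
  · exact continuousAt_collarShift hc hf hq hfc.continuousAt
  · exact continuousAt_id.congr (collarShift_eventuallyEq hc hCc hf' hq).symm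

end CollarShift

/-! ### The extended metric -/

section Shifts

variable {n : ℕ} [NeZero n] {M : Type u} [TopologicalSpace M]
  [ChartedSpace (EuclideanHalfSpace n) M]

section Transport

variable {Ψ : M × ℝ → M} {r : M → M} {ρ : M → ℝ} {U C : Set M} {a : ℝ} {x q : M} {t : ℝ}

lemma add_smul_bv_zero (z : EuclideanSpace ℝ (Fin n)) (t : ℝ) :
    (z + t • bv (0 : Fin n)) 0 = z 0 + t := by
  change z 0 + (t • bv (0 : Fin n)) 0 = z 0 + t
  simp [bv]

lemma dself_comp {φ ψ : M → M} {p : M} (hψ : MDifferentiableAt (𝓡∂ n) (𝓡∂ n) ψ p)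
    (hφ : MDifferentiableAt (𝓡∂ n) (𝓡∂ n) φ (ψ p)) :
    dself (n := n) (φ ∘ ψ) p = (dself φ (ψ p)).comp (dself ψ p) :=
  mfderiv_comp p hφ hψ

variable [IsManifold (𝓡∂ n) ∞ M] {g : RMetric n ∞ M}

lemma coMap_add_mem_collarDom (hC : IsBoundaryComponent n C) (hc : IsCollar n C Ψ r ρ U a)
    (hq : q ∈ U) (hx : r q ∈ (extChartAt (𝓡∂ n) x).source) (ht : ρ q + t < a) :
    coMap (n := n) r ρ x q + t • bv 0 ∈ collarDom C a x := by
  have h := coMap_mem_collarDom hC hc hq hx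
  refine ⟨?_, ?_, ?_⟩
  · rw [bproj_add_smul]
    exact h.1
  · rw [bproj_add_smul]
    exact h.2.1
  · rwa [add_smul_bv_zero, coMap_zero hC hc hq hx]

lemma parMap_coMap_add (hC : IsBoundaryComponent n C) (hc : IsCollar n C Ψ r ρ U a)
    (hq : q ∈ U) (hx : r q ∈ (extChartAt (𝓡∂ n) x).source) :
    parMap Ψ x (coMap (n := n) r ρ x q + t • bv 0) = Ψ (r q, ρ q + t) := by
  unfold parMap
  rw [bproj_add_smul, add_smul_bv_zero, bproj_coMap hC hc hq hx, coMap_zero hC hc hq hx,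
    (extChartAt (𝓡∂ n) x).left_inv hx]

lemma dcomap_coMap_add (hc : IsCollar n C Ψ r ρ U a) (hq : q ∈ U)
    (hx : r q ∈ (extChartAt (𝓡∂ n) x).source) :
    dcomap (fun p => coMap (n := n) r ρ x p + t • bv 0) q = dcomap (coMap r ρ x) q := by
  have h := ((contMDiffAt_coMap hc hq hx).mdifferentiableAt (by simp)).hasMFDerivAt
  have h2 := (h.add (hasMFDerivAt_const (I := 𝓡∂ n) (t • bv (0 : Fin n)) q)).mfderiv
  exact h2.trans (add_zero _)

/-- The derivative of a map that is the translation by `t` in the coordinates of the collar. -/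
lemma dself_of_translation (h : IsPush g Ψ a C) (hC : IsBoundaryComponent n C)
    (hc : IsCollar n C Ψ r ρ U a) (hq : q ∈ U) (hx : r q ∈ (extChartAt (𝓡∂ n) x).source)
    {φ : M → M} (hφ : ∀ᶠ p in 𝓝 q, φ p = Ψ (r p, ρ p + t)) (ht : ∀ᶠ p in 𝓝 q, 0 ≤ ρ p + t)
    (ht' : ρ q + t < a) :
    dself (n := n) φ q = (dmap (parMap Ψ x) (coMap r ρ x q + t • bv 0)).comp
      (dcomap (coMap r ρ x) q) := by
  have hev := eventually_r_mem hc hq hx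
  have h1 : φ =ᶠ[𝓝 q] parMap Ψ x ∘ fun p => coMap (n := n) r ρ x p + t • bv 0 := by
    filter_upwards [hev, hφ] with p hp1 hp2
    rw [hp2, Function.comp_apply, parMap_coMap_add hC hc hp1.1 hp1.2]
  rw [dself_congr (n := n) h1, ← dcomap_coMap_add (t := t) hc hq hx]
  refine dself_comp_dmap_dcomap
    (((contMDiffAt_coMap hc hq hx).add contMDiffAt_const).mdifferentiableAt (by simp))
    (h.mdifferentiableWithinAt_parMap (coMap_add_mem_collarDom hC hc hq hx ht') ?_) ?_
  · rw [add_smul_bv_zero, coMap_zero hC hc hq hx]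
    exact ht.self_of_nhds
  · filter_upwards [hev, ht] with p hp1 hp2
    rwa [mem_range_iff, add_smul_bv_zero, coMap_zero hC hc hp1.1 hp1.2]

end Transport

variable [IsManifold (𝓡∂ n) ∞ M] {g : RMetric n ∞ M}

/-- A compact boundary component with a collar, and a shift by `ε` of the collar parameter. -/
structure IsCollarShift (g : RMetric n ∞ M) (Ψ : M × ℝ → M) (r : M → M) (ρ : M → ℝ) (U C : Set M)
    (a ε : ℝ) (up dn : ℝ → ℝ) : Prop where
  push : IsPush g Ψ a C
  component : IsBoundaryComponent n C
  compact : IsCompact C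
  collar : IsCollar n C Ψ r ρ U a
  shift : IsShift a ε up dn

variable {Ψ : M × ℝ → M} {r : M → M} {ρ : M → ℝ} {U C : Set M} {a ε δ : ℝ} {up dn : ℝ → ℝ}
  {x q : M} {z : EuclideanSpace ℝ (Fin n)}

lemma IsShift.up_mem (h : IsShift a ε up dn) {s : ℝ} (hs : s ∈ Ico 0 a) : up s ∈ Ico 0 a := by
  refine ⟨hs.1.trans (h.le_up s), ?_⟩
  have := h.lt
  rcases le_or_gt (a / 2) s with h1 | h1
  · rw [h.up_far s h1]
    exact hs.2
  · have h2 := h.strictMono h1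
    rw [h.up_far _ le_rfl] at h2
    linarith [h.pos]

lemma IsShift.dn_mem (h : IsShift a ε up dn) {s : ℝ} (hs : s ∈ Ico 0 a) :
    max 0 (dn s) ∈ Ico 0 a :=
  ⟨le_max_left _ _, max_lt (hs.1.trans_lt hs.2) ((h.dn_le s).trans_lt hs.2)⟩

lemma IsShift.max_dn_far (h : IsShift a ε up dn) {s : ℝ} (hs : a / 2 ≤ s) : max 0 (dn s) = s := by
  rw [h.dn_far hs, max_eq_right]
  linarith [h.pos, h.lt]

lemma IsShift.dn_nonneg (h : IsShift a ε up dn) {s : ℝ} (hs : ε ≤ s) : 0 ≤ dn s := by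
  rw [← h.dn_self]
  exact h.strictMono_dn.monotone hs

section Maps

variable [T2Space M]

lemma IsCollarShift.contMDiff_out (hD : IsCollarShift g Ψ r ρ U C a ε up dn) :
    ContMDiff (𝓡∂ n) (𝓡∂ n) ∞ (collarShift Ψ r ρ U up) := by
  intro q
  by_cases hq : q ∈ U
  · exact contMDiffAt_collarShift hD.collar (fun s => hD.shift.up_mem) hq
      hD.shift.contDiff_up.contDiffAt
  · exact contMDiffAt_id.congr_of_eventuallyEq
      (collarShift_eventuallyEq hD.collar hD.compact hD.shift.up_far hq)

lemma IsCollarShift.continuous_in (hD : IsCollarShift g Ψ r ρ U C a ε up dn) :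
    Continuous (collarShift Ψ r ρ U fun s => max 0 (dn s)) :=
  continuous_collarShift hD.collar hD.compact (fun _ => hD.shift.dn_mem)
    (fun _ => hD.shift.max_dn_far)
    (continuous_const.max hD.shift.contDiff_dn.continuous)

lemma IsCollarShift.contMDiffAt_in (hD : IsCollarShift g Ψ r ρ U C a ε up dn)
    (hq : q ∈ U → ε < ρ q) :
    ContMDiffAt (𝓡∂ n) (𝓡∂ n) ∞ (collarShift Ψ r ρ U fun s => max 0 (dn s)) q := by
  by_cases hqU : q ∈ U
  · refine contMDiffAt_collarShift hD.collar (fun s => hD.shift.dn_mem) hqU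
      (hD.shift.contDiff_dn.contDiffAt.congr_of_eventuallyEq ?_)
    filter_upwards [lt_mem_nhds (hq hqU)] with s hs
    exact max_eq_right (hD.shift.dn_nonneg hs.le)
  · exact contMDiffAt_id.congr_of_eventuallyEq
      (collarShift_eventuallyEq hD.collar hD.compact (fun s => hD.shift.max_dn_far) hqU)

lemma IsCollarShift.eventually_lt (hD : IsCollarShift g Ψ r ρ U C a ε up dn)
    (hq : q ∈ U → ε < ρ q) : ∀ᶠ p in 𝓝 q, p ∈ U → ε < ρ p := by
  by_cases hqU : q ∈ U
  · filter_upwards [(hD.collar.smooth_ρ q hqU).continuousAt.eventually (lt_mem_nhds (hq hqU))]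
      with p hp _
    exact hp
  · filter_upwards [hD.collar.eventually_notMem hD.compact hqU] with p hp hpU
    have := hp hpU
    linarith [hD.shift.lt, hD.shift.pos]

end Maps

lemma IsCollarShift.in_out (hD : IsCollarShift g Ψ r ρ U C a ε up dn) (p : M) :
    collarShift Ψ r ρ U (fun s => max 0 (dn s)) (collarShift Ψ r ρ U up p) = p := by
  by_cases hp : p ∈ U
  · have hu : ∀ s ∈ Ico 0 a, up s ∈ Ico 0 a := fun s => hD.shift.up_mem
    rw [collarShift_of_mem (collarShift_mem hD.collar hu hp), r_collarShift hD.collar hu hp,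
      ρ_collarShift hD.collar hu hp, hD.shift.dn_up, max_eq_right (hD.collar.ρ_mem p hp).1,
      hD.collar.apply_r_ρ p hp]
  · rw [collarShift_of_notMem hp, collarShift_of_notMem hp]

lemma IsCollarShift.out_in (hD : IsCollarShift g Ψ r ρ U C a ε up dn) (hq : q ∈ U → ε ≤ ρ q) :
    collarShift Ψ r ρ U up (collarShift Ψ r ρ U (fun s => max 0 (dn s)) q) = q := by
  by_cases hqU : q ∈ U
  · have hu : ∀ s ∈ Ico 0 a, max 0 (dn s) ∈ Ico 0 a := fun s => hD.shift.dn_mem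
    rw [collarShift_of_mem (collarShift_mem hD.collar hu hqU), r_collarShift hD.collar hu hqU,
      ρ_collarShift hD.collar hu hqU, max_eq_right (hD.shift.dn_nonneg (hq hqU)), hD.shift.up_dn,
      hD.collar.apply_r_ρ q hqU]
  · rw [collarShift_of_notMem hqU, collarShift_of_notMem hqU]

lemma IsCollarShift.ρ_pos (hD : IsCollarShift g Ψ r ρ U C a ε up dn) {p : M} (hp : p ∈ U)
    (hC : p ∉ C) : 0 < ρ p := by
  refine lt_of_le_of_ne (hD.collar.ρ_mem p hp).1 fun h0 => hC ?_
  have h1 := hD.collar.apply_r_ρ p hp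
  rw [← h0, hD.push.zero] at h1
  rw [← h1]
  exact hD.collar.r_mem p hp

/-- The pushed-in copy of `M` is what remains beyond the collar. -/
lemma IsCollarShift.out_lt (hD : IsCollarShift g Ψ r ρ U C a ε up dn) {p : M} (hp : p ∉ C)
    (hU : collarShift Ψ r ρ U up p ∈ U) : ε < ρ (collarShift Ψ r ρ U up p) := by
  have hpU : p ∈ U := by
    by_contra hcon
    rw [collarShift_of_notMem hcon] at hU
    exact hcon hU
  rw [ρ_collarShift hD.collar (fun s => hD.shift.up_mem) hpU, ← hD.shift.up_zero]
  exact hD.shift.strictMono (hD.ρ_pos hpU hp)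

lemma IsCollarShift.mem_of_mem (hD : IsCollarShift g Ψ r ρ U C a ε up dn) {p : M} (hp : p ∈ C) :
    p ∈ U ∧ ρ p = 0 ∧ r p = p := by
  have h0 : (0 : ℝ) ∈ Ico 0 a := ⟨le_rfl, hD.push.pos⟩
  have h1 := hD.collar.map_mem p hp 0 h0
  have h2 := hD.collar.ρ_apply p hp 0 h0
  have h3 := hD.collar.r_apply p hp 0 h0
  rw [hD.push.zero] at h1 h2 h3
  exact ⟨h1, h2, h3⟩

open Classical in
/-- The extended metric on `M`: a collar metric for `ρ ≤ ε`, and the push-forward of `g` on the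
rest. -/
def extFam (g : RMetric n ∞ M) (Ψ : M × ℝ → M) (r : M → M) (ρ : M → ℝ) (U : Set M) (ε δ : ℝ)
    (dn : ℝ → ℝ) (q : M) : Bil (EuclideanSpace ℝ (Fin n)) :=
  if q ∈ U ∧ ρ q ≤ ε then (collarBil ε δ (normalJet (parBil g Ψ (r q)))
      (coMap r ρ (r q) q)).bilinearComp (dcomap (coMap r ρ (r q)) q) (dcomap (coMap r ρ (r q)) q)
  else (metFam g (collarShift Ψ r ρ U (fun s => max 0 (dn s)) q)).bilinearComp
    (dself (collarShift Ψ r ρ U fun s => max 0 (dn s)) q)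
    (dself (collarShift Ψ r ρ U fun s => max 0 (dn s)) q)

lemma extFam_of_lt (hq : q ∈ U → ε < ρ q) (v w : EuclideanSpace ℝ (Fin n)) :
    extFam g Ψ r ρ U ε δ dn q v w = metFam g (collarShift Ψ r ρ U (fun s => max 0 (dn s)) q)
      (dself (collarShift Ψ r ρ U fun s => max 0 (dn s)) q v)
      (dself (collarShift Ψ r ρ U fun s => max 0 (dn s)) q w) := by
  unfold extFam
  rw [if_neg fun h => (hq h.1).not_ge h.2]
  rfl

lemma extFam_of_le (hD : IsCollarShift g Ψ r ρ U C a ε up dn) (hq : q ∈ U) (hε : ρ q ≤ ε)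
    (hx : r q ∈ (extChartAt (𝓡∂ n) x).source) (v w : EuclideanSpace ℝ (Fin n)) :
    extFam g Ψ r ρ U ε δ dn q v w = collarBil ε δ (normalJet (parBil g Ψ x)) (coMap r ρ x q)
      (dcomap (coMap r ρ x) q v) (dcomap (coMap r ρ x) q w) := by
  unfold extFam
  rw [if_pos ⟨hq, hε⟩]
  exact collarBil_parBil_eq hD.push hD.component hD.collar hq (mem_extChartAt_source _) hx v w

/-- The extended metric in the coordinates of the collar. -/
lemma extFam_eq_extBil [T2Space M] (hD : IsCollarShift g Ψ r ρ U C a ε up dn) (hq : q ∈ U)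
    (hε : ρ q < ε + a / 4) (hx : r q ∈ (extChartAt (𝓡∂ n) x).source)
    (v w : EuclideanSpace ℝ (Fin n)) :
    extFam g Ψ r ρ U ε δ dn q v w = extBil ε δ (parBil g Ψ x) (coMap r ρ x q)
      (dcomap (coMap r ρ x) q v) (dcomap (coMap r ρ x) q w) := by
  unfold extBil
  rw [coMap_zero hD.component hD.collar hq hx]
  split_ifs with h
  · exact extFam_of_le hD hq h hx v w
  · have hlt := not_le.1 h
    have hs := hD.shift
    have hρ := (hD.collar.smooth_ρ q hq).continuousAt
    have h1 : ∀ᶠ p in 𝓝 q, collarShift Ψ r ρ U (fun s => max 0 (dn s)) p = Ψ (r p, ρ p + -ε) := by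
      filter_upwards [hD.collar.isOpen.mem_nhds hq, hρ.eventually (gt_mem_nhds hε),
        hρ.eventually (lt_mem_nhds hlt)] with p hp1 hp2 hp3
      rw [collarShift_of_mem hp1, max_eq_right (hs.dn_nonneg hp3.le), hs.dn_near hp2.le,
        sub_eq_add_neg]
    have h2 : ∀ᶠ p in 𝓝 q, 0 ≤ ρ p + -ε := by
      filter_upwards [hρ.eventually (lt_mem_nhds hlt)] with p hp
      linarith
    rw [extFam_of_lt fun _ => hlt, dself_of_translation hD.push hD.component hD.collar hq hx h1 h2
      (by linarith [hs.lt, hs.pos]), h1.self_of_nhds,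
      ← parMap_coMap_add hD.component hD.collar hq hx,
      sub_eq_add_neg, ← neg_smul]
    rfl

lemma IsCollarShift.contDiffWithinAt_parBil (hD : IsCollarShift g Ψ r ρ U C a ε up dn) :
    ∀ z ∈ collarDom C a x, 0 ≤ z 0 → ContDiffWithinAt ℝ ∞ (parBil g Ψ x) (range (𝓡∂ n)) z :=
  fun _ hz h0 => ScalarExtension.contDiffWithinAt_parBil hD.push hz h0

/-- The extended metric is of class `C²`. -/
lemma contDiffWithinAt_extFam [T2Space M] (hD : IsCollarShift g Ψ r ρ U C a ε up dn) (q : M) :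
    ContDiffWithinAt ℝ 2 (chartBil (extFam g Ψ r ρ U ε δ dn) q) (range (𝓡∂ n))
      (extChartAt (𝓡∂ n) q q) := by
  have h21 : (2 : WithTop ℕ∞) + 1 ≤ ∞ := by
    exact WithTop.coe_le_coe.2 (le_top : (3 : ℕ∞) ≤ ⊤)
  by_cases hq : q ∈ U ∧ ρ q < ε + a / 4
  · obtain ⟨hqU, hqε⟩ := hq
    have hx : r q ∈ (extChartAt (𝓡∂ n) (r q)).source := mem_extChartAt_source _
    have hev := eventually_r_mem hD.collar hqU hx
    have hρ := (hD.collar.smooth_ρ q hqU).continuousAt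
    have hW := isOpen_collarDom (x := r q) (a := a) hD.component
    have hz0 := coMap_zero hD.component hD.collar hqU hx
    have hzW := coMap_mem_collarDom hD.component hD.collar hqU hx
    refine contDiffWithinAt_chartBil_of_comap (κ := coMap r ρ (r q))
      (B := extBil ε δ (parBil g Ψ (r q))) h21
      (hev.mono fun p hp => contMDiffAt_coMap hD.collar hp.1 hp.2)
      (hev.mono fun p hp => coMap_mem_range hD.component hD.collar hp.1 hp.2) ?_ ?_
    · rcases lt_or_ge (ρ q) ε with h | h
      · refine (contDiffWithinAt_collarBil (ε := ε) (δ := δ) hW hD.contDiffWithinAt_parBil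
          (by rw [hz0]; exact (hD.collar.ρ_mem q hqU).1)
          (bproj_mem_collarDom hD.push.pos hzW)).congr_of_eventuallyEq_of_mem ?_
          (coMap_mem_range hD.component hD.collar hqU hx)
        have : ∀ᶠ w : EuclideanSpace ℝ (Fin n) in 𝓝 (coMap r ρ (r q) q), w 0 < ε :=
          (contDiff_zeroCoord (m := 0)).continuous.continuousAt.eventually
            (gt_mem_nhds (hz0.trans_lt h))
        filter_upwards [nhdsWithin_le_nhds this] with w hw
        exact if_pos hw.le
      · refine (contDiffAt_extBil hW (fun z => bproj_mem_collarDom hD.push.pos) hD.shift.pos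
          hD.contDiffWithinAt_parBil ?_).contDiffWithinAt
        rw [sub_eq_add_neg, ← neg_smul]
        exact coMap_add_mem_collarDom hD.component hD.collar hqU hx
          (by linarith [hD.shift.lt, hD.shift.pos])
    · filter_upwards [hev, hρ.eventually (gt_mem_nhds hqε)] with p hp1 hp2 v w
      exact extFam_eq_extBil hD hp1.1 hp2 hp1.2 v w
  · have hq' : q ∈ U → ε < ρ q := fun h => by
      have := not_lt.1 fun h' => hq ⟨h, h'⟩
      linarith [hD.shift.lt, hD.shift.pos]
    have hev := hD.eventually_lt hq'
    exact contDiffWithinAt_chartBil_of_map h21 two_le_infty g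
      (hev.mono fun p hp => hD.contMDiffAt_in hp) (hev.mono fun p hp v w => extFam_of_lt hp v w)

end Shifts

/-! ### Curvature of the extended metric -/

section ExtendedMetric

variable {n : ℕ} [NeZero n] {M : Type u} [TopologicalSpace M]
  [ChartedSpace (EuclideanHalfSpace n) M] [IsManifold (𝓡∂ n) ∞ M] {g : RMetric n ∞ M}
  {Ψ : M × ℝ → M} {r : M → M} {ρ : M → ℝ} {U C : Set M} {a ε δ : ℝ} {up dn : ℝ → ℝ}
  {x q : M} {z : EuclideanSpace ℝ (Fin n)}

/-- The collar metric of width `ε` and parameter `δ` along `C` is positive definite and has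
non-negative scalar curvature. -/
def IsNonnegCollar (g : RMetric n ∞ M) (Ψ : M × ℝ → M) (C : Set M) (ε δ : ℝ) : Prop :=
  ∀ p ∈ C, ∃ x, p ∈ (extChartAt (𝓡∂ n) x).source ∧
    ∀ z, bproj z = extChartAt (𝓡∂ n) x p → 0 ≤ z 0 → z 0 ≤ ε →
      IsMetric (collarBil ε δ (normalJet (parBil g Ψ x)) z) ∧
      0 ≤ coordScalarCurvature (range (𝓡∂ n)) (matOf (collarBil ε δ (normalJet (parBil g Ψ x)))) z

/-- The extended metric in the parametrization of the collar. -/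
lemma famPull_extFam_parMap (hD : IsCollarShift g Ψ r ρ U C a ε up dn) (hz : z ∈ collarDom C a x)
    (h0 : 0 ≤ z 0) (hε : z 0 ≤ ε) (v w : EuclideanSpace ℝ (Fin n)) :
    famPull (extFam g Ψ r ρ U ε δ dn) (parMap Ψ x) z v w
      = collarBil ε δ (normalJet (parBil g Ψ x)) z v w := by
  rw [famPull_apply, extFam_of_le hD (parMap_mem hD.collar hz h0)
    (by rwa [ρ_parMap hD.collar hz h0]) (r_parMap_mem hD.collar hz h0),
    dcomap_coMap_dmap_parMap hD.push hD.component hD.collar hz h0,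
    dcomap_coMap_dmap_parMap hD.push hD.component hD.collar hz h0, coMap_parMap hD.collar hz h0]

variable [T2Space M]

lemma dself_out_in (hD : IsCollarShift g Ψ r ρ U C a ε up dn) (hq : q ∈ U → ε < ρ q)
    (v : EuclideanSpace ℝ (Fin n)) :
    dself (collarShift Ψ r ρ U up) (collarShift Ψ r ρ U (fun s => max 0 (dn s)) q)
      (dself (collarShift Ψ r ρ U fun s => max 0 (dn s)) q v) = v := by
  have h1 := dself_comp (n := n) ((hD.contMDiffAt_in hq).mdifferentiableAt (by simp))
    ((hD.contMDiff_out (collarShift Ψ r ρ U (fun s => max 0 (dn s)) q)).mdifferentiableAt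
      (by simp))
  have h2 : collarShift Ψ r ρ U up ∘ collarShift Ψ r ρ U (fun s => max 0 (dn s)) =ᶠ[𝓝 q] id := by
    filter_upwards [hD.eventually_lt hq] with p hp
    exact hD.out_in fun h => (hp h).le
  rw [dself_congr (n := n) h2, dself_id] at h1
  exact (DFunLike.congr_fun h1 v).symm

lemma dself_in_out (hD : IsCollarShift g Ψ r ρ U C a ε up dn) {p : M} (hp : p ∉ C)
    (v : EuclideanSpace ℝ (Fin n)) :
    dself (collarShift Ψ r ρ U fun s => max 0 (dn s)) (collarShift Ψ r ρ U up p)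
      (dself (collarShift Ψ r ρ U up) p v) = v := by
  have h1 := dself_comp (n := n) ((hD.contMDiff_out p).mdifferentiableAt (by simp))
    ((hD.contMDiffAt_in (hD.out_lt hp)).mdifferentiableAt (by simp))
  have h2 : collarShift Ψ r ρ U (fun s => max 0 (dn s)) ∘ collarShift Ψ r ρ U up = id :=
    funext hD.in_out
  rw [h2, dself_id] at h1
  exact (DFunLike.congr_fun h1 v).symm

lemma isMetric_extFam (hD : IsCollarShift g Ψ r ρ U C a ε up dn) (hG : IsNonnegCollar g Ψ C ε δ)
    (q : M) : IsMetric (extFam g Ψ r ρ U ε δ dn q) := by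
  by_cases hq : q ∈ U ∧ ρ q ≤ ε
  · obtain ⟨x, hx, hz⟩ := hG (r q) (hD.collar.r_mem q hq.1)
    have h0 := coMap_zero hD.component hD.collar hq.1 hx
    exact (hz (coMap r ρ x q) (bproj_coMap hD.component hD.collar hq.1 hx)
      (by rw [h0]; exact (hD.collar.ρ_mem q hq.1).1) (by rw [h0]; exact hq.2)).1.pullback
      _ (Function.LeftInverse.injective
        (dmap_parMap_dcomap_coMap hD.push hD.component hD.collar hq.1 hx))
      (extFam_of_le hD hq.1 hq.2 hx)
  · have hq' : q ∈ U → ε < ρ q := fun h => not_le.1 fun h' => hq ⟨h, h'⟩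
    exact (isMetric_metFam g _).pullback _
      (Function.LeftInverse.injective (dself_out_in hD hq')) (extFam_of_lt hq')

/-- The collar metric agrees with the given one where it is glued. -/
lemma collarBil_end {B : EuclideanSpace ℝ (Fin n) → Bil (EuclideanSpace ℝ (Fin n))} (hε : ε ≠ 0)
    (hz : z 0 = 0) : collarBil ε δ (normalJet B) (z + ε • bv 0) = B z := by
  have h : normalJet B 0 (z + ε • bv 0) = B z := by
    simp [normalJet, bproj_add_smul, bproj_eq_self hz]
  unfold collarBil
  rw [h, add_smul_bv_zero, hz, zero_add, div_self hε, sub_self]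
  simp

/-- The pushed-in copy of `M` is isometric to `M`. Along `C` this is the matching of the collar with
the metric at `ρ = ε`. -/
lemma extFam_out (hD : IsCollarShift g Ψ r ρ U C a ε up dn) (p : M)
    (v w : EuclideanSpace ℝ (Fin n)) :
    extFam g Ψ r ρ U ε δ dn (collarShift Ψ r ρ U up p) (dself (collarShift Ψ r ρ U up) p v)
      (dself (collarShift Ψ r ρ U up) p w) = metFam g p v w := by
  by_cases hp : p ∈ C
  · obtain ⟨hpU, hρ, hr⟩ := hD.mem_of_mem hp
    have hu : ∀ s ∈ Ico 0 a, up s ∈ Ico 0 a := fun s => hD.shift.up_mem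
    set φ := collarShift Ψ r ρ U up with hφ
    have hφU : φ p ∈ U := collarShift_mem hD.collar hu hpU
    have hrφ : r (φ p) = p := (r_collarShift hD.collar hu hpU).trans hr
    have hρφ : ρ (φ p) = ε := by
      rw [ρ_collarShift hD.collar hu hpU, hρ, hD.shift.up_zero]
    have hrp : r p ∈ (extChartAt (𝓡∂ n) p).source := by
      rw [hr]
      exact mem_extChartAt_source p
    have hrφp : r (φ p) ∈ (extChartAt (𝓡∂ n) p).source := by
      rw [hrφ]
      exact mem_extChartAt_source p
    have hco : coMap (n := n) r ρ p ∘ φ =ᶠ[𝓝 p] fun q => coMap (n := n) r ρ p q + ε • bv 0 := by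
      have : ∀ᶠ q in 𝓝 p, ρ q < a / 4 := (hD.collar.smooth_ρ p hpU).continuousAt.eventually
        (gt_mem_nhds (by rw [hρ]; linarith [hD.push.pos]))
      filter_upwards [hD.collar.isOpen.mem_nhds hpU, this] with q hq1 hq2
      rw [Function.comp_apply, coMap, coMap, r_collarShift hD.collar hu hq1,
        ρ_collarShift hD.collar hu hq1, hD.shift.up_near _ hq2.le, add_smul, add_assoc]
    have hd := dcomap_comp_dself (n := n) (κ := coMap (n := n) r ρ p) (ψ := φ) (p := p) (q := φ p)
      ((contMDiffAt_coMap hD.collar hφU hrφp).mdifferentiableAt (by simp)) rfl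
      ((hD.contMDiff_out p).mdifferentiableAt (by simp))
    rw [dcomap_congr hco, dcomap_coMap_add hD.collar hpU hrp] at hd
    have hd' : ∀ u, dcomap (coMap r ρ p) (φ p) (dself φ p u) = dcomap (coMap r ρ p) p u :=
      fun u => (DFunLike.congr_fun hd u).symm
    have h0 : coMap (n := n) r ρ p p 0 = 0 := by
      rw [coMap_zero hD.component hD.collar hpU hrp, hρ]
    rw [extFam_of_le hD hφU hρφ.le hrφp, hd', hd']
    have hco' : coMap (n := n) r ρ p (φ p) = coMap r ρ p p + ε • bv 0 := hco.self_of_nhds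
    rw [hco', collarBil_end hD.shift.pos.ne' h0]
    unfold parBil
    rw [famPull_apply, dmap_parMap_dcomap_coMap hD.push hD.component hD.collar hpU hrp,
      dmap_parMap_dcomap_coMap hD.push hD.component hD.collar hpU hrp,
      parMap_coMap hD.component hD.collar hpU hrp]
  · rw [extFam_of_lt (hD.out_lt hp), dself_in_out hD hp, dself_in_out hD hp, hD.in_out]

/-- The extended metric, of class `C²`. -/
def extMetric (hD : IsCollarShift g Ψ r ρ U C a ε up dn) (hG : IsNonnegCollar g Ψ C ε δ) :
    RMetric n 2 M :=
  mkMetric (isMetric_extFam hD hG) (contDiffWithinAt_extFam hD)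

lemma eventually_famPull_extMetric (hD : IsCollarShift g Ψ r ρ U C a ε up dn)
    (hG : IsNonnegCollar g Ψ C ε δ) (hz : z ∈ collarDom C a x) (hε : z 0 < ε) :
    ∀ᶠ w in 𝓝[range (𝓡∂ n)] z, ∀ u v, collarBil ε δ (normalJet (parBil g Ψ x)) w u v
      = famPull (metFam (extMetric hD hG)) (parMap Ψ x) w u v := by
  have h1 : ∀ᶠ w : EuclideanSpace ℝ (Fin n) in 𝓝 z, w 0 < ε :=
    (contDiff_zeroCoord (m := 0)).continuous.continuousAt.eventually (gt_mem_nhds hε)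
  filter_upwards [nhdsWithin_le_nhds ((isOpen_collarDom hD.component).mem_nhds hz),
    nhdsWithin_le_nhds h1, self_mem_nhdsWithin] with w hw1 hw2 hw3 u v
  exact (famPull_extFam_parMap hD hw1 (mem_range_iff.1 hw3) hw2.le u v).symm

lemma eventually_isMetric_collarBil (hD : IsCollarShift g Ψ r ρ U C a ε up dn)
    (hG : IsNonnegCollar g Ψ C ε δ) (hz : z ∈ collarDom C a x) (hε : z 0 < ε) :
    ∀ᶠ w in 𝓝[range (𝓡∂ n)] z, IsMetric (collarBil ε δ (normalJet (parBil g Ψ x)) w) := by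
  filter_upwards [nhdsWithin_le_nhds ((isOpen_collarDom hD.component).mem_nhds hz),
    eventually_famPull_extMetric hD hG hz hε, self_mem_nhdsWithin] with w hw1 hw2 hw3
  exact (isMetric_metFam (extMetric hD hG) _).pullback _ (Function.LeftInverse.injective
    (dcomap_coMap_dmap_parMap hD.push hD.component hD.collar hw1 (mem_range_iff.1 hw3))) hw2

/-- The scalar curvature on the pushed-in copy of `M`. -/
lemma scalarCurvature_extMetric_out (hD : IsCollarShift g Ψ r ρ U C a ε up dn)
    (hG : IsNonnegCollar g Ψ C ε δ) (p : M) :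
    scalarCurvature (extMetric hD hG) (collarShift Ψ r ρ U up p) = scalarCurvature g p := by
  have hz := mem_extChartAt_target (I := 𝓡∂ n) p
  have hsm := eventually_contMDiffWithinAt_extChartAt_symm hz
  have h := coordScalarCurvature_famPull (extMetric hD hG) (B := chartBil (metFam g) p)
    (f := collarShift Ψ r ρ U up ∘ (extChartAt (𝓡∂ n) p).symm) le_rfl
    (extChartAt_target_subset p hz)
    (hsm.mono fun w hw => (hD.contMDiff_out _).comp_contMDiffWithinAt w hw)
    (contDiffWithinAt_chartBil_self two_le_infty g p)
    (fun _ _ _ => famPull_symm (fun q => (isMetric_metFam g q).1) _ _)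
    (by filter_upwards [extChartAt_target_mem_nhdsWithin (I := 𝓡∂ n) p] with w hw
        exact isMetric_chartBil (isMetric_metFam g) hw)
    (by filter_upwards [hsm, self_mem_nhdsWithin] with w hw1 hw2 u v
        rw [famPull_apply, dmap_comp_dself ((hD.contMDiff_out _).mdifferentiableAt (by simp))
          (hw1.mdifferentiableWithinAt (by simp)) hw2]
        exact (extFam_out hD _ _ _).symm)
  rw [Function.comp_apply, extChartAt_to_inv] at h
  exact h.symm

/-- The scalar curvature on the collar. -/
lemma scalarCurvature_extMetric_collar (hD : IsCollarShift g Ψ r ρ U C a ε up dn)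
    (hG : IsNonnegCollar g Ψ C ε δ) (hq : q ∈ U) (hε : ρ q < ε) :
    0 ≤ scalarCurvature (extMetric hD hG) q := by
  obtain ⟨x, hx, hx'⟩ := hG (r q) (hD.collar.r_mem q hq)
  set z := coMap (n := n) r ρ x q with hz
  have hz0 : z 0 = ρ q := coMap_zero hD.component hD.collar hq hx
  have hzd : z ∈ collarDom C a x := coMap_mem_collarDom hD.component hD.collar hq hx
  have hz0' : 0 ≤ z 0 := by
    rw [hz0]
    exact (hD.collar.ρ_mem q hq).1
  have hzε : z 0 < ε := by rwa [hz0]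
  have h := coordScalarCurvature_famPull (extMetric hD hG)
    (B := collarBil ε δ (normalJet (parBil g Ψ x))) (f := parMap Ψ x) le_rfl
    (mem_range_iff.2 hz0')
    (hD.push.eventually_contMDiffWithinAt_parMap hzd.1 hzd.2.2)
    (contDiffWithinAt_collarBil (isOpen_collarDom hD.component) hD.contDiffWithinAt_parBil hz0'
      (bproj_mem_collarDom hD.push.pos hzd))
    (fun _ _ _ => collarBil_symm (fun _ _ _ => parBil_symm _ _) _ _)
    (eventually_isMetric_collarBil hD hG hzd hzε)
    (eventually_famPull_extMetric hD hG hzd hzε)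
  rw [hz, parMap_coMap hD.component hD.collar hq hx] at h
  rw [← h]
  exact (hx' z (bproj_coMap hD.component hD.collar hq hx) hz0' hzε.le).2

lemma nonnegScalarCurvature_extMetric (hD : IsCollarShift g Ψ r ρ U C a ε up dn)
    (hG : IsNonnegCollar g Ψ C ε δ) (hg : NonnegScalarCurvature g) :
    NonnegScalarCurvature (extMetric hD hG) := by
  intro q
  by_cases hq : q ∈ U ∧ ρ q < ε
  · exact scalarCurvature_extMetric_collar hD hG hq.1 hq.2
  · rw [← hD.out_in fun h => not_lt.1 fun h' => hq ⟨h, h'⟩, scalarCurvature_extMetric_out]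
    exact hg _

/-- The second fundamental form of the new boundary is `δ` times a positive multiple of the
original metric. -/
lemma secondFundamentalForm_extMetric (hD : IsCollarShift g Ψ r ρ U C a ε up dn)
    (hG : IsNonnegCollar g Ψ C ε δ) (hq : q ∈ C) :
    ∃ c > 0, ∃ b : Bil (EuclideanSpace ℝ (Fin n)), IsMetric b ∧ ∀ v w : Fin n → ℝ,
      v 0 = 0 → w 0 = 0 → secondFundamentalForm (extMetric hD hG) q v w
        = δ * c * b (WithLp.toLp 2 v) (WithLp.toLp 2 w) := by
  set z := extChartAt (𝓡∂ n) q q with hz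
  have hz0 : z 0 = 0 := (mem_boundary_iff (mem_extChartAt_source q)).1
    (hD.component.subset_boundary hq)
  have hzd : z ∈ collarDom C a q :=
    extChartAt_mem_collarDom hD.component hD.push.pos hq (mem_extChartAt_source q)
  have hzε : z 0 < ε := by
    rw [hz0]
    exact hD.shift.pos
  have hzq : parMap Ψ q z = q := by rw [hD.push.parMap_of_zero hz0, hz, extChartAt_to_inv]
  have hm := eventually_isMetric_collarBil hD hG hzd hzε
  have hzr : z ∈ range (𝓡∂ n) := mem_range_iff.2 hz0.ge
  refine ⟨_, Real.sqrt_pos.2 (gradZero_zero_pos (hm.self_of_nhdsWithin hzr)), parBil g Ψ q z,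
    isMetric_parBil hD.push hD.component hD.collar hzd hz0.ge, fun v w hv hw => ?_⟩
  rw [← coordSFF_collarBil hD.shift.pos.ne' (isOpen_collarDom hD.component)
    (fun z => bproj_mem_collarDom hD.push.pos) hD.contDiffWithinAt_parBil
    (fun _ _ _ => parBil_symm _ _)
    (fun z hz h0 i hi => parBil_orthogonal hD.push hD.component hz h0 hi) hz0 hzd hm
    (v := WithLp.toLp 2 v) (w := WithLp.toLp 2 w) hv hw]
  have h := coordSFF_famPull (extMetric hD hG)
    (B := collarBil ε δ (normalJet (parBil g Ψ q))) (f := parMap Ψ q) (by norm_num) hz0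
    (hD.push.eventually_contMDiffWithinAt_parMap hzd.1 hzd.2.2)
    (by rw [hzq]; exact eventually_boundary_parMap hD.push hzd hz0 hzq)
    ((contDiffWithinAt_collarBil (isOpen_collarDom hD.component) hD.contDiffWithinAt_parBil hz0.ge
      (bproj_mem_collarDom hD.push.pos hzd)).of_le (by norm_num))
    (fun _ _ _ => collarBil_symm (fun _ _ _ => parBil_symm _ _) _ _) hm
    (eventually_famPull_extMetric hD hG hzd hzε)
    (v := WithLp.toLp 2 v) (w := WithLp.toLp 2 w) hv hw
  rw [hzq, hD.push.fderivWithin_parMap_tangential hzd hz0 hv,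
    hD.push.fderivWithin_parMap_tangential hzd hz0 hw] at h
  exact h.symm

end ExtendedMetric

/-! ### The extension -/

section Extension

variable {n : ℕ} [NeZero n] {M : Type u} [TopologicalSpace M]
  [ChartedSpace (EuclideanHalfSpace n) M] [IsManifold (𝓡∂ n) ∞ M] {g : RMetric n ∞ M}
  {Ψ : M × ℝ → M} {r : M → M} {ρ : M → ℝ} {U C : Set M} {a ε δ : ℝ} {up dn : ℝ → ℝ}

/-- The conclusion of `exists_collar_nonneg` holds uniformly along a compact mean-convex boundary
component. -/
lemma exists_isNonnegCollar (h : IsPush g Ψ a C) (hC : IsBoundaryComponent n C)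
    (hCc : IsCompact C) (hc : IsCollar n C Ψ r ρ U a) (hg : NonnegScalarCurvature g)
    (hθ : IsStrictlyMeanConvex g C) :
    ∃ η > 0, ∀ ε ∈ Ioo 0 η, ∀ δ ∈ Ioo (-η) η, IsNonnegCollar g Ψ C ε δ := by
  have key : ∀ p ∈ C, ∃ N ∈ 𝓝 (extChartAt (𝓡∂ n) p p), ∃ η > 0, ∀ ε ∈ Ioo 0 η,
      ∀ δ ∈ Ioo (-η) η, ∀ z, bproj z ∈ N → 0 ≤ z 0 → z 0 ≤ ε →
      IsMetric (collarBil ε δ (normalJet (parBil g Ψ p)) z) ∧ 0 ≤ coordScalarCurvature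
        (range (𝓡∂ n)) (matOf (collarBil ε δ (normalJet (parBil g Ψ p)))) z := by
    intro p hp
    have h0 : extChartAt (𝓡∂ n) p p 0 = 0 :=
      (mem_boundary_iff (mem_extChartAt_source p)).1 (hC.subset_boundary hp)
    have hW : extChartAt (𝓡∂ n) p p ∈ collarDom C a p :=
      extChartAt_mem_collarDom hC h.pos hp (mem_extChartAt_source p)
    exact exists_collar_nonneg (isOpen_collarDom hC) (fun z => bproj_mem_collarDom h.pos)
      (fun z => contDiffWithinAt_parBil h) (fun _ _ _ => parBil_symm _ _)
      (fun z hz hz0 => isMetric_parBil h hC hc hz hz0.ge)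
      (fun z hz hz0 => by
        rw [coordScalarCurvature_parBil h hC hc hz hz0.ge]
        exact hg _)
      h0 hW (fun i hi => parBil_orthogonal h hC hW h0 hi) (trace_parBil_neg h hC hc hp (hθ p hp))
  choose! N hN η hη hNη using key
  obtain ⟨t, htC, ht⟩ := hCc.elim_nhds_subcover
    (fun p => (extChartAt (𝓡∂ n) p).source ∩ extChartAt (𝓡∂ n) p ⁻¹' N p)
    (fun p hp => Filter.inter_mem (extChartAt_source_mem_nhds p)
      ((continuousAt_extChartAt p).preimage_mem_nhds (hN p hp)))
  obtain ⟨η₀, hη₀, hle⟩ : ∃ η₀ > 0, ∀ p ∈ t, η₀ ≤ η p := by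
    rcases t.eq_empty_or_nonempty with rfl | hne
    · exact ⟨1, one_pos, by simp⟩
    · obtain ⟨p, hp, hmin⟩ := t.exists_min_image η hne
      exact ⟨η p, hη p (htC p hp), hmin⟩
  refine ⟨η₀, hη₀, fun ε hε δ hδ p hp => ?_⟩
  obtain ⟨x, hxt, hpx, hpN⟩ := mem_iUnion₂.1 (ht hp)
  refine ⟨x, hpx, fun z hz h0 hzε => hNη x (htC x hxt) ε ⟨hε.1, hε.2.trans_le (hle x hxt)⟩ δ
    ⟨by linarith [hle x hxt, hδ.1], hδ.2.trans_le (hle x hxt)⟩ z (by rwa [hz]) h0 hzε⟩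

lemma IsPush.mono (h : IsPush g Ψ a C) {b : ℝ} (hb : 0 < b) (hba : b ≤ a) : IsPush g Ψ b C :=
  ⟨hb, h.smooth.mono (prod_mono_right (Ico_subset_Ico_right hba)), h.zero, h.velocity⟩

/-- The complement of the pushed-in copy of `M \ C` is the part `ρ ≤ ε` of the collar. -/
lemma IsCollarShift.compl_image_out (hD : IsCollarShift g Ψ r ρ U C a ε up dn) :
    (collarShift Ψ r ρ U up '' Cᶜ)ᶜ = {q | q ∈ U ∧ ρ q ≤ ε} := by
  ext q
  refine ⟨fun hq => ?_, ?_⟩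
  · by_contra hcon
    have hlt : q ∈ U → ε < ρ q := fun h => not_le.1 fun h' => hcon ⟨h, h'⟩
    refine hq ⟨_, fun hmem => ?_, hD.out_in fun h => (hlt h).le⟩
    obtain ⟨hU, hρ, -⟩ := hD.mem_of_mem hmem
    have hu : ∀ s ∈ Ico 0 a, max 0 (dn s) ∈ Ico 0 a := fun s => hD.shift.dn_mem
    have hqU : q ∈ U := by
      by_contra hqU
      rw [collarShift_of_notMem hqU] at hU
      exact hqU hU
    rw [ρ_collarShift hD.collar hu hqU, max_eq_right (hD.shift.dn_nonneg (hlt hqU).le)] at hρ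
    have := hD.shift.strictMono_dn (hlt hqU)
    rw [hD.shift.dn_self, hρ] at this
    exact this.false
  · rintro ⟨hqU, hρ⟩ ⟨p, hp, rfl⟩
    exact (hD.out_lt hp hqU).not_ge hρ

/-- The collar beyond the pushed-in copy of `M`, as an embedding of `C × [0, 1]`. -/
lemma IsCollarShift.isDiffeomorphismOn (hD : IsCollarShift g Ψ r ρ U C a ε up dn) :
    IsDiffeomorphismOn ((𝓡∂ n).prod 𝓘(ℝ, ℝ)) (𝓡∂ n) (fun y : M × ℝ => Ψ (y.1, ε * (1 - y.2)))
      (C ×ˢ Icc (0 : ℝ) 1) (collarShift Ψ r ρ U up '' Cᶜ)ᶜ := by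
  have hε := hD.shift.pos
  have hεa : ε < a := by linarith [hD.shift.lt]
  have hmem : ∀ s ∈ Icc (0 : ℝ) 1, ε * (1 - s) ∈ Ico 0 a := fun s hs =>
    ⟨mul_nonneg hε.le (by linarith [hs.2]), by nlinarith [hs.1]⟩
  rw [hD.compl_image_out]
  refine ⟨fun q => (r q, 1 - ρ q / ε), ?_, ?_, ?_, ?_, ?_, ?_⟩
  · rintro ⟨p, s⟩ ⟨hp, hs⟩
    refine ⟨hD.collar.map_mem p hp _ (hmem s hs), ?_⟩
    change ρ (Ψ (p, ε * (1 - s))) ≤ ε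
    rw [hD.collar.ρ_apply p hp _ (hmem s hs)]
    nlinarith [hs.1]
  · rintro q ⟨hq, hρ⟩
    have h1 : 0 ≤ ρ q / ε := div_nonneg (hD.collar.ρ_mem q hq).1 hε.le
    have h2 : ρ q / ε ≤ 1 := (div_le_one hε).2 hρ
    exact ⟨hD.collar.r_mem q hq, by simp only; linarith, by simp only; linarith⟩
  · rintro ⟨p, s⟩ ⟨hp, hs⟩
    simp only
    rw [hD.collar.ρ_apply p hp _ (hmem s hs), hD.collar.r_apply p hp _ (hmem s hs),
      mul_div_cancel_left₀ _ hε.ne', sub_sub_cancel]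
  · rintro q ⟨hq, -⟩
    simp only
    rw [sub_sub_cancel, mul_div_cancel₀ _ hε.ne', hD.collar.apply_r_ρ q hq]
  · have hs : ContMDiff ((𝓡∂ n).prod 𝓘(ℝ, ℝ)) ((𝓡∂ n).prod 𝓘(ℝ, ℝ)) ∞
        (fun y : M × ℝ => (y.1, ε * (1 - y.2))) := by
      have hl : ContDiff ℝ ∞ fun s : ℝ => ε * (1 - s) := by fun_prop
      exact contMDiff_fst.prodMk (hl.contMDiff.comp contMDiff_snd)
    exact ContMDiffOn.comp (t := univ ×ˢ Ico 0 a) hD.collar.smooth hs.contMDiffOn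
      fun y hy => ⟨mem_univ _, hmem _ hy.2⟩
  · intro q hq
    have hl : ContDiff ℝ ∞ fun s : ℝ => 1 - s / ε := by fun_prop
    exact ((hD.collar.smooth_r q hq.1).prodMk
      (hl.contMDiff.contMDiffAt.comp q (hD.collar.smooth_ρ q hq.1))).contMDiffWithinAt

lemma IsCollarShift.image_end (hD : IsCollarShift g Ψ r ρ U C a ε up dn) :
    (fun y : M × ℝ => Ψ (y.1, ε * (1 - y.2))) '' (C ×ˢ {(1 : ℝ)}) = C := by
  ext q
  constructor
  · rintro ⟨⟨p, s⟩, ⟨hp, hs⟩, rfl⟩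
    rw [mem_singleton_iff] at hs
    simp only at hs
    simp only [hs, sub_self, mul_zero, hD.push.zero]
    exact hp
  · intro hq
    exact ⟨(q, 1), ⟨hq, rfl⟩, by simp [hD.push.zero]⟩

/-- The pushed-in copy of `M` moves only the component `C` of the boundary, whose place is taken by
the far end of the collar. -/
lemma IsCollarShift.boundary_eq (hD : IsCollarShift g Ψ r ρ U C a ε up dn) :
    (𝓡∂ n).boundary M = collarShift Ψ r ρ U up '' ((𝓡∂ n).boundary M \ C) ∪ C := by
  have hfix : ∀ p ∈ (𝓡∂ n).boundary M \ C, collarShift Ψ r ρ U up p = p := fun p hp => by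
    refine collarShift_of_notMem fun hU => ?_
    exact (hD.ρ_pos hU hp.2).ne' ((hD.collar.boundary_iff p hU).1 hp.1)
  rw [image_congr hfix, image_id', sdiff_union_of_subset hD.component.subset_boundary]

variable [T2Space M]

lemma IsCollarShift.isEmbedding_out (hD : IsCollarShift g Ψ r ρ U C a ε up dn) :
    Topology.IsEmbedding (collarShift Ψ r ρ U up) :=
  Function.LeftInverse.isEmbedding hD.in_out hD.continuous_in hD.contMDiff_out.continuous

/-- The extension of `(M, g)` by a collar. The extended manifold is `M` itself, in which the
original manifold is embedded by pushing it in. -/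
def collarExtension [SecondCountableTopology M] (hD : IsCollarShift g Ψ r ρ U C a ε up dn)
    (hG : IsNonnegCollar g Ψ C ε δ) : CollarExtension g C where
  carrier := M
  metric := extMetric hD hG
  φ := collarShift Ψ r ρ U up
  isEmbedding := hD.isEmbedding_out
  contMDiff := hD.contMDiff_out
  isometry x v w := extFam_out hD x v w
  collar y := Ψ (y.1, ε * (1 - y.2))
  collar_diffeo := hD.isDiffeomorphismOn
  collar_zero x hx := by
    obtain ⟨hU, hρ, hr⟩ := hD.mem_of_mem hx
    rw [collarShift_of_mem hU, hρ, hr, hD.shift.up_zero]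
    simp
  boundary_eq := by
    rw [hD.image_end]
    exact hD.boundary_eq

lemma newBoundary_collarExtension [SecondCountableTopology M]
    (hD : IsCollarShift g Ψ r ρ U C a ε up dn) (hG : IsNonnegCollar g Ψ C ε δ) :
    (collarExtension hD hG).newBoundary = C := hD.image_end

/-- For all small `δ` there is an extension for which the second fundamental form of the new
boundary is `δ` times a positive definite form. -/
theorem exists_collarExtension [SecondCountableTopology M] (hC : IsBoundaryComponent n C)
    (hCc : IsCompact C) (hg : NonnegScalarCurvature g) (hθ : IsStrictlyMeanConvex g C) :
    ∃ η > 0, ∀ δ ∈ Ioo (-η) η, ∃ X : CollarExtension g C, NonnegScalarCurvature X.metric ∧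
      ∀ q ∈ X.newBoundary, ∃ c > 0, ∃ b : Bil (EuclideanSpace ℝ (Fin n)), IsMetric b ∧
        ∀ v w : Fin n → ℝ, v 0 = 0 → w 0 = 0 →
          secondFundamentalForm X.metric q v w
            = δ * c * b (WithLp.toLp 2 v) (WithLp.toLp 2 w) := by
  obtain ⟨Ψ, s₀, h₀⟩ := exists_isPush g hCc
  obtain ⟨r, ρ, U, a, has, hc⟩ := h₀.exists_isCollar hC hCc
  have h := h₀.mono hc.pos has
  obtain ⟨η, hη, hG⟩ := exists_isNonnegCollar h hC hCc hc hg hθ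
  obtain ⟨η', hη', hs⟩ := exists_isShift hc.pos
  have hε : min η η' / 2 ∈ Ioo 0 (min η η') :=
    ⟨half_pos (lt_min hη hη'), half_lt_self (lt_min hη hη')⟩
  obtain ⟨up, dn, hsh⟩ := hs _ ⟨hε.1, hε.2.trans_le (min_le_right _ _)⟩
  have hD : IsCollarShift g Ψ r ρ U C a (min η η' / 2) up dn := ⟨h, hC, hCc, hc, hsh⟩
  refine ⟨η, hη, fun δ hδ => ?_⟩
  have hGδ := hG _ ⟨hε.1, hε.2.trans_le (min_le_left _ _)⟩ δ hδ
  refine ⟨collarExtension hD hGδ, nonnegScalarCurvature_extMetric hD hGδ hg, fun q hq => ?_⟩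
  rw [newBoundary_collarExtension] at hq
  exact secondFundamentalForm_extMetric hD hGδ hq

end Extension

end ScalarExtension

end

theorem theorem1 (n : ℕ) [NeZero n] (hn : 3 ≤ n)
    (M : Type u) [TopologicalSpace M] [T2Space M] [SecondCountableTopology M]
    [ChartedSpace (EuclideanHalfSpace n) M] [IsManifold (𝓡∂ n) ∞ M]
    (g : ScalarExtension.RMetric n ∞ M) (hg : ScalarExtension.NonnegScalarCurvature g)
    (C : Set M) (hC : ScalarExtension.IsBoundaryComponent n C) (hCc : IsCompact C)
    (hθ : ScalarExtension.IsStrictlyMeanConvex g C) :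
    (∃ X : ScalarExtension.CollarExtension g C,
      ScalarExtension.NonnegScalarCurvature X.metric ∧
        ScalarExtension.IsStrictlyConvex X.metric X.newBoundary) ∧
    (∃ X : ScalarExtension.CollarExtension g C,
      ScalarExtension.NonnegScalarCurvature X.metric ∧
        ScalarExtension.IsTotallyGeodesic X.metric X.newBoundary) ∧
    (∃ X : ScalarExtension.CollarExtension g C,
      ScalarExtension.NonnegScalarCurvature X.metric ∧
        ScalarExtension.IsStrictlyConcave X.metric X.newBoundary) := by
  obtain ⟨η, hη, h⟩ := ScalarExtension.exists_collarExtension hC hCc hg hθ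
  have h0 : ∀ v : Fin n → ℝ, v ≠ 0 → WithLp.toLp 2 v ≠ 0 := fun v hv h => hv <| by
    rwa [WithLp.toLp_eq_zero] at h
  refine ⟨?_, ?_, ?_⟩
  · obtain ⟨X, hX, hs⟩ := h (η / 2) ⟨by linarith, by linarith⟩
    refine ⟨X, hX, fun q hq v hv hv0 => ?_⟩
    obtain ⟨c, hc, b, hb, hf⟩ := hs q hq
    rw [hf v v hv hv]
    exact mul_pos (mul_pos (half_pos hη) hc) (hb.2 _ (h0 v hv0))
  · obtain ⟨X, hX, hs⟩ := h 0 ⟨by linarith, hη⟩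
    refine ⟨X, hX, fun q hq v w hv hw => ?_⟩
    obtain ⟨c, hc, b, hb, hf⟩ := hs q hq
    rw [hf v w hv hw, zero_mul, zero_mul]
  · obtain ⟨X, hX, hs⟩ := h (-(η / 2)) ⟨by linarith, by linarith⟩
    refine ⟨X, hX, fun q hq v hv hv0 => ?_⟩
    obtain ⟨c, hc, b, hb, hf⟩ := hs q hq
    rw [hf v v hv hv]
    exact mul_neg_of_neg_of_pos (mul_neg_of_neg_of_pos (by linarith) hc) (hb.2 _ (h0 v hv0))
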